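/- **Setting.** Let $n,d\in\mathbb N$, $m>0$. Points of $\mathbb R^{nd}$ are written $\underline x=(x_1,\dots,x_n)$ with $x_i\in\mathbb R^d$. Let $\omega(p)=\sqrt{p^2+m^2}$, $\tilde\omega(\underline\xi)=\omega(\xi_1)+\dots+\omega(\xi_n)$, $D_{\underline x}=-\mathrm i\nabla_{\underline x}$, $\tilde B(0,\epsilon)=\{\underline x:|x_i|<\epsilon\ \forall i\}$ and $D_0=\{\underline x: x_i=x_j\text{ for some }i\ne j\}$. For $h\in C_0^\infty(T^*\mathbb R^{nd})$ let $h^{\mathrm w}u(\underline x)=(2\pi)^{-nd}\iint e^{\mathrm i(\underline x-\underline y)\cdot\underline\xi}\,h\big(\tfrac{\underline x+\underline y}{2},\underline\xi\big)u(\underline y)\,d\underline\xi\, d\underline y$ be its Weyl quantization and $h_t(\underline x,\underline\xi)=h(\underline x/t,\underline\xi)$. A symbol $\mathrm H\in C_0^\infty(T^*\mathbb R^{nd};\mathbb R^{nd})$ is *admissible* if there are a compact $K\subset\mathbb R^{nd}$ and $\epsilon>0$ with $K+\tilde B(0,\epsilon)\subset\tilde B(0,1)\setminus D_0$ and $\operatorname{supp}\mathrm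 H\subset\{(\underline x,\underline\xi):\nabla\tilde\omega(\underline\xi)\in K,\ |\underline x-\nabla\tilde\omega(\underline\xi)|<\epsilon\}$. Consider a Haag–Kastler net $\mathcal O\mapsto\mathfrak A(\mathcal O)\subset B(\mathcal H)$ of von Neumann algebras, indexed by the open bounded $\mathcal O\subset\mathbb R^{1+d}$: it is isotonous and local (algebras of spacelike separated regions commute), and covariant under a strongly continuous unitary representation $U(t,x)=e^{\mathrm i(tH-x\cdot P)}$ of translations, i.e. $U(t,x)\mathfrak A(\mathcal O)U(t,x)^*=\mathfrak A(\mathcal O+(t,x))$. Write $\mathbb 1_\Delta(U)$ for the spectral projections of $(H,P)$, $\mathrm{Sp}\,U$ for the joint spectrum, $\mathfrak A$ for the norm closure of $\bigcup_{\mathcal O}\mathfrak A(\mathcal O)$, $H_m=\{(E,p):E=\sqrt{p^2+m^2}\}$ and $G_\mu=\{(E,p):E\ge\sqrt{p^2+\mu^2}\}$. Assume $\mathrm{Sp}\,U=\{0\}\cup H_m\cup G_{2m}$ and $\mathbb 1_{\{0\}}(U)=|\Omega\rangle\langle\Omega|$ with $\Omega$ a unit vector cyclic for $\mathfrak A$.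 For $B\in\mathfrak A$ put $B(t,x)=U(t,x)BU(t,x)^*$ and let $\widehat B(E,p)=(2\pi)^{-(1+d)/2}\int e^{-\mathrm i(Et-p\cdot x)}B(t,x)\,dt\,dx$ (an operator-valued distribution). $B\in\mathfrak A$ is *almost local* if there are $A_r\in\mathfrak A(\{|t|+|x|<r\})$ with $\|B-A_r\|=O(\langle r\rangle^{-\infty})$. Let $\mathcal L_0$ be the span of all $B\in\mathfrak A$ such that $\operatorname{supp}\widehat B$ is compact and disjoint from $\{E\ge|p|\}$, $(t,x)\mapsto B(t,x)$ is $C^\infty$ in norm, and all its partial derivatives of all orders are almost local. For an open bounded $\Delta\subset\mathbb R^{1+d}$, a tuple $(B_1,\dots,B_n)$ of elements of $\mathcal L_0$ is *$\Delta$-admissible* if $$(-\operatorname{supp}\widehat B_i)\cap\mathrm{Sp}\,U\subset H_m\ (i=1,\dots,n),\qquad -(\operatorname{supp}\widehat B_1+\dots+\operatorname{supp}\widehat B_n)\subset\Delta,$$ $$(\overline\Delta+\operatorname{supp}\widehat B_1+\dots+\operatorname{supp}\widehat B_n)\cap\mathrm{Sp}\,U\subset\{0\}.$$ **Proposition 5.2.**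 Let $\mathrm H\in C_0^\infty(T^*\mathbb R^{nd};\mathbb R^{nd})$ be admissible. 1. For every net as above, every open bounded $\Delta\subset\mathbb R^{1+d}$, every $\Delta$-admissible $(B_1,\dots,B_n)$ and every $\Psi\in\mathbb 1_\Delta(U)\mathcal H$, the functions $F_t(\underline x)=(\Omega\,|\,B_1(t,x_1)\cdots B_n(t,x_n)\Psi)$ are in $L^2(\mathbb R^{nd})$ and $$\int_1^\infty\big\|\big(\underline x/t-\nabla\tilde\omega(D_{\underline x})\big)\cdot\mathrm H_t^{\mathrm w}F_t\big\|^2\,\frac{dt}{t}<\infty .$$ 2. There is a constant $c$ such that for all $u\in L^2(\mathbb R^{nd})$ $$\int_1^\infty\big\|\big(\underline x/t-\nabla\tilde\omega(D_{\underline x})\big)\cdot\mathrm H_t^{\mathrm w}e^{-\mathrm it\tilde\omega(D_{\underline x})}u\big\|^2\,\frac{dt}{t}\le c\|u\|^2 .$$ Here $\|\cdot\|$ is the norm of $L^2(\mathbb R^{nd})$ and $\big(\underline x/t-\nabla\tilde\omega(D_{\underline x})\big)\cdot\mathrm H_t^{\mathrm w}=\sum_{k=1}^{nd}\big(\tfrac{\underline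 x_k}{t}-(\partial_k\tilde\omega)(D_{\underline x})\big)\mathrm H_{k,t}^{\mathrm w}$, where for $t>0$ the operators $\mathrm H_{k,t}^{\mathrm w}$ and $\underline x_k\mathrm H_{k,t}^{\mathrm w}$ map $L^2(\mathbb R^{nd})$ to itself. -/

import Mathlib

open MeasureTheory Set Filter
open scoped ENNReal ContDiff FourierTransform

noncomputable section

namespace PropEst

/-! ## Spacetime and translations -/

/-- Minkowski spacetime `ℝ^{1+d}`; points are pairs `(t, x)`, resp. `(E, p)` in energy-momentum
space. The product structure is used only for its topology, smooth structure and Lebesgue measure. -/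
abbrev Spacetime (d : ℕ) : Type := ℝ × EuclideanSpace ℝ (Fin d)

/-- The pairing `E t - p · x` of a spacetime point `(t, x)` with an energy-momentum `(E, p)`. -/
def minkPairing {d : ℕ} (a q : Spacetime d) : ℝ := a.1 * q.1 - inner ℝ a.2 q.2

/-- The double cone `{(t, x) : |t| + |x| < r}`. -/
def doubleCone (d : ℕ) (r : ℝ) : Set (Spacetime d) := {a | |a.1| + ‖a.2‖ < r}

def SpacelikeSeparated {d : ℕ} (O₁ O₂ : Set (Spacetime d)) : Prop :=
  ∀ a ∈ O₁, ∀ b ∈ O₂, |a.1 - b.1| < ‖a.2 - b.2‖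

/-- Mass hyperboloid `H_m = {E = √(p² + m²)}`. -/
def massHyperboloid (d : ℕ) (m : ℝ) : Set (Spacetime d) := {q | q.1 = √(‖q.2‖ ^ 2 + m ^ 2)}

/-- `G_μ = {E ≥ √(p² + μ²)}`. -/
def aboveHyperboloid (d : ℕ) (μ : ℝ) : Set (Spacetime d) := {q | √(‖q.2‖ ^ 2 + μ ^ 2) ≤ q.1}

/-- The closed forward light cone `{E ≥ |p|}`. -/
def forwardCone (d : ℕ) : Set (Spacetime d) := {q | ‖q.2‖ ≤ q.1}

/-- `f̌(t, x) = (2π)^{-(1+d)/2} ∫ exp(-i (E t - p · x)) f(E, p) dE dp`. -/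
def inverseFourierST {d : ℕ} (f : Spacetime d → ℂ) (a : Spacetime d) : ℂ :=
  (((2 * Real.pi) ^ (-(1 + (d : ℝ)) / 2) : ℝ) : ℂ) *
    ∫ q : Spacetime d, Complex.exp (-(Complex.I * (minkPairing a q : ℂ))) * f q

section Operators

variable {d : ℕ} {𝓗 : Type*} [NormedAddCommGroup 𝓗] [InnerProductSpace ℂ 𝓗] [CompleteSpace 𝓗]

/-- The operator `U(a)` of a unitary representation of the translation group `ℝ^{1+d}`. -/
def transl (U : Multiplicative (Spacetime d) →* unitary (𝓗 →L[ℂ] 𝓗)) (a : Spacetime d) :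
    𝓗 →L[ℂ] 𝓗 :=
  (U (Multiplicative.ofAdd a) : 𝓗 →L[ℂ] 𝓗)

/-- The translate `B(a) = U(a) B U(a)*`. -/
def translOp (U : Multiplicative (Spacetime d) →* unitary (𝓗 →L[ℂ] 𝓗)) (a : Spacetime d)
    (B : 𝓗 →L[ℂ] 𝓗) : 𝓗 →L[ℂ] 𝓗 :=
  transl U a * B * star (transl U a)

/-- `ψ` lies in the range of the spectral projection `1_Δ(U)`, where
`U(t, x) = exp(i (t H - x · P))`. The spectral measure `⟨ψ, 1_{(·)}(U) ψ⟩` of `ψ` is the unique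
finite Borel measure `μ` with `⟨ψ, U(t,x) ψ⟩ = ∫ exp(i (t E - x · p)) dμ(E, p)`, and `ψ` is in the
range of `1_Δ(U)` exactly when this measure gives no mass to the complement of `Δ`. -/
def InSpectralSubspace (U : Multiplicative (Spacetime d) →* unitary (𝓗 →L[ℂ] 𝓗))
    (Δ : Set (Spacetime d)) (ψ : 𝓗) : Prop :=
  ∃ μ : Measure (Spacetime d), IsFiniteMeasure μ ∧
    (∀ a : Spacetime d, inner ℂ ψ (transl U a ψ)
      = ∫ q, Complex.exp (Complex.I * (minkPairing a q : ℂ)) ∂μ) ∧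
    μ Δᶜ = 0

/-- The joint spectrum `Sp U` of `(H, P)`, i.e. the support of the spectral measure of `U`. -/
def jointSpectrum (U : Multiplicative (Spacetime d) →* unitary (𝓗 →L[ℂ] 𝓗)) :
    Set (Spacetime d) :=
  {q | ∀ V : Set (Spacetime d), IsOpen V → q ∈ V → ∃ ψ : 𝓗, ψ ≠ 0 ∧ InSpectralSubspace U V ψ}

/-- The quasi-local algebra: the norm closure of the union of the local algebras of all open
bounded regions. -/
def quasiLocal (alg : Set (Spacetime d) → VonNeumannAlgebra 𝓗) : Set (𝓗 →L[ℂ] 𝓗) :=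
  closure {A | ∃ O : Set (Spacetime d), IsOpen O ∧ Bornology.IsBounded O ∧ A ∈ alg O}

end Operators

/-- A Haag-Kastler net of von Neumann algebras on `𝓗` over `ℝ^{1+d}` in the vacuum representation,
with upper and lower mass gap `m`. Only the algebras of open bounded regions matter. -/
structure HaagKastlerNet (d : ℕ) (m : ℝ) (𝓗 : Type*) [NormedAddCommGroup 𝓗]
    [InnerProductSpace ℂ 𝓗] [CompleteSpace 𝓗] where
  /-- the local algebras -/
  alg : Set (Spacetime d) → VonNeumannAlgebra 𝓗
  /-- the unitary representation of translations -/
  U : Multiplicative (Spacetime d) →* unitary (𝓗 →L[ℂ] 𝓗)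
  /-- the vacuum vector -/
  Ω : 𝓗
  isotony : ∀ O₁ O₂ : Set (Spacetime d), IsOpen O₁ → Bornology.IsBounded O₁ →
    IsOpen O₂ → Bornology.IsBounded O₂ → O₁ ⊆ O₂ → ∀ A ∈ alg O₁, A ∈ alg O₂
  locality : ∀ O₁ O₂ : Set (Spacetime d), IsOpen O₁ → Bornology.IsBounded O₁ →
    IsOpen O₂ → Bornology.IsBounded O₂ → SpacelikeSeparated O₁ O₂ →
    ∀ A ∈ alg O₁, ∀ B ∈ alg O₂, A * B = B * A
  strongly_continuous : ∀ ψ : 𝓗, Continuous fun a : Spacetime d => transl U a ψ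
  covariance : ∀ O : Set (Spacetime d), IsOpen O → Bornology.IsBounded O → ∀ a : Spacetime d,
    translOp U a '' {A | A ∈ alg O} = {A | A ∈ alg ((fun b => b + a) '' O)}
  spectrum_condition :
    jointSpectrum U = {0} ∪ massHyperboloid d m ∪ aboveHyperboloid d (2 * m)
  vacuum_norm : ‖Ω‖ = 1
  vacuum_unique : ∀ ψ : 𝓗, InSpectralSubspace U {0} ψ ↔ ψ ∈ Submodule.span ℂ {Ω}
  vacuum_cyclic : Dense ((fun A : 𝓗 →L[ℂ] 𝓗 => A Ω) '' quasiLocal alg)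

namespace HaagKastlerNet

variable {d : ℕ} {m : ℝ} {𝓗 : Type*} [NormedAddCommGroup 𝓗] [InnerProductSpace ℂ 𝓗]
  [CompleteSpace 𝓗] (N : HaagKastlerNet d m 𝓗)

/-- Almost local elements of the quasi-local algebra: approximated in norm by elements of the
algebras of double cones of radius `r`, with an error decaying faster than any power of `r`. -/
def AlmostLocal (B : 𝓗 →L[ℂ] 𝓗) : Prop :=
  B ∈ quasiLocal N.alg ∧
  ∃ A : ℝ → (𝓗 →L[ℂ] 𝓗), (∀ r > 0, A r ∈ N.alg (doubleCone d r)) ∧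
    ∀ k : ℕ, ∃ C : ℝ, ∀ r > 0, (1 + r ^ 2) ^ k * ‖B - A r‖ ≤ C

/-- The operator-valued distribution
`B̂(E, p) = (2π)^{-(1+d)/2} ∫ exp(-i (E t - p · x)) B(t, x) dt dx`
evaluated on a test function `f` of `(E, p)` and applied to the vector `ψ`:
`B̂(f) ψ = ∫ f̌(t, x) B(t, x) ψ dt dx`. -/
def energyMomentumDistribution (B : 𝓗 →L[ℂ] 𝓗) (f : Spacetime d → ℂ) (ψ : 𝓗) : 𝓗 :=
  ∫ a : Spacetime d, inverseFourierST f a • translOp N.U a B ψ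

/-- The energy-momentum transfer `supp B̂`, the support of the distribution `B̂`. -/
def transferSupport (B : 𝓗 →L[ℂ] 𝓗) : Set (Spacetime d) :=
  {q | ∀ V : Set (Spacetime d), IsOpen V → q ∈ V →
    ∃ f : Spacetime d → ℂ, ContDiff ℝ ∞ f ∧ HasCompactSupport f ∧ tsupport f ⊆ V ∧
      ∃ ψ : 𝓗, N.energyMomentumDistribution B f ψ ≠ 0}

def EnergyDecreasing (B : 𝓗 →L[ℂ] 𝓗) : Prop :=
  N.transferSupport B ∩ forwardCone d = ∅

/-- The space `𝓛₀` spanned by the energy decreasing `B` in the quasi-local algebra with compact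
energy-momentum transfer such that `a ↦ B(a)` is smooth in norm and all its derivatives are almost
local. -/
def L0 : Submodule ℂ (𝓗 →L[ℂ] 𝓗) :=
  Submodule.span ℂ {B | B ∈ quasiLocal N.alg ∧ N.EnergyDecreasing B ∧
    IsCompact (N.transferSupport B) ∧
    ContDiff ℝ ∞ (fun a : Spacetime d => translOp N.U a B) ∧
    ∀ (k : ℕ) (a : Spacetime d) (v : Fin k → Spacetime d),
      N.AlmostLocal (iteratedFDeriv ℝ k (fun b : Spacetime d => translOp N.U b B) a v)}

/-- The set `supp B̂₁ + ⋯ + supp B̂ₙ`. -/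
def transferSum {n : ℕ} (B : Fin n → (𝓗 →L[ℂ] 𝓗)) : Set (Spacetime d) :=
  {q | ∃ s : Fin n → Spacetime d, (∀ i, s i ∈ N.transferSupport (B i)) ∧ q = ∑ i, s i}

/-- `Δ`-admissibility of a tuple `(B₁, …, Bₙ)`. -/
structure DeltaAdmissible {n : ℕ} (Δ : Set (Spacetime d)) (B : Fin n → (𝓗 →L[ℂ] 𝓗)) : Prop where
  mem_L0 : ∀ i, B i ∈ N.L0
  to_hyperboloid : ∀ i, ∀ q ∈ N.transferSupport (B i), -q ∈ jointSpectrum N.U →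
    -q ∈ massHyperboloid d m
  from_vacuum : ∀ q ∈ N.transferSum B, -q ∈ Δ
  to_vacuum : ∀ p ∈ closure Δ, ∀ q ∈ N.transferSum B, p + q ∈ jointSpectrum N.U → p + q = 0

end HaagKastlerNet

/-! ## Configuration space, dispersion relation, symbols -/

/-- The configuration space `ℝ^{nd}` of `n` particles in `ℝ^d`, with its Euclidean structure. -/
abbrev Config (n d : ℕ) : Type := EuclideanSpace ℝ (Fin n × Fin d)

/-- The position `xᵢ ∈ ℝ^d` of the `i`-th particle. -/
def particle {n d : ℕ} (x : Config n d) (i : Fin n) : EuclideanSpace ℝ (Fin d) :=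
  WithLp.toLp 2 fun j => x (i, j)

/-- `ω̃(ξ) = ∑ᵢ √(ξᵢ² + m²)`. -/
def omegaTilde {n d : ℕ} (m : ℝ) (ξ : Config n d) : ℝ :=
  ∑ i, √(‖particle ξ i‖ ^ 2 + m ^ 2)

/-- The union `D₀` of the collision planes. -/
def collisionPlanes (n d : ℕ) : Set (Config n d) :=
  {x | ∃ i j : Fin n, i ≠ j ∧ particle x i = particle x j}

/-- `{x : |xᵢ| < r for all i}`. -/
def polyBall (n d : ℕ) (r : ℝ) : Set (Config n d) := {x | ∀ i, ‖particle x i‖ < r}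

/-- Admissibility of a smooth compactly supported symbol `H` on phase space
`T*ℝ^{nd} = ℝ^{nd} × ℝ^{nd}`, whose elements are pairs `(x, ξ)`. -/
structure AdmissibleSymbol {n d : ℕ} {V : Type*} [NormedAddCommGroup V] [NormedSpace ℝ V]
    (m : ℝ) (H : Config n d × Config n d → V) : Prop where
  smooth : ContDiff ℝ ∞ H
  compactSupport : HasCompactSupport H
  localized : ∃ K : Set (Config n d), ∃ ε > 0, IsCompact K ∧
    (∀ k ∈ K, ∀ z ∈ polyBall n d ε, k + z ∈ polyBall n d 1 \ collisionPlanes n d) ∧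
    tsupport H ⊆ {z | gradient (omegaTilde m) z.2 ∈ K ∧ ‖z.1 - gradient (omegaTilde m) z.2‖ < ε}

/-! ## Operators on `L²(ℝ^ℓ)` -/

section L2

variable {ι : Type*} [Fintype ι]

/-- `L²(ℝ^ℓ)`. -/
abbrev L2 (ι : Type*) [Fintype ι] : Type _ :=
  Lp (α := EuclideanSpace ℝ ι) ℂ 2 volume

open Classical in
/-- The element of `L²` given by a square-integrable function. -/
def toL2 (f : EuclideanSpace ℝ ι → ℂ) : L2 ι :=
  if hf : MemLp f 2 (volume : Measure (EuclideanSpace ℝ ι)) then hf.toLp f else 0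

/-- The Weyl quantization
`h^w u (x) = (2π)^{-ℓ} ∫∫ exp(i (x - y) · ξ) h((x + y) / 2, ξ) u(y) dξ dy`.
For `h` smooth with compact support the kernel is a Schwartz function, so that the formula makes
sense for all `u ∈ L²` and gives the bounded extension of `h^w` to `L²`. -/
def weyl (h : EuclideanSpace ℝ ι × EuclideanSpace ℝ ι → ℂ) (u : EuclideanSpace ℝ ι → ℂ)
    (x : EuclideanSpace ℝ ι) : ℂ :=
  (((2 * Real.pi) ^ (-(Fintype.card ι : ℝ)) : ℝ) : ℂ) *
    ∫ y : EuclideanSpace ℝ ι, (∫ ξ : EuclideanSpace ℝ ι,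
      Complex.exp (Complex.I * ((inner ℝ (x - y) ξ : ℝ) : ℂ)) * h ((2 : ℝ)⁻¹ • (x + y), ξ)) * u y

/-- The operator `g(D)`, `D = -i∇`, on `L²` for a bounded measurable function `g`. Mathlib's Fourier
transform has the phase `exp(-2πi x · η)`, so that `D` acts as multiplication by `2πη`. -/
def multiplier (g : EuclideanSpace ℝ ι → ℂ) (u : L2 ι) : L2 ι :=
  𝓕⁻ (toL2 fun η => g ((2 * Real.pi) • η) * (𝓕 u : L2 ι) η)

end L2

/-- The symbol `H_{k,t}(x, ξ) = H_k(x/t, ξ)`, where `H_k` is the `k`-th component of the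
vector-valued symbol `H`. -/
def scaledComponent {n d : ℕ} (H : Config n d × Config n d → Config n d) (k : Fin n × Fin d)
    (t : ℝ) (z : Config n d × Config n d) : ℂ :=
  ((H (t⁻¹ • z.1, z.2) k : ℝ) : ℂ)

/-- `(x/t - ∇ω̃(D)) · H_t^w u = ∑ₖ ((xₖ/t) H_{k,t}^w u - (∂ₖω̃)(D) H_{k,t}^w u)` in `L²(ℝ^{nd})`. -/
def propagationVector {n d : ℕ} (m : ℝ) (H : Config n d × Config n d → Config n d) (t : ℝ)
    (u : Config n d → ℂ) : L2 (Fin n × Fin d) :=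
  ∑ k, (toL2 (fun x => ((x k / t : ℝ) : ℂ) * weyl (scaledComponent H k t) u x)
    - multiplier (fun ξ => ((gradient (omegaTilde m) ξ k : ℝ) : ℂ))
        (toL2 (weyl (scaledComponent H k t) u)))

/-- The free evolution `exp(-i t ω̃(D)) u`. -/
def freeEvolution {n d : ℕ} (m t : ℝ) (u : L2 (Fin n × Fin d)) : L2 (Fin n × Fin d) :=
  multiplier (fun ξ => Complex.exp (-(Complex.I * ((t * omegaTilde m ξ : ℝ) : ℂ)))) u

/-- `F_t(x) = (Ω | B₁(t, x₁) ⋯ Bₙ(t, xₙ) Ψ)`. -/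
def HaagKastlerNet.F {n d : ℕ} {m : ℝ} {𝓗 : Type*} [NormedAddCommGroup 𝓗]
    [InnerProductSpace ℂ 𝓗] [CompleteSpace 𝓗] (N : HaagKastlerNet d m 𝓗)
    (B : Fin n → (𝓗 →L[ℂ] 𝓗)) (Ψ : 𝓗) (t : ℝ) (x : Config n d) : ℂ :=
  inner ℂ N.Ω ((List.ofFn fun i => translOp N.U (t, particle x i) (B i)).prod Ψ)

end PropEst

end

/-!
The function `F_t` behaves like a free evolution away from the collision planes, and both estimates
are instances of one propagation estimate for solutions of `i ∂ₜ u = ω̃(D) u + R`.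

*The propagation estimate.* For `z = x - ∇ω̃(ξ)` let `φ(x, ξ) = χ(ξ)² γ(|z|²)`, where `γ` is
decreasing and `χ` is a momentum cutoff, and let `φ_t(x, ξ) = φ(x / t, ξ)`. Along the free flow `z`
contracts: the derivative `∂ₜ φ_t + ∇ω̃ · ∂ₓ φ_t` equals `t⁻¹ ∑ₖ bₖ²`, with
`bₖ = χ zₖ (-2γ')^{1/2}` at `(x / t, ξ)`. If `-2γ' = χ = 1` on the support of `H`, then
`∑ₖ Hₖ zₖ = ∑ₖ Hₖ bₖ`, so that the quantity to be estimated is bounded by the `bₖ` (`Observable`,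
`exists_observable`, `Reduction.exists_norm_propagationVector_sq_le`). The calculus of the
quantizations at scale `t` (`exists_norm_opS_comp_sub_le`, `exists_norm_commutator_le`,
`hasDerivAt_opH`) turns the identity of symbols into a lower bound for the derivative of the
expectation value of `φ_t^w`, up to errors which are integrable in `t`. Since the expectation value
is bounded, integration in `t` gives the estimate (`exists_integral_norm_opH_sq_le`,
`Reduction.exists_integral_propagationVector_le`). Symbols with compact support have kernels
decaying rapidly away from the diagonal, and all operator bounds are obtained from such kernels by
Young's inequality. For the free evolution `R = 0` (`propagation_freeEvolution`). For `F_t` the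
remainder does no harm because `φ_t` lives at distance of order `t` from the collision planes
(`exists_norm_inner_opH_le`, `propagation_of_equation`).

*The equation for `F_t`.* The transfer of energy-momentum of `Bᵢ` is reproduced by smearing with a
compactly supported function `fᵢ` on energy-momentum space (`smear_orb_eq_smul`). Hence
`i ∂ₜ F_t - ∑ᵢ ω(Dᵢ) F_t` is the sum over `i` of the amplitudes in which `fᵢ` is multiplied by
`-(E + ω(p))` (`equation_amp`). The adjoint of the modified `i`-th operator annihilates the vacuum,
because `-supp B̂ᵢ` meets the spectrum only in the mass hyperboloid
(`star_smear_orb_vacuum_eq_zero`). Moving this operator to the left up to commutators shows that the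
remainder decays rapidly in the distance from the collision planes, by locality
(`commDecay_orb`, `exists_norm_amp_le_collWt`).

*Square-integrability.* A family of operators which sufficiently often applied annihilate a vector
is square-integrable on it if the commutators with the adjoints are integrable, by an argument of
Buchholz (`integral_norm_sq_le_of_annih`). Energy decreasing operators have this property on vectors
of bounded energy, after a decomposition into parts which lower some `E - v · p`, `|v| ≤ 1`
(`exists_lintegral_smear_orb_le`); the estimate is iterated for products
(`exists_lintegral_prod_le`). Spectral subspaces are handled through the operators `h(H, P)`,
`h` smooth with compact support; the spectral measures are obtained from Bochner's theorem
(`exists_measure_of_orbit`), which is proved by Gaussian regularization.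
-/


noncomputable section

namespace PropEst

set_option linter.unusedSectionVars false

/-! ### Polynomially decaying weights -/

section Weights

variable {V : Type*} [NormedAddCommGroup V]

/-- The weight `(1 + ‖z‖)^{-N}`. -/
def wt (N : ℕ) (z : V) : ℝ := ((1 + ‖z‖) ^ N)⁻¹

theorem wt_pos (N : ℕ) (z : V) : 0 < wt N z := by unfold wt; positivity

theorem wt_nonneg (N : ℕ) (z : V) : 0 ≤ wt N z := (wt_pos N z).le

theorem wt_add (M N : ℕ) (z : V) : wt (M + N) z = wt M z * wt N z := by
  unfold wt; rw [pow_add, mul_inv]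

theorem wt_neg (N : ℕ) (z : V) : wt N (-z) = wt N z := by unfold wt; rw [norm_neg]

theorem wt_sub_comm (N : ℕ) (x y : V) : wt N (x - y) = wt N (y - x) := by
  rw [← wt_neg, neg_sub]

theorem wt_antitone {M N : ℕ} (h : M ≤ N) (z : V) : wt N z ≤ wt M z := by
  unfold wt
  exact inv_anti₀ (by positivity) (pow_le_pow_right₀ (by linarith [norm_nonneg z]) h)

theorem continuous_wt (N : ℕ) : Continuous (wt N : V → ℝ) := by
  unfold wt
  exact Continuous.inv₀ (by fun_prop) (fun z => by positivity)

theorem one_add_norm_add_le (x y : V) : 1 + ‖x + y‖ ≤ (1 + ‖x‖) * (1 + ‖y‖) := by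
  nlinarith [norm_add_le x y, norm_nonneg x, norm_nonneg y, mul_nonneg (norm_nonneg x) (norm_nonneg y)]

/-- Peetre's inequality. -/
theorem wt_mul_wt_le (N : ℕ) (x y : V) : wt N x * wt N y ≤ wt N (x + y) := by
  unfold wt
  rw [← mul_inv, ← mul_pow]
  exact inv_anti₀ (by positivity) (pow_le_pow_left₀ (by positivity) (one_add_norm_add_le x y) N)

theorem wt_mul_wt_sub_le (N : ℕ) (x y z : V) : wt N (x - y) * wt N (y - z) ≤ wt N (x - z) := by
  simpa using wt_mul_wt_le N (x - y) (y - z)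

theorem norm_mul_wt_le (N : ℕ) (z : V) : ‖z‖ * wt (N + 1) z ≤ wt N z := by
  rw [wt_add, mul_comm, mul_assoc]
  refine mul_le_of_le_one_right (wt_nonneg _ _) ?_
  unfold wt
  rw [pow_one, inv_mul_le_iff₀ (by positivity)]
  linarith

theorem le_mul_wt_iff {N : ℕ} {z : V} {a C : ℝ} : a ≤ C * wt N z ↔ (1 + ‖z‖) ^ N * a ≤ C := by
  unfold wt
  rw [← div_eq_mul_inv, le_div_iff₀ (by positivity), mul_comm]

variable [NormedSpace ℝ V] [FiniteDimensional ℝ V] [MeasurableSpace V] [BorelSpace V]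

theorem integrable_wt {μ : Measure V} [μ.IsAddHaarMeasure] {N : ℕ}
    (hN : Module.finrank ℝ V < N) : Integrable (wt N : V → ℝ) μ := by
  have h := integrable_one_add_norm (E := V) (μ := μ) (r := N) (by exact_mod_cast hN)
  refine h.congr (Eventually.of_forall fun z => ?_)
  simp only [wt]
  rw [Real.rpow_neg (by positivity), Real.rpow_natCast]

theorem integral_wt_nonneg {μ : Measure V} (N : ℕ) : 0 ≤ ∫ z, wt N z ∂μ :=
  integral_nonneg fun z => wt_nonneg N z

end Weights

/-! ### Oscillatory integrals -/

section Osc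

variable {ι : Type*} [Fintype ι] {F : Type*} [NormedAddCommGroup F] [NormedSpace ℂ F]
variable {P : Type*} [NormedAddCommGroup P] [NormedSpace ℝ P]

/-- The normalisation `(2π)^{-ℓ}`. -/
def fc (ι : Type*) [Fintype ι] : ℝ := (2 * Real.pi) ^ (-(Fintype.card ι : ℝ))

theorem fc_pos (ι : Type*) [Fintype ι] : 0 < fc ι := by
  unfold fc; have := Real.pi_pos; positivity

/-- The inverse Fourier transform `(2π)^{-ℓ} ∫ exp(i z · ξ) q(ξ) dξ`. -/
def invF (q : EuclideanSpace ℝ ι → F) (z : EuclideanSpace ℝ ι) : F :=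
  (fc ι : ℂ) • ∫ ξ : EuclideanSpace ℝ ι, Complex.exp (Complex.I * ((inner ℝ z ξ : ℝ) : ℂ)) • q ξ

/-- The inverse Fourier transform, in the variable `ξ`, of a symbol `h(p, ξ)`. -/
def osc (h : P × EuclideanSpace ℝ ι → F) (p : P) (z : EuclideanSpace ℝ ι) : F :=
  invF (fun ξ => h (p, ξ)) z

theorem norm_exp_I_mul_ofReal (x : ℝ) : ‖Complex.exp (Complex.I * (x : ℂ))‖ = 1 := by
  rw [mul_comm, Complex.norm_exp_ofReal_mul_I]

theorem invF_eq_fourierInv (q : EuclideanSpace ℝ ι → F) (z : EuclideanSpace ℝ ι) :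
    invF q z = 𝓕⁻ (fun η => q ((2 * Real.pi) • η)) z := by
  have hpi : (0 : ℝ) < 2 * Real.pi := by positivity
  rw [Real.fourierInv_eq', invF]
  have := Measure.integral_comp_smul_of_nonneg (volume : Measure (EuclideanSpace ℝ ι))
    (fun ξ => Complex.exp (Complex.I * ((inner ℝ z ξ : ℝ) : ℂ)) • q ξ) (2 * Real.pi) (hR := hpi.le)
  rw [show fc ι = ((2 * Real.pi) ^ Module.finrank ℝ (EuclideanSpace ℝ ι))⁻¹ by
    simp only [fc, finrank_euclideanSpace, Real.rpow_neg hpi.le, Real.rpow_natCast]]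
  rw [Complex.coe_smul, ← this]
  congr 1; ext v; congr 2
  rw [inner_smul_right, real_inner_comm]; push_cast; ring

theorem norm_invF_le (q : EuclideanSpace ℝ ι → F) (z : EuclideanSpace ℝ ι) :
    ‖invF q z‖ ≤ fc ι * ∫ ξ, ‖q ξ‖ := by
  rw [invF, norm_smul, Complex.norm_real, Real.norm_of_nonneg (fc_pos ι).le]
  gcongr
  · exact (fc_pos ι).le
  refine (norm_integral_le_integral_norm _).trans (le_of_eq ?_)
  congr 1; ext ξ; rw [norm_smul, norm_exp_I_mul_ofReal, one_mul]

theorem integrable_exp_smul {q : EuclideanSpace ℝ ι → F} (hq : Integrable q)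
    (z : EuclideanSpace ℝ ι) :
    Integrable fun ξ => Complex.exp (Complex.I * ((inner ℝ z ξ : ℝ) : ℂ)) • q ξ := by
  exact hq.bdd_smul 1 (Continuous.aestronglyMeasurable (by fun_prop))
    (Eventually.of_forall fun ξ => (norm_exp_I_mul_ofReal _).le)

theorem invF_add {q r : EuclideanSpace ℝ ι → F} (hq : Integrable q) (hr : Integrable r)
    (z : EuclideanSpace ℝ ι) : invF (fun ξ => q ξ + r ξ) z = invF q z + invF r z := by
  simp only [invF, smul_add]
  rw [integral_add (integrable_exp_smul hq z) (integrable_exp_smul hr z), smul_add]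

theorem invF_smul (c : ℂ) (q : EuclideanSpace ℝ ι → F) (z : EuclideanSpace ℝ ι) :
    invF (fun ξ => c • q ξ) z = c • invF q z := by
  simp only [invF]
  simp_rw [smul_comm _ c]
  rw [integral_smul, smul_comm]

theorem invF_sum {α : Type*} (s : Finset α) {q : α → EuclideanSpace ℝ ι → F}
    (hq : ∀ i ∈ s, Integrable (q i)) (z : EuclideanSpace ℝ ι) :
    invF (fun ξ => ∑ i ∈ s, q i ξ) z = ∑ i ∈ s, invF (q i) z := by
  simp only [invF, Finset.smul_sum]
  rw [integral_finsetSum _ fun i hi => integrable_exp_smul (hq i hi) z, Finset.smul_sum]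

theorem hasCompactSupport_slice {h : P × EuclideanSpace ℝ ι → F}
    (hs : HasCompactSupport h) (p : P) : HasCompactSupport fun ξ => h (p, ξ) := by
  refine HasCompactSupport.intro (hs.image continuous_snd) (fun ξ hξ => ?_)
  by_contra hne
  exact hξ ⟨(p, ξ), subset_tsupport _ hne, rfl⟩

theorem integrable_slice {h : P × EuclideanSpace ℝ ι → F} (hc : Continuous h)
    (hs : HasCompactSupport h) (p : P) : Integrable fun ξ => h (p, ξ) :=
  Continuous.integrable_of_hasCompactSupport (by fun_prop) (hasCompactSupport_slice hs p)

theorem continuous_invF {q : EuclideanSpace ℝ ι → F} (hq : Integrable q) :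
    Continuous (invF q) := by
  unfold invF
  refine Continuous.const_smul ?_ _
  refine continuous_of_dominated (bound := fun ξ => ‖q ξ‖) ?_ ?_ hq.norm ?_
  · exact fun z => (integrable_exp_smul hq z).aestronglyMeasurable
  · intro z; exact Eventually.of_forall fun ξ => by
      rw [norm_smul, norm_exp_I_mul_ofReal, one_mul]
  · exact Eventually.of_forall fun ξ => by fun_prop

/-- Integration by parts. -/
theorem inner_smul_invF {q : EuclideanSpace ℝ ι → F} (hq : ContDiff ℝ 1 q)
    (hs : HasCompactSupport q) (z v : EuclideanSpace ℝ ι) :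
    ((inner ℝ z v : ℝ) : ℂ) • invF q z = invF (fun ξ => Complex.I • fderiv ℝ q ξ v) z := by
  have hder : ∀ ξ, HasFDerivAt (fun ξ : EuclideanSpace ℝ ι =>
      Complex.exp (Complex.I * ((inner ℝ z ξ : ℝ) : ℂ)))
      ((Complex.exp (Complex.I * ((inner ℝ z ξ : ℝ) : ℂ))) •
        (Complex.I • (Complex.ofRealCLM.comp (innerSL ℝ z)))) ξ := by
    intro ξ
    have h1 : HasFDerivAt (fun ξ : EuclideanSpace ℝ ι => Complex.I * ((inner ℝ z ξ : ℝ) : ℂ))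
        (Complex.I • (Complex.ofRealCLM.comp (innerSL ℝ z))) ξ := by
      have := (Complex.ofRealCLM.comp (innerSL ℝ z)).hasFDerivAt (x := ξ)
      exact this.const_mul Complex.I
    exact h1.cexp
  have hqd : HasCompactSupport (fderiv ℝ q) := hs.fderiv ℝ
  have hcd : Continuous (fderiv ℝ q) := hq.continuous_fderiv one_ne_zero
  have e : Continuous fun ξ : EuclideanSpace ℝ ι =>
      Complex.exp (Complex.I * ((inner ℝ z ξ : ℝ) : ℂ)) := by fun_prop
  have key := integral_bilinear_hasFDerivAt_right_eq_neg_left_of_integrable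
    (B := (ContinuousLinearMap.lsmul ℝ ℂ : ℂ →L[ℝ] F →L[ℝ] F)) (μ := volume) (v := v)
    (f := fun ξ : EuclideanSpace ℝ ι => Complex.exp (Complex.I * ((inner ℝ z ξ : ℝ) : ℂ)))
    (f' := fun ξ => (Complex.exp (Complex.I * ((inner ℝ z ξ : ℝ) : ℂ))) •
        (Complex.I • (Complex.ofRealCLM.comp (innerSL ℝ z)))) (g := q) (g' := fderiv ℝ q)
    ?_ ?_ ?_ (fun ξ _ => hder ξ) (fun ξ _ => (hq.differentiable one_ne_zero ξ).hasFDerivAt)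
  · simp only [ContinuousLinearMap.lsmul_apply] at key
    simp only [invF]
    simp_rw [smul_comm _ Complex.I]
    rw [integral_smul, key, smul_comm]
    congr 1
    rw [← integral_smul, ← integral_neg, ← integral_smul]
    refine integral_congr_ae (Eventually.of_forall fun ξ => ?_)
    simp only [smul_apply, ContinuousLinearMap.comp_apply, innerSL_apply_apply,
      Complex.ofRealCLM_apply, smul_smul, smul_eq_mul]
    rw [smul_neg, smul_smul, ← neg_smul]
    congr 1
    linear_combination (Complex.exp (Complex.I * ((inner ℝ z ξ : ℝ) : ℂ)))
      * ((inner ℝ z v : ℝ) : ℂ) * Complex.I_mul_I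
  · refine Continuous.integrable_of_hasCompactSupport ?_ ?_
    · simp only [ContinuousLinearMap.lsmul_apply, smul_apply]
      exact Continuous.smul (by fun_prop) hq.continuous
    · refine hs.mono' ?_
      exact (Function.support_subset_iff'.2 fun ξ hξ => by
        simp [image_eq_zero_of_notMem_tsupport hξ])
  · refine Continuous.integrable_of_hasCompactSupport ?_ ?_
    · simp only [ContinuousLinearMap.lsmul_apply]
      exact Continuous.smul (by fun_prop) (by fun_prop)
    · refine hqd.mono' ?_
      exact (Function.support_subset_iff'.2 fun ξ hξ => by
        simp [image_eq_zero_of_notMem_tsupport hξ])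
  · refine Continuous.integrable_of_hasCompactSupport ?_ ?_
    · simp only [ContinuousLinearMap.lsmul_apply]
      exact Continuous.smul (by fun_prop) hq.continuous
    · refine hs.mono' ?_
      exact (Function.support_subset_iff'.2 fun ξ hξ => by
        simp [image_eq_zero_of_notMem_tsupport hξ])

theorem fderiv_slice {h : P × EuclideanSpace ℝ ι → F} (hh : ContDiff ℝ 1 h)
    (p : P) (ξ v : EuclideanSpace ℝ ι) :
    fderiv ℝ (fun ξ => h (p, ξ)) ξ v = fderiv ℝ h (p, ξ) (0, v) := by
  have h1 : HasFDerivAt (fun ξ : EuclideanSpace ℝ ι => (p, ξ))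
      (ContinuousLinearMap.inr ℝ P (EuclideanSpace ℝ ι)) ξ :=
    (hasFDerivAt_const p ξ).prodMk (hasFDerivAt_id ξ)
  have h2 := ((hh.differentiable one_ne_zero (p, ξ)).hasFDerivAt).comp ξ h1
  have h3 : fderiv ℝ (fun ξ => h (p, ξ)) ξ
      = (fderiv ℝ h (p, ξ)).comp (ContinuousLinearMap.inr ℝ P (EuclideanSpace ℝ ι)) := h2.fderiv
  rw [h3]; simp

theorem inner_smul_osc {h : P × EuclideanSpace ℝ ι → F} (hh : ContDiff ℝ 1 h)
    (hs : HasCompactSupport h) (p : P) (z v : EuclideanSpace ℝ ι) :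
    ((inner ℝ z v : ℝ) : ℂ) • osc h p z
      = osc (fun x => Complex.I • fderiv ℝ h x (0, v)) p z := by
  have h1 : ContDiff ℝ 1 fun ξ => h (p, ξ) := hh.comp (contDiff_const.prodMk contDiff_id)
  rw [osc, inner_smul_invF h1 (hasCompactSupport_slice hs p)]
  simp only [osc, fderiv_slice hh]

theorem exists_norm_osc_le {h : P × EuclideanSpace ℝ ι → F} (hc : Continuous h)
    (hs : HasCompactSupport h) : ∃ C, ∀ p z, ‖osc h p z‖ ≤ C := by
  obtain ⟨M, hM⟩ := hs.exists_bound_of_continuous hc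
  have hK : IsCompact (Prod.snd '' tsupport h) := hs.image continuous_snd
  refine ⟨fc ι * (M * (volume (Prod.snd '' tsupport h)).toReal), fun p z => ?_⟩
  refine (norm_invF_le _ z).trans ?_
  gcongr
  · exact (fc_pos ι).le
  have : ∫ ξ, ‖h (p, ξ)‖ = ∫ ξ in Prod.snd '' tsupport h, ‖h (p, ξ)‖ := by
    symm
    apply setIntegral_eq_integral_of_forall_compl_eq_zero
    intro ξ hξ
    by_contra hne
    exact hξ ⟨(p, ξ), subset_tsupport _ (by simpa using hne), rfl⟩
  rw [this]
  refine (setIntegral_mono_on (g := fun _ => M) (integrable_slice hc hs p).norm.integrableOn ?_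
    hK.measurableSet fun ξ _ => hM _).trans ?_
  · exact integrableOn_const hK.measure_lt_top.ne
  · rw [setIntegral_const, smul_eq_mul, mul_comm]; rfl

theorem contDiff_fderiv_apply {h : P × EuclideanSpace ℝ ι → F} (hh : ContDiff ℝ ∞ h)
    (v : P × EuclideanSpace ℝ ι) : ContDiff ℝ ∞ fun x => fderiv ℝ h x v :=
  (hh.fderiv_right (m := ∞) le_rfl).clm_apply contDiff_const

theorem hasCompactSupport_fderiv_apply {h : P × EuclideanSpace ℝ ι → F}
    (hs : HasCompactSupport h) (v : P × EuclideanSpace ℝ ι) :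
    HasCompactSupport fun x => fderiv ℝ h x v :=
  (hs.fderiv ℝ).comp_left (g := fun L : P × EuclideanSpace ℝ ι →L[ℝ] F => L v) (by simp)

/-- Rapid decay of `osc h p z` in `z`, uniformly in the parameter. -/
theorem exists_norm_osc_le_wt (N : ℕ) : ∀ {h : P × EuclideanSpace ℝ ι → F}, ContDiff ℝ ∞ h →
    HasCompactSupport h → ∃ C, 0 ≤ C ∧ ∀ p z, ‖osc h p z‖ ≤ C * wt N z := by
  suffices H : ∀ {h : P × EuclideanSpace ℝ ι → F}, ContDiff ℝ ∞ h →
      HasCompactSupport h → ∃ C, ∀ p z, (1 + ‖z‖) ^ N * ‖osc h p z‖ ≤ C by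
    intro h hh hs
    obtain ⟨C, hC⟩ := H hh hs
    refine ⟨C, ?_, fun p z => le_mul_wt_iff.2 (hC p z)⟩
    exact le_trans (by positivity) (hC 0 0)
  induction N with
  | zero =>
    intro h hh hs
    obtain ⟨C, hC⟩ := exists_norm_osc_le hh.continuous hs
    exact ⟨C, by simpa using hC⟩
  | succ N ih =>
    intro h hh hs
    classical
    let b := EuclideanSpace.basisFun ι ℝ
    obtain ⟨C0, hC0⟩ := ih hh hs
    have hj : ∀ j : ι, ∃ C, ∀ p z, (1 + ‖z‖) ^ N *
        ‖osc (fun x => Complex.I • fderiv ℝ h x (0, b j)) p z‖ ≤ C := by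
      intro j
      refine ih (contDiff_const.smul (contDiff_fderiv_apply hh _)) ?_
      exact (hasCompactSupport_fderiv_apply hs (0, b j)).comp_left (g := fun y : F => Complex.I • y)
        (by simp)
    choose C hC using hj
    refine ⟨C0 + ∑ j, C j, fun p z => ?_⟩
    have h1 : ‖z‖ ≤ ∑ j, |inner ℝ z (b j)| := by
      conv_lhs => rw [← b.sum_repr' z]
      refine (norm_sum_le _ _).trans (Finset.sum_le_sum fun j _ => ?_)
      rw [norm_smul, b.orthonormal.1 j, mul_one, Real.norm_eq_abs, real_inner_comm]
    have h2 : ∀ j, |inner ℝ z (b j)| * ‖osc h p z‖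
        = ‖osc (fun x => Complex.I • fderiv ℝ h x (0, b j)) p z‖ := by
      intro j
      rw [← inner_smul_osc (hh.of_le (by exact_mod_cast le_top)) hs, norm_smul,
        Complex.norm_real, Real.norm_eq_abs]
    calc (1 + ‖z‖) ^ (N + 1) * ‖osc h p z‖
        ≤ (1 + ‖z‖) ^ N * (‖osc h p z‖ + ∑ j, |inner ℝ z (b j)| * ‖osc h p z‖) := by
          rw [pow_succ, mul_assoc, ← Finset.sum_mul]
          gcongr
          nlinarith [norm_nonneg (osc h p z)]
      _ ≤ C0 + ∑ j, C j := by
          rw [mul_add, Finset.mul_sum]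
          refine add_le_add (hC0 p z) (Finset.sum_le_sum fun j _ => ?_)
          rw [h2]; exact hC j p z

/-- The differential of a symbol in the parameter. -/
def dpar (h : P × EuclideanSpace ℝ ι → F) (x : P × EuclideanSpace ℝ ι) : P →L[ℝ] F :=
  (fderiv ℝ h x).comp (ContinuousLinearMap.inl ℝ P (EuclideanSpace ℝ ι))

theorem contDiff_dpar {h : P × EuclideanSpace ℝ ι → F} (hh : ContDiff ℝ ∞ h) :
    ContDiff ℝ ∞ (dpar h) :=
  (hh.fderiv_right (m := ∞) le_rfl).clm_comp contDiff_const

theorem hasCompactSupport_dpar {h : P × EuclideanSpace ℝ ι → F} (hs : HasCompactSupport h) :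
    HasCompactSupport (dpar h) :=
  (hs.fderiv ℝ).comp_left (g := fun L : P × EuclideanSpace ℝ ι →L[ℝ] F =>
    L.comp (ContinuousLinearMap.inl ℝ P (EuclideanSpace ℝ ι))) (by simp)

/-- Differentiation of `osc h p z` in the parameter. -/
theorem hasFDerivAt_osc {h : P × EuclideanSpace ℝ ι → F} (hh : ContDiff ℝ ∞ h)
    (hs : HasCompactSupport h) (p : P) (z : EuclideanSpace ℝ ι) :
    HasFDerivAt (fun p => osc h p z) (osc (dpar h) p z) p := by
  have hd := contDiff_dpar hh
  have hds := hasCompactSupport_dpar hs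
  obtain ⟨M, hM⟩ := hds.exists_bound_of_continuous hd.continuous
  have hK : IsCompact (Prod.snd '' tsupport (dpar h)) := hds.image continuous_snd
  have hM0 : 0 ≤ M := (norm_nonneg _).trans (hM 0)
  unfold osc invF
  refine HasFDerivAt.const_smul ?_ (fc ι : ℂ)
  refine hasFDerivAt_integral_of_dominated_of_fderiv_le (𝕜 := ℝ) (s := univ)
    (bound := (Prod.snd '' tsupport (dpar h)).indicator fun _ => M)
    (F' := fun p ξ => Complex.exp (Complex.I * ((inner ℝ z ξ : ℝ) : ℂ)) • dpar h (p, ξ))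
    Filter.univ_mem ?_ ?_ ?_ ?_ ?_ ?_
  · refine Eventually.of_forall fun q => ?_
    exact (integrable_exp_smul (integrable_slice hh.continuous hs q) z).aestronglyMeasurable
  · exact integrable_exp_smul (integrable_slice hh.continuous hs p) z
  · exact (integrable_exp_smul (integrable_slice hd.continuous hds p) z).aestronglyMeasurable
  · refine Eventually.of_forall fun ξ q _ => ?_
    rw [norm_smul, norm_exp_I_mul_ofReal, one_mul]
    by_cases hξ : ξ ∈ Prod.snd '' tsupport (dpar h)
    · rw [indicator_of_mem hξ]; exact hM _
    · rw [indicator_of_notMem hξ]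
      have : dpar h (q, ξ) = 0 := by
        by_contra hne
        exact hξ ⟨(q, ξ), subset_tsupport _ hne, rfl⟩
      rw [this, norm_zero]
  · exact (integrable_indicator_iff hK.measurableSet).2 (integrableOn_const hK.measure_lt_top.ne)
  · refine Eventually.of_forall fun ξ q _ => ?_
    have h1 : HasFDerivAt (fun q : P => (q, ξ))
        (ContinuousLinearMap.inl ℝ P (EuclideanSpace ℝ ι)) q :=
      (hasFDerivAt_id q).prodMk (hasFDerivAt_const ξ q)
    have h2 := ((hh.differentiable (by simp) (q, ξ)).hasFDerivAt).comp q h1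
    exact h2.const_smul _

theorem continuous_osc {h : P × EuclideanSpace ℝ ι → F} (hc : Continuous h)
    (hs : HasCompactSupport h) : Continuous fun x : P × EuclideanSpace ℝ ι => osc h x.1 x.2 := by
  obtain ⟨M, hM⟩ := hs.exists_bound_of_continuous hc
  have hK : IsCompact (Prod.snd '' tsupport h) := hs.image continuous_snd
  unfold osc invF
  refine Continuous.const_smul ?_ _
  refine continuous_of_dominated (bound := (Prod.snd '' tsupport h).indicator fun _ => M) ?_ ?_
    ((integrable_indicator_iff hK.measurableSet).2 (integrableOn_const hK.measure_lt_top.ne)) ?_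
  · exact fun x => (integrable_exp_smul (integrable_slice hc hs x.1) x.2).aestronglyMeasurable
  · refine fun x => Eventually.of_forall fun ξ => ?_
    rw [norm_smul, norm_exp_I_mul_ofReal, one_mul]
    by_cases hξ : ξ ∈ Prod.snd '' tsupport h
    · rw [indicator_of_mem hξ]; exact hM _
    · rw [indicator_of_notMem hξ]
      have : h (x.1, ξ) = 0 := by
        by_contra hne
        exact hξ ⟨(x.1, ξ), subset_tsupport _ hne, rfl⟩
      simp [this]
  · exact Eventually.of_forall fun ξ => by fun_prop

/-- Lipschitz continuity of `osc h p z` in `p`, with rapid decay in `z`. -/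
theorem exists_norm_osc_sub_le_wt {h : P × EuclideanSpace ℝ ι → F} (hh : ContDiff ℝ ∞ h)
    (hs : HasCompactSupport h) (N : ℕ) :
    ∃ C, 0 ≤ C ∧ ∀ p q z, ‖osc h p z - osc h q z‖ ≤ C * ‖p - q‖ * wt N z := by
  obtain ⟨C, hC0, hC⟩ := exists_norm_osc_le_wt N (contDiff_dpar hh) (hasCompactSupport_dpar hs)
  refine ⟨C, hC0, fun p q z => ?_⟩
  have := Convex.norm_image_sub_le_of_norm_hasFDerivWithin_le (𝕜 := ℝ) (s := univ)
    (f := fun p => osc h p z) (f' := fun p => osc (dpar h) p z) (C := C * wt N z)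
    (fun x _ => (hasFDerivAt_osc hh hs x z).hasFDerivWithinAt) (fun x _ => hC x z) convex_univ
    (mem_univ q) (mem_univ p)
  calc _ ≤ C * wt N z * ‖p - q‖ := this
    _ = _ := by ring

theorem exists_norm_invF_le_wt {q : EuclideanSpace ℝ ι → F} (hq : ContDiff ℝ ∞ q)
    (hs : HasCompactSupport q) (N : ℕ) : ∃ C, 0 ≤ C ∧ ∀ z, ‖invF q z‖ ≤ C * wt N z := by
  obtain ⟨C, hC0, hC⟩ := exists_norm_osc_le_wt (P := Fin 0 → ℝ) N
    (h := fun x => q x.2) (hq.comp contDiff_snd) (by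
      refine HasCompactSupport.intro (K := univ ×ˢ tsupport q) (isCompact_univ.prod hs) ?_
      intro x hx
      exact image_eq_zero_of_notMem_tsupport fun h => hx ⟨mem_univ _, h⟩)
  exact ⟨C, hC0, fun z => hC 0 z⟩

theorem integrable_invF {q : EuclideanSpace ℝ ι → F} (hq : ContDiff ℝ ∞ q)
    (hs : HasCompactSupport q) : Integrable (invF q) := by
  obtain ⟨C, hC0, hC⟩ := exists_norm_invF_le_wt hq hs (Fintype.card ι + 1)
  refine ((integrable_wt (by simp)).const_mul C).mono'
    (continuous_invF (hq.continuous.integrable_of_hasCompactSupport hs)).aestronglyMeasurable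
    (Eventually.of_forall hC)

/-- Fourier inversion. -/
theorem integral_exp_smul_invF [CompleteSpace F] {q : EuclideanSpace ℝ ι → F}
    (hq : ContDiff ℝ ∞ q) (hs : HasCompactSupport q) (ξ : EuclideanSpace ℝ ι) :
    ∫ r, Complex.exp (-(Complex.I * ((inner ℝ r ξ : ℝ) : ℂ))) • invF q r = q ξ := by
  have hpi : (2 * Real.pi) ≠ 0 := by positivity
  have hQs : HasCompactSupport fun η => q ((2 * Real.pi) • η) := hs.comp_smul hpi
  have hQc : Continuous fun η => q ((2 * Real.pi) • η) := hq.continuous.comp (by fun_prop)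
  have hfun : invF q = 𝓕⁻ (fun η => q ((2 * Real.pi) • η)) := funext (invF_eq_fourierInv q)
  have h1 := congrFun (hQc.fourier_fourierInv_eq (hQc.integrable_of_hasCompactSupport hQs) (by
    have := integrable_invF hq hs
    rw [hfun] at this
    convert this.comp_neg using 1
    ext w; rw [Real.fourierInv_eq_fourier_neg, neg_neg])) ((2 * Real.pi)⁻¹ • ξ)
  rw [← hfun, Real.fourier_eq'] at h1
  rw [smul_smul, mul_inv_cancel₀ hpi, one_smul] at h1
  rw [← h1]
  congr 1; funext r; congr 2
  rw [inner_smul_right]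
  push_cast
  have : ((Real.pi : ℝ) : ℂ) ≠ 0 := by exact_mod_cast Real.pi_ne_zero
  field_simp

/-- Convolution with an inverse Fourier transform. -/
theorem integral_mul_invF_sub {A b : EuclideanSpace ℝ ι → ℂ} (hA : Integrable A)
    (hb : Integrable b) (ζ : EuclideanSpace ℝ ι) :
    ∫ r, A r * invF b (ζ - r) = invF (fun ξ =>
      (∫ r, Complex.exp (-(Complex.I * ((inner ℝ r ξ : ℝ) : ℂ))) * A r) * b ξ) ζ := by
  have e : ∀ r ξ : EuclideanSpace ℝ ι,
      Complex.exp (Complex.I * ((inner ℝ (ζ - r) ξ : ℝ) : ℂ))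
      = Complex.exp (Complex.I * ((inner ℝ ζ ξ : ℝ) : ℂ))
        * Complex.exp (-(Complex.I * ((inner ℝ r ξ : ℝ) : ℂ))) := by
    intro r ξ; rw [← Complex.exp_add, inner_sub_left]; push_cast; ring_nf
  simp only [invF, smul_eq_mul]
  have h1 : ∀ r, A r * ((fc ι : ℂ) * ∫ ξ, Complex.exp (Complex.I * ((inner ℝ (ζ - r) ξ : ℝ) : ℂ)) * b ξ)
      = (fc ι : ℂ) * ∫ ξ, Complex.exp (Complex.I * ((inner ℝ (ζ - r) ξ : ℝ) : ℂ)) * (A r * b ξ) := by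
    intro r
    rw [mul_left_comm, ← integral_const_mul]
    congr 2; funext ξ; ring
  simp_rw [h1]
  rw [integral_const_mul, integral_integral_swap]
  · congr 2; funext ξ
    rw [mul_comm _ (b ξ), ← mul_assoc, ← integral_const_mul]
    congr 1; funext r
    rw [e]; ring
  · have := (hA.mul_prod hb).bdd_mul (c := 1) (f := fun x : EuclideanSpace ℝ ι × EuclideanSpace ℝ ι =>
      Complex.exp (Complex.I * ((inner ℝ (ζ - x.1) x.2 : ℝ) : ℂ)))
      (Continuous.aestronglyMeasurable (by fun_prop))
      (Eventually.of_forall fun ξ => (norm_exp_I_mul_ofReal _).le)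
    exact this

/-- The inverse Fourier transform turns products into convolutions. -/
theorem integral_invF_mul_invF_sub {a b : EuclideanSpace ℝ ι → ℂ} (ha : ContDiff ℝ ∞ a)
    (has : HasCompactSupport a) (hb : Integrable b) (ζ : EuclideanSpace ℝ ι) :
    ∫ r, invF a r * invF b (ζ - r) = invF (fun ξ => a ξ * b ξ) ζ := by
  rw [integral_mul_invF_sub (integrable_invF ha has) hb]
  congr 1; funext ξ
  rw [← integral_exp_smul_invF ha has ξ]; rfl

theorem conj_invF (q : EuclideanSpace ℝ ι → ℂ) (z : EuclideanSpace ℝ ι) :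
    (starRingEnd ℂ) (invF q z) = invF (fun ξ => (starRingEnd ℂ) (q ξ)) (-z) := by
  simp only [invF, smul_eq_mul, map_mul, Complex.conj_ofReal, ← integral_conj]
  congr 2; funext ξ
  rw [← Complex.exp_conj]
  simp

end Osc

/-! ### Integral operators on `L²` with rapidly decaying kernels -/

section Kernels

variable {ι : Type*} [Fintype ι]

local notation "E" => EuclideanSpace ℝ ι

/-- Young's inequality `‖G * u‖₂ ≤ ‖G‖₁ ‖u‖₂` for nonnegative functions. -/
theorem lintegral_convolution_sq_le {V : Type*} [NormedAddCommGroup V] [NormedSpace ℝ V]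
    [FiniteDimensional ℝ V] [MeasurableSpace V] [BorelSpace V] (μ : Measure V)
    [μ.IsAddHaarMeasure] {G u : V → ℝ≥0∞} (hG : Measurable G) (hu : AEMeasurable u μ) :
    ∫⁻ x, (∫⁻ y, G (x - y) * u y ∂μ) ^ 2 ∂μ ≤ (∫⁻ z, G z ∂μ) ^ 2 * ∫⁻ y, u y ^ 2 ∂μ := by
  wlog hum : Measurable u generalizing u
  · have h1 := hu.ae_eq_mk
    have h2 : ∀ x, ∫⁻ y, G (x - y) * u y ∂μ = ∫⁻ y, G (x - y) * hu.mk u y ∂μ := fun x =>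
      lintegral_congr_ae (by filter_upwards [h1] with y hy; rw [hy])
    have h3 : ∫⁻ y, u y ^ 2 ∂μ = ∫⁻ y, hu.mk u y ^ 2 ∂μ :=
      lintegral_congr_ae (by filter_upwards [h1] with y hy; rw [hy])
    simp_rw [h2, h3]
    exact this hu.measurable_mk.aemeasurable hu.measurable_mk
  have hsub : ∀ x, ∫⁻ y, G (x - y) ∂μ = ∫⁻ z, G z ∂μ := fun x => lintegral_sub_left_eq_self G x
  have hcs : ∀ x, (∫⁻ y, G (x - y) * u y ∂μ) ^ 2
      ≤ (∫⁻ z, G z ∂μ) * ∫⁻ y, G (x - y) * u y ^ 2 ∂μ := by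
    intro x
    have hGx : Measurable fun y => G (x - y) := hG.comp (measurable_const.sub measurable_id)
    have hconj : Real.HolderConjugate 2 2 := Real.HolderConjugate.two_two
    have h := ENNReal.lintegral_mul_le_Lp_mul_Lq μ hconj
      (f := fun y => G (x - y) ^ (1 / 2 : ℝ)) (g := fun y => G (x - y) ^ (1 / 2 : ℝ) * u y)
      (hGx.pow_const _).aemeasurable ((hGx.pow_const _).mul hum).aemeasurable
    have e1 : ∀ y, ((fun y => G (x - y) ^ (1 / 2 : ℝ)) * fun y => G (x - y) ^ (1 / 2 : ℝ) * u y) y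
        = G (x - y) * u y := by
      intro y
      simp only [Pi.mul_apply]
      rw [← mul_assoc, ← ENNReal.rpow_add_of_nonneg _ _ (by norm_num) (by norm_num)]
      norm_num
    have e2 : ∀ y, (G (x - y) ^ (1 / 2 : ℝ)) ^ (2 : ℝ) = G (x - y) := by
      intro y; rw [← ENNReal.rpow_mul]; norm_num
    have e3 : ∀ y, (G (x - y) ^ (1 / 2 : ℝ) * u y) ^ (2 : ℝ) = G (x - y) * u y ^ 2 := by
      intro y; rw [ENNReal.mul_rpow_of_nonneg _ _ (by norm_num), e2]; norm_num
    simp_rw [e1, e2, e3, hsub] at h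
    calc (∫⁻ y, G (x - y) * u y ∂μ) ^ 2 ≤ _ := pow_le_pow_left₀ (zero_le) h 2
      _ = _ := by
        rw [mul_pow, ← ENNReal.rpow_natCast, ← ENNReal.rpow_natCast, ← ENNReal.rpow_mul,
          ← ENNReal.rpow_mul]
        norm_num
  calc _ ≤ ∫⁻ x, (∫⁻ z, G z ∂μ) * ∫⁻ y, G (x - y) * u y ^ 2 ∂μ ∂μ := lintegral_mono hcs
    _ = (∫⁻ z, G z ∂μ) * ∫⁻ x, ∫⁻ y, G (x - y) * u y ^ 2 ∂μ ∂μ := by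
        refine lintegral_const_mul _ ?_
        exact Measurable.lintegral_prod_right' (f := fun p : V × V => G (p.1 - p.2) * u p.2 ^ 2)
          ((hG.comp (measurable_fst.sub measurable_snd)).mul ((hum.comp measurable_snd).pow_const 2))
    _ = (∫⁻ z, G z ∂μ) * ∫⁻ y, ∫⁻ x, G (x - y) * u y ^ 2 ∂μ ∂μ := by
        rw [lintegral_lintegral_swap]
        exact ((hG.comp (measurable_fst.sub measurable_snd)).mul
          ((hum.comp measurable_snd).pow_const 2)).aemeasurable
    _ = _ := by
        rw [sq (∫⁻ z, G z ∂μ), mul_assoc]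
        congr 1
        rw [← lintegral_const_mul _ (hum.pow_const 2)]
        congr 1; funext y
        have hm : Measurable fun x => G (x - y) := hG.comp (measurable_id.sub measurable_const)
        rw [lintegral_mul_const _ hm,
          lintegral_sub_right_eq_self G y]

/-- The integral operator with kernel `K`. -/
def kop (K : E → E → ℂ) (u : E → ℂ) (x : E) : ℂ := ∫ y, K x y * u y

/-- Continuous kernels which decay rapidly away from the diagonal. -/
structure IsKer (K : E → E → ℂ) : Prop where
  cont : Continuous fun p : E × E => K p.1 p.2
  bound : ∀ N : ℕ, ∃ C : ℝ, 0 ≤ C ∧ ∀ x y, ‖K x y‖ ≤ C * wt N (x - y)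

/-- The exponent beyond which the weights are integrable. -/
abbrev dimN (ι : Type*) [Fintype ι] : ℕ := Fintype.card ι + 1

/-- The `L¹` norm of the basic integrable weight. -/
def wtInt (ι : Type*) [Fintype ι] : ℝ := ∫ z : EuclideanSpace ℝ ι, wt (dimN ι) z

theorem wtInt_nonneg : 0 ≤ wtInt ι := integral_wt_nonneg _

theorem integrable_wt_dimN : Integrable (wt (dimN ι) : E → ℝ) := integrable_wt (by simp)

theorem integrable_wt_of_le {N : ℕ} (h : dimN ι ≤ N) : Integrable (wt N : E → ℝ) :=
  integrable_wt (by simp only [finrank_euclideanSpace]; unfold dimN at h; omega)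

theorem memLp_wt : MemLp (wt (dimN ι) : E → ℝ) 2 volume := by
  rw [memLp_two_iff_integrable_sq (continuous_wt _).aestronglyMeasurable]
  refine (integrable_wt_of_le (ι := ι) (N := dimN ι + dimN ι) (by omega)).congr
    (Eventually.of_forall fun z => ?_)
  simp only [wt_add, sq]

theorem memLp_wt_sub (x : E) : MemLp (fun y => wt (dimN ι) (x - y) : E → ℝ) 2 volume := by
  have := (memLp_wt (ι := ι)).comp_measurePreserving (Measure.measurePreserving_sub_left volume x)
  exact this

theorem lintegral_wt : ∫⁻ z : E, ENNReal.ofReal (wt (dimN ι) z) = ENNReal.ofReal (wtInt ι) :=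
  (ofReal_integral_eq_lintegral_ofReal integrable_wt_dimN
    (Eventually.of_forall fun z => wt_nonneg _ z)).symm

theorem integrable_wt_mul {u : E → ℂ} (hu : MemLp u 2 volume) (x : E) :
    Integrable fun y => wt (dimN ι) (x - y) * ‖u y‖ :=
  (memLp_wt_sub x).integrable_mul hu.norm

theorem integrable_ker_mul {K : E → E → ℂ} (hK : IsKer K) {u : E → ℂ} (hu : MemLp u 2 volume)
    (x : E) : Integrable fun y => K x y * u y := by
  obtain ⟨C, hC0, hC⟩ := hK.bound (dimN ι)
  refine ((integrable_wt_mul hu x).const_mul C).mono' ?_ (Eventually.of_forall fun y => ?_)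
  · exact (hK.cont.comp (by fun_prop : Continuous fun y => (x, y))).aestronglyMeasurable.mul hu.1
  · rw [norm_mul, ← mul_assoc]; gcongr; exact hC x y

theorem aestronglyMeasurable_kop {K : E → E → ℂ} (hK : IsKer K) {u : E → ℂ}
    (hu : AEStronglyMeasurable u volume) : AEStronglyMeasurable (kop K u) volume := by
  unfold kop
  exact AEStronglyMeasurable.integral_prod_right' (f := fun p : E × E => K p.1 p.2 * u p.2)
    (hK.cont.aestronglyMeasurable.mul hu.comp_snd)

/-- A pointwise bound by a convolution with an integrable weight gives a bound in `L²`. -/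
theorem eLpNorm_le_of_le_convolution {f u : E → ℂ} (hu : AEStronglyMeasurable u volume) {C : ℝ}
    (hC : 0 ≤ C) (h : ∀ x, ‖f x‖ₑ ≤ ∫⁻ y, ENNReal.ofReal (C * wt (dimN ι) (x - y)) * ‖u y‖ₑ) :
    eLpNorm f 2 volume ≤ ENNReal.ofReal (C * wtInt ι) * eLpNorm u 2 volume := by
  have hG : Measurable fun z : E => ENNReal.ofReal (C * wt (dimN ι) z) :=
    (((continuous_wt _).measurable).const_mul C).ennreal_ofReal
  have hy := lintegral_convolution_sq_le (volume : Measure E) hG hu.enorm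
  have hI : ∫⁻ z : E, ENNReal.ofReal (C * wt (dimN ι) z) = ENNReal.ofReal (C * wtInt ι) := by
    simp_rw [ENNReal.ofReal_mul hC]
    rw [lintegral_const_mul _ (continuous_wt _).measurable.ennreal_ofReal, lintegral_wt]
  rw [hI] at hy
  have e2 : ∀ g : E → ℂ, eLpNorm g 2 volume = (∫⁻ x, ‖g x‖ₑ ^ 2) ^ (1 / 2 : ℝ) := by
    intro g
    rw [eLpNorm_eq_lintegral_rpow_enorm_toReal (by norm_num) (by norm_num)]
    norm_num
  rw [e2, e2]
  calc _ ≤ (ENNReal.ofReal (C * wtInt ι) ^ 2 * ∫⁻ y, ‖u y‖ₑ ^ 2) ^ (1 / 2 : ℝ) := by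
        gcongr
        refine (lintegral_mono fun x => ?_).trans hy
        gcongr; exact h x
    _ = _ := by
        rw [ENNReal.mul_rpow_of_nonneg _ _ (by norm_num), ← ENNReal.rpow_natCast,
          ← ENNReal.rpow_mul]
        norm_num

theorem enorm_kop_le {K : E → E → ℂ} {u : E → ℂ} {C : ℝ}
    (h : ∀ x y, ‖K x y‖ ≤ C * wt (dimN ι) (x - y)) (x : E) :
    ‖kop K u x‖ₑ ≤ ∫⁻ y, ENNReal.ofReal (C * wt (dimN ι) (x - y)) * ‖u y‖ₑ := by
  refine (enorm_integral_le_lintegral_enorm _).trans (lintegral_mono fun y => ?_)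
  rw [enorm_mul]
  gcongr
  rw [← ofReal_norm]
  exact ENNReal.ofReal_le_ofReal (h x y)

theorem eLpNorm_kop_le {K : E → E → ℂ} {u : E → ℂ} (hu : AEStronglyMeasurable u volume)
    {C : ℝ} (hC : 0 ≤ C) (h : ∀ x y, ‖K x y‖ ≤ C * wt (dimN ι) (x - y)) :
    eLpNorm (kop K u) 2 volume ≤ ENNReal.ofReal (C * wtInt ι) * eLpNorm u 2 volume :=
  eLpNorm_le_of_le_convolution hu hC (enorm_kop_le h)

theorem memLp_kop {K : E → E → ℂ} (hK : IsKer K) {u : E → ℂ} (hu : MemLp u 2 volume) :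
    MemLp (kop K u) 2 volume := by
  obtain ⟨C, hC0, hC⟩ := hK.bound (dimN ι)
  exact ⟨aestronglyMeasurable_kop hK hu.1,
    (eLpNorm_kop_le hu.1 hC0 hC).trans_lt (ENNReal.mul_lt_top ENNReal.ofReal_lt_top hu.2)⟩

theorem kop_congr_ae {K : E → E → ℂ} {u v : E → ℂ} (h : u =ᵐ[volume] v) : kop K u = kop K v := by
  funext x
  exact integral_congr_ae (by filter_upwards [h] with y hy; rw [hy])

theorem kop_add {K : E → E → ℂ} (hK : IsKer K) {u v : E → ℂ} (hu : MemLp u 2 volume)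
    (hv : MemLp v 2 volume) : kop K (u + v) = kop K u + kop K v := by
  funext x
  simp only [kop, Pi.add_apply, mul_add]
  exact integral_add (integrable_ker_mul hK hu x) (integrable_ker_mul hK hv x)

theorem kop_smul {K : E → E → ℂ} (c : ℂ) (u : E → ℂ) : kop K (c • u) = c • kop K u := by
  funext x
  simp only [kop, Pi.smul_apply, smul_eq_mul, mul_left_comm _ c]
  exact integral_const_mul c _

/-- The bounded operator on `L²` with kernel `K`. -/
def kopL (K : E → E → ℂ) (hK : IsKer K) : L2 ι →L[ℂ] L2 ι :=
  LinearMap.mkContinuousOfExistsBound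
    { toFun := fun u => (memLp_kop hK (Lp.memLp u)).toLp _
      map_add' := fun u v => by
        rw [← MemLp.toLp_add]
        exact MemLp.toLp_congr _ _ (Eventually.of_forall fun x => congrFun
          ((kop_congr_ae (Lp.coeFn_add u v)).trans (kop_add hK (Lp.memLp u) (Lp.memLp v))) x)
      map_smul' := fun c u => by
        rw [RingHom.id_apply, ← MemLp.toLp_const_smul]
        exact MemLp.toLp_congr _ _ (Eventually.of_forall fun x => congrFun
          ((kop_congr_ae (Lp.coeFn_smul c u)).trans (kop_smul c _)) x) }
    (by
      obtain ⟨C, hC0, hC⟩ := hK.bound (dimN ι)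
      refine ⟨C * wtInt ι, fun u => ?_⟩
      change ‖(memLp_kop hK (Lp.memLp u)).toLp _‖ ≤ _
      rw [Lp.norm_toLp, Lp.norm_def, ← ENNReal.toReal_ofReal (mul_nonneg hC0 wtInt_nonneg),
        ← ENNReal.toReal_mul]
      exact ENNReal.toReal_mono (ENNReal.mul_ne_top ENNReal.ofReal_ne_top (Lp.eLpNorm_ne_top u))
        (eLpNorm_kop_le (Lp.aestronglyMeasurable u) hC0 hC))

theorem kopL_apply {K : E → E → ℂ} (hK : IsKer K) (u : L2 ι) :
    kopL K hK u = (memLp_kop hK (Lp.memLp u)).toLp _ := rfl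

theorem coeFn_kopL {K : E → E → ℂ} (hK : IsKer K) (u : L2 ι) :
    kopL K hK u =ᵐ[volume] kop K u :=
  MemLp.coeFn_toLp (memLp_kop hK (Lp.memLp u))

theorem kopL_toLp {K : E → E → ℂ} (hK : IsKer K) {u : E → ℂ} (hu : MemLp u 2 volume) :
    kopL K hK (hu.toLp u) = (memLp_kop hK hu).toLp _ := by
  rw [kopL_apply]
  exact MemLp.toLp_congr _ _ (Eventually.of_forall fun x =>
    congrFun (kop_congr_ae hu.coeFn_toLp) x)

theorem norm_kopL_apply_le {K : E → E → ℂ} (hK : IsKer K) {C : ℝ} (hC : 0 ≤ C)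
    (h : ∀ x y, ‖K x y‖ ≤ C * wt (dimN ι) (x - y)) (u : L2 ι) :
    ‖kopL K hK u‖ ≤ C * wtInt ι * ‖u‖ := by
  rw [kopL_apply, Lp.norm_toLp, Lp.norm_def, ← ENNReal.toReal_ofReal (mul_nonneg hC wtInt_nonneg),
    ← ENNReal.toReal_mul]
  exact ENNReal.toReal_mono (ENNReal.mul_ne_top ENNReal.ofReal_ne_top (Lp.eLpNorm_ne_top u))
    (eLpNorm_kop_le (Lp.aestronglyMeasurable u) hC h)

theorem norm_kopL_le {K : E → E → ℂ} (hK : IsKer K) {C : ℝ} (hC : 0 ≤ C)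
    (h : ∀ x y, ‖K x y‖ ≤ C * wt (dimN ι) (x - y)) : ‖kopL K hK‖ ≤ C * wtInt ι :=
  ContinuousLinearMap.opNorm_le_bound _ (mul_nonneg hC wtInt_nonneg) (norm_kopL_apply_le hK hC h)

theorem IsKer.sub {K K' : E → E → ℂ} (hK : IsKer K) (hK' : IsKer K') :
    IsKer fun x y => K x y - K' x y := by
  refine ⟨hK.cont.sub hK'.cont, fun N => ?_⟩
  obtain ⟨C, hC0, hC⟩ := hK.bound N
  obtain ⟨C', hC0', hC'⟩ := hK'.bound N
  refine ⟨C + C', by positivity, fun x y => (norm_sub_le _ _).trans ?_⟩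
  rw [add_mul]; exact add_le_add (hC x y) (hC' x y)

theorem IsKer.add {K K' : E → E → ℂ} (hK : IsKer K) (hK' : IsKer K') :
    IsKer fun x y => K x y + K' x y := by
  refine ⟨hK.cont.add hK'.cont, fun N => ?_⟩
  obtain ⟨C, hC0, hC⟩ := hK.bound N
  obtain ⟨C', hC0', hC'⟩ := hK'.bound N
  refine ⟨C + C', by positivity, fun x y => (norm_add_le _ _).trans ?_⟩
  rw [add_mul]; exact add_le_add (hC x y) (hC' x y)

theorem IsKer.const_mul {K : E → E → ℂ} (hK : IsKer K) (c : ℂ) :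
    IsKer fun x y => c * K x y := by
  refine ⟨hK.cont.const_mul c, fun N => ?_⟩
  obtain ⟨C, hC0, hC⟩ := hK.bound N
  refine ⟨‖c‖ * C, by positivity, fun x y => ?_⟩
  rw [norm_mul, mul_assoc]; gcongr; exact hC x y

theorem kopL_sub {K K' : E → E → ℂ} (hK : IsKer K) (hK' : IsKer K') :
    kopL _ (hK.sub hK') = kopL K hK - kopL K' hK' := by
  ext1 u
  rw [sub_apply, kopL_apply, kopL_apply, kopL_apply, ← MemLp.toLp_sub]
  refine MemLp.toLp_congr _ _ (Eventually.of_forall fun x => ?_)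
  simp only [kop, Pi.sub_apply, sub_mul]
  exact integral_sub (integrable_ker_mul hK (Lp.memLp u) x) (integrable_ker_mul hK' (Lp.memLp u) x)

theorem kopL_add {K K' : E → E → ℂ} (hK : IsKer K) (hK' : IsKer K') :
    kopL _ (hK.add hK') = kopL K hK + kopL K' hK' := by
  ext1 u
  rw [add_apply, kopL_apply, kopL_apply, kopL_apply, ← MemLp.toLp_add]
  refine MemLp.toLp_congr _ _ (Eventually.of_forall fun x => ?_)
  simp only [kop, Pi.add_apply, add_mul]
  exact integral_add (integrable_ker_mul hK (Lp.memLp u) x) (integrable_ker_mul hK' (Lp.memLp u) x)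

theorem kopL_const_mul {K : E → E → ℂ} (hK : IsKer K) (c : ℂ) :
    kopL _ (hK.const_mul c) = c • kopL K hK := by
  ext1 u
  rw [smul_apply, kopL_apply, kopL_apply, ← MemLp.toLp_const_smul]
  refine MemLp.toLp_congr _ _ (Eventually.of_forall fun x => ?_)
  simp only [kop, Pi.smul_apply, smul_eq_mul, mul_assoc]
  exact integral_const_mul c _

theorem norm_kopL_sub_le {K K' : E → E → ℂ} (hK : IsKer K) (hK' : IsKer K') {C : ℝ} (hC : 0 ≤ C)
    (h : ∀ x y, ‖K x y - K' x y‖ ≤ C * wt (dimN ι) (x - y)) :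
    ‖kopL K hK - kopL K' hK'‖ ≤ C * wtInt ι := by
  rw [← kopL_sub]; exact norm_kopL_le _ hC h

theorem kopL_congr {K K' : E → E → ℂ} (h : K = K') (hK : IsKer K) (hK' : IsKer K') :
    kopL K hK = kopL K' hK' := by subst h; rfl

/-- The kernel of the product of two integral operators. -/
def kcomp (K K' : E → E → ℂ) (x z : E) : ℂ := ∫ y, K x y * K' y z

theorem kcomp_eq (K K' : E → E → ℂ) (x z : E) :
    kcomp K K' x z = ∫ r, K x (x - r) * K' (x - r) z :=
  (integral_sub_left_eq_self (fun y => K x y * K' y z) volume x).symm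

theorem norm_mul_ker_le {N M : ℕ} {K K' : E → E → ℂ} {C C' : ℝ} (hC0 : 0 ≤ C) (hC0' : 0 ≤ C')
    (hC : ∀ x y, ‖K x y‖ ≤ C * wt (N + M) (x - y)) (hC' : ∀ x y, ‖K' x y‖ ≤ C' * wt N (x - y))
    (x y z : E) : ‖K x y * K' y z‖ ≤ C * C' * wt N (x - z) * wt M (x - y) := by
  rw [norm_mul]
  calc ‖K x y‖ * ‖K' y z‖ ≤ (C * wt (N + M) (x - y)) * (C' * wt N (y - z)) :=
        mul_le_mul (hC x y) (hC' y z) (norm_nonneg _) (mul_nonneg hC0 (wt_nonneg _ _))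
    _ = C * C' * (wt N (x - y) * wt N (y - z)) * wt M (x - y) := by rw [wt_add]; ring
    _ ≤ _ := by
        gcongr
        · exact wt_nonneg _ _
        · exact wt_mul_wt_sub_le N x y z

theorem integrable_wt_sub (x : E) : Integrable fun y => wt (dimN ι) (x - y) :=
  (integrable_wt_dimN (ι := ι)).comp_sub_left x

theorem integral_wt_sub (x : E) : ∫ y, wt (dimN ι) (x - y) = wtInt ι :=
  integral_sub_left_eq_self (fun y => wt (dimN ι) y) volume x

theorem IsKer.comp {K K' : E → E → ℂ} (hK : IsKer K) (hK' : IsKer K') : IsKer (kcomp K K') := by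
  refine ⟨?_, fun N => ?_⟩
  · obtain ⟨C, hC0, hC⟩ := hK.bound (0 + dimN ι)
    obtain ⟨C', hC0', hC'⟩ := hK'.bound 0
    simp_rw [kcomp_eq]
    have hc : ∀ r : E, Continuous fun p : E × E => K p.1 (p.1 - r) * K' (p.1 - r) p.2 := fun r =>
      (hK.cont.comp (by fun_prop : Continuous fun p : E × E => (p.1, p.1 - r))).mul
      (hK'.cont.comp (by fun_prop : Continuous fun p : E × E => (p.1 - r, p.2)))
    refine continuous_of_dominated (bound := fun r => C * C' * wt (dimN ι) r) ?_ ?_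
      ((integrable_wt_dimN).const_mul _) (Eventually.of_forall hc)
    · intro p
      exact ((hK.cont.comp (by fun_prop : Continuous fun r => (p.1, p.1 - r))).mul
        (hK'.cont.comp (by fun_prop : Continuous fun r => (p.1 - r, p.2)))).aestronglyMeasurable
    · intro p; refine Eventually.of_forall fun r => ?_
      have := norm_mul_ker_le hC0 hC0' hC hC' p.1 (p.1 - r) p.2
      refine this.trans (le_of_eq ?_)
      simp [wt]
  · obtain ⟨C, hC0, hC⟩ := hK.bound (N + dimN ι)
    obtain ⟨C', hC0', hC'⟩ := hK'.bound N
    refine ⟨C * C' * wtInt ι, mul_nonneg (mul_nonneg hC0 hC0') wtInt_nonneg, fun x z => ?_⟩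
    refine (norm_integral_le_of_norm_le ((integrable_wt_sub x).const_mul _)
      (Eventually.of_forall fun y => norm_mul_ker_le hC0 hC0' hC hC' x y z)).trans (le_of_eq ?_)
    rw [integral_const_mul, integral_wt_sub]; ring

theorem kop_kop {K K' : E → E → ℂ} (hK : IsKer K) (hK' : IsKer K') {u : E → ℂ}
    (hu : MemLp u 2 volume) : kop K (kop K' u) = kop (kcomp K K') u := by
  funext x
  obtain ⟨C, hC0, hC⟩ := hK.bound (dimN ι + dimN ι)
  obtain ⟨C', hC0', hC'⟩ := hK'.bound (dimN ι)
  simp only [kop, kcomp]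
  simp_rw [← integral_const_mul, ← integral_mul_const]
  have e : ∀ y z, K x y * (K' y z * u z) = K x y * K' y z * u z := fun y z => by ring
  simp_rw [← e]
  rw [integral_integral_swap]
  · have hm : AEStronglyMeasurable (fun p : E × E => K x p.1 * (K' p.1 p.2 * u p.2))
        (volume.prod volume) :=
      (hK.cont.comp (by fun_prop : Continuous fun p : E × E => (x, p.1))).aestronglyMeasurable.mul
        (hK'.cont.aestronglyMeasurable.mul hu.1.comp_snd)
    have hb := ((integrable_wt_sub x).mul_prod (integrable_wt_mul hu x)).const_mul (C * C')
    refine Integrable.mono' hb hm (Eventually.of_forall fun p => ?_)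
    simp only [Function.uncurry_def]
    rw [e, norm_mul]
    refine (mul_le_mul_of_nonneg_right (norm_mul_ker_le hC0 hC0' hC hC' x p.1 p.2)
      (norm_nonneg (u p.2))).trans (le_of_eq ?_)
    ring

theorem kopL_comp {K K' : E → E → ℂ} (hK : IsKer K) (hK' : IsKer K') :
    kopL K hK ∘L kopL K' hK' = kopL _ (hK.comp hK') := by
  ext1 u
  rw [ContinuousLinearMap.comp_apply, kopL_apply hK' u, kopL_toLp hK, kopL_apply]
  exact MemLp.toLp_congr _ _ (Eventually.of_forall fun x =>
    congrFun (kop_kop hK hK' (Lp.memLp u)) x)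

theorem IsKer.adj {K : E → E → ℂ} (hK : IsKer K) :
    IsKer fun x y => (starRingEnd ℂ) (K y x) := by
  refine ⟨Complex.continuous_conj.comp (hK.cont.comp continuous_swap), fun N => ?_⟩
  obtain ⟨C, hC0, hC⟩ := hK.bound N
  refine ⟨C, hC0, fun x y => ?_⟩
  rw [RCLike.norm_conj, wt_sub_comm]; exact hC y x

theorem inner_kop_eq {K : E → E → ℂ} (hK : IsKer K) {u v : E → ℂ} (hu : MemLp u 2 volume)
    (hv : MemLp v 2 volume) :
    ∫ x, (starRingEnd ℂ) (u x) * kop K v x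
      = ∫ y, (starRingEnd ℂ) (kop (fun x y => (starRingEnd ℂ) (K y x)) u y) * v y := by
  obtain ⟨C, hC0, hC⟩ := hK.bound (dimN ι)
  simp only [kop]
  simp_rw [← integral_conj, ← integral_const_mul, ← integral_mul_const, map_mul, Complex.conj_conj]
  rw [integral_integral_swap]
  · congr 1; funext y; congr 1; funext x; ring
  · have hm : AEStronglyMeasurable
        (fun p : E × E => (starRingEnd ℂ) (u p.1) * (K p.1 p.2 * v p.2)) (volume.prod volume) :=
      (Complex.continuous_conj.comp_aestronglyMeasurable hu.1).comp_fst.mul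
        (hK.cont.aestronglyMeasurable.mul hv.1.comp_snd)
    -- the kernel of the modulus is bounded on `L²`
    have hW : IsKer fun x y : E => (((K x y) : ℂ)) := hK
    refine (integrable_prod_iff hm).2 ⟨Eventually.of_forall fun x => ?_, ?_⟩
    · exact (integrable_ker_mul hK hv x).const_mul ((starRingEnd ℂ) (u x))
    · have hG : MemLp (fun x => (∫ y, ‖K x y * v y‖ : ℝ)) 2 volume := by
        refine ⟨?_, ?_⟩
        · exact (hK.cont.aestronglyMeasurable.mul hv.1.comp_snd).norm.integral_prod_right'
        · refine lt_of_le_of_lt ?_ (ENNReal.mul_lt_top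
            (ENNReal.ofReal_lt_top (r := C * wtInt ι)) hv.2)
          have := eLpNorm_le_of_le_convolution (f := fun x => (((∫ y, ‖K x y * v y‖ : ℝ)) : ℂ))
            hv.1 hC0 (fun x => ?_)
          · refine le_trans (le_of_eq ?_) this
            exact eLpNorm_congr_norm_ae (Eventually.of_forall fun x => by simp)
          · rw [← ofReal_norm, Complex.norm_real, Real.norm_of_nonneg
              (integral_nonneg fun y => norm_nonneg _), ofReal_integral_norm_eq_lintegral_enorm
              (integrable_ker_mul hK hv x)]
            refine lintegral_mono fun y => ?_
            rw [enorm_mul]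
            gcongr
            rw [← ofReal_norm]
            exact ENNReal.ofReal_le_ofReal (hC x y)
      have := hu.norm.integrable_mul hG
      refine this.congr (Eventually.of_forall fun x => ?_)
      simp only [Pi.mul_apply, norm_mul, RCLike.norm_conj]
      rw [← integral_const_mul]

theorem inner_L2_eq (u v : L2 ι) : inner ℂ u v = ∫ x, (starRingEnd ℂ) (u x) * v x := by
  rw [L2.inner_def]
  congr 1; funext x
  rw [RCLike.inner_apply, mul_comm]

theorem inner_kopL {K : E → E → ℂ} (hK : IsKer K) (u v : L2 ι) :
    inner ℂ u (kopL K hK v) = inner ℂ (kopL _ hK.adj u) v := by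
  rw [inner_L2_eq, inner_L2_eq]
  have h1 : ∫ x, (starRingEnd ℂ) (u x) * (kopL K hK v) x
      = ∫ x, (starRingEnd ℂ) (u x) * kop K v x := integral_congr_ae (by
    filter_upwards [coeFn_kopL hK v] with x hx; rw [hx])
  have h2 : ∫ x, (starRingEnd ℂ) ((kopL _ hK.adj u) x) * v x
      = ∫ x, (starRingEnd ℂ) (kop (fun x y => (starRingEnd ℂ) (K y x)) u x) * v x :=
    integral_congr_ae (by filter_upwards [coeFn_kopL hK.adj u] with x hx; rw [hx])
  rw [h1, h2, inner_kop_eq hK (Lp.memLp u) (Lp.memLp v)]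

end Kernels

/-! ### Calculus of slowly varying Weyl symbols -/

section Calculus

variable {ι : Type*} [Fintype ι]

local notation "E" => EuclideanSpace ℝ ι

/-- The position-space form `κ(m, z)` of a Weyl symbol: `z` is the variable dual to the momentum.
The function decays rapidly in `z` and is Lipschitz in `m`. -/
structure IsSym (κ : E → E → ℂ) : Prop where
  cont : Continuous fun p : E × E => κ p.1 p.2
  bound : ∀ N : ℕ, ∃ C : ℝ, 0 ≤ C ∧ ∀ m z, ‖κ m z‖ ≤ C * wt N z
  lip : ∀ N : ℕ, ∃ C : ℝ, 0 ≤ C ∧ ∀ m m' z, ‖κ m z - κ m' z‖ ≤ C * ‖m - m'‖ * wt N z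

/-- The kernel of the Weyl quantization at scale `t` of the symbol with position-space form `κ`. -/
def ker (t : ℝ) (κ : E → E → ℂ) (x y : E) : ℂ := κ ((2 * t)⁻¹ • (x + y)) (x - y)

theorem IsSym.isKer {κ : E → E → ℂ} (hκ : IsSym κ) (t : ℝ) : IsKer (ker t κ) := by
  refine ⟨hκ.cont.comp (by fun_prop :
    Continuous fun p : E × E => ((2 * t)⁻¹ • (p.1 + p.2), p.1 - p.2)), fun N => ?_⟩
  obtain ⟨C, hC0, hC⟩ := hκ.bound N
  exact ⟨C, hC0, fun x y => hC _ _⟩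

/-- The quantization at scale `t`. -/
def opS (κ : E → E → ℂ) (hκ : IsSym κ) (t : ℝ) : L2 ι →L[ℂ] L2 ι := kopL (ker t κ) (hκ.isKer t)

theorem exists_norm_opS_le {κ : E → E → ℂ} (hκ : IsSym κ) : ∃ C, 0 ≤ C ∧ ∀ t, ‖opS κ hκ t‖ ≤ C := by
  obtain ⟨C, hC0, hC⟩ := hκ.bound (dimN ι)
  exact ⟨C * wtInt ι, mul_nonneg hC0 wtInt_nonneg, fun t => norm_kopL_le _ hC0 fun x y => hC _ _⟩

theorem IsSym.integrable_conv {κ₁ κ₂ : E → E → ℂ} (h₁ : IsSym κ₁) (h₂ : IsSym κ₂) (m m' : E → E)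
    (hm : Continuous m) (hm' : Continuous m') (ζ : E) :
    Integrable fun r => κ₁ (m r) r * κ₂ (m' r) (ζ - r) := by
  obtain ⟨C, hC0, hC⟩ := h₁.bound (dimN ι)
  obtain ⟨C', hC0', hC'⟩ := h₂.bound 0
  refine ((integrable_wt_dimN (ι := ι)).const_mul (C * C')).mono' ?_
    (Eventually.of_forall fun r => ?_)
  · exact ((h₁.cont.comp (by fun_prop : Continuous fun r => (m r, r))).mul
      (h₂.cont.comp (by fun_prop : Continuous fun r => (m' r, ζ - r)))).aestronglyMeasurable
  · rw [norm_mul]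
    have h1 := hC (m r) r
    have h2 : ‖κ₂ (m' r) (ζ - r)‖ ≤ C' := by simpa [wt] using hC' (m' r) (ζ - r)
    calc _ ≤ (C * wt (dimN ι) r) * C' := mul_le_mul h1 h2 (norm_nonneg _)
          (mul_nonneg hC0 (wt_nonneg _ _))
      _ = _ := by ring

/-- Leading order of the product formula: the product of two slowly varying operators has, up to
`O(1/t)`, the symbol obtained by convolution of the position-space forms. -/
theorem exists_norm_opS_comp_sub_le {κ₁ κ₂ κ₃ : E → E → ℂ} (h₁ : IsSym κ₁) (h₂ : IsSym κ₂)
    (h₃ : IsSym κ₃) (h : ∀ m ζ, ∫ r, κ₁ m r * κ₂ m (ζ - r) = κ₃ m ζ) :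
    ∃ C, 0 ≤ C ∧ ∀ t > 0, ‖opS κ₁ h₁ t ∘L opS κ₂ h₂ t - opS κ₃ h₃ t‖ ≤ C / t := by
  set d := dimN ι
  obtain ⟨C₁, hC₁0, hC₁⟩ := h₁.bound (d + d + 1)
  obtain ⟨C₂, hC₂0, hC₂⟩ := h₂.bound (d + 1)
  obtain ⟨L₁, hL₁0, hL₁⟩ := h₁.lip (d + d + 1)
  obtain ⟨L₂, hL₂0, hL₂⟩ := h₂.lip (d + 1)
  refine ⟨(L₁ * C₂ + C₁ * L₂) * wtInt ι * wtInt ι, by have := wtInt_nonneg (ι := ι); positivity,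
    fun t ht => ?_⟩
  have hw := wtInt_nonneg (ι := ι)
  have key : ∀ x z, ‖kcomp (ker t κ₁) (ker t κ₂) x z - ker t κ₃ x z‖
      ≤ ((L₁ * C₂ + C₁ * L₂) * wtInt ι / t) * wt d (x - z) := by
    intro x z
    set m := (2 * t)⁻¹ • (x + z) with hm
    set ζ := x - z with hζ
    have e1 : kcomp (ker t κ₁) (ker t κ₂) x z
        = ∫ r, κ₁ (m + (2 * t)⁻¹ • (ζ - r)) r * κ₂ (m - (2 * t)⁻¹ • r) (ζ - r) := by
      rw [kcomp_eq]
      congr 1; funext r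
      simp only [ker]
      congr 2
      · rw [hm, hζ, ← smul_add]; congr 1; abel
      · abel
      · rw [hm, ← smul_sub]; congr 1; abel
      · rw [hζ]; abel
    have e2 : ker t κ₃ x z = ∫ r, κ₁ m r * κ₂ m (ζ - r) := (h m ζ).symm
    rw [e1, e2, ← integral_sub (h₁.integrable_conv h₂ _ _ (by fun_prop) (by fun_prop) ζ)
      (h₁.integrable_conv h₂ _ _ (by fun_prop) (by fun_prop) ζ)]
    have hpt : ∀ r, ‖κ₁ (m + (2 * t)⁻¹ • (ζ - r)) r * κ₂ (m - (2 * t)⁻¹ • r) (ζ - r)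
        - κ₁ m r * κ₂ m (ζ - r)‖ ≤ ((L₁ * C₂ + C₁ * L₂) / t * wt d ζ) * wt d r := by
      intro r
      have hd1 : ‖m + (2 * t)⁻¹ • (ζ - r) - m‖ = (2 * t)⁻¹ * ‖ζ - r‖ := by
        rw [add_sub_cancel_left, norm_smul, Real.norm_of_nonneg (by positivity)]
      have hd2 : ‖m - (2 * t)⁻¹ • r - m‖ = (2 * t)⁻¹ * ‖r‖ := by
        rw [sub_sub_cancel_left, norm_neg, norm_smul, Real.norm_of_nonneg (by positivity)]
      have hA := hL₁ (m + (2 * t)⁻¹ • (ζ - r)) m r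
      have hB := hL₂ (m - (2 * t)⁻¹ • r) m (ζ - r)
      rw [hd1] at hA
      rw [hd2] at hB
      have hp : wt d r * wt d (ζ - r) ≤ wt d ζ := by simpa using wt_mul_wt_le d r (ζ - r)
      have hn1 := norm_mul_wt_le d (ζ - r)
      have hn2 := norm_mul_wt_le (d + d) r
      have hw1 : wt (d + d + 1) r ≤ wt (d + d) r := wt_antitone (by omega) r
      have hw2 : wt (d + 1) (ζ - r) ≤ wt d (ζ - r) := wt_antitone (by omega) _
      have e : κ₁ (m + (2 * t)⁻¹ • (ζ - r)) r * κ₂ (m - (2 * t)⁻¹ • r) (ζ - r)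
          - κ₁ m r * κ₂ m (ζ - r)
          = (κ₁ (m + (2 * t)⁻¹ • (ζ - r)) r - κ₁ m r) * κ₂ (m - (2 * t)⁻¹ • r) (ζ - r)
          + κ₁ m r * (κ₂ (m - (2 * t)⁻¹ • r) (ζ - r) - κ₂ m (ζ - r)) := by ring
      have wn := fun N (z : E) => wt_nonneg N z
      have hdd : wt (d + d) r * wt d (ζ - r) ≤ wt d ζ * wt d r := by
        rw [wt_add]
        calc wt d r * wt d r * wt d (ζ - r) = (wt d r * wt d (ζ - r)) * wt d r := by ring
          _ ≤ _ := mul_le_mul_of_nonneg_right hp (wn _ _)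
      rw [e]
      calc _ ≤ (L₁ * ((2 * t)⁻¹ * ‖ζ - r‖) * wt (d + d + 1) r) * (C₂ * wt (d + 1) (ζ - r))
            + (C₁ * wt (d + d + 1) r) * (L₂ * ((2 * t)⁻¹ * ‖r‖) * wt (d + 1) (ζ - r)) := by
            refine (norm_add_le _ _).trans (add_le_add ?_ ?_)
            · rw [norm_mul]
              exact mul_le_mul hA (hC₂ _ _) (norm_nonneg _) ((norm_nonneg _).trans hA)
            · rw [norm_mul]
              exact mul_le_mul (hC₁ _ _) hB (norm_nonneg _) ((norm_nonneg _).trans (hC₁ m r))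
        _ = (2 * t)⁻¹ * (L₁ * C₂ * (wt (d + d + 1) r * (‖ζ - r‖ * wt (d + 1) (ζ - r)))
            + C₁ * L₂ * ((‖r‖ * wt (d + d + 1) r) * wt (d + 1) (ζ - r))) := by ring
        _ ≤ (2 * t)⁻¹ * (L₁ * C₂ * (wt d ζ * wt d r) + C₁ * L₂ * (wt d ζ * wt d r)) := by
            have i1 : wt (d + d + 1) r * (‖ζ - r‖ * wt (d + 1) (ζ - r)) ≤ wt d ζ * wt d r :=
              (mul_le_mul hw1 hn1 (mul_nonneg (norm_nonneg _) (wn _ _)) (wn _ _)).trans hdd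
            have i2 : (‖r‖ * wt (d + d + 1) r) * wt (d + 1) (ζ - r) ≤ wt d ζ * wt d r :=
              (mul_le_mul hn2 hw2 (wn _ _) (wn _ _)).trans hdd
            gcongr
        _ = (2 : ℝ)⁻¹ * ((L₁ * C₂ + C₁ * L₂) / t * wt d ζ * wt d r) := by
            field_simp
        _ ≤ _ := by
            have : 0 ≤ (L₁ * C₂ + C₁ * L₂) / t * wt d ζ * wt d r :=
              mul_nonneg (mul_nonneg (by positivity) (wn _ _)) (wn _ _)
            linarith
    refine (norm_integral_le_of_norm_le ((integrable_wt_dimN).const_mul _)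
      (Eventually.of_forall hpt)).trans (le_of_eq ?_)
    rw [integral_const_mul]
    change _ * wtInt ι = _
    ring
  have hC : 0 ≤ (L₁ * C₂ + C₁ * L₂) * wtInt ι / t := by positivity
  have := norm_kopL_sub_le ((h₁.isKer t).comp (h₂.isKer t)) (h₃.isKer t) hC key
  rw [opS, opS, opS, kopL_comp]
  refine this.trans (le_of_eq ?_)
  ring

/-- Smooth compactly supported symbols. -/
structure IsCc {V F : Type*} [NormedAddCommGroup V] [NormedSpace ℝ V] [NormedAddCommGroup F]
    [NormedSpace ℝ F] (h : V → F) : Prop where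
  smooth : ContDiff ℝ ∞ h
  compact : HasCompactSupport h

section IsCc

variable {V F : Type*} [NormedAddCommGroup V] [NormedSpace ℝ V] [NormedAddCommGroup F]
    [NormedSpace ℝ F]

theorem IsCc.integrable [MeasurableSpace V] [BorelSpace V] [SecondCountableTopologyEither V F]
    {μ : Measure V} [IsFiniteMeasureOnCompacts μ] {h : V → F} (hh : IsCc h) : Integrable h μ :=
  hh.smooth.continuous.integrable_of_hasCompactSupport hh.compact

theorem IsCc.of_support {h : V → F} (hs : ContDiff ℝ ∞ h) {K : Set V} (hK : IsCompact K)
    (h0 : ∀ x ∉ K, h x = 0) : IsCc h := ⟨hs, HasCompactSupport.intro hK h0⟩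

theorem IsCc.mul_left {h g : V → ℂ} (hh : IsCc h) (hg : ContDiff ℝ ∞ g) :
    IsCc fun x => g x * h x := ⟨hg.mul hh.smooth, hh.compact.mul_left⟩

theorem IsCc.mul_right {h g : V → ℂ} (hh : IsCc h) (hg : ContDiff ℝ ∞ g) :
    IsCc fun x => h x * g x := ⟨hh.smooth.mul hg, hh.compact.mul_right⟩

theorem IsCc.sub {h g : V → F} (hh : IsCc h) (hg : IsCc g) : IsCc fun x => h x - g x := by
  refine ⟨hh.smooth.sub hg.smooth, ?_⟩
  exact hh.compact.sub hg.compact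

theorem IsCc.sum {α : Type*} (s : Finset α) {h : α → V → F} (hh : ∀ i, IsCc (h i)) :
    IsCc fun x => ∑ i ∈ s, h i x := by
  classical
  refine ⟨ContDiff.sum fun i _ => (hh i).smooth, ?_⟩
  refine HasCompactSupport.intro (K := ⋃ i ∈ s, tsupport (h i))
    (s.isCompact_biUnion fun i _ => (hh i).compact) fun x hx => ?_
  refine Finset.sum_eq_zero fun i hi => image_eq_zero_of_notMem_tsupport fun h' => hx ?_
  exact mem_biUnion hi h'

theorem IsCc.fderiv_apply {h : V → F} (hh : IsCc h) (v : V) : IsCc fun x => fderiv ℝ h x v :=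
  ⟨(hh.smooth.fderiv_right (m := ∞) le_rfl).clm_apply contDiff_const,
    (hh.compact.fderiv ℝ).comp_left (g := fun L : V →L[ℝ] F => L v) (by simp)⟩

end IsCc

theorem IsCc.isSym {h : E × E → ℂ} (hh : IsCc h) : IsSym (osc h) :=
  ⟨continuous_osc hh.smooth.continuous hh.compact,
    fun N => exists_norm_osc_le_wt N hh.smooth hh.compact,
    fun N => exists_norm_osc_sub_le_wt hh.smooth hh.compact N⟩

theorem IsCc.isSym_const {q : E → ℂ} (hq : IsCc q) : IsSym fun _ : E => invF q := by
  refine ⟨(continuous_invF hq.integrable).comp continuous_snd, fun N => ?_, fun N => ⟨0, le_rfl, ?_⟩⟩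
  · obtain ⟨C, h0, hC⟩ := exists_norm_invF_le_wt hq.smooth hq.compact N
    exact ⟨C, h0, fun _ => hC⟩
  · simp

theorem IsCc.slice {h : E × E → ℂ} (hh : IsCc h) (p : E) : IsCc fun ξ => h (p, ξ) :=
  ⟨hh.smooth.comp (contDiff_const.prodMk contDiff_id), hasCompactSupport_slice hh.compact p⟩

/-- The Weyl quantization at scale `t` of a smooth compactly supported symbol. -/
def opH (h : E × E → ℂ) (hh : IsCc h) (t : ℝ) : L2 ι →L[ℂ] L2 ι := opS (osc h) hh.isSym t

/-- The operator `q(D)` for a smooth compactly supported `q`. -/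
def opD (q : E → ℂ) (hq : IsCc q) : L2 ι →L[ℂ] L2 ι := opS _ hq.isSym_const 1

theorem opD_eq (q : E → ℂ) (hq : IsCc q) (t : ℝ) : opD q hq = opS _ hq.isSym_const t := rfl

theorem opH_congr {h g : E × E → ℂ} (hh : IsCc h) (hg : IsCc g) (e : ∀ x, h x = g x) (t : ℝ) :
    opH h hh t = opH g hg t := by
  have : h = g := funext e
  subst this; rfl

theorem exists_norm_opH_comp_sub_le {a b : E × E → ℂ} (ha : IsCc a) (hb : IsCc b)
    (hab : IsCc fun x => a x * b x) :
    ∃ C, 0 ≤ C ∧ ∀ t > 0, ‖opH a ha t ∘L opH b hb t - opH _ hab t‖ ≤ C / t :=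
  exists_norm_opS_comp_sub_le ha.isSym hb.isSym hab.isSym fun m ζ =>
    integral_invF_mul_invF_sub (ha.slice m).smooth (ha.slice m).compact (hb.slice m).integrable ζ

theorem exists_norm_opD_comp_opH_sub_le {q : E → ℂ} {h : E × E → ℂ} (hq : IsCc q) (hh : IsCc h)
    (hqh : IsCc fun x => q x.2 * h x) :
    ∃ C, 0 ≤ C ∧ ∀ t > 0, ‖opD q hq ∘L opH h hh t - opH _ hqh t‖ ≤ C / t :=
  exists_norm_opS_comp_sub_le hq.isSym_const hh.isSym hqh.isSym fun m ζ =>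
    integral_invF_mul_invF_sub hq.smooth hq.compact (hh.slice m).integrable ζ

theorem exists_norm_opH_comp_opD_sub_le {q : E → ℂ} {h : E × E → ℂ} (hq : IsCc q) (hh : IsCc h)
    (hqh : IsCc fun x => h x * q x.2) :
    ∃ C, 0 ≤ C ∧ ∀ t > 0, ‖opH h hh t ∘L opD q hq - opH _ hqh t‖ ≤ C / t :=
  exists_norm_opS_comp_sub_le hh.isSym hq.isSym_const hqh.isSym fun m ζ =>
    integral_invF_mul_invF_sub (hh.slice m).smooth (hh.slice m).compact hq.integrable ζ

theorem opH_sub {a b : E × E → ℂ} (ha : IsCc a) (hb : IsCc b) (hab : IsCc fun x => a x - b x)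
    (t : ℝ) : opH _ hab t = opH a ha t - opH b hb t := by
  rw [opH, opS, opH, opS, opH, opS, ← kopL_sub]
  refine kopL_congr ?_ _ _
  funext x y
  simp only [ker, osc]
  have h1 := invF_add (ha.slice ((2 * t)⁻¹ • (x + y))).integrable
    (r := fun ξ => (-1 : ℂ) • b ((2 * t)⁻¹ • (x + y), ξ))
    ((hb.slice ((2 * t)⁻¹ • (x + y))).integrable.smul (-1 : ℂ)) (x - y)
  rw [invF_smul] at h1
  simpa only [neg_smul, one_smul, ← sub_eq_add_neg] using h1

theorem opH_sum {α : Type*} [Fintype α] {h : α → E × E → ℂ} (hh : ∀ i, IsCc (h i))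
    (hs : IsCc fun x => ∑ i, h i x) (t : ℝ) : opH _ hs t = ∑ i, opH (h i) (hh i) t := by
  classical
  suffices H : ∀ s : Finset α, opH _ (IsCc.sum s hh) t = ∑ i ∈ s, opH (h i) (hh i) t from
    H Finset.univ
  intro s
  induction s using Finset.induction_on with
  | empty =>
    rw [Finset.sum_empty]
    have := norm_kopL_le (K := ker t (osc fun x : E × E => ∑ i ∈ (∅ : Finset α), h i x))
      ((IsCc.sum ∅ hh).isSym.isKer t) le_rfl (fun x y => by simp [ker, osc, invF])
    rw [zero_mul] at this
    exact norm_le_zero_iff.1 this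
  | insert a s ha ih =>
    rw [Finset.sum_insert ha, ← ih, opH, opS, opH, opS, opH, opS, ← kopL_add]
    refine kopL_congr ?_ _ _
    funext x y
    simp only [ker, osc, Finset.sum_insert ha]
    exact invF_add ((hh a).slice _).integrable ((IsCc.sum s hh).slice _).integrable _

/-- Operators with real symbols are symmetric. -/
theorem inner_opH_of_real {h : E × E → ℂ} (hh : IsCc h) (hr : ∀ x, (starRingEnd ℂ) (h x) = h x)
    (t : ℝ) (u v : L2 ι) : inner ℂ u (opH h hh t v) = inner ℂ (opH h hh t u) v := by
  rw [opH, opS, inner_kopL]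
  congr 2
  refine kopL_congr ?_ _ _
  funext x y
  simp only [ker, osc, conj_invF, hr]
  rw [neg_sub, add_comm]

theorem inner_opD_of_real {q : E → ℂ} (hq : IsCc q) (hr : ∀ x, (starRingEnd ℂ) (q x) = q x)
    (u v : L2 ι) : inner ℂ u (opD q hq v) = inner ℂ (opD q hq u) v := by
  rw [opD, opS, inner_kopL]
  congr 2
  refine kopL_congr ?_ _ _
  funext x y
  simp only [ker, conj_invF, hr]
  rw [neg_sub]

end Calculus

section Commutator

variable {ι : Type*} [Fintype ι]

local notation "E" => EuclideanSpace ℝ ι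

theorem osc_apply {P : Type*} [NormedAddCommGroup P] [NormedSpace ℝ P]
    {h : P × E → P →L[ℝ] ℂ} (hh : IsCc h) (m : P) (z : E) (v : P) :
    osc h m z v = osc (fun x => h x v) m z := by
  simp only [osc, invF, smul_apply]
  rw [ContinuousLinearMap.integral_apply (integrable_exp_smul
    (integrable_slice hh.smooth.continuous hh.compact m) z)]
  simp

theorem IsCc.dpar {P F : Type*} [NormedAddCommGroup P] [NormedSpace ℝ P] [NormedAddCommGroup F]
    [NormedSpace ℂ F] {h : P × E → F} (hh : IsCc h) : IsCc (dpar h) :=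
  ⟨contDiff_dpar hh.smooth, hasCompactSupport_dpar hh.compact⟩

/-- First order Taylor expansion of `osc h m z` in `m`. -/
theorem exists_norm_osc_taylor_le {h : E × E → ℂ} (hh : IsCc h) (N : ℕ) :
    ∃ C, 0 ≤ C ∧ ∀ m δ z, ‖osc h (m + δ) z - osc h m z - osc (dpar h) m z δ‖
      ≤ C * ‖δ‖ ^ 2 * wt N z := by
  obtain ⟨C, hC0, hC⟩ := exists_norm_osc_sub_le_wt hh.dpar.smooth hh.dpar.compact N
  refine ⟨C, hC0, fun m δ z => ?_⟩
  have := Convex.norm_image_sub_le_of_norm_hasFDerivWithin_le' (𝕜 := ℝ)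
    (s := Metric.closedBall m ‖δ‖) (f := fun p => osc h p z) (f' := fun p => osc (dpar h) p z)
    (φ := osc (dpar h) m z) (C := C * ‖δ‖ * wt N z) (x := m) (y := m + δ)
    (fun x _ => (hasFDerivAt_osc hh.smooth hh.compact x z).hasFDerivWithinAt) (fun x hx => ?_)
    (convex_closedBall _ _) (Metric.mem_closedBall_self (norm_nonneg _)) (by simp)
  · rw [add_sub_cancel_left] at this
    calc _ ≤ _ := this
      _ = _ := by ring
  · refine (hC x m z).trans ?_
    have hx' : ‖x - m‖ ≤ ‖δ‖ := by simpa [dist_eq_norm] using hx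
    have := wt_nonneg N z
    gcongr

/-- The commutator `[w(D), Op_t(φ)] = -(i/t) Op_t(∇w · ∂_x φ) + O(t⁻²)`. -/
theorem exists_norm_commutator_le {w : E → ℂ} {φ g : E × E → ℂ} (hw : IsCc w) (hφ : IsCc φ)
    (hg : IsCc g) (h : ∀ x, g x = ∑ j, fderiv ℝ w x.2 (EuclideanSpace.basisFun ι ℝ j)
      * fderiv ℝ φ x (EuclideanSpace.basisFun ι ℝ j, 0)) :
    ∃ C, 0 ≤ C ∧ ∀ t > 0, ‖opD w hw ∘L opH φ hφ t - opH φ hφ t ∘L opD w hw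
      + (Complex.I * (t : ℂ)⁻¹) • opH g hg t‖ ≤ C / t ^ 2 := by
  classical
  set d := dimN ι
  set b := EuclideanSpace.basisFun ι ℝ
  obtain ⟨C, hC0, hC⟩ := exists_norm_osc_taylor_le hφ d
  obtain ⟨W, hW0, hW⟩ := exists_norm_invF_le_wt hw.smooth hw.compact (d + d + 2)
  have hI := wtInt_nonneg (ι := ι)
  refine ⟨C * W * wtInt ι * wtInt ι, by positivity, fun t ht => ?_⟩
  have hwS := hw.isSym_const
  have hφS := hφ.isSym
  -- the first order term
  have hmain : ∀ m ζ, ∫ r, invF w r * osc (dpar φ) m (ζ - r) r = Complex.I * osc g m ζ := by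
    intro m ζ
    have hj : ∀ j, IsCc fun ξ => fderiv ℝ w ξ (b j) := fun j => hw.fderiv_apply _
    have hj2 : ∀ j, IsCc fun x => fderiv ℝ φ x (b j, 0) := fun j => hφ.fderiv_apply _
    have hr : ∀ r : E, osc (dpar φ) m (ζ - r) r
        = ∑ j, ((inner ℝ r (b j) : ℝ) : ℂ) * osc (fun x => fderiv ℝ φ x (b j, 0)) m (ζ - r) := by
      intro r
      conv_lhs => rw [← b.sum_repr' r]
      rw [map_sum]
      refine Finset.sum_congr rfl fun j _ => ?_
      rw [map_smul, b.sum_repr' r, osc_apply hφ.dpar, real_inner_comm]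
      simp [dpar]
    have hr2 : ∀ r, invF w r * osc (dpar φ) m (ζ - r) r = ∑ j, Complex.I *
        (invF (fun ξ => fderiv ℝ w ξ (b j)) r
          * osc (fun x => fderiv ℝ φ x (b j, 0)) m (ζ - r)) := by
      intro r
      rw [hr, Finset.mul_sum]
      refine Finset.sum_congr rfl fun j _ => ?_
      have := inner_smul_invF (hw.smooth.of_le (by exact_mod_cast le_top)) hw.compact r (b j)
      rw [invF_smul, smul_eq_mul, smul_eq_mul] at this
      linear_combination (osc (fun x => fderiv ℝ φ x (b j, 0)) m (ζ - r)) * this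
    simp_rw [hr2]
    rw [integral_finsetSum]
    · simp_rw [integral_const_mul]
      rw [← Finset.mul_sum]
      congr 1
      have : ∀ j, ∫ r, invF (fun ξ => fderiv ℝ w ξ (b j)) r
          * osc (fun x => fderiv ℝ φ x (b j, 0)) m (ζ - r)
          = invF (fun ξ => fderiv ℝ w ξ (b j) * fderiv ℝ φ (m, ξ) (b j, 0)) ζ := fun j =>
        integral_invF_mul_invF_sub (hj j).smooth (hj j).compact ((hj2 j).slice m).integrable ζ
      simp_rw [this]
      rw [← invF_sum _ fun j _ => (((hj2 j).slice m).mul_left (hj j).smooth).integrable]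
      simp only [osc, h]
    · intro j _
      exact ((hj j).isSym_const.integrable_conv (hj2 j).isSym (fun _ => m) (fun _ => m)
        continuous_const continuous_const ζ).const_mul _
  have hint3 : ∀ m ζ, Integrable fun r => invF w r * osc (dpar φ) m (ζ - r) r := by
    intro m ζ
    obtain ⟨D, hD0, hD⟩ := exists_norm_osc_le_wt 0 hφ.dpar.smooth hφ.dpar.compact
    refine ((integrable_wt_dimN (ι := ι)).const_mul (W * D)).mono' ?_
      (Eventually.of_forall fun r => ?_)
    · have hc := continuous_osc hφ.dpar.smooth.continuous hφ.dpar.compact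
      exact ((continuous_invF hw.integrable).mul
        ((hc.comp (by fun_prop : Continuous fun r => (m, ζ - r))).clm_apply
          continuous_id)).aestronglyMeasurable
    · rw [norm_mul]
      have h1 : ‖osc (dpar φ) m (ζ - r) r‖ ≤ D * ‖r‖ := by
        refine (ContinuousLinearMap.le_opNorm _ _).trans ?_
        gcongr
        simpa [wt] using hD m (ζ - r)
      calc _ ≤ (W * wt (d + d + 2) r) * (D * ‖r‖) :=
            mul_le_mul (hW r) h1 (norm_nonneg _) (mul_nonneg hW0 (wt_nonneg _ _))
        _ ≤ (W * wt (d + 1) r) * (D * ‖r‖) := by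
            gcongr; exact wt_antitone (by omega) r
        _ = W * D * (‖r‖ * wt (d + 1) r) := by ring
        _ ≤ _ := by gcongr; exact norm_mul_wt_le d r
  set K1 := kcomp (ker t fun _ : E => invF w) (ker t (osc φ))
  set K2 := kcomp (ker t (osc φ)) (ker t fun _ : E => invF w)
  have hK1 : IsKer K1 := (hwS.isKer t).comp (hφS.isKer t)
  have hK2 : IsKer K2 := (hφS.isKer t).comp (hwS.isKer t)
  have key : ∀ x z, ‖K1 x z - K2 x z - (-(Complex.I * (t : ℂ)⁻¹)) * ker t (osc g) x z‖
      ≤ (C * W * wtInt ι / t ^ 2) * wt d (x - z) := by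
    intro x z
    set m := (2 * t)⁻¹ • (x + z) with hm
    set ζ := x - z with hζ
    have e1 : K1 x z = ∫ r, invF w r * osc φ (m - (2 * t)⁻¹ • r) (ζ - r) := by
      change kcomp _ _ x z = _
      rw [kcomp_eq]
      congr 1; funext r
      simp only [ker]
      congr 2
      · abel
      · rw [hm, ← smul_sub]; congr 1; abel
      · rw [hζ]; abel
    have e2 : K2 x z = ∫ r, invF w r * osc φ (m + (2 * t)⁻¹ • r) (ζ - r) := by
      change ∫ y, ker t (osc φ) x y * ker t (fun _ : E => invF w) y z = _
      rw [← integral_add_right_eq_self _ z]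
      congr 1; funext r
      simp only [ker]
      rw [mul_comm]
      congr 2
      · abel
      · rw [hm, ← smul_add]; congr 1; abel
      · rw [hζ]; abel
    have i1 := hwS.integrable_conv hφS (fun _ => m) (fun r => m - (2 * t)⁻¹ • r)
      continuous_const (by fun_prop) ζ
    have i2 := hwS.integrable_conv hφS (fun _ => m) (fun r => m + (2 * t)⁻¹ • r)
      continuous_const (by fun_prop) ζ
    have e3 : (-(Complex.I * (t : ℂ)⁻¹)) * ker t (osc g) x z
        = ∫ r, -(t : ℂ)⁻¹ * (invF w r * osc (dpar φ) m (ζ - r) r) := by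
      rw [integral_const_mul, hmain]
      change _ * osc g m ζ = _
      ring
    have i12 : Integrable fun r => invF w r * osc φ (m - (2 * t)⁻¹ • r) (ζ - r)
        - invF w r * osc φ (m + (2 * t)⁻¹ • r) (ζ - r) := i1.sub i2
    rw [e1, e2, e3, ← integral_sub i1 i2, ← integral_sub i12 ((hint3 m ζ).const_mul _)]
    have hpt : ∀ r, ‖invF w r * osc φ (m - (2 * t)⁻¹ • r) (ζ - r)
        - invF w r * osc φ (m + (2 * t)⁻¹ • r) (ζ - r)
        - -(t : ℂ)⁻¹ * (invF w r * osc (dpar φ) m (ζ - r) r)‖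
        ≤ (C * W / t ^ 2 * wt d ζ) * wt d r := by
      intro r
      have a1 := hC m (-((2 * t)⁻¹ • r)) (ζ - r)
      have a2 := hC m ((2 * t)⁻¹ • r) (ζ - r)
      rw [← sub_eq_add_neg, norm_neg] at a1
      have hδ : ‖(2 * t)⁻¹ • r‖ ^ 2 = (4 * t ^ 2)⁻¹ * ‖r‖ ^ 2 := by
        rw [norm_smul, Real.norm_of_nonneg (by positivity), mul_pow, inv_pow]
        ring
      rw [hδ] at a1 a2
      have hl : osc (dpar φ) m (ζ - r) ((2 * t)⁻¹ • r)
          = (2 : ℂ)⁻¹ * (t : ℂ)⁻¹ * osc (dpar φ) m (ζ - r) r := by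
        rw [map_smul, Complex.real_smul]; push_cast; rw [mul_inv]
      rw [map_neg] at a1
      have e : invF w r * osc φ (m - (2 * t)⁻¹ • r) (ζ - r)
          - invF w r * osc φ (m + (2 * t)⁻¹ • r) (ζ - r)
          - -(t : ℂ)⁻¹ * (invF w r * osc (dpar φ) m (ζ - r) r)
          = invF w r * ((osc φ (m - (2 * t)⁻¹ • r) (ζ - r) - osc φ m (ζ - r)
              - -osc (dpar φ) m (ζ - r) ((2 * t)⁻¹ • r))
            - (osc φ (m + (2 * t)⁻¹ • r) (ζ - r) - osc φ m (ζ - r)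
              - osc (dpar φ) m (ζ - r) ((2 * t)⁻¹ • r))) := by
        rw [hl]; ring
      rw [e, norm_mul]
      have wn := fun N (z : E) => wt_nonneg N z
      have hp : wt d r * wt d (ζ - r) ≤ wt d ζ := by simpa using wt_mul_wt_le d r (ζ - r)
      have hq : ‖r‖ ^ 2 * wt (d + d + 2) r ≤ wt d r * wt d r := by
        have h1 := norm_mul_wt_le (d + d + 1) r
        have h2 := norm_mul_wt_le (d + d) r
        calc ‖r‖ ^ 2 * wt (d + d + 2) r = ‖r‖ * (‖r‖ * wt (d + d + 2) r) := by ring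
          _ ≤ ‖r‖ * wt (d + d + 1) r := by gcongr
          _ ≤ _ := by rw [← wt_add]; exact h2
      calc _ ≤ (W * wt (d + d + 2) r) * (C * ((4 * t ^ 2)⁻¹ * ‖r‖ ^ 2) * wt d (ζ - r)
              + C * ((4 * t ^ 2)⁻¹ * ‖r‖ ^ 2) * wt d (ζ - r)) :=
            mul_le_mul (hW r) ((norm_sub_le _ _).trans (add_le_add a1 a2)) (norm_nonneg _)
              (mul_nonneg hW0 (wn _ _))
        _ = (2 * t ^ 2)⁻¹ * (C * W) * ((‖r‖ ^ 2 * wt (d + d + 2) r) * wt d (ζ - r)) := by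
            field_simp; ring
        _ ≤ (2 * t ^ 2)⁻¹ * (C * W) * (wt d ζ * wt d r) := by
            refine mul_le_mul_of_nonneg_left ?_ (by positivity)
            calc _ ≤ (wt d r * wt d r) * wt d (ζ - r) := mul_le_mul_of_nonneg_right hq (wn _ _)
              _ = (wt d r * wt d (ζ - r)) * wt d r := by ring
              _ ≤ _ := mul_le_mul_of_nonneg_right hp (wn _ _)
        _ = (2 : ℝ)⁻¹ * (C * W / t ^ 2 * wt d ζ * wt d r) := by field_simp
        _ ≤ _ := by
            have : 0 ≤ C * W / t ^ 2 * wt d ζ * wt d r :=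
              mul_nonneg (mul_nonneg (by positivity) (wn _ _)) (wn _ _)
            linarith
    refine (norm_integral_le_of_norm_le ((integrable_wt_dimN).const_mul _)
      (Eventually.of_forall hpt)).trans (le_of_eq ?_)
    rw [integral_const_mul]
    change _ * wtInt ι = _
    ring
  have hgK := (hg.isSym.isKer t).const_mul (-(Complex.I * (t : ℂ)⁻¹))
  have := norm_kopL_sub_le (hK1.sub hK2) hgK (by positivity) key
  rw [kopL_sub, kopL_const_mul] at this
  rw [opD_eq w hw t, opH, opH, opS, opS, opS, kopL_comp, kopL_comp]
  rw [neg_smul, sub_neg_eq_add] at this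
  refine this.trans (le_of_eq ?_)
  ring

/-- Multiplication of a quantization by `x_k / t`. -/
theorem coord_mul_kop_ker {h : E × E → ℂ} (hh : IsCc h) (k : ι) (t : ℝ) (ht : 0 < t)
    (h1 : IsCc fun x => ((x.1 k : ℝ) : ℂ) * h x)
    (h2 : IsCc fun x => Complex.I * fderiv ℝ h x (0, EuclideanSpace.basisFun ι ℝ k))
    {u : E → ℂ} (hu : MemLp u 2 volume) (x : E) :
    ((x k / t : ℝ) : ℂ) * kop (ker t (osc h)) u x
      = kop (ker t (osc fun x => ((x.1 k : ℝ) : ℂ) * h x)) u x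
        + ((2 * t : ℝ) : ℂ)⁻¹ * kop (ker t (osc fun x =>
          Complex.I * fderiv ℝ h x (0, EuclideanSpace.basisFun ι ℝ k))) u x := by
  simp only [kop]
  rw [← integral_const_mul, ← integral_const_mul,
    ← integral_add (integrable_ker_mul (h1.isSym.isKer t) hu x)
      ((integrable_ker_mul (h2.isSym.isKer t) hu x).const_mul _)]
  congr 1; funext y
  simp only [ker]
  have e1 : osc (fun x : E × E => ((x.1 k : ℝ) : ℂ) * h x) ((2 * t)⁻¹ • (x + y)) (x - y)
      = ((((2 * t)⁻¹ • (x + y)) k : ℝ) : ℂ) * osc h ((2 * t)⁻¹ • (x + y)) (x - y) := by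
    simp only [osc]
    exact invF_smul (((((2 * t)⁻¹ • (x + y)) k : ℝ)) : ℂ) _ _
  have e2 := inner_smul_osc (hh.smooth.of_le (by exact_mod_cast le_top)) hh.compact
    ((2 * t)⁻¹ • (x + y)) (x - y) (EuclideanSpace.basisFun ι ℝ k)
  simp only [smul_eq_mul] at e2
  rw [e1, ← e2, real_inner_comm, EuclideanSpace.basisFun_inner]
  simp only [PiLp.smul_apply, PiLp.add_apply, PiLp.sub_apply, smul_eq_mul]
  push_cast
  have : (t : ℂ) ≠ 0 := by exact_mod_cast ht.ne'
  field_simp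
  ring

end Commutator

/-! ### Smooth cutoff functions -/

/-- A smooth function with compact support in `U` which is `1` near a compact set `K ⊆ U`. -/
theorem exists_smooth_cutoff {V : Type*} [NormedAddCommGroup V] [NormedSpace ℝ V]
    [FiniteDimensional ℝ V] {K U : Set V} (hK : IsCompact K) (hU : IsOpen U) (hKU : K ⊆ U) :
    ∃ χ : V → ℝ, ContDiff ℝ ∞ χ ∧ HasCompactSupport χ ∧ (∀ᶠ x in nhdsSet K, χ x = 1) ∧
      tsupport χ ⊆ U ∧ ∀ x, χ x ∈ Icc (0 : ℝ) 1 := by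
  obtain ⟨L, hL, hKL, hLU⟩ := exists_compact_between hK hU hKU
  obtain ⟨f, hf1, hf0, hf⟩ := exists_contMDiffMap_one_nhds_of_subset_interior (n := ⊤)
    (modelWithCornersSelf ℝ V) hK.isClosed hKL
  have hsupp : tsupport f ⊆ L := by
    refine closure_minimal (fun x hx => ?_) hL.isClosed
    by_contra h
    exact hx (hf0 x h)
  exact ⟨f, f.contMDiff.contDiff, hL.of_isClosed_subset (isClosed_tsupport _) hsupp, hf1,
    hsupp.trans hLU, hf⟩

/-! ### Fourier multipliers -/

section Multipliers

variable {ι : Type*} [Fintype ι]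

local notation "E" => EuclideanSpace ℝ ι

theorem toL2_eq {f : E → ℂ} (hf : MemLp f 2 volume) : toL2 f = hf.toLp f := by
  rw [toL2, dif_pos hf]

/-- Bounded measurable functions. -/
structure IsBddMeas (g : E → ℂ) (M : ℝ) : Prop where
  meas : Measurable g
  bound : ∀ ξ, ‖g ξ‖ ≤ M

theorem IsBddMeas.memLp {g : E → ℂ} {M : ℝ} (hg : IsBddMeas g M) {u : E → ℂ}
    (hu : MemLp u 2 volume) : MemLp (fun η => g ((2 * Real.pi) • η) * u η) 2 volume := by
  refine MemLp.of_le_mul hu (c := M) ?_ (Eventually.of_forall fun η => ?_)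
  · exact ((hg.meas.comp (measurable_const_smul _)).aestronglyMeasurable).mul hu.1
  · rw [norm_mul]; gcongr; exact hg.bound _

/-- The Fourier transform of `g(D) u` is `g(2πη) û(η)`. -/
theorem fourier_multiplier {g : E → ℂ} {M : ℝ} (hg : IsBddMeas g M) (u : L2 ι) :
    (𝓕 (multiplier g u) : L2 ι) = (hg.memLp (Lp.memLp (𝓕 u : L2 ι))).toLp _ := by
  rw [multiplier, FourierTransform.fourier_fourierInv_eq, toL2_eq]

theorem norm_multiplier {g : E → ℂ} {M : ℝ} (hg : IsBddMeas g M) (u : L2 ι) :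
    ‖multiplier g u‖ = ‖(hg.memLp (Lp.memLp (𝓕 u : L2 ι))).toLp _‖ := by
  rw [← fourier_multiplier hg, Lp.norm_fourier_eq]

theorem L2_eq_of_fourier_eq {u v : L2 ι} (h : (𝓕 u : L2 ι) = 𝓕 v) : u = v :=
  (Lp.fourierTransformₗᵢ E ℂ).injective h

theorem norm_multiplier_le_of_le {g g' : E → ℂ} {M M' c : ℝ} (hg : IsBddMeas g M)
    (hg' : IsBddMeas g' M') (h : ∀ ξ, ‖g ξ‖ ≤ c * ‖g' ξ‖) (u : L2 ι) :
    ‖multiplier g u‖ ≤ c * ‖multiplier g' u‖ := by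
  rw [norm_multiplier hg, norm_multiplier hg']
  refine Lp.norm_le_mul_norm_of_ae_le_mul ?_
  filter_upwards [(hg.memLp (Lp.memLp (𝓕 u : L2 ι))).coeFn_toLp,
    (hg'.memLp (Lp.memLp (𝓕 u : L2 ι))).coeFn_toLp] with η h1 h2
  rw [h1, h2, norm_mul, norm_mul, ← mul_assoc]
  gcongr; exact h _

theorem isBddMeas_one : IsBddMeas (fun _ : E => (1 : ℂ)) 1 := ⟨measurable_const, by simp⟩

theorem multiplier_one (u : L2 ι) : multiplier (fun _ => 1) u = u := by
  apply L2_eq_of_fourier_eq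
  rw [fourier_multiplier isBddMeas_one]
  conv_rhs => rw [← Lp.toLp_coeFn (𝓕 u : L2 ι) (Lp.memLp _)]
  exact MemLp.toLp_congr _ _ (Eventually.of_forall fun η => one_mul _)

theorem norm_multiplier_le {g : E → ℂ} {M : ℝ} (hg : IsBddMeas g M) (u : L2 ι) :
    ‖multiplier g u‖ ≤ M * ‖u‖ := by
  have := norm_multiplier_le_of_le hg isBddMeas_one (c := M) (by simpa using hg.bound) u
  rwa [multiplier_one] at this

theorem multiplier_add {g : E → ℂ} {M : ℝ} (hg : IsBddMeas g M) (u v : L2 ι) :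
    multiplier g (u + v) = multiplier g u + multiplier g v := by
  apply L2_eq_of_fourier_eq
  rw [FourierAdd.fourier_add, fourier_multiplier hg, fourier_multiplier hg,
    fourier_multiplier hg, ← MemLp.toLp_add]
  refine MemLp.toLp_congr _ _ ?_
  rw [FourierAdd.fourier_add]
  filter_upwards [Lp.coeFn_add (𝓕 u : L2 ι) (𝓕 v)] with η h
  simp only [Pi.add_apply] at h ⊢
  rw [h, mul_add]

theorem multiplier_smul {g : E → ℂ} {M : ℝ} (hg : IsBddMeas g M) (c : ℂ) (u : L2 ι) :
    multiplier g (c • u) = c • multiplier g u := by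
  apply L2_eq_of_fourier_eq
  rw [FourierSMul.fourier_smul, fourier_multiplier hg, fourier_multiplier hg,
    ← MemLp.toLp_const_smul]
  refine MemLp.toLp_congr _ _ ?_
  rw [FourierSMul.fourier_smul]
  filter_upwards [Lp.coeFn_smul c (𝓕 u : L2 ι)] with η h
  simp only [Pi.smul_apply, smul_eq_mul] at h ⊢
  rw [h]; ring

/-- The multiplier `g(D)` as a bounded operator. -/
def multL (g : E → ℂ) (M : ℝ) (hg : IsBddMeas g M) : L2 ι →L[ℂ] L2 ι :=
  LinearMap.mkContinuous
    { toFun := multiplier g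
      map_add' := multiplier_add hg
      map_smul' := multiplier_smul hg } M (norm_multiplier_le hg)

theorem multL_apply {g : E → ℂ} {M : ℝ} (hg : IsBddMeas g M) (u : L2 ι) :
    multL g M hg u = multiplier g u := rfl

theorem multiplier_sub_symbol {g g' h : E → ℂ} {M M' M'' : ℝ} (hg : IsBddMeas g M)
    (hg' : IsBddMeas g' M') (hh : IsBddMeas h M'') (e : ∀ ξ, h ξ = g ξ - g' ξ) (u : L2 ι) :
    multiplier h u = multiplier g u - multiplier g' u := by
  apply L2_eq_of_fourier_eq
  rw [show (𝓕 (multiplier g u - multiplier g' u) : L2 ι)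
      = 𝓕 (multiplier g u) - 𝓕 (multiplier g' u) from
      (Lp.fourierTransformₗᵢ E ℂ).map_sub _ _,
    fourier_multiplier hg, fourier_multiplier hg', fourier_multiplier hh, ← MemLp.toLp_sub]
  refine MemLp.toLp_congr _ _ (Eventually.of_forall fun η => ?_)
  simp only [Pi.sub_apply, e, sub_mul]

theorem multiplier_multiplier {g g' h : E → ℂ} {M M' M'' : ℝ} (hg : IsBddMeas g M)
    (hg' : IsBddMeas g' M') (hh : IsBddMeas h M'') (e : ∀ ξ, h ξ = g ξ * g' ξ) (u : L2 ι) :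
    multiplier g (multiplier g' u) = multiplier h u := by
  apply L2_eq_of_fourier_eq
  rw [fourier_multiplier hg, fourier_multiplier hh]
  refine MemLp.toLp_congr _ _ ?_
  rw [fourier_multiplier hg']
  filter_upwards [(hg'.memLp (Lp.memLp (𝓕 u : L2 ι))).coeFn_toLp] with η h1
  rw [h1, e, mul_assoc]

theorem IsCc.exists_isBddMeas {q : E → ℂ} (hq : IsCc q) : ∃ M, IsBddMeas q M := by
  obtain ⟨M, hM⟩ := hq.compact.exists_bound_of_continuous hq.smooth.continuous
  exact ⟨M, hq.smooth.continuous.measurable, hM⟩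

/-- For `q ∈ C_c^∞`, the multiplier `q(D)` is the convolution with the inverse Fourier transform
of `q`. -/
theorem opD_apply_eq_multiplier {q : E → ℂ} (hq : IsCc q) (u : L2 ι) :
    opD q hq u = multiplier q u := by
  obtain ⟨M, hM⟩ := hq.exists_isBddMeas
  rw [← multL_apply hM]
  revert u
  suffices h : ∀ f : SchwartzMap E ℂ, opD q hq (f.toLp 2) = multL q M hM (f.toLp 2) by
    intro u
    refine DenseRange.induction_on (p := fun u => opD q hq u = multL q M hM u)
      (SchwartzMap.denseRange_toLpCLM (F := ℂ) (μ := (volume : Measure E)) (p := 2)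
        ENNReal.ofNat_ne_top) u
      (isClosed_eq (opD q hq).continuous (multL q M hM).continuous) fun f => h f
  intro f
  have hpi : (2 * Real.pi) ≠ 0 := by positivity
  rw [multL_apply]
  -- the product `q(2πη) f̂(η)` as a Schwartz function
  have hS1 : HasCompactSupport fun η : E => q ((2 * Real.pi) • η) * (𝓕 f : SchwartzMap E ℂ) η :=
    (hq.compact.comp_smul hpi).mul_right
  have hS2 : ContDiff ℝ ∞ fun η : E => q ((2 * Real.pi) • η) * (𝓕 f : SchwartzMap E ℂ) η :=
    (hq.smooth.comp (contDiff_const_smul _)).mul (SchwartzMap.smooth _ _)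
  set S : SchwartzMap E ℂ := hS1.toSchwartzMap hS2 with hS
  have e1 : multiplier q (f.toLp 2) = (𝓕⁻ S).toLp 2 := by
    rw [multiplier, ← SchwartzMap.toLp_fourierInv_eq, toL2_eq (hM.memLp (Lp.memLp _))]
    congr 1
    refine MemLp.toLp_congr _ (S.memLp 2) ?_
    rw [SchwartzMap.toLp_fourier_eq]
    filter_upwards [(𝓕 f : SchwartzMap E ℂ).coeFn_toLp 2 volume] with η hη
    rw [hη]; rfl
  rw [e1]
  change opS _ hq.isSym_const 1 (f.toLp 2) = _
  rw [opS]
  change kopL _ _ ((f.memLp 2).toLp f) = ((𝓕⁻ S).memLp 2).toLp _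
  rw [kopL_toLp]
  refine MemLp.toLp_congr _ _ (Eventually.of_forall fun x => ?_)
  have h1 : kop (ker 1 fun _ : E => invF q) f x = ∫ r, f r * invF q (x - r) := by
    simp only [kop, ker]; congr 1; funext r; ring
  rw [h1, integral_mul_invF_sub f.integrable hq.integrable, invF_eq_fourierInv,
    SchwartzMap.fourierInv_coe]
  refine congrFun (congrArg _ (funext fun η => ?_)) x
  have : (𝓕 f : SchwartzMap E ℂ) η
      = ∫ r, Complex.exp (-(Complex.I * ((inner ℝ r ((2 * Real.pi) • η) : ℝ) : ℂ))) * f r := by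
    rw [SchwartzMap.fourier_coe, Real.fourier_eq']
    congr 1; funext r
    rw [smul_eq_mul, inner_smul_right]
    congr 2; push_cast; ring
  rw [← this, mul_comm]; rfl

/-- Replacing a bounded multiplier in front of a quantization by its symbol costs `O(1/t)`. -/
theorem exists_norm_multiplier_opH_sub_le {g : E → ℂ} {M : ℝ} (hgs : ContDiff ℝ ∞ g)
    (hg : IsBddMeas g M) {h : E × E → ℂ} (hh : IsCc h) (hgh : IsCc fun x => g x.2 * h x) :
    ∃ C, 0 ≤ C ∧ ∀ t > 0, ∀ u, ‖multiplier g (opH h hh t u) - opH _ hgh t u‖ ≤ C / t * ‖u‖ := by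
  have hK : IsCompact (Prod.snd '' tsupport h) := hh.compact.image continuous_snd
  obtain ⟨χ, hχs, hχc, hχ1, -, -⟩ := exists_smooth_cutoff hK isOpen_univ (subset_univ _)
  set q : E → ℂ := fun ξ => ((χ ξ : ℝ) : ℂ)
  have hq : IsCc q := ⟨Complex.ofRealCLM.contDiff.comp hχs, hχc.comp_left (g := fun x : ℝ => (x : ℂ))
    (by simp)⟩
  have hq1 : ∀ ξ ∈ Prod.snd '' tsupport h, q ξ = 1 := fun ξ hξ => by
    simp only [q, (hχ1.self_of_nhdsSet ξ hξ), Complex.ofReal_one]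
  have hqh : ∀ x, q x.2 * h x = h x := by
    intro x
    by_cases hx : x ∈ tsupport h
    · rw [hq1 _ ⟨x, hx, rfl⟩, one_mul]
    · rw [image_eq_zero_of_notMem_tsupport hx, mul_zero]
  have hqh' : IsCc fun x => q x.2 * h x := by simpa only [hqh] using hh
  have hgq : IsCc fun ξ => g ξ * q ξ := hq.mul_left hgs
  have hgqh : IsCc fun x => (fun ξ => g ξ * q ξ) x.2 * h x := by
    simpa only [mul_assoc, hqh] using hgh
  obtain ⟨Mq, hMq⟩ := hq.exists_isBddMeas
  obtain ⟨Mgq, hMgq⟩ := hgq.exists_isBddMeas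
  have hM0 : 0 ≤ M := (norm_nonneg _).trans (hg.bound 0)
  obtain ⟨C₁, hC₁0, hC₁⟩ := exists_norm_opD_comp_opH_sub_le hq hh hqh'
  obtain ⟨C₂, hC₂0, hC₂⟩ := exists_norm_opD_comp_opH_sub_le hgq hh hgqh
  refine ⟨M * C₁ + C₂, by positivity, fun t ht u => ?_⟩
  have hone : IsBddMeas (fun ξ : E => 1 - q ξ) (1 + Mq) :=
    ⟨measurable_const.sub hMq.meas, fun ξ => (norm_sub_le _ _).trans (by simpa using hMq.bound ξ)⟩
  have hgone : IsBddMeas (fun ξ : E => g ξ * (1 - q ξ)) (M * (1 + Mq)) :=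
    ⟨hg.meas.mul hone.meas, fun ξ => by
      rw [norm_mul]; exact mul_le_mul (hg.bound ξ) (hone.bound ξ) (norm_nonneg _) hM0⟩
  set v := opH h hh t u
  have s1 : multiplier (fun ξ => g ξ * (1 - q ξ)) v
      = multiplier g v - multiplier (fun ξ => g ξ * q ξ) v :=
    multiplier_sub_symbol hg hMgq hgone (fun ξ => by ring) v
  have s2 : multiplier (fun ξ => 1 - q ξ) v = v - multiplier q v := by
    rw [multiplier_sub_symbol isBddMeas_one hMq hone (fun ξ => rfl) v, multiplier_one]
  have s3 : ‖multiplier (fun ξ => g ξ * (1 - q ξ)) v‖ ≤ M * ‖v - multiplier q v‖ := by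
    rw [← s2]
    exact norm_multiplier_le_of_le hgone hone (fun ξ => by
      rw [norm_mul]; gcongr; exact hg.bound ξ) v
  have b1 : ‖v - multiplier q v‖ ≤ C₁ / t * ‖u‖ := by
    rw [← opD_apply_eq_multiplier hq, norm_sub_rev]
    have := (opD q hq ∘L opH h hh t - opH _ hqh' t).le_of_opNorm_le (hC₁ t ht) u
    rw [opH_congr hqh' hh hqh] at this
    exact this
  have b2 : ‖multiplier (fun ξ => g ξ * q ξ) v - opH _ hgh t u‖ ≤ C₂ / t * ‖u‖ := by
    rw [← opD_apply_eq_multiplier hgq]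
    have := (opD _ hgq ∘L opH h hh t - opH _ hgqh t).le_of_opNorm_le (hC₂ t ht) u
    rw [opH_congr hgqh hgh (fun x => by rw [mul_assoc, hqh])] at this
    exact this
  have e : multiplier g v - opH _ hgh t u = multiplier (fun ξ => g ξ * (1 - q ξ)) v
      + (multiplier (fun ξ => g ξ * q ξ) v - opH _ hgh t u) := by rw [s1]; abel
  rw [e]
  calc _ ≤ M * (C₁ / t * ‖u‖) + C₂ / t * ‖u‖ :=
        (norm_add_le _ _).trans (add_le_add (s3.trans (by gcongr)) b2)
    _ = _ := by ring

end Multipliers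

/-! ### The dispersion relation and the propagation vector -/

section Dispersion

variable {n d : ℕ}

/-- The linear map `x ↦ x_i`. -/
def particleL (n d : ℕ) (i : Fin n) : Config n d →L[ℝ] EuclideanSpace ℝ (Fin d) :=
  LinearMap.toContinuousLinearMap
    { toFun := fun x => particle x i
      map_add' := fun x y => by ext j; simp [particle]
      map_smul' := fun c x => by ext j; simp [particle] }

theorem particle_apply (x : Config n d) (i : Fin n) (j : Fin d) : particle x i j = x (i, j) := rfl

theorem continuous_particle (i : Fin n) : Continuous fun x : Config n d => particle x i :=
  (particleL n d i).continuous

theorem contDiff_particle (i : Fin n) : ContDiff ℝ ∞ fun x : Config n d => particle x i :=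
  (particleL n d i).contDiff

theorem particle_add (x y : Config n d) (i : Fin n) :
    particle (x + y) i = particle x i + particle y i := map_add (particleL n d i) x y

theorem particle_sub (x y : Config n d) (i : Fin n) :
    particle (x - y) i = particle x i - particle y i := map_sub (particleL n d i) x y

theorem particle_smul (c : ℝ) (x : Config n d) (i : Fin n) :
    particle (c • x) i = c • particle x i := map_smul (particleL n d i) c x

theorem norm_particle_le (x : Config n d) (i : Fin n) : ‖particle x i‖ ≤ ‖x‖ := by
  rw [EuclideanSpace.norm_eq, EuclideanSpace.norm_eq, Fintype.sum_prod_type]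
  refine Real.sqrt_le_sqrt ?_
  exact Finset.single_le_sum (f := fun i => ∑ j, ‖x (i, j)‖ ^ 2)
    (fun i _ => Finset.sum_nonneg fun j _ => by positivity) (Finset.mem_univ i)

theorem contDiff_omega {V : Type*} [NormedAddCommGroup V] [InnerProductSpace ℝ V] {m : ℝ}
    (hm : 0 < m) : ContDiff ℝ ∞ fun p : V => √(‖p‖ ^ 2 + m ^ 2) :=
  ((contDiff_norm_sq ℝ).add contDiff_const).sqrt fun p => by positivity

theorem contDiff_omegaTilde {m : ℝ} (hm : 0 < m) :
    ContDiff ℝ ∞ (omegaTilde m : Config n d → ℝ) := by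
  unfold omegaTilde
  exact ContDiff.sum fun i _ => (contDiff_omega hm).comp (contDiff_particle i)

theorem abs_sqrt_sub_sqrt_le {m a b : ℝ} (hm : 0 < m) :
    |√(a ^ 2 + m ^ 2) - √(b ^ 2 + m ^ 2)| ≤ |a - b| := by
  have ha : 0 < √(a ^ 2 + m ^ 2) := Real.sqrt_pos.2 (by positivity)
  have hb : 0 < √(b ^ 2 + m ^ 2) := Real.sqrt_pos.2 (by positivity)
  have ha2 := Real.sq_sqrt (show (0 : ℝ) ≤ a ^ 2 + m ^ 2 by positivity)
  have hb2 := Real.sq_sqrt (show (0 : ℝ) ≤ b ^ 2 + m ^ 2 by positivity)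
  have h1 : |a| ≤ √(a ^ 2 + m ^ 2) := Real.abs_le_sqrt (by nlinarith [sq_nonneg m])
  have h2 : |b| ≤ √(b ^ 2 + m ^ 2) := Real.abs_le_sqrt (by nlinarith [sq_nonneg m])
  have h3 : |√(a ^ 2 + m ^ 2) - √(b ^ 2 + m ^ 2)| * (√(a ^ 2 + m ^ 2) + √(b ^ 2 + m ^ 2))
      = |a - b| * |a + b| := by
    rw [← abs_of_pos (add_pos ha hb), ← abs_mul, ← abs_mul]
    congr 1; nlinarith
  have h4 : |a + b| ≤ √(a ^ 2 + m ^ 2) + √(b ^ 2 + m ^ 2) := (abs_add_le a b).trans (by linarith)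
  have h5 : 0 < √(a ^ 2 + m ^ 2) + √(b ^ 2 + m ^ 2) := add_pos ha hb
  refine le_of_mul_le_mul_right ?_ h5
  rw [h3]; gcongr

theorem lipschitz_omegaTilde {m : ℝ} (hm : 0 < m) :
    LipschitzWith n (omegaTilde m : Config n d → ℝ) := by
  refine LipschitzWith.of_dist_le_mul fun x y => ?_
  rw [Real.dist_eq, dist_eq_norm, omegaTilde, omegaTilde, ← Finset.sum_sub_distrib]
  calc _ ≤ ∑ i : Fin n, |√(‖particle x i‖ ^ 2 + m ^ 2) - √(‖particle y i‖ ^ 2 + m ^ 2)| :=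
        Finset.abs_sum_le_sum_abs _ _
    _ ≤ ∑ _i : Fin n, ‖x - y‖ := Finset.sum_le_sum fun i _ => by
        refine (abs_sqrt_sub_sqrt_le hm).trans ((abs_norm_sub_norm_le _ _).trans ?_)
        rw [← particle_sub]; exact norm_particle_le _ i
    _ = _ := by simp

/-- The velocity `∇ω̃`. -/
abbrev vel (n d : ℕ) (m : ℝ) (ξ : Config n d) : Config n d := gradient (omegaTilde m) ξ

theorem contDiff_vel {m : ℝ} (hm : 0 < m) : ContDiff ℝ ∞ (vel n d m) := by
  unfold vel gradient
  exact (InnerProductSpace.toDual ℝ (Config n d)).symm.contDiff.comp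
    ((contDiff_omegaTilde hm).fderiv_right (m := ∞) le_rfl)

theorem norm_vel_le {m : ℝ} (hm : 0 < m) (ξ : Config n d) : ‖vel n d m ξ‖ ≤ n := by
  unfold vel gradient
  rw [LinearIsometryEquiv.norm_map]
  exact norm_fderiv_le_of_lipschitz ℝ (lipschitz_omegaTilde hm)

theorem vel_apply {m : ℝ} (ξ : Config n d) (k : Fin n × Fin d) :
    vel n d m ξ k
      = fderiv ℝ (omegaTilde m) ξ (EuclideanSpace.basisFun (Fin n × Fin d) ℝ k) := by
  have := inner_gradient_left (𝕜 := ℝ) (f := omegaTilde m) (x := ξ)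
    (y := EuclideanSpace.basisFun (Fin n × Fin d) ℝ k)
  rw [← this, real_inner_comm, EuclideanSpace.basisFun_inner]

theorem contDiff_coord {ι : Type*} [Fintype ι] (k : ι) :
    ContDiff ℝ ∞ fun x : EuclideanSpace ℝ ι => x k :=
  contDiff_piLp_apply (p := 2) (i := k)

/-- The component `k` of the velocity, as a complex function. -/
def velC (n d : ℕ) (m : ℝ) (k : Fin n × Fin d) (ξ : Config n d) : ℂ := ((vel n d m ξ k : ℝ) : ℂ)

theorem contDiff_velC {m : ℝ} (hm : 0 < m) (k : Fin n × Fin d) : ContDiff ℝ ∞ (velC n d m k) :=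
  Complex.ofRealCLM.contDiff.comp ((contDiff_coord k).comp (contDiff_vel hm))

theorem isBddMeas_velC {m : ℝ} (hm : 0 < m) (k : Fin n × Fin d) :
    IsBddMeas (velC n d m k) n := by
  refine ⟨(contDiff_velC hm k).continuous.measurable, fun ξ => ?_⟩
  rw [velC, Complex.norm_real]
  exact (PiLp.norm_apply_le _ k).trans (norm_vel_le hm ξ)

/-- The component `k` of the symbol, as a complex function. -/
def comp (H : Config n d × Config n d → Config n d) (k : Fin n × Fin d)
    (x : Config n d × Config n d) : ℂ := ((H x k : ℝ) : ℂ)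

theorem isCc_comp {m : ℝ} {H : Config n d × Config n d → Config n d} (hH : AdmissibleSymbol m H)
    (k : Fin n × Fin d) : IsCc (comp H k) :=
  ⟨Complex.ofRealCLM.contDiff.comp ((contDiff_coord k).comp hH.smooth),
    hH.compactSupport.comp_left (g := fun y : Config n d => ((y k : ℝ) : ℂ)) (by simp)⟩

theorem weyl_scaledComponent (H : Config n d × Config n d → Config n d) (k : Fin n × Fin d)
    (t : ℝ) (u : Config n d → ℂ) :
    weyl (scaledComponent H k t) u = kop (ker t (osc (comp H k))) u := by
  funext x
  rw [weyl, kop, ← integral_const_mul]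
  congr 1; funext y
  rw [← mul_assoc]
  congr 1
  simp only [ker, osc, invF, fc, smul_eq_mul, scaledComponent, comp, smul_smul, mul_inv]
  rw [mul_comm t⁻¹]

/-- The symbol `(x_k - ∂_k ω̃(ξ)) H_k(x, ξ)`. -/
def zcomp (m : ℝ) (H : Config n d × Config n d → Config n d) (k : Fin n × Fin d)
    (x : Config n d × Config n d) : ℂ := ((x.1 k : ℝ) : ℂ) * comp H k x - velC n d m k x.2 * comp H k x

theorem isCc_coord_comp {m : ℝ} {H : Config n d × Config n d → Config n d}
    (hH : AdmissibleSymbol m H) (k : Fin n × Fin d) :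
    IsCc fun x : Config n d × Config n d => ((x.1 k : ℝ) : ℂ) * comp H k x :=
  (isCc_comp hH k).mul_left (Complex.ofRealCLM.contDiff.comp ((contDiff_coord k).comp contDiff_fst))

theorem isCc_velC_comp {m : ℝ} (hm : 0 < m) {H : Config n d × Config n d → Config n d}
    (hH : AdmissibleSymbol m H) (k : Fin n × Fin d) :
    IsCc fun x : Config n d × Config n d => velC n d m k x.2 * comp H k x :=
  (isCc_comp hH k).mul_left ((contDiff_velC hm k).comp contDiff_snd)

theorem isCc_zcomp {m : ℝ} (hm : 0 < m) {H : Config n d × Config n d → Config n d}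
    (hH : AdmissibleSymbol m H) (k : Fin n × Fin d) : IsCc (zcomp m H k) :=
  (isCc_coord_comp hH k).sub (isCc_velC_comp hm hH k)

/-- The symbol `i ∂_{ξ_k} H_k`, which arises from the commutator of `x_k` with `H_k^w`. -/
def dcomp (H : Config n d × Config n d → Config n d) (k : Fin n × Fin d)
    (x : Config n d × Config n d) : ℂ :=
  Complex.I * fderiv ℝ (comp H k) x (0, EuclideanSpace.basisFun (Fin n × Fin d) ℝ k)

theorem isCc_dcomp {m : ℝ} {H : Config n d × Config n d → Config n d}
    (hH : AdmissibleSymbol m H) (k : Fin n × Fin d) : IsCc (dcomp H k) :=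
  ((isCc_comp hH k).fderiv_apply _).mul_left contDiff_const

theorem memLp_weyl {m : ℝ} {H : Config n d × Config n d → Config n d}
    (hH : AdmissibleSymbol m H) (k : Fin n × Fin d) (t : ℝ) {u : Config n d → ℂ}
    (hu : MemLp u 2 volume) : MemLp (weyl (scaledComponent H k t) u) 2 volume := by
  rw [weyl_scaledComponent]
  exact memLp_kop ((isCc_comp hH k).isSym.isKer t) hu

theorem coord_mul_weyl {m : ℝ} {H : Config n d × Config n d → Config n d}
    (hH : AdmissibleSymbol m H) (k : Fin n × Fin d) {t : ℝ} (ht : 0 < t) {u : Config n d → ℂ}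
    (hu : MemLp u 2 volume) :
    (fun x => ((x k / t : ℝ) : ℂ) * weyl (scaledComponent H k t) u x)
      = kop (ker t (osc fun x => ((x.1 k : ℝ) : ℂ) * comp H k x)) u
        + ((2 * t : ℝ) : ℂ)⁻¹ • kop (ker t (osc (dcomp H k))) u := by
  rw [weyl_scaledComponent]
  funext x
  exact coord_mul_kop_ker (isCc_comp hH k) k t ht (isCc_coord_comp hH k) (isCc_dcomp hH k) hu x

theorem memLp_coord_mul_weyl {m : ℝ} {H : Config n d × Config n d → Config n d}
    (hH : AdmissibleSymbol m H) (k : Fin n × Fin d) {t : ℝ} (ht : 0 < t) {u : Config n d → ℂ}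
    (hu : MemLp u 2 volume) :
    MemLp (fun x => ((x k / t : ℝ) : ℂ) * weyl (scaledComponent H k t) u x) 2 volume := by
  rw [coord_mul_weyl hH k ht hu]
  exact (memLp_kop ((isCc_coord_comp hH k).isSym.isKer t) hu).add
    ((memLp_kop ((isCc_dcomp hH k).isSym.isKer t) hu).const_smul _)

theorem opH_toLp {ι : Type*} [Fintype ι] {h : EuclideanSpace ℝ ι × EuclideanSpace ℝ ι → ℂ}
    (hh : IsCc h) (t : ℝ) {u : EuclideanSpace ℝ ι → ℂ} (hu : MemLp u 2 volume) :
    opH h hh t (hu.toLp u) = (memLp_kop (hh.isSym.isKer t) hu).toLp _ :=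
  kopL_toLp (hh.isSym.isKer t) hu

theorem propagationVector_eq {m : ℝ} {H : Config n d × Config n d → Config n d}
    (hH : AdmissibleSymbol m H) {t : ℝ} (ht : 0 < t) {u : Config n d → ℂ} (hu : MemLp u 2 volume) :
    propagationVector m H t u = ∑ k, (opH _ (isCc_coord_comp hH k) t (hu.toLp u)
      + ((2 * t : ℝ) : ℂ)⁻¹ • opH _ (isCc_dcomp hH k) t (hu.toLp u)
      - multiplier (velC n d m k) (opH _ (isCc_comp hH k) t (hu.toLp u))) := by
  rw [propagationVector]
  refine Finset.sum_congr rfl fun k _ => ?_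
  rw [opH_toLp, opH_toLp, opH_toLp, toL2_eq (memLp_coord_mul_weyl hH k ht hu),
    toL2_eq (memLp_weyl hH k t hu)]
  congr 1
  · rw [← MemLp.toLp_const_smul, ← MemLp.toLp_add]
    exact MemLp.toLp_congr _ _ (Eventually.of_forall fun x =>
      congrFun (coord_mul_weyl hH k ht hu) x)
  · change multiplier (velC n d m k) _ = _
    congr 1
    exact MemLp.toLp_congr _ _ (Eventually.of_forall fun x =>
      congrFun (weyl_scaledComponent H k t u) x)

/-- The propagation vector is given, up to `O(1/t)`, by the quantization of the symbol
`(x - ∇ω̃(ξ)) · H(x, ξ)`. -/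
theorem exists_norm_propagationVector_sub_le {m : ℝ} (hm : 0 < m)
    {H : Config n d × Config n d → Config n d} (hH : AdmissibleSymbol m H) :
    ∃ C, 0 ≤ C ∧ ∀ t > 0, ∀ u : Config n d → ℂ, ∀ hu : MemLp u 2 volume,
      ‖propagationVector m H t u - ∑ k, opH _ (isCc_zcomp hm hH k) t (hu.toLp u)‖
        ≤ C / t * ‖hu.toLp u‖ := by
  have h1 : ∀ k, ∃ C, 0 ≤ C ∧ ∀ t > 0, ∀ u : L2 (Fin n × Fin d),
      ‖(opH _ (isCc_coord_comp hH k) t u + ((2 * t : ℝ) : ℂ)⁻¹ • opH _ (isCc_dcomp hH k) t u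
      - multiplier (velC n d m k) (opH _ (isCc_comp hH k) t u)) - opH _ (isCc_zcomp hm hH k) t u‖
        ≤ C / t * ‖u‖ := by
    intro k
    obtain ⟨C₁, hC₁0, hC₁⟩ := exists_norm_multiplier_opH_sub_le (contDiff_velC hm k)
      (isBddMeas_velC hm k) (isCc_comp hH k) (isCc_velC_comp hm hH k)
    obtain ⟨C₂, hC₂0, hC₂⟩ := exists_norm_opS_le (isCc_dcomp hH k).isSym
    refine ⟨C₂ + C₁, by positivity, fun t ht u => ?_⟩
    have e := congrArg (fun A : L2 (Fin n × Fin d) →L[ℂ] L2 (Fin n × Fin d) => A u)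
      (opH_sub (isCc_coord_comp hH k) (isCc_velC_comp hm hH k) (isCc_zcomp hm hH k) t)
    simp only [sub_apply] at e
    change opH _ (isCc_zcomp hm hH k) t u = _ at e
    rw [e]
    have e2 : ∀ a b c f : L2 (Fin n × Fin d), a + b - c - (a - f) = b - (c - f) := fun a b c f => by
      abel
    rw [e2]
    refine (norm_sub_le _ _).trans ?_
    rw [add_div, add_mul]
    refine add_le_add ?_ (hC₁ t ht u)
    rw [norm_smul, norm_inv, Complex.norm_real, Real.norm_of_nonneg (by positivity)]
    have h3 : ‖opH _ (isCc_dcomp hH k) t u‖ ≤ C₂ * ‖u‖ :=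
      ContinuousLinearMap.le_of_opNorm_le _ (hC₂ t) u
    calc _ ≤ t⁻¹ * (C₂ * ‖u‖) := by gcongr; linarith
      _ = _ := by ring
  choose C hC0 hC using h1
  refine ⟨∑ k, C k, Finset.sum_nonneg fun k _ => hC0 k, fun t ht u hu => ?_⟩
  rw [propagationVector_eq hH ht hu, ← Finset.sum_sub_distrib, Finset.sum_div, Finset.sum_mul]
  exact (norm_sum_le _ _).trans (Finset.sum_le_sum fun k _ => hC k t ht _)

end Dispersion

/-! ### The propagation observable -/

section Observable

variable {n d : ℕ}

/-- A smooth antiderivative used to build the observable: `γ' = -ρ²/2` and `γ` vanishes where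
`s ≥ a`. -/
theorem exists_antideriv_sq {ρ : ℝ → ℝ} (hρ : ContDiff ℝ ∞ ρ) {a : ℝ} (ha : ∀ s, a ≤ s → ρ s = 0) :
    ∃ γ : ℝ → ℝ, ContDiff ℝ ∞ γ ∧ (∀ s, HasDerivAt γ (-(ρ s ^ 2) / 2) s) ∧
      ∀ s, a ≤ s → γ s = 0 := by
  have hc : Continuous fun s => -(ρ s ^ 2) / 2 := by have := hρ.continuous; fun_prop
  have hd : ∀ s, HasDerivAt (fun s => ∫ x in a..s, -(ρ x ^ 2) / 2) (-(ρ s ^ 2) / 2) s := fun s =>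
    intervalIntegral.integral_hasDerivAt_right (hc.intervalIntegrable _ _)
      (hc.stronglyMeasurableAtFilter _ _) hc.continuousAt
  refine ⟨fun s => ∫ x in a..s, -(ρ x ^ 2) / 2, ?_, hd, fun s hs => ?_⟩
  · rw [contDiff_infty_iff_deriv]
    refine ⟨fun s => (hd s).differentiableAt, ?_⟩
    have : deriv (fun s => ∫ x in a..s, -(ρ x ^ 2) / 2) = fun s => -(ρ s ^ 2) / 2 :=
      funext fun s => (hd s).deriv
    rw [this]
    exact (hρ.pow 2).neg.div_const 2
  · refine (intervalIntegral.integral_congr (g := fun _ => 0) fun x hx => ?_).trans (by simp)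
    rw [uIcc_of_le hs] at hx
    simp [ha x hx.1]

/-- The data of a propagation observable for the admissible symbol `H`. With
`z = x - ∇ω̃(ξ)`, the symbol is `φ = χ(ξ)² γ(|z|²)`, where `γ ≥ 0` is decreasing; its derivative
along the free flow is `1/t` times the sum of the squares of `b_k = χ(ξ) z_k ρ(|z|²)`, `ρ² = -2γ'`.
The configurations in the support of `φ` keep away from the collision planes. -/
structure Observable (m : ℝ) (H : Config n d × Config n d → Config n d) where
  χ : Config n d → ℝ
  φ : Config n d × Config n d → ℂ
  b : Fin n × Fin d → Config n d × Config n d → ℂ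
  cutoff_compact : HasCompactSupport χ
  cutoff_eq_one : ∀ x ∈ tsupport H, χ x.2 = 1
  isCc : IsCc φ
  isCc_b : ∀ k, IsCc (b k)
  real : ∀ x, (starRingEnd ℂ) (φ x) = φ x
  real_b : ∀ k x, (starRingEnd ℂ) (b k x) = b k x
  support : ∀ x, x.2 ∉ tsupport χ → φ =ᶠ[nhds x] 0
  deriv_flow : ∀ x, fderiv ℝ φ x (vel n d m x.2, 0) - fderiv ℝ φ x (x.1, 0) = ∑ k, b k x * b k x
  comp_mul : ∀ k x, comp H k x * b k x = zcomp m H k x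
  sep : ∃ c > 0, ∀ x, φ x ≠ 0 → ∀ i j, i ≠ j → c ≤ ‖particle x.1 i - particle x.1 j‖

theorem exists_observable {m : ℝ} (hm : 0 < m) {H : Config n d × Config n d → Config n d}
    (hH : AdmissibleSymbol m H) : Nonempty (Observable m H) := by
  obtain ⟨K, ε, hε, hK, hKD, hsupp⟩ := hH.localized
  set v := vel n d m with hv
  have hvs : ContDiff ℝ ∞ v := contDiff_vel hm
  have hvc : Continuous v := hvs.continuous
  have hS : IsCompact (tsupport H) := hH.compactSupport
  obtain ⟨ε₀, hε₀, hε₀ε, hz⟩ : ∃ ε₀, 0 < ε₀ ∧ ε₀ < ε ∧ ∀ x ∈ tsupport H, ‖x.1 - v x.2‖ ≤ ε₀ := by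
    rcases (tsupport H).eq_empty_or_nonempty with he | hne
    · exact ⟨ε / 2, by positivity, by linarith, by simp [he]⟩
    · obtain ⟨x₀, hx₀, hmax⟩ := hS.exists_isMaxOn hne
        (f := fun x : Config n d × Config n d => ‖x.1 - v x.2‖) (by fun_prop)
      refine ⟨max (ε / 2) ‖x₀.1 - v x₀.2‖, lt_max_of_lt_left (by positivity),
        max_lt (by linarith) (hsupp hx₀).2, fun x hx => le_max_of_le_right (hmax hx)⟩
  -- `ρ = 1` up to `ε₀`, `ρ = 0` from `ε₁` on; the rest `ε - ε₁` is left for the velocities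
  obtain ⟨ε₁, h01, h1ε⟩ := exists_between hε₀ε
  have hε₁ : 0 < ε₁ := hε₀.trans h01
  -- cutoff in momentum space
  set U : Set (Config n d) := {ξ | ∃ k ∈ K, ‖v ξ - k‖ < ε - ε₁} with hU
  have hUo : IsOpen U := by
    have : U = ⋃ k ∈ K, {ξ | ‖v ξ - k‖ < ε - ε₁} := by ext ξ; simp [hU]
    rw [this]
    exact isOpen_biUnion fun k _ => isOpen_lt (by fun_prop) continuous_const
  have hKU : Prod.snd '' tsupport H ⊆ U := by
    rintro _ ⟨x, hx, rfl⟩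
    exact ⟨v x.2, (hsupp hx).1, by simpa using h1ε⟩
  obtain ⟨χ, hχs, hχc, hχ1, hχU, -⟩ := exists_smooth_cutoff (hS.image continuous_snd) hUo hKU
  -- cutoff in the variable `|z|²`
  obtain ⟨ρ, hρs, hρc, hρ1, hρU, -⟩ := exists_smooth_cutoff (isCompact_Icc (a := (0 : ℝ)) (b := ε₀ ^ 2))
    (isOpen_Iio (a := ε₁ ^ 2)) (fun s hs => lt_of_le_of_lt hs.2 (by gcongr))
  have hρ0 : ∀ s, ε₁ ^ 2 ≤ s → ρ s = 0 := fun s hs =>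
    image_eq_zero_of_notMem_tsupport fun h => absurd (hρU h) (by simpa using hs)
  obtain ⟨γ, hγs, hγd, hγ0⟩ := exists_antideriv_sq hρs hρ0
  set Z : Config n d × Config n d → Config n d := fun x => x.1 - v x.2 with hZ
  have hZs : ContDiff ℝ ∞ Z := contDiff_fst.sub (hvs.comp contDiff_snd)
  have hN : ContDiff ℝ ∞ fun x => ‖Z x‖ ^ 2 := hZs.norm_sq ℝ
  set φr : Config n d × Config n d → ℝ := fun x => χ x.2 ^ 2 * γ (‖Z x‖ ^ 2) with hφr
  set br : Fin n × Fin d → Config n d × Config n d → ℝ :=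
    fun k x => χ x.2 * (Z x k * ρ (‖Z x‖ ^ 2)) with hbr
  have hφs : ContDiff ℝ ∞ φr := ((hχs.comp contDiff_snd).pow 2).mul (hγs.comp hN)
  have hbs : ∀ k, ContDiff ℝ ∞ (br k) := fun k =>
    (hχs.comp contDiff_snd).mul (((contDiff_coord k).comp hZs).mul (hρs.comp hN))
  have hsq : ∀ x, ε₁ < ‖Z x‖ → ε₁ ^ 2 ≤ ‖Z x‖ ^ 2 := fun x h => by gcongr
  set L : Set (Config n d × Config n d) :=
    {x | x ∈ Metric.closedBall (0 : Config n d) (n + ε₁) ×ˢ tsupport χ ∧ ‖Z x‖ ≤ ε₁} with hL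
  have hLc : IsCompact L := by
    have : IsCompact (Metric.closedBall (0 : Config n d) (n + ε₁) ×ˢ tsupport χ) :=
      (isCompact_closedBall _ _).prod hχc
    exact this.inter_right (isClosed_le hZs.continuous.norm continuous_const)
  have hLmem : ∀ x, x.2 ∈ tsupport χ → ‖Z x‖ ≤ ε₁ → x ∈ L := by
    intro x h1 h2
    refine ⟨⟨?_, h1⟩, h2⟩
    rw [mem_closedBall_zero_iff]
    have : x.1 = v x.2 + Z x := by simp [hZ]
    rw [this]
    exact (norm_add_le _ _).trans (add_le_add (norm_vel_le hm _) h2)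
  have hφ0 : ∀ x ∉ L, φr x = 0 := by
    intro x hx
    by_cases h1 : x.2 ∈ tsupport χ
    · have h2 : ε₁ < ‖Z x‖ := not_le.1 fun h => hx (hLmem x h1 h)
      simp only [hφr, hγ0 _ (hsq x h2), mul_zero]
    · simp only [hφr, image_eq_zero_of_notMem_tsupport h1]; ring
  have hb0 : ∀ k, ∀ x ∉ L, br k x = 0 := by
    intro k x hx
    by_cases h1 : x.2 ∈ tsupport χ
    · have h2 : ε₁ < ‖Z x‖ := not_le.1 fun h => hx (hLmem x h1 h)
      simp only [hbr, hρ0 _ (hsq x h2), mul_zero]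
    · simp only [hbr, image_eq_zero_of_notMem_tsupport h1]; ring
  have hfd : ∀ x δ, fderiv ℝ φr x (δ, 0)
      = χ x.2 ^ 2 * (-(ρ (‖Z x‖ ^ 2) ^ 2) / 2 * (2 * inner ℝ (Z x) δ)) := by
    intro x δ
    have hl : HasDerivAt (fun s : ℝ => x + s • ((δ, 0) : Config n d × Config n d)) (δ, 0) 0 := by
      simpa using ((hasDerivAt_id (0 : ℝ)).smul_const ((δ, 0) : Config n d × Config n d)).const_add x
    have h1 : HasDerivAt (fun s : ℝ => φr (x + s • ((δ, 0) : Config n d × Config n d)))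
        (fderiv ℝ φr x (δ, 0)) 0 := by
      have := (hφs.differentiable (by simp) (x + (0 : ℝ) • ((δ, 0) : Config n d × Config n d))).hasFDerivAt
      have h := this.comp_hasDerivAt (0 : ℝ) hl
      simpa [Function.comp_def] using h
    have hn : HasDerivAt (fun s : ℝ => ‖Z x + s • δ‖ ^ 2) (2 * inner ℝ (Z x) δ) 0 := by
      have h2 : HasDerivAt (fun s : ℝ => Z x + s • δ) δ 0 := by
        simpa using ((hasDerivAt_id (0 : ℝ)).smul_const δ).const_add (Z x)
      simpa using h2.norm_sq
    have hg : HasDerivAt (fun s : ℝ => γ (‖Z x + s • δ‖ ^ 2))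
        (-(ρ (‖Z x‖ ^ 2) ^ 2) / 2 * (2 * inner ℝ (Z x) δ)) 0 := by
      have h3 := hγd (‖Z x + (0 : ℝ) • δ‖ ^ 2)
      have := h3.comp (0 : ℝ) hn
      simpa [Function.comp_def] using this
    have h4 : HasDerivAt (fun s : ℝ => φr (x + s • ((δ, 0) : Config n d × Config n d)))
        (χ x.2 ^ 2 * (-(ρ (‖Z x‖ ^ 2) ^ 2) / 2 * (2 * inner ℝ (Z x) δ))) 0 := by
      refine (hg.const_mul (χ x.2 ^ 2)).congr_of_eventuallyEq (Eventually.of_forall fun s => ?_)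
      simp only [hφr, hZ, Prod.fst_add, Prod.snd_add, Prod.smul_fst, Prod.smul_snd, smul_zero,
        add_zero]
      rw [add_sub_right_comm]
    exact h1.unique h4
  have hfc : ∀ x δ, fderiv ℝ (fun x => ((φr x : ℝ) : ℂ)) x δ = ((fderiv ℝ φr x δ : ℝ) : ℂ) := by
    intro x δ
    have := Complex.ofRealCLM.hasFDerivAt.comp x (hφs.differentiable (by simp) x).hasFDerivAt
    have h2 : fderiv ℝ (fun x => ((φr x : ℝ) : ℂ)) x = Complex.ofRealCLM.comp (fderiv ℝ φr x) :=
      this.fderiv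
    rw [h2]; rfl
  refine ⟨{
    χ := χ
    φ := fun x => ((φr x : ℝ) : ℂ)
    b := fun k x => ((br k x : ℝ) : ℂ)
    cutoff_compact := hχc
    cutoff_eq_one := fun x hx => hχ1.self_of_nhdsSet _ ⟨x, hx, rfl⟩
    isCc := IsCc.of_support (Complex.ofRealCLM.contDiff.comp hφs) hLc fun x hx => by simp [hφ0 x hx]
    isCc_b := fun k => IsCc.of_support (Complex.ofRealCLM.contDiff.comp (hbs k)) hLc fun x hx => by
      simp [hb0 k x hx]
    real := fun x => Complex.conj_ofReal _
    real_b := fun k x => Complex.conj_ofReal _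
    support := fun x hx => ?_
    deriv_flow := fun x => ?_
    comp_mul := fun k x => ?_
    sep := ?_ }⟩
  · have ho : IsOpen {y : Config n d × Config n d | y.2 ∉ tsupport χ} :=
      (isClosed_tsupport χ).isOpen_compl.preimage continuous_snd
    filter_upwards [ho.mem_nhds hx] with y hy
    have : χ y.2 = 0 := image_eq_zero_of_notMem_tsupport hy
    simp [hφr, this]
  · rw [hfc, hfc, hfd, hfd]
    norm_cast
    have h1 : ‖Z x‖ ^ 2 = ∑ k, Z x k * Z x k := by
      rw [EuclideanSpace.norm_sq_eq]
      exact Finset.sum_congr rfl fun k _ => by rw [Real.norm_eq_abs, sq_abs, sq]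
    have h2 : inner ℝ (Z x) x.1 - inner ℝ (Z x) (v x.2) = ‖Z x‖ ^ 2 := by
      rw [← inner_sub_right, ← real_inner_self_eq_norm_sq]
    have h3 : ∑ k, br k x * br k x = χ x.2 ^ 2 * ρ (‖Z x‖ ^ 2) ^ 2 * ∑ k, Z x k * Z x k := by
      rw [Finset.mul_sum]
      exact Finset.sum_congr rfl fun k _ => by simp only [hbr]; ring
    rw [h3, ← h1]
    linear_combination χ x.2 ^ 2 * ρ (‖Z x‖ ^ 2) ^ 2 * h2
  · by_cases hx : x ∈ tsupport H
    · have h1 : χ x.2 = 1 := hχ1.self_of_nhdsSet _ ⟨x, hx, rfl⟩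
      have h2 : ρ (‖Z x‖ ^ 2) = 1 := hρ1.self_of_nhdsSet _
        ⟨by positivity, pow_le_pow_left₀ (norm_nonneg _) (hz x hx) 2⟩
      simp only [hbr, h1, h2]
      simp only [zcomp, hZ, hv, velC, PiLp.sub_apply]
      push_cast; ring
    · have : comp H k x = 0 := by simp [comp, image_eq_zero_of_notMem_tsupport hx]
      simp [this, zcomp]
  · -- separation from the collision planes, by compactness
    have hsep : ∀ p : Fin n × Fin n, ∃ c > 0, ∀ x ∈ L, p.1 ≠ p.2 →
        c ≤ ‖particle x.1 p.1 - particle x.1 p.2‖ := by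
      intro p
      by_cases hp : p.1 = p.2
      · exact ⟨1, one_pos, fun x _ h => absurd hp h⟩
      rcases L.eq_empty_or_nonempty with he | hne
      · exact ⟨1, one_pos, by simp [he]⟩
      obtain ⟨x₀, hx₀, hmin⟩ := hLc.exists_isMinOn hne
        (f := fun x : Config n d × Config n d => ‖particle x.1 p.1 - particle x.1 p.2‖) (by
          have h1 := (continuous_particle (d := d) p.1)
          have h2 := (continuous_particle (d := d) p.2)
          exact (((h1.comp continuous_fst).sub (h2.comp continuous_fst)).norm).continuousOn)
      refine ⟨_, ?_, fun x hx _ => hmin hx⟩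
      change 0 < ‖particle x₀.1 p.1 - particle x₀.1 p.2‖
      rw [norm_pos_iff, sub_ne_zero]
      intro heq
      obtain ⟨k, hk, hkv⟩ := hχU hx₀.1.2
      have hmem := hKD k hk (x₀.1 - k) (fun i => by
        refine (norm_particle_le _ i).trans_lt ?_
        have : x₀.1 - k = (v x₀.2 - k) + Z x₀ := by simp [hZ]
        rw [this]
        exact (norm_add_le _ _).trans_lt (by linarith [hx₀.2]))
      rw [add_sub_cancel] at hmem
      exact hmem.2 ⟨p.1, p.2, hp, heq⟩
    choose c hc0 hc using hsep
    have hfin : ∃ c' > 0, ∀ p, c' ≤ c p := by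
      rcases isEmpty_or_nonempty (Fin n × Fin n) with he | hne
      · exact ⟨1, one_pos, fun p => he.elim p⟩
      · obtain ⟨p, hp⟩ := Finite.exists_min c
        exact ⟨c p, hc0 p, hp⟩
    obtain ⟨c', hc'0, hc'⟩ := hfin
    refine ⟨c', hc'0, fun x hx i j hij => (hc' (i, j)).trans (hc (i, j) x ?_ hij)⟩
    by_contra hxL
    exact hx (by simp [hφ0 x hxL])

end Observable

/-! ### Dependence of the quantization on the scale -/

section Scale

variable {ι : Type*} [Fintype ι]

local notation "E" => EuclideanSpace ℝ ι

theorem isLittleO_abs_sub_sq (t : ℝ) :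
    (fun s : ℝ => |s - t| ^ 2) =o[nhds t] fun s => s - t := by
  have : (fun s : ℝ => |s - t| ^ 2) = fun s => (s - t) * (s - t) := by
    funext s; rw [sq_abs, sq]
  rw [this]
  have h1 : (fun s : ℝ => s - t) =o[nhds t] fun _ => (1 : ℝ) := by
    rw [Asymptotics.isLittleO_one_iff]
    have : Tendsto (fun s : ℝ => s - t) (nhds t) (nhds (t - t)) :=
      (continuous_id.sub continuous_const).tendsto t
    simpa using this
  simpa using h1.mul_isBigO (Asymptotics.isBigO_refl (fun s : ℝ => s - t) (nhds t))

/-- The radial derivative in the base variable, `(x, ξ) ↦ x · ∂ₓ h(x, ξ)`. -/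
def radial (h : E × E → ℂ) (x : E × E) : ℂ := fderiv ℝ h x (x.1, 0)

theorem IsCc.radial {h : E × E → ℂ} (hh : IsCc h) : IsCc (radial h) := by
  refine IsCc.of_support ?_ (hh.compact.fderiv ℝ).isCompact fun x hx => ?_
  · exact (hh.smooth.fderiv_right (m := ∞) le_rfl).clm_apply (contDiff_fst.prodMk contDiff_const)
  · have : fderiv ℝ h x = 0 := image_eq_zero_of_notMem_tsupport hx
    simp [PropEst.radial, this]

theorem hasDerivAt_ker {h : E × E → ℂ} (hh : IsCc h) (x y : E) {t : ℝ} (ht : 0 < t) :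
    HasDerivAt (fun s => ker s (osc h) x y) (((-t⁻¹ : ℝ) : ℂ) * ker t (osc (radial h)) x y) t := by
  have h1 := hasFDerivAt_osc hh.smooth hh.compact ((2 * t)⁻¹ • (x + y)) (x - y)
  have h2 : HasDerivAt (fun s : ℝ => (2 * s)⁻¹ • (x + y)) ((-t⁻¹) • ((2 * t)⁻¹ • (x + y))) t := by
    have : HasDerivAt (fun s : ℝ => (2 * s)⁻¹) (-t⁻¹ * (2 * t)⁻¹) t := by
      have h3 : HasDerivAt (fun s : ℝ => (2 * s)⁻¹) (-(2 * 1) / (2 * t) ^ 2) t :=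
        ((hasDerivAt_id' t).const_mul 2).fun_inv (by positivity)
      refine h3.congr_deriv ?_
      field_simp
    simpa [smul_smul] using this.smul_const (x + y)
  have h3 := h1.comp_hasDerivAt t h2
  rw [map_smul, osc_apply hh.dpar, Complex.real_smul] at h3
  exact h3

theorem exists_norm_ker_sub_le {h : E × E → ℂ} (hh : IsCc h) (N : ℕ) :
    ∃ C, 0 ≤ C ∧ ∀ s t : ℝ, 1 / 2 ≤ s → 1 / 2 ≤ t → ∀ x y,
      ‖ker s (osc h) x y - ker t (osc h) x y‖ ≤ C * wt N (x - y) * |s - t| := by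
  obtain ⟨C, hC0, hC⟩ := hh.radial.isSym.bound N
  refine ⟨2 * C, by positivity, fun s t hs ht x y => ?_⟩
  refine (convex_Ici (1 / 2 : ℝ)).norm_image_sub_le_of_norm_hasDerivWithin_le
    (f := fun s => ker s (osc h) x y)
    (fun r hr => (hasDerivAt_ker hh x y (lt_of_lt_of_le (by norm_num) hr)).hasDerivWithinAt)
    (fun r hr => ?_) ht hs
  have hr : (1 / 2 : ℝ) ≤ r := hr
  have hr0 : 0 < r := lt_of_lt_of_le (by norm_num) hr
  rw [norm_mul, Complex.norm_real, norm_neg, norm_inv, Real.norm_of_nonneg hr0.le, mul_assoc]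
  refine mul_le_mul ?_ (hC _ _) (norm_nonneg _) (by norm_num)
  rw [inv_le_comm₀ hr0 (by norm_num)]; linarith

theorem exists_norm_opH_sub_le {h : E × E → ℂ} (hh : IsCc h) :
    ∃ C, 0 ≤ C ∧ ∀ s t : ℝ, 1 / 2 ≤ s → 1 / 2 ≤ t → ‖opH h hh s - opH h hh t‖ ≤ C * |s - t| := by
  obtain ⟨C, hC0, hC⟩ := exists_norm_ker_sub_le hh (dimN ι)
  have := wtInt_nonneg (ι := ι)
  refine ⟨C * wtInt ι, by positivity, fun s t hs ht => ?_⟩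
  refine (norm_kopL_sub_le (hh.isSym.isKer s) (hh.isSym.isKer t) (C := C * |s - t|) (by positivity)
    fun x y => (hC s t hs ht x y).trans (by nlinarith)).trans (by nlinarith)

theorem continuousOn_opH {h : E × E → ℂ} (hh : IsCc h) :
    ContinuousOn (fun t => opH h hh t) (Ici (1 / 2)) := by
  obtain ⟨C, hC0, hC⟩ := exists_norm_opH_sub_le hh
  have : LipschitzOnWith ⟨C, hC0⟩ (fun t => opH h hh t) (Ici (1 / 2)) :=
    LipschitzOnWith.of_dist_le_mul fun s hs t ht => by
      rw [dist_eq_norm, Real.dist_eq]; exact hC s t hs ht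
  exact this.continuousOn

/-- The quantization is differentiable in the scale, with respect to the operator norm. -/
theorem hasDerivAt_opH {h : E × E → ℂ} (hh : IsCc h) {t : ℝ} (ht : 1 ≤ t) :
    HasDerivAt (fun s => opH h hh s) (((-t⁻¹ : ℝ) : ℂ) • opH _ hh.radial t) t := by
  obtain ⟨C, hC0, hC⟩ := hh.radial.isSym.bound (dimN ι)
  obtain ⟨L, hL0, hL⟩ := exists_norm_ker_sub_le hh.radial (dimN ι)
  have hI := wtInt_nonneg (ι := ι)
  have ht0 : 0 < t := by linarith
  have key : ∀ s, 1 / 2 ≤ s → ∀ x y, ‖ker s (osc h) x y - ker t (osc h) x y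
      - ((((s - t) * -t⁻¹ : ℝ) : ℂ)) * ker t (osc (radial h)) x y‖
      ≤ (2 * (L + C)) * |s - t| ^ 2 * wt (dimN ι) (x - y) := by
    intro s hs x y
    set D : ℝ → ℂ := fun r => ker r (osc h) x y
      - (((r - t) * -t⁻¹ : ℝ) : ℂ) * ker t (osc (radial h)) x y
    have hD : ∀ r, 0 < r → HasDerivAt D (((-r⁻¹ : ℝ) : ℂ) * ker r (osc (radial h)) x y
        - ((-t⁻¹ : ℝ) : ℂ) * ker t (osc (radial h)) x y) r := by
      intro r hr
      refine (hasDerivAt_ker hh x y hr).sub ?_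
      have h1 : HasDerivAt (fun r : ℝ => (r - t) * -t⁻¹) (-t⁻¹) r := by
        simpa using ((hasDerivAt_id r).sub_const t).mul_const (-t⁻¹)
      exact (h1.ofReal_comp).mul_const _
    have h2 := (convex_uIcc t s).norm_image_sub_le_of_norm_hasDerivWithin_le (f := D)
      (C := (2 * (L + C)) * |s - t| * wt (dimN ι) (x - y)) (x := t) (y := s)
      (fun r hr => (hD r ?_).hasDerivWithinAt) (fun r hr => ?_) left_mem_uIcc right_mem_uIcc
    · have : D s - D t = ker s (osc h) x y - ker t (osc h) x y
          - ((((s - t) * -t⁻¹ : ℝ) : ℂ)) * ker t (osc (radial h)) x y := by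
        simp only [D]; push_cast; ring
      rw [← this]
      refine h2.trans (le_of_eq ?_)
      rw [Real.norm_eq_abs]; ring
    · exact lt_of_lt_of_le (lt_min ht0 (by linarith)) hr.1
    · have hr2 : 1 / 2 ≤ r := (le_min (by linarith) hs).trans hr.1
      have hr0 : 0 < r := by linarith
      have hrt : |r - t| ≤ |s - t| := abs_sub_left_of_mem_uIcc hr
      have e : ((-r⁻¹ : ℝ) : ℂ) * ker r (osc (radial h)) x y
          - ((-t⁻¹ : ℝ) : ℂ) * ker t (osc (radial h)) x y
          = ((-r⁻¹ : ℝ) : ℂ) * (ker r (osc (radial h)) x y - ker t (osc (radial h)) x y)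
            + ((t⁻¹ - r⁻¹ : ℝ) : ℂ) * ker t (osc (radial h)) x y := by push_cast; ring
      have hri : r⁻¹ ≤ 2 := by rw [inv_le_comm₀ hr0 (by norm_num)]; linarith
      have hti : t⁻¹ ≤ 1 := inv_le_one_of_one_le₀ ht
      have h5 : |t⁻¹ - r⁻¹| ≤ 2 * |s - t| := by
        have : t⁻¹ - r⁻¹ = (r - t) * (t⁻¹ * r⁻¹) := by field_simp
        rw [this, abs_mul, abs_of_nonneg (show 0 ≤ t⁻¹ * r⁻¹ by positivity), mul_comm]
        refine mul_le_mul ?_ hrt (abs_nonneg _) (by norm_num)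
        calc t⁻¹ * r⁻¹ ≤ 1 * 2 := mul_le_mul hti hri (by positivity) (by norm_num)
          _ = 2 := by norm_num
      rw [e]
      refine (norm_add_le _ _).trans ?_
      rw [norm_mul, norm_mul, Complex.norm_real, Complex.norm_real, norm_neg,
        Real.norm_of_nonneg (inv_nonneg.2 hr0.le), Real.norm_eq_abs]
      have h3 := (hL r t hr2 (by linarith) x y).trans
        (mul_le_mul_of_nonneg_left hrt (mul_nonneg hL0 (wt_nonneg _ _)))
      have h4 := hC ((2 * t)⁻¹ • (x + y)) (x - y)
      calc _ ≤ 2 * (L * wt (dimN ι) (x - y) * |s - t|) + 2 * |s - t| * (C * wt (dimN ι) (x - y)) :=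
            add_le_add (mul_le_mul hri h3 (norm_nonneg _) (by norm_num))
              (mul_le_mul h5 h4 (norm_nonneg _) (by positivity))
        _ = _ := by ring
  have hop : ∀ s, 1 / 2 ≤ s → ‖opH h hh s - opH h hh t - (s - t) • (((-t⁻¹ : ℝ) : ℂ) •
      opH _ hh.radial t)‖ ≤ (2 * (L + C)) * wtInt ι * |s - t| ^ 2 := by
    intro s hs
    have e : opH h hh s - opH h hh t - (s - t) • (((-t⁻¹ : ℝ) : ℂ) • opH _ hh.radial t)
        = kopL _ (((hh.isSym.isKer s).sub (hh.isSym.isKer t)).sub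
          ((hh.radial.isSym.isKer t).const_mul (((s - t) * -t⁻¹ : ℝ) : ℂ))) := by
      rw [kopL_sub ((hh.isSym.isKer s).sub (hh.isSym.isKer t))
          ((hh.radial.isSym.isKer t).const_mul (((s - t) * -t⁻¹ : ℝ) : ℂ)),
        kopL_sub (hh.isSym.isKer s) (hh.isSym.isKer t), kopL_const_mul (hh.radial.isSym.isKer t)
          (((s - t) * -t⁻¹ : ℝ) : ℂ)]
      simp only [opH, opS]
      congr 1
      ext1 u
      simp only [smul_apply]
      rw [Complex.ofReal_mul, mul_smul, Complex.coe_smul (s - t)]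
      rfl
    rw [e]
    refine (norm_kopL_le _ (C := (2 * (L + C)) * |s - t| ^ 2) (by positivity) (key s hs)).trans
      (le_of_eq (by ring))
  rw [hasDerivAt_iff_isLittleO]
  refine Asymptotics.IsBigO.trans_isLittleO (g := fun s : ℝ => |s - t| ^ 2) ?_ ?_
  · refine Asymptotics.IsBigO.of_bound ((2 * (L + C)) * wtInt ι) ?_
    filter_upwards [Ioi_mem_nhds (show 1 / 2 < t by linarith)] with s hs
    refine (hop s (le_of_lt hs)).trans (le_of_eq ?_)
    rw [Real.norm_of_nonneg (by positivity)]
  · exact isLittleO_abs_sub_sq t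

end Scale

/-! ### The propagation estimate -/

section Propagation

variable {n d : ℕ}

/-- A weight which is small unless two of the particles are close to each other. -/
def collWt (N : ℕ) (x : Config n d) : ℝ :=
  ∑ p ∈ Finset.univ.filter (fun p : Fin n × Fin n => p.1 ≠ p.2),
    wt N (particle x p.1 - particle x p.2)

theorem collWt_nonneg (N : ℕ) (x : Config n d) : 0 ≤ collWt N x :=
  Finset.sum_nonneg fun _ _ => wt_nonneg _ _

/-- The exponent of the collision weight needed in the propagation estimate. -/
abbrev collN (n d : ℕ) : ℕ := dimN (Fin n × Fin d) + 2

/-- A symbol supported away from the collision planes, quantized at scale `t`, is negligible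
against the collision weight. -/
theorem exists_collWt_mul_ker_le {φ : Config n d × Config n d → ℂ} (hφ : IsCc φ)
    (hsep : ∃ c > 0, ∀ x, φ x ≠ 0 → ∀ i j, i ≠ j → c ≤ ‖particle x.1 i - particle x.1 j‖) :
    ∃ C, 0 ≤ C ∧ ∀ t : ℝ, 1 ≤ t → ∀ x y, collWt (collN n d) x * ‖ker t (osc φ) x y‖
      ≤ C / t ^ 2 * wt (dimN (Fin n × Fin d)) x * wt (dimN (Fin n × Fin d)) (x - y) := by
  obtain ⟨c, hc0, hc⟩ := hsep
  set D := dimN (Fin n × Fin d) with hD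
  set N := collN n d with hN
  obtain ⟨C, hC0, hC⟩ := hφ.isSym.bound (N + D + D)
  obtain ⟨R, hR⟩ := hφ.compact.isCompact.isBounded.exists_norm_le
  have hR' : ∀ x, φ x ≠ 0 → ‖x.1‖ ≤ |R| := fun x hx =>
    (norm_fst_le x).trans ((hR x (subset_tsupport _ hx)).trans (le_abs_self R))
  set B : ℝ := C * (1 + |R|) ^ D / c ^ N
  have hB0 : 0 ≤ B := by positivity
  have main : ∀ t : ℝ, 1 ≤ t → ∀ x y : Config n d, ∀ i j, i ≠ j →
      wt N (particle x i - particle x j) * ‖ker t (osc φ) x y‖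
      ≤ B / t ^ 2 * (wt D x * wt D (x - y)) := by
    intro t ht x y i j hij
    have ht0 : 0 < t := by linarith
    by_cases hk : ker t (osc φ) x y = 0
    · rw [hk, norm_zero, mul_zero]
      have := wt_nonneg D x; have := wt_nonneg D (x - y); positivity
    set p := (2 * t)⁻¹ • (x + y) with hp
    obtain ⟨ξ, hξ⟩ : ∃ ξ, φ (p, ξ) ≠ 0 := by
      by_contra! h
      apply hk
      change osc φ p (x - y) = 0
      simp [osc, invF, h]
    have h1 := hR' _ hξ
    have h2 := hc _ hξ i j hij
    simp only at h1 h2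
    have hxy : x + y = (2 * t) • p := by rw [hp, smul_inv_smul₀ (by positivity)]
    set a := particle x i - particle x j with ha
    -- the distance of the particles is at least of order `t` on the support
    have h3 : t * c ≤ ‖a‖ + ‖x - y‖ := by
      have e : (2 * t) • (particle p i - particle p j)
          = (2 : ℝ) • a - (particle (x - y) i - particle (x - y) j) := by
        rw [smul_sub, ← particle_smul, ← particle_smul, ← hxy, ha]
        simp only [particle_add, particle_sub]
        module
      have h4 : 2 * t * c ≤ ‖(2 * t) • (particle p i - particle p j)‖ := by
        rw [norm_smul, Real.norm_of_nonneg (by positivity)]; gcongr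
      rw [e] at h4
      have h5 := (norm_sub_le ((2 : ℝ) • a) (particle (x - y) i - particle (x - y) j)).trans
        (add_le_add le_rfl (norm_sub_le _ _))
      rw [norm_smul, Real.norm_of_nonneg (by norm_num)] at h5
      linarith [norm_particle_le (x - y) i, norm_particle_le (x - y) j]
    have h4 : ‖x‖ ≤ t * |R| + ‖x - y‖ := by
      have e : (2 : ℝ) • x = (2 * t) • p + (x - y) := by rw [← hxy]; module
      have h5 : ‖(2 : ℝ) • x‖ ≤ ‖(2 * t) • p‖ + ‖x - y‖ := by rw [e]; exact norm_add_le _ _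
      rw [norm_smul, norm_smul, Real.norm_of_nonneg (by norm_num),
        Real.norm_of_nonneg (by positivity)] at h5
      nlinarith [norm_nonneg (x - y)]
    have hw1 : wt N a * wt N (x - y) ≤ (t ^ N * c ^ N)⁻¹ := by
      unfold wt
      rw [← mul_inv, ← mul_pow, ← mul_pow]
      refine inv_anti₀ (by positivity) (pow_le_pow_left₀ (by positivity) ?_ N)
      nlinarith [norm_nonneg a, norm_nonneg (x - y), mul_nonneg (norm_nonneg a) (norm_nonneg (x - y))]
    have hw2 : wt D (x - y) ≤ t ^ D * (1 + |R|) ^ D * wt D x := by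
      unfold wt
      rw [← mul_pow, ← div_eq_mul_inv, le_div_iff₀ (by positivity), inv_mul_le_iff₀ (by positivity),
        ← mul_pow]
      refine pow_le_pow_left₀ (by positivity) ?_ D
      nlinarith [norm_nonneg (x - y), abs_nonneg R, mul_nonneg (norm_nonneg (x - y)) (abs_nonneg R),
        mul_nonneg (norm_nonneg (x - y)) (sub_nonneg.2 ht), mul_nonneg ht0.le
        (mul_nonneg (norm_nonneg (x - y)) (abs_nonneg R))]
    have w0 := wt_nonneg D (x - y)
    have w1 := wt_nonneg N a
    have w2 := wt_nonneg N (x - y)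
    have w3 := wt_nonneg D x
    calc wt N a * ‖ker t (osc φ) x y‖ ≤ wt N a * (C * wt (N + D + D) (x - y)) := by
          gcongr; exact hC _ _
      _ = C * (wt N a * wt N (x - y)) * wt D (x - y) * wt D (x - y) := by
          rw [wt_add (N + D) D, wt_add N D]; ring
      _ ≤ C * (t ^ N * c ^ N)⁻¹ * (t ^ D * (1 + |R|) ^ D * wt D x) * wt D (x - y) := by
          gcongr
      _ = B / t ^ 2 * (wt D x * wt D (x - y)) := by
          have : t ^ N = t ^ D * t ^ 2 := by rw [hN, ← pow_add]
          rw [this]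
          simp only [B]
          field_simp
  refine ⟨(Finset.univ.filter (fun p : Fin n × Fin n => p.1 ≠ p.2)).card * B, by positivity,
    fun t ht x y => ?_⟩
  rw [collWt, Finset.sum_mul]
  refine (Finset.sum_le_card_nsmul _ _ (B / t ^ 2 * (wt D x * wt D (x - y))) fun p hp =>
    main t ht x y p.1 p.2 (Finset.mem_filter.1 hp).2).trans (le_of_eq ?_)
  rw [nsmul_eq_mul]; ring

/-- A bounded function and one concentrated near the collision planes have a matrix element of order
`t⁻²` with a symbol supported away from the collision planes. -/
theorem exists_norm_inner_opH_le {φ : Config n d × Config n d → ℂ} (hφ : IsCc φ)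
    (hsep : ∃ c > 0, ∀ x, φ x ≠ 0 → ∀ i j, i ≠ j → c ≤ ‖particle x.1 i - particle x.1 j‖) :
    ∃ C, 0 ≤ C ∧ ∀ t : ℝ, 1 ≤ t → ∀ (u R : L2 (Fin n × Fin d)) (A A' : ℝ), 0 ≤ A → 0 ≤ A' →
      (∀ᵐ x, ‖u x‖ ≤ A) → (∀ᵐ x, ‖R x‖ ≤ A' * collWt (collN n d) x) →
      ‖inner ℂ R (opH φ hφ t u)‖ ≤ C * A * A' / t ^ 2 := by
  obtain ⟨C, hC0, hC⟩ := exists_collWt_mul_ker_le hφ hsep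
  set D := dimN (Fin n × Fin d) with hD
  set I := wtInt (Fin n × Fin d) with hI
  have hI0 : 0 ≤ I := wtInt_nonneg
  refine ⟨C * I * I, by positivity, fun t ht u R A A' hA hA' hu hR => ?_⟩
  rw [inner_L2_eq]
  refine (norm_integral_le_of_norm_le (g := fun x => C * A * A' * I / t ^ 2 * wt D x)
    (integrable_wt_dimN.const_mul _) ?_).trans (le_of_eq ?_)
  · filter_upwards [hR, coeFn_kopL (hφ.isSym.isKer t) u] with x hx hk
    have hk' : opH φ hφ t u x = kop (ker t (osc φ)) u x := hk
    rw [hk', norm_mul, RCLike.norm_conj, kop]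
    have hw := wt_nonneg D x
    calc ‖R x‖ * ‖∫ y, ker t (osc φ) x y * u y‖
        ≤ (A' * collWt (collN n d) x) * ‖∫ y, ker t (osc φ) x y * u y‖ := by gcongr
      _ = A' * ‖∫ y, (collWt (collN n d) x : ℂ) * (ker t (osc φ) x y * u y)‖ := by
          rw [integral_const_mul, norm_mul, Complex.norm_real,
            Real.norm_of_nonneg (collWt_nonneg _ _), mul_assoc]
      _ ≤ A' * ∫ y, C / t ^ 2 * wt D x * A * wt D (x - y) := by
          gcongr
          refine norm_integral_le_of_norm_le ((integrable_wt_sub x).const_mul _) ?_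
          filter_upwards [hu] with y hy
          rw [norm_mul, norm_mul, Complex.norm_real, Real.norm_of_nonneg (collWt_nonneg _ _),
            ← mul_assoc]
          have := wt_nonneg D (x - y)
          calc _ ≤ (C / t ^ 2 * wt D x * wt D (x - y)) * A :=
                mul_le_mul (hC t ht x y) hy (norm_nonneg _) (by positivity)
            _ = _ := by ring
      _ = _ := by rw [integral_const_mul, integral_wt_sub]; ring
  · rw [integral_const_mul]
    have : ∫ x : Config n d, wt D x = I := rfl
    rw [this]; ring

/-- Positivity, up to integrable errors, of the derivative of the propagation observable along a
solution of `∂ₜ u = -i (w(D) u + R)`, integrated in time. -/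
theorem exists_integral_norm_opH_sq_le {m : ℝ} {H : Config n d × Config n d → Config n d}
    (O : Observable m H) {w : Config n d → ℂ} (hw : IsCc w)
    (hwr : ∀ ξ, (starRingEnd ℂ) (w ξ) = w ξ)
    (hwv : ∀ ξ ∈ tsupport O.χ, ∀ j, fderiv ℝ w ξ (EuclideanSpace.basisFun (Fin n × Fin d) ℝ j)
      = velC n d m j ξ) :
    ∃ c, 0 ≤ c ∧ ∀ (u R : ℝ → L2 (Fin n × Fin d)) (A A' : ℝ),
      (∀ t, 1 ≤ t → HasDerivAt u (-(Complex.I • (opD w hw (u t) + R t))) t) →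
      (∀ t, 1 ≤ t → ‖u t‖ ≤ A) →
      (∀ t, 1 ≤ t → ‖inner ℂ (R t) (opH O.φ O.isCc t (u t))‖ ≤ A' / t ^ 2) →
      ∀ T, 1 ≤ T → ∫ t in (1 : ℝ)..T, (∑ k, ‖opH (O.b k) (O.isCc_b k) t (u t)‖ ^ 2) / t
        ≤ c * A ^ 2 + 2 * A' := by
  classical
  set e := EuclideanSpace.basisFun (Fin n × Fin d) ℝ
  -- the symbol of the commutator
  set g : Config n d × Config n d → ℂ := fun x => ∑ j, fderiv ℝ w x.2 (e j) * fderiv ℝ O.φ x (e j, 0)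
  have hg : IsCc g := by
    refine IsCc.sum Finset.univ fun j => ?_
    exact (O.isCc.fderiv_apply _).mul_left
      (((hw.smooth.fderiv_right (m := ∞) le_rfl).clm_apply contDiff_const).comp contDiff_snd)
  have hgv : ∀ x, g x = fderiv ℝ O.φ x (vel n d m x.2, 0) := by
    intro x
    by_cases hx : x.2 ∈ tsupport O.χ
    · have h1 : ((vel n d m x.2, 0) : Config n d × Config n d)
          = ∑ j, (vel n d m x.2 j) • ((e j, 0) : Config n d × Config n d) := by
        refine Prod.ext ?_ ?_
        · rw [Prod.fst_sum]
          simpa [e] using ((EuclideanSpace.basisFun (Fin n × Fin d) ℝ).sum_repr (vel n d m x.2)).symm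
        · rw [Prod.snd_sum]; simp
      rw [h1, map_sum]
      refine Finset.sum_congr rfl fun j _ => ?_
      rw [map_smul, hwv _ hx, velC, Complex.real_smul]
    · have : fderiv ℝ O.φ x = 0 := by
        rw [(O.support x hx).fderiv_eq]; simp
      simp [g, this]
  have hb2 : ∀ k, IsCc fun x => O.b k x * O.b k x := fun k =>
    (O.isCc_b k).mul_left (O.isCc_b k).smooth
  have hsum : IsCc fun x => ∑ k, O.b k x * O.b k x := IsCc.sum Finset.univ hb2
  have hgs : IsCc fun x => g x - radial O.φ x := hg.sub O.isCc.radial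
  have hgb : ∀ t, opH g hg t - opH _ O.isCc.radial t = ∑ k, opH _ (hb2 k) t := by
    intro t
    rw [← opH_sub hg O.isCc.radial hgs, ← opH_sum hb2 hsum]
    refine opH_congr hgs hsum (fun x => ?_) t
    rw [hgv, radial, O.deriv_flow]
  obtain ⟨C₁, hC₁0, hC₁⟩ := exists_norm_commutator_le hw O.isCc hg fun x => rfl
  have hY := fun k => exists_norm_opH_comp_sub_le (O.isCc_b k) (O.isCc_b k) (hb2 k)
  choose C₂ hC₂0 hC₂ using hY
  obtain ⟨C₃, hC₃0, hC₃⟩ := exists_norm_opS_le O.isCc.isSym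
  set K : ℝ := C₁ + ∑ k, C₂ k
  have hK0 : 0 ≤ K := add_nonneg hC₁0 (Finset.sum_nonneg fun k _ => hC₂0 k)
  refine ⟨2 * C₃ + K, by positivity, fun u R A A' hu hA hR T hT => ?_⟩
  set Φ : ℝ → L2 (Fin n × Fin d) →L[ℂ] L2 (Fin n × Fin d) := fun t => opH O.φ O.isCc t
  set W := opD w hw
  set f : ℝ → ℝ := fun t => (inner ℂ (u t) (Φ t (u t))).re
  set b : ℝ → ℝ := fun t => (∑ k, ‖opH (O.b k) (O.isCc_b k) t (u t)‖ ^ 2) / t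
  have hA0 : 0 ≤ A := (norm_nonneg _).trans (hA 1 le_rfl)
  have hA'0 : 0 ≤ A' := by simpa using (norm_nonneg _).trans (hR 1 le_rfl)
  have huc : ContinuousOn u (Icc 1 T) := fun t ht => (hu t ht.1).continuousAt.continuousWithinAt
  have hbc : ContinuousOn b (Icc 1 T) := by
    refine ContinuousOn.div ?_ continuousOn_id fun t ht => by have := ht.1; positivity
    refine continuousOn_finsetSum _ fun k _ => ContinuousOn.pow (ContinuousOn.norm ?_) 2
    exact ((continuousOn_opH (O.isCc_b k)).mono fun t ht => by
      have := ht.1; simp only [mem_Ici]; linarith).clm_apply huc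
  -- the derivative of the expectation value
  have hder : ∀ t, 1 ≤ t → ∃ f', HasDerivAt f f' t ∧ b t - (K * A ^ 2 + 2 * A') / t ^ 2 ≤ f' := by
    intro t ht
    have ht0 : 0 < t := by linarith
    set v := u t
    set v' := -(Complex.I • (W v + R t))
    have h1 : HasDerivAt (fun s => Φ s (u s))
        ((((-t⁻¹ : ℝ) : ℂ) • opH _ O.isCc.radial t) v + Φ t v') t := by
      have h2 := (ContinuousLinearMap.restrictScalarsL ℂ (L2 (Fin n × Fin d)) (L2 (Fin n × Fin d))
        ℝ ℝ).hasFDerivAt.comp_hasDerivAt t (hasDerivAt_opH O.isCc ht)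
      exact h2.clm_apply (hu t ht)
    have h3 := (hu t ht).inner ℂ h1
    have h4 := Complex.reCLM.hasFDerivAt.comp_hasDerivAt t h3
    refine ⟨_, h4, ?_⟩
    set Z := W ∘L Φ t - Φ t ∘L W + (Complex.I * (t : ℂ)⁻¹) • opH g hg t
    have hZ : ‖inner ℂ v (Z v)‖ ≤ C₁ / t ^ 2 * A ^ 2 := by
      refine (norm_inner_le_norm _ _).trans ?_
      calc ‖v‖ * ‖Z v‖ ≤ ‖v‖ * (‖Z‖ * ‖v‖) := by gcongr; exact Z.le_opNorm v
        _ ≤ A * (C₁ / t ^ 2 * A) := by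
            have := hA t ht
            gcongr
            exact hC₁ t ht0
        _ = _ := by ring
    have hsq : ∀ k, ‖opH (O.b k) (O.isCc_b k) t v‖ ^ 2 - C₂ k / t * A ^ 2
        ≤ (inner ℂ v (opH _ (hb2 k) t v)).re := by
      intro k
      have e1 : inner ℂ v (opH (O.b k) (O.isCc_b k) t (opH (O.b k) (O.isCc_b k) t v))
          = ((‖opH (O.b k) (O.isCc_b k) t v‖ ^ 2 : ℝ) : ℂ) := by
        rw [inner_opH_of_real _ (O.real_b k), inner_self_eq_norm_sq_to_K]; norm_cast
      set Y := opH (O.b k) (O.isCc_b k) t ∘L opH (O.b k) (O.isCc_b k) t - opH _ (hb2 k) t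
      have e2 : opH _ (hb2 k) t v
          = opH (O.b k) (O.isCc_b k) t (opH (O.b k) (O.isCc_b k) t v) - Y v := by
        simp [Y]
      have e3 : ‖inner ℂ v (Y v)‖ ≤ C₂ k / t * A ^ 2 := by
        refine (norm_inner_le_norm _ _).trans ?_
        calc ‖v‖ * ‖Y v‖ ≤ ‖v‖ * (‖Y‖ * ‖v‖) := by gcongr; exact Y.le_opNorm v
          _ ≤ A * (C₂ k / t * A) := by
              have := hA t ht
              have := hC₂0 k
              gcongr
              exact hC₂ k t ht0
          _ = _ := by ring
      rw [e2, inner_sub_right, e1, Complex.sub_re, Complex.ofReal_re]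
      linarith [(Complex.abs_re_le_norm (inner ℂ v (Y v))), le_abs_self (inner ℂ v (Y v)).re]
    set r := inner ℂ (R t) (Φ t v) with hr
    have hr' : inner ℂ v (Φ t (R t)) = (starRingEnd ℂ) r := by
      rw [inner_opH_of_real _ O.real, hr, inner_conj_symm]
    have hre : |r.im| ≤ A' / t ^ 2 := (Complex.abs_im_le_norm r).trans (hR t ht)
    have hW : inner ℂ (W v) (Φ t v) = inner ℂ v (W (Φ t v)) := (inner_opD_of_real hw hwr _ _).symm
    have hcomm : inner ℂ v (W (Φ t v)) - inner ℂ v (Φ t (W v))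
        = inner ℂ v (Z v) - Complex.I * (t : ℂ)⁻¹ * inner ℂ v (opH g hg t v) := by
      simp only [Z, add_apply, sub_apply,
        smul_apply, ContinuousLinearMap.comp_apply, inner_add_right,
        inner_sub_right, inner_smul_right]
      ring
    have hrad : inner ℂ v (opH g hg t v) - inner ℂ v (opH _ O.isCc.radial t v)
        = ∑ k, inner ℂ v (opH _ (hb2 k) t v) := by
      rw [← inner_sub_right, ← sub_apply, hgb]
      simp [inner_sum]
    have htot : inner ℂ v ((((-t⁻¹ : ℝ) : ℂ) • opH _ O.isCc.radial t) v + Φ t v')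
        + inner ℂ v' (Φ t v)
        = ((t⁻¹ : ℝ) : ℂ) * ∑ k, inner ℂ v (opH _ (hb2 k) t v) + Complex.I * inner ℂ v (Z v)
          + Complex.I * (r - (starRingEnd ℂ) r) := by
      simp only [v', smul_apply, inner_add_right, inner_smul_right, map_neg,
        map_smul, map_add, inner_neg_right, inner_neg_left, inner_smul_left, inner_add_left,
        Complex.conj_I]
      rw [hr', hW, ← hr, ← hrad]
      push_cast
      linear_combination Complex.I * hcomm - (t : ℂ)⁻¹ * inner ℂ v (opH g hg t v) * Complex.I_sq
    have h5 : b t - (K * A ^ 2 + 2 * A') / t ^ 2 ≤ (((t⁻¹ : ℝ) : ℂ) * ∑ k, inner ℂ v (opH _ (hb2 k) t v)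
        + Complex.I * inner ℂ v (Z v) + Complex.I * (r - (starRingEnd ℂ) r)).re := by
      have e1 : (((t⁻¹ : ℝ) : ℂ) * ∑ k, inner ℂ v (opH _ (hb2 k) t v)).re
          = t⁻¹ * ∑ k, (inner ℂ v (opH _ (hb2 k) t v)).re := by
        rw [Complex.re_ofReal_mul, Complex.re_sum]
      have e2 : (Complex.I * inner ℂ v (Z v)).re = -(inner ℂ v (Z v)).im := by simp
      have e3 : (Complex.I * (r - (starRingEnd ℂ) r)).re = -(2 * r.im) := by simp; ring
      rw [Complex.add_re, Complex.add_re, e1, e2, e3]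
      have e4 := Finset.sum_le_sum fun k (_ : k ∈ Finset.univ) => hsq k
      rw [Finset.sum_sub_distrib, ← Finset.sum_mul, ← Finset.sum_div] at e4
      have e5 := mul_le_mul_of_nonneg_left e4 (inv_nonneg.2 ht0.le)
      have e6 := (Complex.abs_im_le_norm (inner ℂ v (Z v))).trans hZ
      have e7 : b t = t⁻¹ * ∑ k, ‖opH (O.b k) (O.isCc_b k) t v‖ ^ 2 := by
        simp only [b]; rw [div_eq_inv_mul]
      have e8 : (K * A ^ 2 + 2 * A') / t ^ 2 = C₁ / t ^ 2 * A ^ 2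
          + t⁻¹ * ((∑ k, C₂ k) / t * A ^ 2) + 2 * (A' / t ^ 2) := by
        simp only [K]; field_simp
      rw [e7, e8]
      rw [mul_sub] at e5
      linarith [le_abs_self (inner ℂ v (Z v)).im, le_abs_self r.im]
    rw [← htot] at h5
    exact h5
  choose! f' hf' hbf using hder
  have hfb : ∀ t, 1 ≤ t → |f t| ≤ C₃ * A ^ 2 := by
    intro t ht
    refine (Complex.abs_re_le_norm _).trans ((norm_inner_le_norm _ _).trans ?_)
    have h1 := hA t ht
    calc ‖u t‖ * ‖Φ t (u t)‖ ≤ ‖u t‖ * (‖Φ t‖ * ‖u t‖) := by gcongr; exact (Φ t).le_opNorm _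
      _ ≤ A * (C₃ * A) := by gcongr; exact hC₃ t
      _ = _ := by ring
  have hgc : ContinuousOn (fun t : ℝ => (K * A ^ 2 + 2 * A') / t ^ 2) (Icc 1 T) :=
    ContinuousOn.div continuousOn_const (by fun_prop) fun t ht => by have := ht.1; positivity
  have h1 := intervalIntegral.integral_le_sub_of_hasDeriv_right_of_le hT
    (g := f) (g' := f') (φ := fun t => b t - (K * A ^ 2 + 2 * A') / t ^ 2)
    (fun t ht => (hf' t ht.1).continuousAt.continuousWithinAt)
    (fun t ht => (hf' t ht.1.le).hasDerivWithinAt)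
    ((hbc.sub hgc).integrableOn_Icc) (fun t ht => hbf t ht.1.le)
  have hi1 : IntervalIntegrable b volume 1 T := (hbc.mono (by rw [uIcc_of_le hT])).intervalIntegrable
  have hi2 : IntervalIntegrable (fun t : ℝ => (K * A ^ 2 + 2 * A') / t ^ 2) volume 1 T :=
    (hgc.mono (by rw [uIcc_of_le hT])).intervalIntegrable
  rw [intervalIntegral.integral_sub hi1 hi2] at h1
  have h2 : ∫ t in (1 : ℝ)..T, (K * A ^ 2 + 2 * A') / t ^ 2 ≤ K * A ^ 2 + 2 * A' := by
    have : ∀ t ∈ uIcc (1 : ℝ) T, HasDerivAt (fun t => -((K * A ^ 2 + 2 * A') * t⁻¹))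
        ((K * A ^ 2 + 2 * A') / t ^ 2) t := by
      intro t ht
      rw [uIcc_of_le hT] at ht
      have h0 : t ≠ 0 := by have := ht.1; positivity
      have := ((hasDerivAt_inv h0).const_mul (K * A ^ 2 + 2 * A')).neg
      refine this.congr_deriv ?_
      field_simp
    rw [intervalIntegral.integral_eq_sub_of_hasDerivAt this hi2]
    have : 0 ≤ (K * A ^ 2 + 2 * A') * T⁻¹ := by positivity
    simp only [inv_one, mul_one]
    linarith
  have h3 := abs_le.1 (hfb 1 le_rfl)
  have h4 := abs_le.1 (hfb T hT)
  calc _ ≤ f T - f 1 + (K * A ^ 2 + 2 * A') := by linarith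
    _ ≤ _ := by nlinarith

end Propagation

section Reduction

variable {n d : ℕ}

/-- The data to which the propagation estimate for the symbol `H` is reduced: an observable, a
cutoff `q` in momentum space which is `1` on its support, and a truncation `w` of the dispersion
relation `ω̃` which agrees with `ω̃` on the support of `q`. -/
structure Reduction (m : ℝ) (H : Config n d × Config n d → Config n d) extends Observable m H where
  q : Config n d → ℂ
  w : Config n d → ℂ
  isCc_q : IsCc q
  isCc_w : IsCc w
  w_mul_q : ∀ ξ, w ξ * q ξ = (omegaTilde m ξ : ℂ) * q ξ
  q_eq_one : ∀ x ∈ tsupport H, q x.2 = 1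
  conj_w : ∀ ξ, (starRingEnd ℂ) (w ξ) = w ξ
  deriv_w : ∀ ξ ∈ tsupport χ, ∀ j,
    fderiv ℝ w ξ (EuclideanSpace.basisFun (Fin n × Fin d) ℝ j) = velC n d m j ξ

theorem isCc_ofReal {V : Type*} [NormedAddCommGroup V] [NormedSpace ℝ V] {χ : V → ℝ}
    (hs : ContDiff ℝ ∞ χ) (hc : HasCompactSupport χ) : IsCc fun x => ((χ x : ℝ) : ℂ) :=
  ⟨Complex.ofRealCLM.contDiff.comp hs, hc.comp_left (g := fun x : ℝ => (x : ℂ)) (by simp)⟩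

theorem exists_reduction {m : ℝ} (hm : 0 < m) {H : Config n d × Config n d → Config n d}
    (hH : AdmissibleSymbol m H) : Nonempty (Reduction m H) := by
  obtain ⟨O⟩ := exists_observable hm hH
  obtain ⟨χ₃, h3s, h3c, h31, -, -⟩ :=
    exists_smooth_cutoff O.cutoff_compact.isCompact isOpen_univ (subset_univ _)
  obtain ⟨χ₂, h2s, h2c, h21, -, -⟩ :=
    exists_smooth_cutoff h3c.isCompact isOpen_univ (subset_univ _)
  have hws : ContDiff ℝ ∞ fun ξ => omegaTilde m ξ * χ₂ ξ := (contDiff_omegaTilde hm).mul h2s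
  have hwc : HasCompactSupport fun ξ => omegaTilde m ξ * χ₂ ξ := h2c.mul_left
  have hsub : tsupport O.χ ⊆ tsupport χ₃ := fun ξ hξ => subset_tsupport _ (by
    have := h31.self_of_nhdsSet ξ hξ
    simp [this])
  refine ⟨{
    toObservable := O
    q := fun ξ => ((χ₃ ξ : ℝ) : ℂ)
    w := fun ξ => ((omegaTilde m ξ * χ₂ ξ : ℝ) : ℂ)
    isCc_q := isCc_ofReal h3s h3c
    isCc_w := isCc_ofReal hws hwc
    w_mul_q := fun ξ => ?_
    q_eq_one := fun x hx => ?_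
    conj_w := fun ξ => Complex.conj_ofReal _
    deriv_w := fun ξ hξ j => ?_ }⟩
  · by_cases h : ξ ∈ tsupport χ₃
    · simp [h21.self_of_nhdsSet ξ h]
    · simp [image_eq_zero_of_notMem_tsupport h]
  · have : x.2 ∈ tsupport O.χ := subset_tsupport _ (by simp [O.cutoff_eq_one x hx])
    simp [h31.self_of_nhdsSet _ this]
  · have h1 : (fun ξ => omegaTilde m ξ * χ₂ ξ) =ᶠ[nhds ξ] omegaTilde m := by
      filter_upwards [mem_nhdsSet_iff_forall.1 h21 ξ (hsub hξ)] with η hη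
      have hη : χ₂ η = 1 := hη
      rw [hη, mul_one]
    have h2 : HasFDerivAt (fun ξ => ((omegaTilde m ξ * χ₂ ξ : ℝ) : ℂ))
        (Complex.ofRealCLM.comp (fderiv ℝ (omegaTilde m) ξ)) ξ := by
      refine Complex.ofRealCLM.hasFDerivAt.comp ξ ?_
      exact ((((contDiff_omegaTilde hm).differentiable (by simp)) ξ).hasFDerivAt).congr_of_eventuallyEq
        h1
    rw [h2.fderiv, velC, vel_apply]
    rfl

/-- As `H_k z_k = H_k b_k`, the propagation vector is controlled by the operators with symbols
`b_k`. -/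
theorem Reduction.exists_norm_propagationVector_sq_le {m : ℝ} (hm : 0 < m)
    {H : Config n d × Config n d → Config n d} (hH : AdmissibleSymbol m H) (O : Reduction m H) :
    ∃ C, 0 ≤ C ∧ ∀ t > 0, ∀ (U : Config n d → ℂ) (hU : MemLp U 2 volume),
      ‖propagationVector m H t U‖ ^ 2 ≤ C * ((∑ k, ‖opH (O.b k) (O.isCc_b k) t
        (opD O.q O.isCc_q (hU.toLp U))‖ ^ 2) + ‖hU.toLp U‖ ^ 2 / t ^ 2) := by
  obtain ⟨C₀, hC₀0, hC₀⟩ := exists_norm_propagationVector_sub_le hm hH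
  have hz := isCc_zcomp hm hH
  have hzq : ∀ k, IsCc fun x : Config n d × Config n d => zcomp m H k x * O.q x.2 := fun k =>
    (hz k).mul_right (O.isCc_q.smooth.comp contDiff_snd)
  have hzq' : ∀ k x, zcomp m H k x * O.q x.2 = zcomp m H k x := by
    intro k x
    by_cases hx : x ∈ tsupport H
    · rw [O.q_eq_one x hx, mul_one]
    · have : comp H k x = 0 := by simp [comp, image_eq_zero_of_notMem_tsupport hx]
      simp [zcomp, this]
  have hcb : ∀ k, IsCc fun x => comp H k x * O.b k x := fun k =>
    (isCc_comp hH k).mul_right (O.isCc_b k).smooth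
  have h1 := fun k => exists_norm_opH_comp_opD_sub_le O.isCc_q (hz k) (hzq k)
  have h2 := fun k => exists_norm_opH_comp_sub_le (isCc_comp hH k) (O.isCc_b k) (hcb k)
  have h3 := fun k => exists_norm_opS_le (isCc_comp hH k).isSym
  obtain ⟨D, hD0, hD⟩ := exists_norm_opS_le O.isCc_q.isSym_const
  choose C₁ hC₁0 hC₁ using h1
  choose C₂ hC₂0 hC₂ using h2
  choose C₃ hC₃0 hC₃ using h3
  set S : ℝ := C₀ + ∑ k, (C₁ k + C₂ k * D)
  set M : ℝ := ∑ k, C₃ k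
  have hS0 : 0 ≤ S := add_nonneg hC₀0 (Finset.sum_nonneg fun k _ =>
    add_nonneg (hC₁0 k) (mul_nonneg (hC₂0 k) hD0))
  have hM0 : 0 ≤ M := Finset.sum_nonneg fun k _ => hC₃0 k
  refine ⟨2 * M ^ 2 + 2 * S ^ 2, by positivity, fun t ht U hU => ?_⟩
  set V := hU.toLp U
  set u := opD O.q O.isCc_q V
  have hk : ∀ k, ‖opH _ (hz k) t V‖ ≤ C₃ k * ‖opH (O.b k) (O.isCc_b k) t u‖
      + (C₁ k + C₂ k * D) / t * ‖V‖ := by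
    intro k
    have e1 : ‖opH _ (hz k) t u - opH _ (hz k) t V‖ ≤ C₁ k / t * ‖V‖ := by
      have := hC₁ k t ht
      rw [opH_congr (hzq k) (hz k) (hzq' k)] at this
      exact (ContinuousLinearMap.le_of_opNorm_le _ this V)
    have e2 : ‖opH _ (isCc_comp hH k) t (opH (O.b k) (O.isCc_b k) t u) - opH _ (hz k) t u‖
        ≤ C₂ k / t * ‖u‖ := by
      have := hC₂ k t ht
      rw [opH_congr (hcb k) (hz k) (O.comp_mul k)] at this
      exact (ContinuousLinearMap.le_of_opNorm_le _ this u)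
    have e3 : ‖u‖ ≤ D * ‖V‖ := ContinuousLinearMap.le_of_opNorm_le _ (hD 1) V
    have e4 : ‖opH _ (isCc_comp hH k) t (opH (O.b k) (O.isCc_b k) t u)‖
        ≤ C₃ k * ‖opH (O.b k) (O.isCc_b k) t u‖ :=
      ContinuousLinearMap.le_of_opNorm_le _ (hC₃ k t) _
    have e5 : opH _ (hz k) t V = opH _ (isCc_comp hH k) t (opH (O.b k) (O.isCc_b k) t u)
        - (opH _ (isCc_comp hH k) t (opH (O.b k) (O.isCc_b k) t u) - opH _ (hz k) t u)
        - (opH _ (hz k) t u - opH _ (hz k) t V) := by abel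
    have e6 : C₂ k / t * ‖u‖ ≤ C₂ k / t * (D * ‖V‖) :=
      mul_le_mul_of_nonneg_left e3 (div_nonneg (hC₂0 k) ht.le)
    rw [e5]
    refine (norm_sub_le _ _).trans ((add_le_add (norm_sub_le _ _) le_rfl).trans ?_)
    calc _ ≤ C₃ k * ‖opH (O.b k) (O.isCc_b k) t u‖ + C₂ k / t * (D * ‖V‖) + C₁ k / t * ‖V‖ := by
          linarith
      _ = _ := by ring
  set Q : ℝ := √(∑ k, ‖opH (O.b k) (O.isCc_b k) t u‖ ^ 2)
  have hQ2 : Q ^ 2 = ∑ k, ‖opH (O.b k) (O.isCc_b k) t u‖ ^ 2 := Real.sq_sqrt (by positivity)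
  have hQk : ∀ k, ‖opH (O.b k) (O.isCc_b k) t u‖ ≤ Q := fun k =>
    Real.le_sqrt_of_sq_le (Finset.single_le_sum (f := fun k => ‖opH (O.b k) (O.isCc_b k) t u‖ ^ 2)
      (fun _ _ => by positivity) (Finset.mem_univ k))
  have hp : ‖propagationVector m H t U‖ ≤ M * Q + S / t * ‖V‖ := by
    have e1 := hC₀ t ht U hU
    have e2 : ‖∑ k, opH _ (hz k) t V‖ ≤ ∑ k, (C₃ k * Q + (C₁ k + C₂ k * D) / t * ‖V‖) :=
      norm_sum_le_of_le _ fun k _ => (hk k).trans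
        (add_le_add (mul_le_mul_of_nonneg_left (hQk k) (hC₃0 k)) le_rfl)
    rw [Finset.sum_add_distrib, ← Finset.sum_mul, ← Finset.sum_mul, ← Finset.sum_div] at e2
    have e3 : ‖propagationVector m H t U‖ ≤ ‖propagationVector m H t U - ∑ k, opH _ (hz k) t V‖
        + ‖∑ k, opH _ (hz k) t V‖ := by
      simpa using norm_add_le (propagationVector m H t U - ∑ k, opH _ (hz k) t V)
        (∑ k, opH _ (hz k) t V)
    calc _ ≤ _ := e3.trans (add_le_add e1 e2)
      _ = _ := by simp only [S, M]; ring
  rw [← hQ2]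
  have hV : 0 ≤ S / t * ‖V‖ := by positivity
  have hQ0 : 0 ≤ Q := Real.sqrt_nonneg _
  calc _ ≤ (M * Q + S / t * ‖V‖) ^ 2 := by gcongr
    _ ≤ 2 * (M * Q) ^ 2 + 2 * (S / t * ‖V‖) ^ 2 := by nlinarith [sq_nonneg (M * Q - S / t * ‖V‖)]
    _ = 2 * M ^ 2 * Q ^ 2 + 2 * S ^ 2 * (‖V‖ ^ 2 / t ^ 2) := by ring
    _ ≤ _ := by
        have a1 : 0 ≤ Q ^ 2 := by positivity
        have a2 : 0 ≤ ‖V‖ ^ 2 / t ^ 2 := by positivity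
        have a3 := sq_nonneg M
        have a4 := sq_nonneg S
        nlinarith [mul_nonneg a3 a2, mul_nonneg a4 a1]

theorem continuousOn_propagationVector {m : ℝ} (hm : 0 < m)
    {H : Config n d × Config n d → Config n d} (hH : AdmissibleSymbol m H)
    {U : ℝ → Config n d → ℂ} (hU : ∀ t, MemLp (U t) 2 volume)
    (hc : ContinuousOn (fun t => (hU t).toLp (U t)) (Ici 1)) :
    ContinuousOn (fun t => propagationVector m H t (U t)) (Ici 1) := by
  have hsub : Ici (1 : ℝ) ⊆ Ici (1 / 2) := Ici_subset_Ici.2 (by norm_num)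
  have hop : ∀ {h : Config n d × Config n d → ℂ} (hh : IsCc h),
      ContinuousOn (fun t => opH h hh t ((hU t).toLp (U t))) (Ici 1) := fun hh =>
    ((continuousOn_opH hh).mono hsub).clm_apply hc
  have hinv : ContinuousOn (fun t : ℝ => ((2 * t : ℝ) : ℂ)⁻¹) (Ici 1) := by
    refine ContinuousOn.inv₀ (Continuous.continuousOn (by fun_prop)) fun t ht => ?_
    have ht : 1 ≤ t := ht
    have : 2 * t ≠ 0 := by positivity
    exact_mod_cast this
  have h1 := fun k => hop (isCc_coord_comp hH k)
  have h2 := fun k => hinv.smul (hop (isCc_dcomp hH k))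
  have h3 := fun k => (multL (velC n d m k) n (isBddMeas_velC hm k)).continuous.comp_continuousOn
    (hop (isCc_comp hH k))
  have h4 := continuousOn_finsetSum Finset.univ fun k _ => ((h1 k).add (h2 k)).sub (h3 k)
  refine h4.congr fun t ht => ?_
  rw [propagationVector_eq hH (lt_of_lt_of_le one_pos ht) (hU t)]
  rfl

/-- The propagation estimate for a curve in `L²` whose momentum-localized part solves the free
equation up to a remainder that does not see the observable. -/
theorem Reduction.exists_integral_propagationVector_le {m : ℝ} (hm : 0 < m)
    {H : Config n d × Config n d → Config n d} (hH : AdmissibleSymbol m H) (O : Reduction m H) :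
    ∃ c, 0 ≤ c ∧ ∀ (U : ℝ → Config n d → ℂ) (hU : ∀ t, MemLp (U t) 2 volume)
      (R : ℝ → L2 (Fin n × Fin d)) (A A' : ℝ),
      ContinuousOn (fun t => (hU t).toLp (U t)) (Ici 1) →
      (∀ t, 1 ≤ t → ‖(hU t).toLp (U t)‖ ≤ A) →
      (∀ t, 1 ≤ t → HasDerivAt (fun t => opD O.q O.isCc_q ((hU t).toLp (U t)))
        (-(Complex.I • (opD O.w O.isCc_w (opD O.q O.isCc_q ((hU t).toLp (U t))) + R t))) t) →
      (∀ t, 1 ≤ t → ‖inner ℂ (R t) (opH O.φ O.isCc t (opD O.q O.isCc_q ((hU t).toLp (U t))))‖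
        ≤ A' / t ^ 2) →
      IntegrableOn (fun t => ‖propagationVector m H t (U t)‖ ^ 2 / t) (Ioi 1) ∧
        ∫ t in Ioi (1 : ℝ), ‖propagationVector m H t (U t)‖ ^ 2 / t ≤ c * (A ^ 2 + A') := by
  obtain ⟨C, hC0, hC⟩ := O.exists_norm_propagationVector_sq_le hm hH
  obtain ⟨c, hc0, hc⟩ := exists_integral_norm_opH_sq_le O.toObservable O.isCc_w O.conj_w O.deriv_w
  obtain ⟨D, hD0, hD⟩ := exists_norm_opS_le O.isCc_q.isSym_const
  refine ⟨C * (c * D ^ 2 + 2 + 1), by positivity, fun U hU R A A' hUc hA hder hR => ?_⟩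
  set V : ℝ → L2 (Fin n × Fin d) := fun t => (hU t).toLp (U t)
  set u : ℝ → L2 (Fin n × Fin d) := fun t => opD O.q O.isCc_q (V t)
  have hA0 : 0 ≤ A := (norm_nonneg _).trans (hA 1 le_rfl)
  have hA'0 : 0 ≤ A' := by simpa using (norm_nonneg _).trans (hR 1 le_rfl)
  have hu : ∀ t, 1 ≤ t → ‖u t‖ ≤ D * A := fun t ht =>
    (ContinuousLinearMap.le_of_opNorm_le _ (hD 1) (V t)).trans
      (mul_le_mul_of_nonneg_left (hA t ht) hD0)
  have hest := hc u R (D * A) A' hder hu hR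
  set P : ℝ → ℝ := fun t => ‖propagationVector m H t (U t)‖ ^ 2 / t
  set b : ℝ → ℝ := fun t => (∑ k, ‖opH (O.b k) (O.isCc_b k) t (u t)‖ ^ 2) / t
  have hPc : ContinuousOn P (Ici 1) :=
    ((continuousOn_propagationVector hm hH hU hUc).norm.pow 2).div continuousOn_id fun t ht => by
      have ht : 1 ≤ t := ht
      positivity
  have huc : ContinuousOn u (Ici 1) := (opD O.q O.isCc_q).continuous.comp_continuousOn hUc
  have hbc : ContinuousOn b (Ici 1) := by
    refine ContinuousOn.div ?_ continuousOn_id fun t ht => by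
      have ht : 1 ≤ t := ht
      positivity
    refine continuousOn_finsetSum _ fun k _ => ContinuousOn.pow (ContinuousOn.norm ?_) 2
    exact ((continuousOn_opH (O.isCc_b k)).mono
      (Ici_subset_Ici.2 (by norm_num : (1 / 2 : ℝ) ≤ 1))).clm_apply huc
  have hP0 : ∀ t, 1 ≤ t → 0 ≤ P t := fun t ht => by
    have : 0 ≤ t := by linarith
    positivity
  have hbound : ∀ T, 1 ≤ T → ∫ t in (1 : ℝ)..T, P t ≤ C * (c * D ^ 2 + 2 + 1) * (A ^ 2 + A') := by
    intro T hT
    have hsub : uIcc 1 T ⊆ Ici 1 := by rw [uIcc_of_le hT]; exact fun t ht => ht.1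
    have i1 : IntervalIntegrable P volume 1 T := (hPc.mono hsub).intervalIntegrable
    have i2 : IntervalIntegrable b volume 1 T := (hbc.mono hsub).intervalIntegrable
    have i3 : IntervalIntegrable (fun t : ℝ => A ^ 2 / t ^ 2) volume 1 T := by
      refine (ContinuousOn.div continuousOn_const (by fun_prop) fun t ht => ?_).intervalIntegrable
      have : 1 ≤ t := hsub ht
      positivity
    have h2 : ∫ t in (1 : ℝ)..T, A ^ 2 / t ^ 2 ≤ A ^ 2 := by
      have : ∀ t ∈ uIcc (1 : ℝ) T, HasDerivAt (fun t => -(A ^ 2 * t⁻¹)) (A ^ 2 / t ^ 2) t := by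
        intro t ht
        have ht1 : 1 ≤ t := hsub ht
        have h0 : t ≠ 0 := by positivity
        have := ((hasDerivAt_inv h0).const_mul (A ^ 2)).neg
        refine this.congr_deriv ?_
        field_simp
      rw [intervalIntegral.integral_eq_sub_of_hasDerivAt this i3]
      have : 0 ≤ A ^ 2 * T⁻¹ := by positivity
      simp only [inv_one, mul_one]
      linarith
    have h3 : ∫ t in (1 : ℝ)..T, P t ≤ ∫ t in (1 : ℝ)..T, C * (b t + A ^ 2 / t ^ 2) := by
      refine intervalIntegral.integral_mono_on hT i1 ((i2.add i3).const_mul C) fun t ht => ?_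
      have ht1 : 1 ≤ t := ht.1
      have ht0 : 0 < t := by linarith
      have e1 := hC t ht0 (U t) (hU t)
      have e2 : ‖V t‖ ^ 2 / t ^ 2 / t ≤ A ^ 2 / t ^ 2 := by
        rw [div_le_iff₀ ht0]
        have e3 : ‖V t‖ ^ 2 / t ^ 2 ≤ A ^ 2 / t ^ 2 := by gcongr; exact hA t ht1
        have e4 : 0 ≤ A ^ 2 / t ^ 2 := by positivity
        nlinarith
      calc P t ≤ C * ((∑ k, ‖opH (O.b k) (O.isCc_b k) t (u t)‖ ^ 2) + ‖V t‖ ^ 2 / t ^ 2) / t := by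
            simp only [P]; gcongr
        _ = C * (b t + ‖V t‖ ^ 2 / t ^ 2 / t) := by simp only [b]; ring
        _ ≤ _ := by gcongr
    rw [intervalIntegral.integral_const_mul, intervalIntegral.integral_add i2 i3] at h3
    have h4 := hest T hT
    calc _ ≤ C * ((c * (D * A) ^ 2 + 2 * A') + A ^ 2) := h3.trans (by gcongr)
      _ ≤ _ := by
        rw [mul_assoc]
        refine mul_le_mul_of_nonneg_left ?_ hC0
        have : 0 ≤ c * D ^ 2 * A' := by positivity
        nlinarith [sq_nonneg A]
  have hint : IntegrableOn P (Ioi 1) := by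
    refine integrableOn_Ioi_of_intervalIntegral_norm_bounded
      (C * (c * D ^ 2 + 2 + 1) * (A ^ 2 + A')) 1 (l := atTop) (b := fun T : ℝ => T) (fun T => ?_)
      tendsto_id ?_
    · exact ((hPc.mono fun t ht => ht.1).integrableOn_Icc).mono_set Ioc_subset_Icc_self
    · filter_upwards [eventually_ge_atTop 1] with T hT
      refine (le_of_eq ?_).trans (hbound T hT)
      refine intervalIntegral.integral_congr fun t ht => ?_
      rw [uIcc_of_le hT] at ht
      exact Real.norm_of_nonneg (hP0 t ht.1)
  refine ⟨hint, le_of_tendsto (intervalIntegral_tendsto_integral_Ioi 1 hint tendsto_id) ?_⟩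
  filter_upwards [eventually_ge_atTop 1] with T hT
  exact hbound T hT

end Reduction

/-! ### The free evolution -/

section FreeEvolution

variable {n d : ℕ}

theorem norm_toLp_sq {ι : Type*} [Fintype ι] {f : EuclideanSpace ℝ ι → ℂ} (hf : MemLp f 2 volume) :
    ‖hf.toLp f‖ ^ 2 = ∫ x, ‖f x‖ ^ 2 := by
  have h1 : ((‖hf.toLp f‖ ^ 2 : ℝ) : ℂ) = inner ℂ (hf.toLp f) (hf.toLp f) := by
    rw [inner_self_eq_norm_sq_to_K]; norm_cast
  rw [inner_L2_eq] at h1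
  have h2 : ∫ x, (starRingEnd ℂ) (hf.toLp f x) * hf.toLp f x = ((∫ x, ‖f x‖ ^ 2 : ℝ) : ℂ) := by
    rw [← integral_complex_ofReal]
    refine integral_congr_ae ?_
    filter_upwards [hf.coeFn_toLp] with x hx
    rw [hx, mul_comm, Complex.mul_conj, Complex.normSq_eq_norm_sq]
  rw [h2] at h1
  exact_mod_cast h1

/-- The symbol of the free evolution. -/
def evolC (n d : ℕ) (m t : ℝ) (ξ : Config n d) : ℂ :=
  Complex.exp (-(Complex.I * ((t * omegaTilde m ξ : ℝ) : ℂ)))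

theorem norm_evolC (m t : ℝ) (ξ : Config n d) : ‖evolC n d m t ξ‖ = 1 := by
  have : evolC n d m t ξ = Complex.exp (((-(t * omegaTilde m ξ) : ℝ) : ℂ) * Complex.I) := by
    rw [evolC]; congr 1; push_cast; ring
  rw [this, Complex.norm_exp_ofReal_mul_I]

theorem continuous_evolC {m : ℝ} (hm : 0 < m) :
    Continuous fun p : ℝ × Config n d => evolC n d m p.1 p.2 := by
  have h := (contDiff_omegaTilde (n := n) (d := d) hm).continuous
  unfold evolC
  fun_prop

theorem isBddMeas_evolC {m : ℝ} (hm : 0 < m) (t : ℝ) : IsBddMeas (evolC n d m t) 1 :=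
  ⟨((continuous_evolC hm).comp (Continuous.prodMk_right t)).measurable,
    fun ξ => (norm_evolC m t ξ).le⟩

theorem freeEvolution_eq (m t : ℝ) (u : L2 (Fin n × Fin d)) :
    freeEvolution m t u = multiplier (evolC n d m t) u := rfl

theorem norm_freeEvolution_le {m : ℝ} (hm : 0 < m) (t : ℝ) (u : L2 (Fin n × Fin d)) :
    ‖freeEvolution m t u‖ ≤ ‖u‖ := by
  simpa [freeEvolution_eq] using norm_multiplier_le (isBddMeas_evolC hm t) u

theorem continuous_freeEvolution {m : ℝ} (hm : 0 < m) (u : L2 (Fin n × Fin d)) :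
    Continuous fun t => freeEvolution m t u := by
  rw [continuous_iff_continuousAt]
  intro t
  have hb : ∀ s, IsBddMeas (fun ξ => evolC n d m s ξ - evolC n d m t ξ) 2 := fun s =>
    ⟨(isBddMeas_evolC hm s).meas.sub (isBddMeas_evolC hm t).meas, fun ξ => by
      refine (norm_sub_le _ _).trans ?_
      rw [norm_evolC, norm_evolC]; norm_num⟩
  set û : L2 (Fin n × Fin d) := 𝓕 u
  have hn : ∀ s, ‖freeEvolution m s u - freeEvolution m t u‖ ^ 2
      = ∫ η, ‖(evolC n d m s ((2 * Real.pi) • η) - evolC n d m t ((2 * Real.pi) • η)) * û η‖ ^ 2 := by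
    intro s
    rw [freeEvolution_eq, freeEvolution_eq, ← multiplier_sub_symbol (isBddMeas_evolC hm s)
      (isBddMeas_evolC hm t) (hb s) (fun ξ => rfl), norm_multiplier (hb s), norm_toLp_sq]
  have hcont : Continuous fun s => ∫ η, ‖(evolC n d m s ((2 * Real.pi) • η)
      - evolC n d m t ((2 * Real.pi) • η)) * û η‖ ^ 2 := by
    refine continuous_of_dominated (bound := fun η => 4 * ‖û η‖ ^ 2) (fun s => ?_) (fun s => ?_) ?_ ?_
    · exact (((hb s).memLp (Lp.memLp û)).1.norm.pow 2)
    · refine Eventually.of_forall fun η => ?_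
      rw [Real.norm_of_nonneg (by positivity), norm_mul, mul_pow]
      gcongr
      calc _ ≤ (2 : ℝ) ^ 2 := by gcongr; exact (hb s).bound _
        _ = 4 := by norm_num
    · exact ((Lp.memLp û).integrable_norm_pow (by norm_num)).const_mul 4
    · refine Eventually.of_forall fun η => ?_
      have : Continuous fun s => evolC n d m s ((2 * Real.pi) • η) :=
        (continuous_evolC hm).comp (Continuous.prodMk_left _)
      fun_prop
  rw [ContinuousAt, tendsto_iff_norm_sub_tendsto_zero]
  have h0 := (hcont.tendsto t).sqrt
  simp only [sub_self, zero_mul, norm_zero] at h0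
  have h00 : √(∫ _η : Config n d, (0 : ℝ) ^ 2) = 0 := by simp
  rw [h00] at h0
  refine h0.congr fun s => ?_
  rw [← hn, Real.sqrt_sq (norm_nonneg _)]

theorem multiplier_const_mul {ι : Type*} [Fintype ι] {g : EuclideanSpace ℝ ι → ℂ} {M : ℝ}
    (hg : IsBddMeas g M) (c : ℂ) {M' : ℝ} (hcg : IsBddMeas (fun ξ => c * g ξ) M') (u : L2 ι) :
    multiplier (fun ξ => c * g ξ) u = c • multiplier g u := by
  rw [← multiplier_smul hg]
  apply L2_eq_of_fourier_eq
  rw [fourier_multiplier hcg, fourier_multiplier hg]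
  refine MemLp.toLp_congr _ _ ?_
  rw [FourierSMul.fourier_smul]
  filter_upwards [Lp.coeFn_smul c (𝓕 u : L2 ι)] with η h
  rw [h]
  simp only [Pi.smul_apply, smul_eq_mul]
  ring

/-- For `q ∈ C_c^∞`, the curve `q(D) exp(-i t ω̃(D)) u` is differentiable in `L²`. -/
theorem hasDerivAt_opD_freeEvolution {m : ℝ} (hm : 0 < m) {q w : Config n d → ℂ} (hq : IsCc q)
    (hw : IsCc w) (hwq : ∀ ξ, w ξ * q ξ = (omegaTilde m ξ : ℂ) * q ξ) (u : L2 (Fin n × Fin d))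
    (t : ℝ) : HasDerivAt (fun t => opD q hq (freeEvolution m t u))
      (-(Complex.I • opD w hw (opD q hq (freeEvolution m t u)))) t := by
  obtain ⟨M, hM⟩ := hq.exists_isBddMeas
  obtain ⟨M', hM'⟩ := hw.exists_isBddMeas
  have hM0 : 0 ≤ M := (norm_nonneg _).trans (hM.bound 0)
  have hM'0 : 0 ≤ M' := (norm_nonneg _).trans (hM'.bound 0)
  have h1 : ∀ s, IsBddMeas (fun ξ => q ξ * evolC n d m s ξ) M := fun s =>
    ⟨hM.meas.mul (isBddMeas_evolC hm s).meas, fun ξ => by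
      rw [norm_mul, norm_evolC, mul_one]; exact hM.bound ξ⟩
  have h2 : IsBddMeas (fun ξ => w ξ * (q ξ * evolC n d m t ξ)) (M' * M) :=
    ⟨hM'.meas.mul (h1 t).meas, fun ξ => by
      rw [norm_mul]; exact mul_le_mul (hM'.bound ξ) ((h1 t).bound ξ) (norm_nonneg _) hM'0⟩
  have e1 : ∀ s, opD q hq (freeEvolution m s u) = multiplier (fun ξ => q ξ * evolC n d m s ξ) u :=
    fun s => by
      rw [opD_apply_eq_multiplier]
      exact multiplier_multiplier hM (isBddMeas_evolC hm s) (h1 s) (fun ξ => rfl) u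
  have e2 : opD w hw (opD q hq (freeEvolution m t u))
      = multiplier (fun ξ => w ξ * (q ξ * evolC n d m t ξ)) u := by
    rw [opD_apply_eq_multiplier, e1]
    exact multiplier_multiplier hM' (h1 t) h2 (fun ξ => rfl) u
  -- second order remainder of the symbol
  have key : ∀ s, |s - t| * M' ≤ 1 → ∀ ξ, ‖q ξ * evolC n d m s ξ - q ξ * evolC n d m t ξ
      - -(Complex.I * ((s - t : ℝ) : ℂ)) * (w ξ * (q ξ * evolC n d m t ξ))‖
      ≤ M * M' ^ 2 * |s - t| ^ 2 := by
    intro s hs ξ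
    by_cases hqξ : q ξ = 0
    · simp only [hqξ, zero_mul, mul_zero, sub_zero, norm_zero]; positivity
    have hwξ : w ξ = (omegaTilde m ξ : ℂ) := mul_right_cancel₀ hqξ (hwq ξ)
    set z : ℂ := -(Complex.I * ((s - t : ℝ) : ℂ)) * w ξ
    have hz : ‖z‖ ≤ |s - t| * M' := by
      simp only [z]
      rw [norm_mul, norm_neg, norm_mul, Complex.norm_I, one_mul, Complex.norm_real,
        Real.norm_eq_abs]
      gcongr; exact hM'.bound ξ
    have hev : evolC n d m s ξ = evolC n d m t ξ * Complex.exp z := by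
      rw [evolC, evolC, ← Complex.exp_add]
      congr 1
      simp only [z, hwξ]
      push_cast; ring
    have : q ξ * evolC n d m s ξ - q ξ * evolC n d m t ξ
        - -(Complex.I * ((s - t : ℝ) : ℂ)) * (w ξ * (q ξ * evolC n d m t ξ))
        = q ξ * evolC n d m t ξ * (Complex.exp z - 1 - z) := by
      rw [hev]; simp only [z]; ring
    rw [this, norm_mul]
    calc _ ≤ M * ‖z‖ ^ 2 := mul_le_mul ((h1 t).bound ξ)
          (Complex.norm_exp_sub_one_sub_id_le (hz.trans hs)) (norm_nonneg _) hM0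
      _ ≤ M * (|s - t| * M') ^ 2 := by gcongr
      _ = _ := by ring
  have hrem : ∀ s, |s - t| * M' ≤ 1 → ‖opD q hq (freeEvolution m s u)
      - opD q hq (freeEvolution m t u)
      - (s - t) • -(Complex.I • opD w hw (opD q hq (freeEvolution m t u)))‖
      ≤ M * M' ^ 2 * ‖u‖ * |s - t| ^ 2 := by
    intro s hs
    have h3 : IsBddMeas (fun ξ => q ξ * evolC n d m s ξ - q ξ * evolC n d m t ξ) (M + M) :=
      ⟨(h1 s).meas.sub (h1 t).meas, fun ξ => (norm_sub_le _ _).trans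
        (add_le_add ((h1 s).bound ξ) ((h1 t).bound ξ))⟩
    set c : ℂ := -(Complex.I * ((s - t : ℝ) : ℂ))
    have h4 : IsBddMeas (fun ξ => c * (w ξ * (q ξ * evolC n d m t ξ))) (‖c‖ * (M' * M)) :=
      ⟨h2.meas.const_mul c, fun ξ => by rw [norm_mul]; gcongr; exact h2.bound ξ⟩
    have h5 : IsBddMeas (fun ξ => q ξ * evolC n d m s ξ - q ξ * evolC n d m t ξ
      - c * (w ξ * (q ξ * evolC n d m t ξ))) (M * M' ^ 2 * |s - t| ^ 2) :=
      ⟨h3.meas.sub h4.meas, key s hs⟩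
    have e3 : (s - t) • -(Complex.I • opD w hw (opD q hq (freeEvolution m t u)))
        = multiplier (fun ξ => c * (w ξ * (q ξ * evolC n d m t ξ))) u := by
      have hs : ∀ v : L2 (Fin n × Fin d), (s - t) • v = ((s - t : ℝ) : ℂ) • v := fun v =>
        (Complex.coe_smul (s - t) v).symm
      rw [multiplier_const_mul h2 c h4, ← e2, hs, smul_neg, smul_smul,
        ← neg_smul]
      congr 1
      simp only [c]; ring
    rw [e3, e1, e1, ← multiplier_sub_symbol (h1 s) (h1 t) h3 (fun ξ => rfl),
      ← multiplier_sub_symbol h3 h4 h5 (fun ξ => rfl)]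
    refine (norm_multiplier_le h5 u).trans (le_of_eq (by ring))
  rw [hasDerivAt_iff_isLittleO]
  refine Asymptotics.IsBigO.trans_isLittleO (g := fun s : ℝ => |s - t| ^ 2) ?_ ?_
  · refine Asymptotics.IsBigO.of_bound (M * M' ^ 2 * ‖u‖) ?_
    have hc : Continuous fun s : ℝ => |s - t| * M' := by fun_prop
    have h0 := (hc.tendsto t).eventually_lt_const (u := 1) (by simp)
    filter_upwards [h0] with s hs
    refine (hrem s hs.le).trans (le_of_eq ?_)
    rw [Real.norm_of_nonneg (by positivity)]
  · exact isLittleO_abs_sub_sq t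

/-- The propagation estimate for the free evolution. -/
theorem propagation_freeEvolution {m : ℝ} (hm : 0 < m)
    {H : Config n d × Config n d → Config n d} (hH : AdmissibleSymbol m H) :
    ∃ c : ℝ, ∀ u : L2 (Fin n × Fin d),
      IntegrableOn (fun t : ℝ => ‖propagationVector m H t (freeEvolution m t u)‖ ^ 2 / t) (Ioi 1) ∧
      ∫ t in Ioi (1 : ℝ), ‖propagationVector m H t (freeEvolution m t u)‖ ^ 2 / t
        ≤ c * ‖u‖ ^ 2 := by
  obtain ⟨O⟩ := exists_reduction hm hH
  obtain ⟨c, hc0, hc⟩ := O.exists_integral_propagationVector_le hm hH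
  refine ⟨c, fun u => ?_⟩
  have e : ∀ t, (Lp.memLp (freeEvolution m t u)).toLp _ = freeEvolution m t u := fun t =>
    Lp.toLp_coeFn _ _
  have := hc (fun t => freeEvolution m t u) (fun t => Lp.memLp _) (fun _ => 0) ‖u‖ 0 ?_ ?_ ?_ ?_
  · simpa using this
  · simp only [e]
    exact (continuous_freeEvolution hm u).continuousOn
  · intro t _
    rw [e]
    exact norm_freeEvolution_le hm t u
  · intro t _
    simp only [e, add_zero]
    exact hasDerivAt_opD_freeEvolution hm O.isCc_q O.isCc_w O.w_mul_q u t
  · intro t _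
    simp

end FreeEvolution

/-! ### The propagation estimate for solutions with interaction -/

section Interacting

variable {n d : ℕ}

/-- The configuration with the `i`-th particle at `r` and the others at the origin. -/
def single (i : Fin n) : EuclideanSpace ℝ (Fin d) →L[ℝ] Config n d :=
  LinearMap.toContinuousLinearMap
    { toFun := fun r => WithLp.toLp 2 fun k => if k.1 = i then r k.2 else 0
      map_add' := fun x y => by ext k; by_cases h : k.1 = i <;> simp [h]
      map_smul' := fun c x => by ext k; by_cases h : k.1 = i <;> simp [h] }

theorem single_apply (i : Fin n) (r : EuclideanSpace ℝ (Fin d)) (k : Fin n × Fin d) :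
    single i r k = if k.1 = i then r k.2 else 0 := rfl

theorem particle_single (i j : Fin n) (r : EuclideanSpace ℝ (Fin d)) :
    particle (single i r) j = if j = i then r else 0 := by
  ext k
  by_cases h : j = i <;> simp [particle, single_apply, h]

theorem inner_single (i : Fin n) (r : EuclideanSpace ℝ (Fin d)) (ξ : Config n d) :
    inner ℝ (single i r) ξ = inner ℝ r (particle ξ i) := by
  simp only [PiLp.inner_apply, Fintype.sum_prod_type]
  rw [Finset.sum_eq_single i]
  · simp [single_apply, particle_apply]
  · intro j _ hj; simp [single_apply, hj]
  · simp

/-- A one-particle convolution acts on an inverse Fourier transform by multiplying the symbol. -/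
theorem integral_invF_mul_invF_sub_single {σ q} (hσ : IsCc (σ : EuclideanSpace ℝ (Fin d) → ℂ))
    (hq : IsCc (q : Config n d → ℂ)) (i : Fin n) (z : Config n d) :
    ∫ r, invF σ r * invF q (z - single i r) = invF (fun ξ => σ (particle ξ i) * q ξ) z := by
  have hσi : Integrable (invF σ) := integrable_invF hσ.smooth hσ.compact
  have hqi : Integrable q := hq.integrable
  have e : ∀ r, invF σ r * invF q (z - single i r) = (fc (Fin n × Fin d) : ℂ) * ∫ ξ,
      (invF σ r * Complex.exp (-(Complex.I * ((inner ℝ r (particle ξ i) : ℝ) : ℂ))))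
        * (Complex.exp (Complex.I * ((inner ℝ z ξ : ℝ) : ℂ)) * q ξ) := by
    intro r
    rw [invF.eq_def q, smul_eq_mul, mul_left_comm, ← integral_const_mul]
    congr 2; funext ξ
    rw [inner_sub_left, inner_single, smul_eq_mul]
    have : Complex.exp (Complex.I * ((inner ℝ z ξ - inner ℝ r (particle ξ i) : ℝ) : ℂ))
        = Complex.exp (-(Complex.I * ((inner ℝ r (particle ξ i) : ℝ) : ℂ)))
          * Complex.exp (Complex.I * ((inner ℝ z ξ : ℝ) : ℂ)) := by
      rw [← Complex.exp_add]; push_cast; ring_nf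
    rw [this]; ring
  simp_rw [e]
  rw [integral_const_mul, integral_integral_swap]
  · rw [invF, smul_eq_mul]
    congr 2; funext ξ
    rw [integral_mul_const]
    have := integral_exp_smul_invF hσ.smooth hσ.compact (particle ξ i)
    simp only [smul_eq_mul, mul_comm _ (invF σ _)] at this
    rw [this, smul_eq_mul]; ring
  · have h1 : Integrable (fun p : EuclideanSpace ℝ (Fin d) × Config n d => invF σ p.1 * q p.2) :=
      hσi.mul_prod hqi
    have hp := continuous_particle (d := d) i
    refine (h1.bdd_mul (c := 1) (f := fun p : EuclideanSpace ℝ (Fin d) × Config n d =>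
      Complex.exp (-(Complex.I * ((inner ℝ p.1 (particle p.2 i) : ℝ) : ℂ)))
        * Complex.exp (Complex.I * ((inner ℝ z p.2 : ℝ) : ℂ)))
      (Continuous.aestronglyMeasurable (by fun_prop)) (Eventually.of_forall fun p => ?_)).congr
      (Eventually.of_forall fun p => ?_)
    · rw [norm_mul, norm_exp_I_mul_ofReal, mul_one,
        show -(Complex.I * ((inner ℝ p.1 (particle p.2 i) : ℝ) : ℂ))
          = Complex.I * ((-(inner ℝ p.1 (particle p.2 i)) : ℝ) : ℂ) by push_cast; ring,
        norm_exp_I_mul_ofReal]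
    · simp only [Function.uncurry]; ring

/-- Convolution in the variables of the `i`-th particle. -/
def pconv (σ : EuclideanSpace ℝ (Fin d) → ℂ) (i : Fin n) (u : Config n d → ℂ) (x : Config n d) : ℂ :=
  ∫ r, invF σ r * u (x - single i r)

theorem isCc_single_mul {σ q} (hσ : IsCc (σ : EuclideanSpace ℝ (Fin d) → ℂ))
    (hq : IsCc (q : Config n d → ℂ)) (i : Fin n) : IsCc fun ξ => σ (particle ξ i) * q ξ :=
  hq.mul_left (hσ.smooth.comp (contDiff_particle i))

theorem kop_pconv {σ q} (hσ : IsCc (σ : EuclideanSpace ℝ (Fin d) → ℂ))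
    (hq : IsCc (q : Config n d → ℂ)) (i : Fin n) {u : Config n d → ℂ} (hu : Continuous u) {A : ℝ}
    (hA : ∀ x, ‖u x‖ ≤ A) :
    kop (ker 1 fun _ => invF q) (pconv σ i u)
      = kop (ker 1 fun _ => invF fun ξ => σ (particle ξ i) * q ξ) u := by
  funext x
  have hσi : Integrable (invF σ) := integrable_invF hσ.smooth hσ.compact
  have hqi : Integrable (invF q) := integrable_invF hq.smooth hq.compact
  have hqc : Continuous (invF q) := continuous_invF hq.integrable
  have hσc : Continuous (invF σ) := continuous_invF hσ.integrable
  have hA0 : 0 ≤ A := (norm_nonneg _).trans (hA 0)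
  have hqx : Integrable fun y => invF q (x - y) := hqi.comp_sub_left x
  simp only [kop, ker, pconv]
  calc ∫ y, invF q (x - y) * ∫ r, invF σ r * u (y - single i r)
      = ∫ y, ∫ r, invF q (x - y) * (invF σ r * u (y - single i r)) := by
        simp_rw [integral_const_mul]
    _ = ∫ r, ∫ y, invF q (x - y) * (invF σ r * u (y - single i r)) := by
        rw [integral_integral_swap]
        have h1 : Integrable (fun p : Config n d × EuclideanSpace ℝ (Fin d) =>
          invF q (x - p.1) * invF σ p.2) := hqx.mul_prod hσi
        refine (h1.bdd_mul (c := A) (f := fun p : Config n d × EuclideanSpace ℝ (Fin d) =>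
          u (p.1 - single i p.2)) (Continuous.aestronglyMeasurable (by fun_prop))
          (Eventually.of_forall fun p => hA _)).congr (Eventually.of_forall fun p => ?_)
        simp only [Function.uncurry]; ring
    _ = ∫ r, ∫ y, invF σ r * invF q (x - y - single i r) * u y := by
        congr 1; funext r
        rw [← integral_add_right_eq_self _ (single i r)]
        congr 1; funext y
        rw [add_sub_cancel_right, sub_sub]; ring
    _ = ∫ y, ∫ r, invF σ r * invF q (x - y - single i r) * u y := by
        rw [integral_integral_swap]
        have h1 : Integrable (fun p : EuclideanSpace ℝ (Fin d) × Config n d =>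
            invF σ p.1 * invF q (x - p.2 - single i p.1)) := by
          refine (integrable_prod_iff (Continuous.aestronglyMeasurable (by fun_prop))).2
            ⟨Eventually.of_forall fun r => ?_, ?_⟩
          · have h2 := (hqi.comp_sub_left (x - single i r)).const_mul (invF σ r)
            refine h2.congr (Eventually.of_forall fun y => ?_)
            simp only [sub_right_comm]
          · have : (fun r => ∫ y, ‖invF σ r * invF q (x - y - single i r)‖)
                = fun r => ‖invF σ r‖ * ∫ y, ‖invF q y‖ := by
              funext r
              simp_rw [norm_mul]
              rw [integral_const_mul, ← integral_sub_left_eq_self (fun y => ‖invF q y‖) volume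
                (x - single i r)]
              congr 2; funext y
              rw [sub_right_comm]
            rw [this]
            exact hσi.norm.mul_const _
        exact h1.mul_bdd (c := A) (f := fun p : EuclideanSpace ℝ (Fin d) × Config n d => _)
          (g := fun p : EuclideanSpace ℝ (Fin d) × Config n d => u p.2)
          (Continuous.aestronglyMeasurable (by fun_prop)) (Eventually.of_forall fun p => hA _)
    _ = _ := by
        congr 1; funext y
        rw [integral_mul_const, integral_invF_mul_invF_sub_single hσ hq]

theorem wt_add_self_le_wt_particle_sub (N : ℕ) (z : Config n d) (i j : Fin n) :
    wt (N + N) z ≤ wt N (particle z i - particle z j) := by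
  unfold wt
  rw [← two_mul, pow_mul]
  refine inv_anti₀ (by positivity) (pow_le_pow_left₀ (by positivity) ?_ N)
  have := norm_sub_le (particle z i) (particle z j)
  nlinarith [norm_particle_le z i, norm_particle_le z j, norm_nonneg z]

theorem wt_mul_collWt_le (N : ℕ) (x y : Config n d) :
    wt (N + N) (x - y) * collWt N y ≤ collWt N x := by
  rw [collWt, collWt, Finset.mul_sum]
  refine Finset.sum_le_sum fun p _ => ?_
  refine (mul_le_mul_of_nonneg_right (wt_add_self_le_wt_particle_sub N (x - y) p.1 p.2)
    (wt_nonneg _ _)).trans ((wt_mul_wt_le N _ _).trans (le_of_eq ?_))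
  congr 1
  rw [particle_sub, particle_sub]; abel

/-- The estimate for a solution of `i ∂ₜ F = σ(D₁) F + ⋯ + σ(Dₙ) F + R`, with a remainder `R` that
is small unless two particles are close, where `σ` is the dispersion relation truncated outside of a
large ball. -/
theorem propagation_of_equation {m : ℝ} (hm : 0 < m) {H : Config n d × Config n d → Config n d}
    (hH : AdmissibleSymbol m H) : ∃ ρ : ℝ, ∀ σ : EuclideanSpace ℝ (Fin d) → ℂ, IsCc σ →
      (∀ p, ‖p‖ ≤ ρ → σ p = ((√(‖p‖ ^ 2 + m ^ 2) : ℝ) : ℂ)) →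
      ∀ (F F' R : ℝ → Config n d → ℂ) (hF : ∀ t, MemLp (F t) 2 volume)
        (hF' : ∀ t, MemLp (F' t) 2 volume) (A A₁ A₂ : ℝ),
      (∀ t, MemLp (R t) 2 volume) →
      (∀ t, HasDerivAt (fun t => (hF t).toLp (F t)) ((hF' t).toLp (F' t)) t) →
      (∀ t, ‖(hF t).toLp (F t)‖ ≤ A) → (∀ t, Continuous (F t)) → (∀ t x, ‖F t x‖ ≤ A₁) →
      (∀ t, Continuous (R t)) → (∀ t x, ‖R t x‖ ≤ A₂ * collWt (collN n d) x) →
      (∀ t x, Complex.I * F' t x = (∑ i, pconv σ i (F t) x) + R t x) →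
      IntegrableOn (fun t => ‖propagationVector m H t (F t)‖ ^ 2 / t) (Ioi 1) := by
  obtain ⟨O⟩ := exists_reduction hm hH
  obtain ⟨ρ, hρ⟩ := O.isCc_q.compact.isCompact.isBounded.exists_norm_le
  refine ⟨ρ, fun σ hσ hσρ F F' R hF hF' A A₁ A₂ hR hder hA hFc hA₁ hRc hA₂ heq => ?_⟩
  obtain ⟨c, hc0, hc⟩ := O.exists_integral_propagationVector_le hm hH
  set N := collN n d
  obtain ⟨B, hB0, hB⟩ := exists_norm_invF_le_wt O.isCc_q.smooth O.isCc_q.compact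
    (N + N + dimN (Fin n × Fin d))
  obtain ⟨C, hC0, hC⟩ := exists_norm_inner_opH_le O.isCc O.sep
  have hA₁0 : 0 ≤ A₁ := (norm_nonneg _).trans (hA₁ 0 0)
  set A₂' := max A₂ 0
  have hA₂0 : 0 ≤ A₂' := le_max_right _ _
  have hA₂' : ∀ t x, ‖R t x‖ ≤ A₂' * collWt N x := fun t x => (hA₂ t x).trans
    (mul_le_mul_of_nonneg_right (le_max_left _ _) (collWt_nonneg _ _))
  set I := wtInt (Fin n × Fin d)
  have hI0 : 0 ≤ I := wtInt_nonneg
  have hKq : IsKer (ker 1 fun _ : Config n d => invF O.q) := O.isCc_q.isSym_const.isKer 1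
  have hopD : ∀ {g : Config n d → ℂ} (hg : MemLp g 2 volume), opD O.q O.isCc_q (hg.toLp g)
      = (memLp_kop hKq hg).toLp _ := fun hg => kopL_toLp hKq hg
  have hB1 : ∀ z : Config n d, ‖invF O.q z‖ ≤ B * wt (dimN (Fin n × Fin d)) z := fun z =>
    (hB z).trans (mul_le_mul_of_nonneg_left (wt_antitone (Nat.le_add_left _ _) z) hB0)
  -- bounds on the localized functions
  have hbF : ∀ t, ∀ᵐ x, ‖opD O.q O.isCc_q ((hF t).toLp (F t)) x‖ ≤ B * I * A₁ := by
    intro t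
    rw [hopD (hF t)]
    filter_upwards [(memLp_kop hKq (hF t)).coeFn_toLp] with x hx
    rw [hx]
    refine (norm_integral_le_of_norm_le (g := fun y => B * A₁ * wt (dimN (Fin n × Fin d)) (x - y))
      ((integrable_wt_sub x).const_mul _) (Eventually.of_forall fun y => ?_)).trans (le_of_eq ?_)
    · rw [norm_mul]
      have := wt_nonneg (dimN (Fin n × Fin d)) (x - y)
      calc _ ≤ B * wt (dimN (Fin n × Fin d)) (x - y) * A₁ :=
            mul_le_mul (hB1 _) (hA₁ _ _) (norm_nonneg _) (by positivity)
        _ = _ := by ring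
    · rw [integral_const_mul, integral_wt_sub]; ring
  have hbR : ∀ t, ∀ᵐ x, ‖opD O.q O.isCc_q ((hR t).toLp (R t)) x‖ ≤ B * I * A₂' * collWt N x := by
    intro t
    rw [hopD (hR t)]
    filter_upwards [(memLp_kop hKq (hR t)).coeFn_toLp] with x hx
    rw [hx]
    refine (norm_integral_le_of_norm_le
      (g := fun y => B * A₂' * collWt N x * wt (dimN (Fin n × Fin d)) (x - y))
      ((integrable_wt_sub x).const_mul _) (Eventually.of_forall fun y => ?_)).trans (le_of_eq ?_)
    · rw [norm_mul]
      have h1 := wt_nonneg (dimN (Fin n × Fin d)) (x - y)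
      have h2 := wt_nonneg (N + N) (x - y)
      calc _ ≤ B * wt (N + N + dimN (Fin n × Fin d)) (x - y) * (A₂' * collWt N y) :=
            mul_le_mul (hB _) (hA₂' _ _) (norm_nonneg _)
              (mul_nonneg hB0 (wt_nonneg _ _))
        _ = B * A₂' * (wt (N + N) (x - y) * collWt N y) * wt (dimN (Fin n × Fin d)) (x - y) := by
            rw [wt_add (N + N)]; ring
        _ ≤ _ := by
            gcongr
            exact wt_mul_collWt_le N x y
    · rw [integral_const_mul, integral_wt_sub]; ring
  -- the equation for the localized function
  have hwq : IsCc fun ξ => O.w ξ * O.q ξ := O.isCc_q.mul_left O.isCc_w.smooth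
  have hKwq := hwq.isSym_const.isKer 1
  have hsum : ∀ ξ, O.w ξ * O.q ξ = ∑ i, σ (particle ξ i) * O.q ξ := by
    intro ξ
    by_cases h : ξ ∈ tsupport O.q
    · rw [O.w_mul_q, ← Finset.sum_mul, omegaTilde, Complex.ofReal_sum]
      congr 1
      exact Finset.sum_congr rfl fun i _ => (hσρ _ ((norm_particle_le ξ i).trans (hρ ξ h))).symm
    · simp [image_eq_zero_of_notMem_tsupport h]
  have hG : ∀ t, MemLp (fun x => ∑ i, pconv σ i (F t) x) 2 volume := by
    intro t
    refine (((hF' t).const_mul Complex.I).sub (hR t)).ae_eq (Eventually.of_forall fun x => ?_)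
    simp only [Pi.sub_apply]
    rw [heq, add_sub_cancel_right]
  have hGeq : ∀ t, opD O.q O.isCc_q ((hG t).toLp _)
      = opD O.w O.isCc_w (opD O.q O.isCc_q ((hF t).toLp (F t))) := by
    intro t
    obtain ⟨M, hM⟩ := O.isCc_q.exists_isBddMeas
    obtain ⟨M', hM'⟩ := O.isCc_w.exists_isBddMeas
    obtain ⟨M'', hM''⟩ := hwq.exists_isBddMeas
    rw [opD_apply_eq_multiplier O.isCc_w, opD_apply_eq_multiplier O.isCc_q ((hF t).toLp (F t)),
      multiplier_multiplier hM' hM hM'' (fun ξ => rfl), ← opD_apply_eq_multiplier hwq]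
    rw [hopD (hG t), show opD _ hwq ((hF t).toLp (F t)) = (memLp_kop hKwq (hF t)).toLp _ from
      kopL_toLp hKwq (hF t)]
    refine MemLp.toLp_congr _ _ (Eventually.of_forall fun x => ?_)
    have hpb : ∀ i x, ‖pconv σ i (F t) x‖ ≤ (∫ r, ‖invF σ r‖) * A₁ := by
      intro i x
      rw [← integral_mul_const]
      refine norm_integral_le_of_norm_le ((integrable_invF hσ.smooth hσ.compact).norm.mul_const _)
        (Eventually.of_forall fun r => ?_)
      rw [norm_mul]; gcongr; exact hA₁ _ _
    have hpc : ∀ i, Continuous (pconv σ i (F t)) := by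
      intro i
      unfold pconv
      have hσc : Continuous (invF σ) := continuous_invF hσ.integrable
      have hFt := hFc t
      refine continuous_of_dominated (bound := fun r => ‖invF σ r‖ * A₁) (fun x =>
        Continuous.aestronglyMeasurable (by fun_prop)) (fun x => Eventually.of_forall fun r => ?_)
        ((integrable_invF hσ.smooth hσ.compact).norm.mul_const _)
        (Eventually.of_forall fun r => by fun_prop)
      rw [norm_mul]; gcongr; exact hA₁ _ _
    have hqx : Integrable fun y => invF O.q (x - y) :=
      (integrable_invF O.isCc_q.smooth O.isCc_q.compact).comp_sub_left x
    calc kop (ker 1 fun _ => invF O.q) (fun x => ∑ i, pconv σ i (F t) x) x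
        = ∑ i, kop (ker 1 fun _ => invF O.q) (pconv σ i (F t)) x := by
          simp only [kop, ker, Finset.mul_sum]
          rw [integral_finsetSum _ fun i _ => ?_]
          exact hqx.mul_bdd (hpc i).aestronglyMeasurable (Eventually.of_forall (hpb i))
      _ = ∑ i, kop (ker 1 fun _ => invF fun ξ => σ (particle ξ i) * O.q ξ) (F t) x :=
          Finset.sum_congr rfl fun i _ => by rw [kop_pconv hσ O.isCc_q i (hFc t) (hA₁ t)]
      _ = kop (ker 1 fun _ => invF fun ξ => O.w ξ * O.q ξ) (F t) x := by
          simp only [kop, ker]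
          rw [← integral_finsetSum _ fun i _ => ?_]
          · congr 1; funext y
            rw [← Finset.sum_mul]
            congr 1
            simp_rw [hsum]
            rw [invF_sum _ fun i _ => (isCc_single_mul hσ O.isCc_q i).integrable]
          · have h1 := isCc_single_mul hσ O.isCc_q i
            exact ((integrable_invF h1.smooth h1.compact).comp_sub_left x).mul_bdd
              (hFc t).aestronglyMeasurable (Eventually.of_forall (hA₁ t))
  have hFG : ∀ t, (hF' t).toLp (F' t)
      = -(Complex.I • ((hG t).toLp _ + (hR t).toLp (R t))) := by
    intro t
    rw [← MemLp.toLp_add, ← MemLp.toLp_const_smul, ← MemLp.toLp_neg]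
    refine MemLp.toLp_congr _ _ (Eventually.of_forall fun x => ?_)
    simp only [Pi.neg_apply, Pi.smul_apply, Pi.add_apply, smul_eq_mul]
    rw [← heq, ← mul_assoc, Complex.I_mul_I]; ring
  refine (hc F hF (fun t => opD O.q O.isCc_q ((hR t).toLp (R t))) A
    (C * (B * I * A₁) * (B * I * A₂')) ?_ (fun t _ => hA t) ?_ ?_).1
  · exact fun t _ => (hder t).continuousAt.continuousWithinAt
  · intro t _
    have h1 := ((opD O.q O.isCc_q).restrictScalars ℝ).hasFDerivAt.comp_hasDerivAt t (hder t)
    refine h1.congr_deriv ?_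
    change opD O.q O.isCc_q ((hF' t).toLp (F' t)) = _
    rw [hFG, map_neg, map_smul, map_add, hGeq]
  · intro t ht
    exact hC t ht _ _ _ _ (by positivity) (by positivity) (hbF t) (hbR t)

end Interacting

/-! ### Bochner's theorem -/

section Bochner

variable {V : Type*} [NormedAddCommGroup V] [InnerProductSpace ℝ V] [FiniteDimensional ℝ V]
  [MeasurableSpace V] [BorelSpace V] {𝓗 : Type*} [NormedAddCommGroup 𝓗] [InnerProductSpace ℂ 𝓗]
  [CompleteSpace 𝓗]

theorem integrable_gaussian {b : ℝ} (hb : 0 < b) :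
    Integrable fun x : V => Real.exp (-b * ‖x‖ ^ 2) := by
  have h := (GaussianFourier.integrable_cexp_neg_mul_sq_norm_add (V := V) (b := (b : ℂ)) (by simpa using hb) 0 0).norm
  refine h.congr (Eventually.of_forall fun x => ?_)
  simp only [zero_mul, add_zero, Complex.norm_exp]
  congr 1
  norm_cast

theorem integral_gaussian_pos {b : ℝ} (hb : 0 < b) : 0 < ∫ x : V, Real.exp (-b * ‖x‖ ^ 2) := by
  rw [GaussianFourier.integral_rexp_neg_mul_sq_norm hb]
  have := Real.pi_pos
  positivity

theorem exp_mul_exp_eq (ε : ℝ) (a s : V) :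
    Real.exp (-(2 * ε) * ‖a‖ ^ 2) * Real.exp (-(2 * ε) * ‖a + s‖ ^ 2)
      = Real.exp (-ε * ‖s‖ ^ 2) * Real.exp (-(4 * ε) * ‖a + (2 : ℝ)⁻¹ • s‖ ^ 2) := by
  rw [← Real.exp_add, ← Real.exp_add]
  congr 1
  rw [norm_add_sq_real, norm_add_sq_real, norm_smul, inner_smul_right]
  norm_num
  ring

/-- A Gaussian average of a positive definite function, which is itself the Fourier transform of a
positive density. -/
def regularized (g : V → ℂ) (η : ℝ) (t : V) : ℂ :=
  ∫ r : V, ((Real.exp (-η ^ 2 * ‖t - η • r‖ ^ 2) * Real.exp (-(1 / 4) * ‖r‖ ^ 2) : ℝ) : ℂ)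
    * g (t - η • r)

theorem continuous_regularized {g : V → ℂ} (hg : Continuous g) {M : ℝ} (hM : ∀ x, ‖g x‖ ≤ M)
    (t : V) : Continuous fun η => regularized g η t := by
  unfold regularized
  refine continuous_of_dominated (bound := fun r => Real.exp (-(1 / 4) * ‖r‖ ^ 2) * M)
    (fun η => Continuous.aestronglyMeasurable (by fun_prop))
    (fun η => Eventually.of_forall fun r => ?_) ((integrable_gaussian (by norm_num)).mul_const M)
    (Eventually.of_forall fun r => by fun_prop)
  rw [norm_mul, Complex.norm_real, Real.norm_of_nonneg (by positivity)]
  have : Real.exp (-η ^ 2 * ‖t - η • r‖ ^ 2) ≤ 1 := Real.exp_le_one_iff.2 (by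
    have : 0 ≤ η ^ 2 * ‖t - η • r‖ ^ 2 := by positivity
    linarith)
  gcongr
  · exact mul_le_of_le_one_left (by positivity) this
  · exact hM _

theorem regularized_zero (g : V → ℂ) (t : V) :
    regularized g 0 t = ((∫ r : V, Real.exp (-(1 / 4) * ‖r‖ ^ 2) : ℝ) : ℂ) * g t := by
  simp only [regularized]
  rw [← integral_complex_ofReal, ← integral_mul_const]
  congr 1; funext r
  simp

/-- The regularized function is, up to a factor, the Fourier transform of a finite measure. -/
theorem exists_measure_regularized {T : V → 𝓗} (hT : Continuous T) {g : V → ℂ}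
    (hg : ∀ a b, inner ℂ (T a) (T b) = g (b - a)) {η : ℝ} (hη : 0 < η) :
    ∃ μ : Measure V, IsFiniteMeasure μ ∧ ∃ κ : ℂ, κ ≠ 0 ∧
      ∀ t, charFun μ t = κ * regularized g η t := by
  have hgc : Continuous g := by
    have : g = fun b => inner ℂ (T 0) (T b) := by funext b; rw [hg, sub_zero]
    rw [this]; fun_prop
  have hTn : ∀ a, ‖T a‖ = ‖T 0‖ := fun a => by
    have h1 : ((‖T a‖ ^ 2 : ℝ) : ℂ) = ((‖T 0‖ ^ 2 : ℝ) : ℂ) := by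
      have e1 : ((‖T a‖ ^ 2 : ℝ) : ℂ) = inner ℂ (T a) (T a) := by
        rw [inner_self_eq_norm_sq_to_K]; norm_cast
      have e2 : ((‖T 0‖ ^ 2 : ℝ) : ℂ) = inner ℂ (T 0) (T 0) := by
        rw [inner_self_eq_norm_sq_to_K]; norm_cast
      rw [e1, e2, hg, hg, sub_self, sub_self]
    have h2 : ‖T a‖ ^ 2 = ‖T 0‖ ^ 2 := by exact_mod_cast h1
    exact (pow_left_inj₀ (norm_nonneg _) (norm_nonneg _) two_ne_zero).1 h2
  set M := ‖T 0‖
  have hgM : ∀ x, ‖g x‖ ≤ M * M := fun x => by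
    have := norm_inner_le_norm (𝕜 := ℂ) (T 0) (T x)
    rwa [hg, sub_zero, hTn x] at this
  have hη2 : 0 < η ^ 2 := by positivity
  set f : V → ℝ := fun a => Real.exp (-(2 * η ^ 2) * ‖a‖ ^ 2) with hf
  have hfi : Integrable f := integrable_gaussian (by positivity)
  have hfc : Continuous f := by simp only [hf]; fun_prop
  have hf0 : ∀ a, 0 ≤ f a := fun a => (Real.exp_pos _).le
  set w : V → V → 𝓗 := fun q a => ((f a : ℂ) * Complex.exp (Complex.I * ((-inner ℝ a q : ℝ) : ℂ))) • T a
  have hwn : ∀ q a, ‖w q a‖ = f a * M := fun q a => by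
    simp only [w]
    rw [norm_smul, norm_mul, norm_exp_I_mul_ofReal, mul_one, Complex.norm_real,
      Real.norm_of_nonneg (hf0 a), hTn a]
  have hwi : ∀ q, Integrable (w q) := fun q =>
    (hfi.mul_const M).mono' (Continuous.aestronglyMeasurable (by simp only [w]; fun_prop))
      (Eventually.of_forall fun a => (hwn q a).le)
  set v : V → 𝓗 := fun q => ∫ a, w q a
  have hvc : Continuous v := by
    refine continuous_of_dominated (bound := fun a => f a * M) (fun q => (hwi q).1)
      (fun q => Eventually.of_forall fun a => (hwn q a).le) (hfi.mul_const M)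
      (Eventually.of_forall fun a => by simp only [w]; fun_prop)
  have hvn : ∀ q, ‖v q‖ ≤ (∫ a, f a) * M := fun q => by
    rw [← integral_mul_const]
    exact norm_integral_le_of_norm_le (hfi.mul_const M) (Eventually.of_forall fun a => (hwn q a).le)
  set p : V → ℝ := fun q => ‖v q‖ ^ 2 * Real.exp (-η ^ 2 * ‖q‖ ^ 2)
  have hpc : Continuous p := by simp only [p]; fun_prop
  have hp0 : ∀ q, 0 ≤ p q := fun q => by positivity
  have hpi : Integrable p := by
    refine ((integrable_gaussian hη2).const_mul (((∫ a, f a) * M) ^ 2)).mono' hpc.aestronglyMeasurable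
      (Eventually.of_forall fun q => ?_)
    rw [Real.norm_of_nonneg (hp0 q)]
    simp only [p]
    gcongr
    exact hvn q
  set μ : Measure V := volume.withDensity fun q => ENNReal.ofReal (p q)
  have hμf : IsFiniteMeasure μ := isFiniteMeasure_withDensity_ofReal hpi.2
  -- the norm as a double integral
  have hsq : ∀ q, ((‖v q‖ ^ 2 : ℝ) : ℂ) = ∫ z : V × V, ((f z.1 * f z.2 : ℝ) : ℂ) * g (z.2 - z.1)
      * Complex.exp (Complex.I * ((inner ℝ (z.1 - z.2) q : ℝ) : ℂ)) := by
    intro q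
    have e1 : ((‖v q‖ ^ 2 : ℝ) : ℂ) = inner ℂ (v q) (v q) := by
      rw [inner_self_eq_norm_sq_to_K]; norm_cast
    have e2 : ∀ c, inner ℂ (v q) (w q c) = ∫ a, inner ℂ (w q a) (w q c) := fun c => by
      rw [← inner_conj_symm, ← integral_inner (hwi q), ← integral_conj]
      simp_rw [inner_conj_symm]
    have e3 : inner ℂ (v q) (v q) = ∫ c, ∫ a, inner ℂ (w q a) (w q c) := by
      conv_lhs => rw [show v q = ∫ c, w q c from rfl]
      rw [← integral_inner (hwi q)]
      exact integral_congr_ae (Eventually.of_forall fun c => e2 c)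
    have e4 : ∀ a c, inner ℂ (w q a) (w q c) = ((f a * f c : ℝ) : ℂ) * g (c - a)
        * Complex.exp (Complex.I * ((inner ℝ (a - c) q : ℝ) : ℂ)) := fun a c => by
      simp only [w]
      rw [inner_smul_left, inner_smul_right, hg, map_mul, Complex.conj_ofReal, ← Complex.exp_conj,
        map_mul, Complex.conj_I, Complex.conj_ofReal]
      have : Complex.exp (Complex.I * ((inner ℝ (a - c) q : ℝ) : ℂ))
          = Complex.exp (-Complex.I * ((-inner ℝ a q : ℝ) : ℂ))
            * Complex.exp (Complex.I * ((-inner ℝ c q : ℝ) : ℂ)) := by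
        rw [← Complex.exp_add, inner_sub_left]; push_cast; ring_nf
      rw [this]; push_cast; ring
    rw [e1, e3, integral_integral_swap]
    · simp_rw [e4]
      have hi : Integrable fun z : V × V => ((f z.1 * f z.2 : ℝ) : ℂ) * g (z.2 - z.1)
          * Complex.exp (Complex.I * ((inner ℝ (z.1 - z.2) q : ℝ) : ℂ)) := by
        refine ((hfi.mul_prod hfi).mul_const (M * M)).mono' (Continuous.aestronglyMeasurable (by fun_prop))
          (Eventually.of_forall fun z => ?_)
        rw [norm_mul, norm_mul, norm_exp_I_mul_ofReal, mul_one, Complex.norm_real,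
          Real.norm_of_nonneg (mul_nonneg (hf0 _) (hf0 _))]
        have := hgM (z.2 - z.1)
        have := mul_nonneg (hf0 z.1) (hf0 z.2)
        gcongr
      exact (integral_prod _ hi).symm
    · refine ((hfi.mul_prod hfi).mul_const (M * M)).mono' (Continuous.aestronglyMeasurable (by
        simp only [w]; fun_prop)) (Eventually.of_forall fun z => ?_)
      refine (norm_inner_le_norm _ _).trans (le_of_eq ?_)
      rw [hwn, hwn]; ring
  -- the Fourier transform of the density
  set cδ : ℂ := (Real.pi / ((η ^ 2 : ℝ) : ℂ)) ^ (Module.finrank ℝ V / 2 : ℂ)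
  have hG : ∀ s : V, ∫ q : V, Complex.exp (-((η ^ 2 : ℝ) : ℂ) * ‖q‖ ^ 2 + Complex.I * (inner ℝ s q : ℝ))
      = cδ * ((Real.exp (-(1 / (4 * η ^ 2)) * ‖s‖ ^ 2) : ℝ) : ℂ) := fun s => by
    rw [GaussianFourier.integral_cexp_neg_mul_sq_norm_add (by rw [Complex.ofReal_re]; exact hη2)]
    congr 1
    push_cast
    congr 1
    rw [Complex.I_sq]
    field_simp
  have hchar : ∀ t, charFun μ t = ∫ z : V × V, ((f z.1 * f z.2 : ℝ) : ℂ) * g (z.2 - z.1)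
      * (cδ * ((Real.exp (-(1 / (4 * η ^ 2)) * ‖t - (z.2 - z.1)‖ ^ 2) : ℝ) : ℂ)) := by
    intro t
    have hbig : Integrable (Function.uncurry fun (q : V) (z : V × V) =>
        ((f z.1 * f z.2 : ℝ) : ℂ) * g (z.2 - z.1)
        * Complex.exp (-((η ^ 2 : ℝ) : ℂ) * ‖q‖ ^ 2
          + Complex.I * (inner ℝ (t - (z.2 - z.1)) q : ℝ))) := by
      refine ((integrable_gaussian (V := V) hη2).mul_prod
        ((hfi.mul_prod hfi).mul_const (M * M))).mono' (Continuous.aestronglyMeasurable (by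
          rw [Function.uncurry_def]; fun_prop)) (Eventually.of_forall fun x => ?_)
      obtain ⟨q, z⟩ := x
      simp only [Function.uncurry]
      rw [norm_mul, norm_mul, Complex.norm_real, Real.norm_of_nonneg (mul_nonneg (hf0 _) (hf0 _)),
        Complex.exp_add, norm_mul, norm_exp_I_mul_ofReal, mul_one, Complex.norm_exp, mul_comm]
      have e : (-((η ^ 2 : ℝ) : ℂ) * (‖q‖ : ℂ) ^ 2).re = -η ^ 2 * ‖q‖ ^ 2 := by norm_cast
      rw [e]
      have := hgM (z.2 - z.1)
      have := mul_nonneg (hf0 z.1) (hf0 z.2)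
      gcongr
    calc charFun μ t = ∫ q, ((‖v q‖ ^ 2 : ℝ) : ℂ) * Complex.exp (-((η ^ 2 : ℝ) : ℂ) * ‖q‖ ^ 2
          + Complex.I * (inner ℝ t q : ℝ)) := by
          rw [charFun_apply, integral_withDensity_eq_integral_toReal_smul
            (f := fun q => ENNReal.ofReal (p q)) hpc.measurable.ennreal_ofReal
            (Eventually.of_forall fun q => ENNReal.ofReal_lt_top)]
          congr 1; funext q
          rw [ENNReal.toReal_ofReal (hp0 q), Complex.real_smul, Complex.exp_add, real_inner_comm]
          simp only [p]
          push_cast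
          rw [mul_comm Complex.I]; ring
      _ = ∫ q, ∫ z : V × V, ((f z.1 * f z.2 : ℝ) : ℂ) * g (z.2 - z.1)
          * Complex.exp (-((η ^ 2 : ℝ) : ℂ) * ‖q‖ ^ 2
            + Complex.I * (inner ℝ (t - (z.2 - z.1)) q : ℝ)) := by
          congr 1; funext q
          rw [hsq, ← integral_mul_const]
          congr 1; funext z
          rw [mul_assoc, ← Complex.exp_add]
          congr 2
          have : inner ℝ (t - (z.2 - z.1)) q = inner ℝ (z.1 - z.2) q + inner ℝ t q := by
            rw [← inner_add_left]; congr 1; abel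
          rw [this]; push_cast; ring
      _ = _ := by
          rw [integral_integral_swap hbig]
          congr 1; funext z
          rw [integral_const_mul, hG]
  refine ⟨μ, hμf, ((∫ a : V, Real.exp (-(4 * η ^ 2) * ‖a‖ ^ 2) : ℝ) : ℂ) * cδ
    * ((η ^ Module.finrank ℝ V : ℝ) : ℂ), ?_, fun t => ?_⟩
  · refine mul_ne_zero (mul_ne_zero ?_ ?_) ?_
    · exact Complex.ofReal_ne_zero.2
        (integral_gaussian_pos (V := V) (b := 4 * η ^ 2) (by positivity)).ne'
    · have : (Real.pi / ((η ^ 2 : ℝ) : ℂ)) ≠ 0 := by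
        refine div_ne_zero (by exact_mod_cast Real.pi_ne_zero) (by exact_mod_cast hη2.ne')
      simp only [cδ, Complex.cpow_def_of_ne_zero this]
      exact Complex.exp_ne_zero _
    · exact_mod_cast (pow_pos hη _).ne'
  · rw [hchar]
    set k : V → ℂ := fun s => g s * (cδ * ((Real.exp (-(1 / (4 * η ^ 2)) * ‖t - s‖ ^ 2) : ℝ) : ℂ))
    have hkc : Continuous k := by simp only [k]; fun_prop
    have hkM : ∀ s, ‖k s‖ ≤ M * M * ‖cδ‖ := fun s => by
      simp only [k]
      rw [norm_mul, norm_mul, Complex.norm_real, Real.norm_of_nonneg (Real.exp_pos _).le]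
      have h1 : Real.exp (-(1 / (4 * η ^ 2)) * ‖t - s‖ ^ 2) ≤ 1 := Real.exp_le_one_iff.2 (by
        have : 0 ≤ 1 / (4 * η ^ 2) * ‖t - s‖ ^ 2 := by positivity
        linarith)
      exact mul_le_mul (hgM s) (mul_le_of_le_one_right (norm_nonneg _) h1) (by positivity)
        (by positivity)
    have hint : Integrable fun z : V × V => ((f z.1 * f z.2 : ℝ) : ℂ) * k (z.2 - z.1) := by
      refine ((hfi.mul_prod hfi).mul_const (M * M * ‖cδ‖)).mono'
        (Continuous.aestronglyMeasurable (by fun_prop)) (Eventually.of_forall fun z => ?_)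
      rw [norm_mul, Complex.norm_real, Real.norm_of_nonneg (mul_nonneg (hf0 _) (hf0 _))]
      have := mul_nonneg (hf0 z.1) (hf0 z.2)
      exact mul_le_mul_of_nonneg_left (hkM _) this
    have hint2 : Integrable fun z : V × V => ((f z.1 * f (z.1 + z.2) : ℝ) : ℂ) * k z.2 := by
      have h4 : Integrable fun z : V × V => Real.exp (-(4 * η ^ 2) * ‖z.1 + (2 : ℝ)⁻¹ • z.2‖ ^ 2)
          * Real.exp (-η ^ 2 * ‖z.2‖ ^ 2) := by
        refine ((integrable_prod_iff' (Continuous.aestronglyMeasurable (by fun_prop))).2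
          ⟨Eventually.of_forall fun s => ?_, ?_⟩)
        · exact ((integrable_gaussian (V := V) (b := 4 * η ^ 2) (by positivity)).comp_add_right
            ((2 : ℝ)⁻¹ • s)).mul_const (Real.exp (-η ^ 2 * ‖s‖ ^ 2))
        · have : (fun s : V => ∫ a : V, ‖Real.exp (-(4 * η ^ 2) * ‖a + (2 : ℝ)⁻¹ • s‖ ^ 2)
              * Real.exp (-η ^ 2 * ‖s‖ ^ 2)‖) = fun s => (∫ a : V, Real.exp (-(4 * η ^ 2) * ‖a‖ ^ 2))
              * Real.exp (-η ^ 2 * ‖s‖ ^ 2) := by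
            funext s
            simp_rw [norm_mul, Real.norm_of_nonneg (Real.exp_pos _).le]
            rw [integral_mul_const, integral_add_right_eq_self
              (fun a : V => Real.exp (-(4 * η ^ 2) * ‖a‖ ^ 2))]
          rw [this]
          exact (integrable_gaussian hη2).const_mul _
      refine (h4.mul_const (M * M * ‖cδ‖)).mono' (Continuous.aestronglyMeasurable (by fun_prop))
        (Eventually.of_forall fun z => ?_)
      rw [norm_mul, Complex.norm_real, Real.norm_of_nonneg (mul_nonneg (hf0 _) (hf0 _))]
      have := mul_nonneg (hf0 z.1) (hf0 (z.1 + z.2))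
      refine (mul_le_mul_of_nonneg_left (hkM z.2) this).trans (le_of_eq ?_)
      simp only [f]
      rw [exp_mul_exp_eq]; ring
    calc _ = ∫ a, ∫ c, ((f a * f c : ℝ) : ℂ) * k (c - a) := by
          rw [← integral_prod _ hint]
          congr 1; funext z
          simp only [k]; ring
      _ = ∫ a, ∫ s, ((f a * f (a + s) : ℝ) : ℂ) * k s := by
          congr 1; funext a
          rw [← integral_add_left_eq_self _ a]
          simp_rw [add_sub_cancel_left]
      _ = ∫ s, ∫ a, ((f a * f (a + s) : ℝ) : ℂ) * k s := integral_integral_swap hint2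
      _ = ∫ s, ((∫ a : V, Real.exp (-(4 * η ^ 2) * ‖a‖ ^ 2) : ℝ) : ℂ)
            * (((Real.exp (-η ^ 2 * ‖s‖ ^ 2) : ℝ) : ℂ) * k s) := by
          congr 1; funext s
          rw [integral_mul_const, integral_complex_ofReal]
          have : ∫ a, f a * f (a + s) = Real.exp (-η ^ 2 * ‖s‖ ^ 2)
              * ∫ a : V, Real.exp (-(4 * η ^ 2) * ‖a‖ ^ 2) := by
            simp only [f]
            simp_rw [exp_mul_exp_eq]
            rw [integral_const_mul, integral_add_right_eq_self
              (fun a : V => Real.exp (-(4 * η ^ 2) * ‖a‖ ^ 2))]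
          rw [this]; push_cast; ring
      _ = ((∫ a : V, Real.exp (-(4 * η ^ 2) * ‖a‖ ^ 2) : ℝ) : ℂ)
            * ∫ s, ((Real.exp (-η ^ 2 * ‖t - s‖ ^ 2) : ℝ) : ℂ) * k (t - s) := by
          rw [integral_const_mul, integral_sub_left_eq_self (fun s =>
            ((Real.exp (-η ^ 2 * ‖s‖ ^ 2) : ℝ) : ℂ) * k s) volume t]
      _ = ((∫ a : V, Real.exp (-(4 * η ^ 2) * ‖a‖ ^ 2) : ℝ) : ℂ) * (((η ^ Module.finrank ℝ V : ℝ) : ℂ)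
            * ∫ r, ((Real.exp (-η ^ 2 * ‖t - η • r‖ ^ 2) : ℝ) : ℂ) * k (t - η • r)) := by
          congr 1
          rw [Measure.integral_comp_smul_of_nonneg volume (fun s =>
            ((Real.exp (-η ^ 2 * ‖t - s‖ ^ 2) : ℝ) : ℂ) * k (t - s)) η (hR := hη.le),
            Complex.real_smul, ← mul_assoc, ← Complex.ofReal_mul,
            mul_inv_cancel₀ (pow_pos hη _).ne', Complex.ofReal_one, one_mul]
      _ = _ := by
          have e : ∫ r, ((Real.exp (-η ^ 2 * ‖t - η • r‖ ^ 2) : ℝ) : ℂ) * k (t - η • r)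
              = cδ * regularized g η t := by
            rw [regularized, ← integral_const_mul]
            congr 1; funext r
            simp only [k]
            rw [sub_sub_cancel, norm_smul, Real.norm_of_nonneg hη.le]
            have : -(1 / (4 * η ^ 2)) * (η * ‖r‖) ^ 2 = -(1 / 4) * ‖r‖ ^ 2 := by field_simp
            rw [this]; push_cast; ring
          rw [e]; ring

/-- **Bochner's theorem** for the matrix elements of a unitary representation. -/
theorem exists_measure_of_orbit {T : V → 𝓗} (hT : Continuous T) {g : V → ℂ}
    (hg : ∀ a b, inner ℂ (T a) (T b) = g (b - a)) :
    ∃ μ : Measure V, IsFiniteMeasure μ ∧ ∀ t, charFun μ t = g t := by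
  have hgc : Continuous g := by
    have : g = fun b => inner ℂ (T 0) (T b) := by funext b; rw [hg, sub_zero]
    rw [this]; fun_prop
  have hg0 : g 0 = ((‖T 0‖ ^ 2 : ℝ) : ℂ) := by
    have := hg 0 0
    rw [sub_self] at this
    rw [← this, inner_self_eq_norm_sq_to_K]; norm_cast
  have hgM : ∀ x, ‖g x‖ ≤ ‖T 0‖ * ‖T 0‖ := fun x => by
    have h1 := norm_inner_le_norm (𝕜 := ℂ) (T 0) (T x)
    have h2 : ‖T x‖ = ‖T 0‖ := by
      have : ((‖T x‖ ^ 2 : ℝ) : ℂ) = ((‖T 0‖ ^ 2 : ℝ) : ℂ) := by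
        have h3 := hg x x
        rw [sub_self] at h3
        rw [← hg0, ← h3, inner_self_eq_norm_sq_to_K]; norm_cast
      exact (pow_left_inj₀ (norm_nonneg _) (norm_nonneg _) two_ne_zero).1 (by exact_mod_cast this)
    rwa [hg, sub_zero, h2] at h1
  by_cases h0 : T 0 = 0
  · refine ⟨0, inferInstance, fun t => ?_⟩
    have := hgM t
    simp only [h0, norm_zero, mul_zero, norm_le_zero_iff] at this
    rw [this, charFun_zero_measure]
  have hn0 : (‖T 0‖ ^ 2 : ℝ) ≠ 0 := by
    have := norm_pos_iff.2 h0
    positivity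
  set c : ℂ := ((∫ r : V, Real.exp (-(1 / 4) * ‖r‖ ^ 2) : ℝ) : ℂ)
  have hc0 : c ≠ 0 := by
    exact Complex.ofReal_ne_zero.2 (integral_gaussian_pos (V := V) (b := 1 / 4) (by norm_num)).ne'
  have hlim : ∀ t, Tendsto (fun η => regularized g η t) (nhds 0) (nhds (c * g t)) := fun t => by
    rw [← regularized_zero]
    exact (continuous_regularized hgc hgM t).tendsto 0
  have hcg0 : c * g 0 ≠ 0 := mul_ne_zero hc0 (by rw [hg0]; exact_mod_cast hn0)
  obtain ⟨η₀, hη₀, hne⟩ := Metric.eventually_nhds_iff.1 ((hlim 0).eventually_ne hcg0)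
  set η : ℕ → ℝ := fun k => η₀ * (1 / ((k : ℝ) + 2))
  have hηp : ∀ k, 0 < η k := fun k => by positivity
  have hηl : Tendsto η atTop (nhds 0) := by
    have h1 : Tendsto (fun k : ℕ => 1 / ((k : ℝ) + 2)) atTop (nhds 0) := by
      have := (tendsto_one_div_add_atTop_nhds_zero_nat (𝕜 := ℝ)).comp (tendsto_add_atTop_nat 1)
      refine this.congr fun k => ?_
      simp only [Function.comp_apply]; push_cast; ring_nf
    have h2 := h1.const_mul η₀
    rwa [mul_zero] at h2
  have hηne : ∀ k, regularized g (η k) 0 ≠ 0 := fun k => hne (by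
    rw [dist_zero_right, Real.norm_of_nonneg (hηp k).le]
    have : 1 / ((k : ℝ) + 2) < 1 := by
      rw [div_lt_one (by positivity)]
      have : (0 : ℝ) ≤ k := Nat.cast_nonneg k
      linarith
    calc η₀ * (1 / ((k : ℝ) + 2)) < η₀ * 1 := by gcongr
      _ = η₀ := mul_one _)
  have hμ := fun k => exists_measure_regularized hT hg (hηp k)
  choose μ hμf κ hκ hchar using hμ
  have hμ0 : ∀ k, (μ k).real univ ≠ 0 := fun k h => by
    have h1 := hchar k 0
    rw [charFun_zero, h] at h1
    exact mul_ne_zero (hκ k) (hηne k) (by simpa using h1.symm)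
  have hμu : ∀ k, μ k univ ≠ 0 := fun k h => hμ0 k (by simp [measureReal_def, h])
  set ν : ℕ → Measure V := fun k => (μ k univ)⁻¹ • μ k
  have hνp : ∀ k, IsProbabilityMeasure (ν k) := fun k =>
    ⟨by simp only [ν, Measure.smul_apply, smul_eq_mul]
        exact ENNReal.inv_mul_cancel (hμu k) (measure_ne_top _ _)⟩
  have hνc : ∀ k t, charFun (ν k) t = regularized g (η k) t / regularized g (η k) 0 := by
    intro k t
    have h1 : (((μ k).real univ : ℝ) : ℂ) = κ k * regularized g (η k) 0 := by
      rw [← hchar, charFun_zero]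
    simp only [ν, charFun_apply]
    rw [integral_smul_measure, ← charFun_apply, hchar, ENNReal.toReal_inv, Complex.real_smul]
    have h2 : (((μ k univ).toReal⁻¹ : ℝ) : ℂ) = (κ k * regularized g (η k) 0)⁻¹ := by
      rw [← h1]; push_cast; rfl
    rw [h2]
    have := hκ k
    have := hηne k
    field_simp
  have hνl : ∀ t, Tendsto (fun k => charFun (ν k) t) atTop (nhds (g t / g 0)) := fun t => by
    have h1 := ((hlim t).comp hηl).div ((hlim 0).comp hηl) hcg0
    rw [mul_div_mul_left _ _ hc0] at h1
    exact h1.congr fun k => (hνc k t).symm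
  have htight : IsTightMeasureSet (Set.range ν) :=
    isTightMeasureSet_of_tendsto_charFun (f := fun t => g t / g 0)
      (hgc.div_const _).continuousAt hνl
  set P : ℕ → ProbabilityMeasure V := fun k => ⟨ν k, hνp k⟩
  have hcomp : IsCompact (closure (Set.range P)) := by
    refine isCompact_closure_of_isTightMeasureSet (htight.subset ?_)
    rintro _ ⟨_, ⟨k, rfl⟩, rfl⟩
    exact ⟨k, rfl⟩
  obtain ⟨μ', -, hμ'⟩ := hcomp.ultrafilter_le_nhds ((Filter.hyperfilter ℕ).map P)
    (le_principal_iff.2 (mem_map.2 (Filter.univ_mem' fun k => subset_closure ⟨k, rfl⟩)))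
  have hμ'' : Tendsto P (Filter.hyperfilter ℕ) (nhds μ') := hμ'
  have hle : (Filter.hyperfilter ℕ : Filter ℕ) ≤ atTop := Nat.hyperfilter_le_atTop
  have hch : ∀ t, charFun (μ' : Measure V) t = g t / g 0 := fun t => by
    rw [ProbabilityMeasure.tendsto_iff_forall_integral_rclike_tendsto ℂ] at hμ''
    refine tendsto_nhds_unique ?_ ((hνl t).mono_left hle)
    rw [charFun_eq_integral_innerProbChar]
    refine (hμ'' (BoundedContinuousFunction.innerProbChar t)).congr fun k => ?_
    rw [charFun_eq_integral_innerProbChar]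
    rfl
  refine ⟨ENNReal.ofReal (‖T 0‖ ^ 2) • (μ' : Measure V), ?_, fun t => ?_⟩
  · exact Measure.smul_finite _ ENNReal.ofReal_ne_top
  · rw [charFun_apply, integral_smul_measure, ← charFun_apply, hch,
      ENNReal.toReal_ofReal (by positivity), hg0, Complex.real_smul]
    have : ((‖T 0‖ ^ 2 : ℝ) : ℂ) ≠ 0 := by exact_mod_cast hn0
    field_simp

end Bochner

/-! ### The Fourier transform on spacetime -/

theorem exists_map_volume_eq_smul {V W : Type*} [NormedAddCommGroup V] [NormedSpace ℝ V]
    [FiniteDimensional ℝ V] [MeasureSpace V] [BorelSpace V]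
    [(volume : Measure V).IsAddHaarMeasure]
    [NormedAddCommGroup W] [NormedSpace ℝ W] [FiniteDimensional ℝ W] [MeasureSpace W] [BorelSpace W]
    [(volume : Measure W).IsAddHaarMeasure] (e : V ≃L[ℝ] W) :
    ∃ c : ℝ≥0∞, c ≠ 0 ∧ c ≠ ⊤ ∧ (volume : Measure V).map e = c • (volume : Measure W) := by
  have : ((volume : Measure V).map e).IsAddHaarMeasure := e.isAddHaarMeasure_map _
  have h := Measure.isAddLeftInvariant_eq_smul ((volume : Measure V).map e) (volume : Measure W)
  refine ⟨_, ?_, ENNReal.coe_ne_top, h⟩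
  exact ENNReal.coe_ne_zero.2 (Measure.addHaarScalarFactor_pos_of_isAddHaarMeasure _ _).ne'

theorem exists_integral_comp_eq_mul {V W : Type*} [NormedAddCommGroup V] [NormedSpace ℝ V]
    [FiniteDimensional ℝ V] [MeasureSpace V] [BorelSpace V]
    [(volume : Measure V).IsAddHaarMeasure]
    [NormedAddCommGroup W] [NormedSpace ℝ W] [FiniteDimensional ℝ W] [MeasureSpace W] [BorelSpace W]
    [(volume : Measure W).IsAddHaarMeasure] (e : V ≃L[ℝ] W) :
    ∃ c : ℂ, c ≠ 0 ∧ ∀ F : W → ℂ, ∫ v, F (e v) = c * ∫ w, F w := by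
  obtain ⟨c, hc0, hct, hc⟩ := exists_map_volume_eq_smul e
  refine ⟨(c.toReal : ℂ), ?_, fun F => ?_⟩
  · exact Complex.ofReal_ne_zero.2 (ENNReal.toReal_ne_zero.2 ⟨hc0, hct⟩)
  · have h1 := (e.toHomeomorph.measurableEmbedding).integral_map (μ := volume) F
    refine h1.symm.trans ?_
    rw [← Complex.real_smul, ← integral_smul_measure, ← hc]
    rfl

section Spacetime

variable {d : ℕ}

instance : (volume : Measure (Spacetime d)).IsAddHaarMeasure :=
  inferInstanceAs ((volume : Measure ℝ).prod (volume : Measure (EuclideanSpace ℝ (Fin d)))).IsAddHaarMeasure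

/-- Spacetime with the Euclidean inner product. -/
abbrev EST (d : ℕ) : Type := EuclideanSpace ℝ (Option (Fin d))

/-- The identification of energy-momentum space with a Euclidean space. -/
def toE (d : ℕ) : Spacetime d ≃L[ℝ] EST d :=
  LinearEquiv.toContinuousLinearEquiv
    { toFun := fun a => WithLp.toLp 2 fun o => o.elim a.1 fun j => a.2 j
      invFun := fun z => (z none, WithLp.toLp 2 fun j => z (some j))
      map_add' := fun a b => by ext o; cases o <;> simp
      map_smul' := fun c a => by ext o; cases o <;> simp
      left_inv := fun a => by ext <;> simp
      right_inv := fun z => by ext o; cases o <;> simp }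

/-- Time reflection. -/
def reflE (d : ℕ) : Spacetime d ≃L[ℝ] Spacetime d :=
  (ContinuousLinearEquiv.neg ℝ).prodCongr (ContinuousLinearEquiv.refl ℝ _)

/-- The identification of position space with a Euclidean space, which turns the Minkowski pairing
into minus the inner product. -/
def posE (d : ℕ) : Spacetime d ≃L[ℝ] EST d := (reflE d).trans (toE d)

theorem toE_none (a : Spacetime d) : toE d a none = a.1 := rfl

theorem toE_some (a : Spacetime d) (j : Fin d) : toE d a (some j) = a.2 j := rfl

theorem inner_posE_toE (a q : Spacetime d) : inner ℝ (posE d a) (toE d q) = -minkPairing a q := by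
  simp only [PiLp.inner_apply, Fintype.sum_option, minkPairing]
  have h1 : posE d a none = -a.1 := rfl
  have h2 : ∀ j, posE d a (some j) = a.2 j := fun j => rfl
  simp only [toE_none, toE_some, h1, h2]
  simp only [RCLike.inner_apply, conj_trivial]
  rw [neg_sub, mul_neg, mul_comm q.1]
  ring

theorem continuous_minkPairing : Continuous fun z : Spacetime d × Spacetime d =>
    minkPairing z.1 z.2 := by
  unfold minkPairing; fun_prop

theorem minkPairing_sub_left (a b q : Spacetime d) :
    minkPairing (a - b) q = minkPairing a q - minkPairing b q := by
  simp only [minkPairing, Prod.fst_sub, Prod.snd_sub, inner_sub_left]; ring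

theorem minkPairing_add_right (a p q : Spacetime d) :
    minkPairing a (p + q) = minkPairing a p + minkPairing a q := by
  simp only [minkPairing, Prod.fst_add, Prod.snd_add, inner_add_right]; ring

theorem minkPairing_neg_right (a q : Spacetime d) : minkPairing a (-q) = -minkPairing a q := by
  simp only [minkPairing, Prod.fst_neg, Prod.snd_neg, inner_neg_right]; ring

theorem IsCc.comp_equiv {V W F : Type*} [NormedAddCommGroup V] [NormedSpace ℝ V]
    [NormedAddCommGroup W] [NormedSpace ℝ W] [NormedAddCommGroup F] [NormedSpace ℝ F] {f : W → F}
    (hf : IsCc f) (e : V ≃L[ℝ] W) : IsCc fun v => f (e v) :=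
  ⟨hf.smooth.comp e.contDiff, hf.compact.comp_homeomorph e.toHomeomorph⟩

theorem exists_inverseFourierST_eq (d : ℕ) : ∃ c : ℂ, c ≠ 0 ∧ ∀ (f : Spacetime d → ℂ) a,
    inverseFourierST f a = c * invF (fun z => f ((toE d).symm z)) (posE d a) := by
  obtain ⟨c, hc0, hc⟩ := exists_integral_comp_eq_mul (toE d)
  have hpi := Real.pi_pos
  have h1 : (((2 * Real.pi) ^ (-(1 + (d : ℝ)) / 2) : ℝ) : ℂ) ≠ 0 :=
    Complex.ofReal_ne_zero.2 (by positivity)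
  have h2 : (fc (Option (Fin d)) : ℂ) ≠ 0 := Complex.ofReal_ne_zero.2 (fc_pos _).ne'
  refine ⟨(((2 * Real.pi) ^ (-(1 + (d : ℝ)) / 2) : ℝ) : ℂ) * c * (fc (Option (Fin d)) : ℂ)⁻¹, ?_,
    fun f a => ?_⟩
  · exact mul_ne_zero (mul_ne_zero h1 hc0) (inv_ne_zero h2)
  · rw [invF, smul_eq_mul, inverseFourierST]
    rw [mul_assoc, inv_mul_cancel_left₀ h2, mul_assoc, ← hc]
    congr 2; funext q
    rw [inner_posE_toE, ContinuousLinearEquiv.symm_apply_apply, smul_eq_mul]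
    push_cast; rw [mul_neg]

theorem exists_wt_comp_le {V W : Type*} [NormedAddCommGroup V] [NormedSpace ℝ V]
    [NormedAddCommGroup W] [NormedSpace ℝ W] (e : V ≃L[ℝ] W) (N : ℕ) :
    ∃ C, 0 ≤ C ∧ ∀ v, wt N (e v) ≤ C * wt N v := by
  set K : ℝ := ‖(e.symm : W →L[ℝ] V)‖ + 1
  have hK : 1 ≤ K := by simp [K]
  refine ⟨K ^ N, by positivity, fun v => le_mul_wt_iff.2 ?_⟩
  have h1 : 1 + ‖v‖ ≤ K * (1 + ‖e v‖) := by
    have h2 : ‖v‖ ≤ ‖(e.symm : W →L[ℝ] V)‖ * ‖e v‖ := by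
      have := (e.symm : W →L[ℝ] V).le_opNorm (e v)
      simpa using this
    have := norm_nonneg (e v)
    simp only [K] at hK ⊢
    nlinarith
  calc (1 + ‖v‖) ^ N * wt N (e v) ≤ (K * (1 + ‖e v‖)) ^ N * wt N (e v) := by
        have := wt_nonneg N (e v); gcongr
    _ = K ^ N := by
        rw [mul_pow, wt, mul_assoc, mul_inv_cancel₀ (by positivity), mul_one]

theorem exists_norm_inverseFourierST_le_wt {f : Spacetime d → ℂ} (hf : IsCc f) (N : ℕ) :
    ∃ C, 0 ≤ C ∧ ∀ a, ‖inverseFourierST f a‖ ≤ C * wt N a := by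
  obtain ⟨c, -, hc⟩ := exists_inverseFourierST_eq d
  have h1 := hf.comp_equiv (toE d).symm
  obtain ⟨C, hC0, hC⟩ := exists_norm_invF_le_wt h1.smooth h1.compact N
  obtain ⟨C', hC'0, hC'⟩ := exists_wt_comp_le (posE d) N
  refine ⟨‖c‖ * C * C', by positivity, fun a => ?_⟩
  rw [hc, norm_mul, mul_assoc, mul_assoc]
  gcongr
  exact (hC _).trans (mul_le_mul_of_nonneg_left (hC' a) hC0)

theorem continuous_inverseFourierST {f : Spacetime d → ℂ} (hf : IsCc f) :
    Continuous (inverseFourierST f) := by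
  obtain ⟨c, -, hc⟩ := exists_inverseFourierST_eq d
  have h1 := hf.comp_equiv (toE d).symm
  rw [show inverseFourierST f = _ from funext (hc f)]
  exact continuous_const.mul ((continuous_invF h1.integrable).comp (posE d).continuous)

/-- An exponent for which the weight on spacetime is integrable. -/
def dimST (d : ℕ) : ℕ := Module.finrank ℝ (Spacetime d) + 1

theorem integrable_wt_dimST : Integrable (wt (dimST d) : Spacetime d → ℝ) :=
  integrable_wt (Nat.lt_succ_self _)

theorem integrable_inverseFourierST {f : Spacetime d → ℂ} (hf : IsCc f) :
    Integrable (inverseFourierST f) := by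
  obtain ⟨C, hC0, hC⟩ := exists_norm_inverseFourierST_le_wt hf (dimST d)
  exact (integrable_wt_dimST.const_mul C).mono'
    (continuous_inverseFourierST hf).aestronglyMeasurable (Eventually.of_forall hC)

/-- The Fourier inversion formula on spacetime; the value of the constant is irrelevant. -/
theorem exists_fourier_inversion (d : ℕ) : ∃ κ : ℂ, κ ≠ 0 ∧ ∀ f : Spacetime d → ℂ, IsCc f → ∀ q,
    ∫ a, Complex.exp (Complex.I * (minkPairing a q : ℂ)) * inverseFourierST f a = κ * f q := by
  obtain ⟨c, hc0, hc⟩ := exists_inverseFourierST_eq d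
  obtain ⟨b, hb0, hb⟩ := exists_integral_comp_eq_mul (posE d)
  refine ⟨c * b, mul_ne_zero hc0 hb0, fun f hf q => ?_⟩
  have h1 := hf.comp_equiv (toE d).symm
  have h2 := integral_exp_smul_invF h1.smooth h1.compact (toE d q)
  rw [ContinuousLinearEquiv.symm_apply_apply] at h2
  rw [mul_assoc, ← h2, ← hb, ← integral_const_mul]
  congr 1; funext a
  rw [inner_posE_toE, hc, smul_eq_mul]
  push_cast
  rw [mul_neg, neg_neg]; ring

/-- The constant of the Fourier inversion formula. -/
def kap (d : ℕ) : ℂ := (exists_fourier_inversion d).choose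

theorem kap_ne_zero (d : ℕ) : kap d ≠ 0 := (exists_fourier_inversion d).choose_spec.1

theorem integral_exp_mul_inverseFourierST {f : Spacetime d → ℂ} (hf : IsCc f) (q : Spacetime d) :
    ∫ a, Complex.exp (Complex.I * (minkPairing a q : ℂ)) * inverseFourierST f a = kap d * f q :=
  (exists_fourier_inversion d).choose_spec.2 f hf q

theorem norm_exp_neg_I_mul_ofReal (x : ℝ) : ‖Complex.exp (-(Complex.I * (x : ℂ)))‖ = 1 := by
  have := norm_exp_I_mul_ofReal (-x)
  rwa [Complex.ofReal_neg, mul_neg] at this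

theorem continuous_exp_minkPairing (a : Spacetime d) : Continuous fun q : Spacetime d =>
    Complex.exp (-(Complex.I * (minkPairing a q : ℂ))) := by
  have := continuous_minkPairing (d := d)
  fun_prop

theorem integrable_exp_minkPairing_mul {f : Spacetime d → ℂ} (hf : Integrable f) (a : Spacetime d) :
    Integrable fun q => Complex.exp (-(Complex.I * (minkPairing a q : ℂ))) * f q :=
  hf.bdd_mul (c := 1) (continuous_exp_minkPairing a).aestronglyMeasurable
    (Eventually.of_forall fun _ => (norm_exp_neg_I_mul_ofReal _).le)

theorem inverseFourierST_sum {α : Type*} (s : Finset α) {f : α → Spacetime d → ℂ}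
    (hf : ∀ i ∈ s, IsCc (f i)) (a : Spacetime d) :
    inverseFourierST (fun q => ∑ i ∈ s, f i q) a = ∑ i ∈ s, inverseFourierST (f i) a := by
  simp only [inverseFourierST, Finset.mul_sum]
  rw [integral_finsetSum _ fun i hi => integrable_exp_minkPairing_mul (hf i hi).integrable a,
    Finset.mul_sum]

theorem inverseFourierST_sub {f g : Spacetime d → ℂ} (hf : IsCc f) (hg : IsCc g) (a : Spacetime d) :
    inverseFourierST (fun q => f q - g q) a = inverseFourierST f a - inverseFourierST g a := by
  simp only [inverseFourierST, mul_sub]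
  rw [integral_sub (integrable_exp_minkPairing_mul hf.integrable a)
    (integrable_exp_minkPairing_mul hg.integrable a), mul_sub]

theorem inverseFourierST_const_mul (c : ℂ) (f : Spacetime d → ℂ) (a : Spacetime d) :
    inverseFourierST (fun q => c * f q) a = c * inverseFourierST f a := by
  simp only [inverseFourierST]
  simp_rw [mul_left_comm _ c]
  rw [integral_const_mul, mul_left_comm]

theorem conj_inverseFourierST (f : Spacetime d → ℂ) (a : Spacetime d) :
    (starRingEnd ℂ) (inverseFourierST f a)
      = inverseFourierST (fun q => (starRingEnd ℂ) (f (-q))) a := by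
  simp only [inverseFourierST, map_mul, Complex.conj_ofReal, ← integral_conj]
  congr 1
  rw [← integral_neg_eq_self]
  congr 1; funext q
  rw [← Complex.exp_conj, minkPairing_neg_right]
  simp

/-- The time derivative of an inverse Fourier transform. -/
theorem hasDerivAt_inverseFourierST {f : Spacetime d → ℂ} (hf : IsCc f) (t : ℝ)
    (x : EuclideanSpace ℝ (Fin d)) :
    HasDerivAt (fun t => inverseFourierST f (t, x))
      (inverseFourierST (fun q => -(Complex.I * (q.1 : ℂ)) * f q) (t, x)) t := by
  have hfE : Continuous fun q : Spacetime d => -(Complex.I * (q.1 : ℂ)) * f q := by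
    have := hf.smooth.continuous
    fun_prop
  have hEi : Integrable fun q : Spacetime d => -(Complex.I * (q.1 : ℂ)) * f q :=
    hfE.integrable_of_hasCompactSupport hf.compact.mul_left
  unfold inverseFourierST
  refine HasDerivAt.const_mul _ ?_
  refine (hasDerivAt_integral_of_dominated_loc_of_deriv_le (x₀ := t) (s := univ)
    (bound := fun q => ‖-(Complex.I * (q.1 : ℂ)) * f q‖)
    (F' := fun t q => Complex.exp (-(Complex.I * (minkPairing (t, x) q : ℂ)))
      * (-(Complex.I * (q.1 : ℂ)) * f q)) univ_mem
    (Eventually.of_forall fun s => (integrable_exp_minkPairing_mul hf.integrable _).1)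
    (integrable_exp_minkPairing_mul hf.integrable _)
    (integrable_exp_minkPairing_mul hEi _).1 (Eventually.of_forall fun q s _ => ?_) hEi.norm
    (Eventually.of_forall fun q s _ => ?_)).2
  · rw [norm_mul, norm_exp_neg_I_mul_ofReal, one_mul]
  · have h1 : HasDerivAt (fun s : ℝ => (minkPairing (s, x) q : ℂ)) (q.1 : ℂ) s := by
      refine HasDerivAt.ofReal_comp (f := fun s : ℝ => minkPairing (s, x) q) (u := q.1) ?_
      simp only [minkPairing]
      simpa using ((hasDerivAt_id s).mul_const q.1).sub_const (inner ℝ x q.2)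
    have h2 := ((h1.const_mul Complex.I).neg).cexp.mul_const (f q)
    refine h2.congr_deriv ?_
    simp only [Pi.neg_apply]
    ring

/-- Convolution in the space variables multiplies the symbol by a function of the momentum. -/
theorem integral_invF_mul_inverseFourierST {σ : EuclideanSpace ℝ (Fin d) → ℂ} (hσ : IsCc σ)
    {f : Spacetime d → ℂ} (hf : IsCc f) (t : ℝ) (x : EuclideanSpace ℝ (Fin d)) :
    ∫ r, invF σ r * inverseFourierST f (t, x + r)
      = inverseFourierST (fun q => σ (-q.2) * f q) (t, x) := by
  have hσi := integrable_invF hσ.smooth hσ.compact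
  have hσc := continuous_invF (hσ.integrable (μ := volume))
  have e : ∀ r q, Complex.exp (-(Complex.I * (minkPairing (t, x + r) q : ℂ)))
      = Complex.exp (-(Complex.I * (minkPairing (t, x) q : ℂ)))
        * Complex.exp (-(Complex.I * ((inner ℝ r (-q.2) : ℝ) : ℂ))) := fun r q => by
    rw [← Complex.exp_add]
    congr 1
    simp only [minkPairing, inner_add_left, inner_neg_right]
    push_cast; ring
  have hint : Integrable (Function.uncurry fun (r : EuclideanSpace ℝ (Fin d)) (q : Spacetime d) =>
      invF σ r * (Complex.exp (-(Complex.I * (minkPairing (t, x + r) q : ℂ))) * f q)) := by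
    refine (hσi.mul_prod (hf.integrable (μ := volume))).norm.mono' (Continuous.aestronglyMeasurable ?_)
      (Eventually.of_forall fun z => ?_)
    · have := hf.smooth.continuous
      have := continuous_minkPairing (d := d)
      rw [Function.uncurry_def]
      fun_prop
    · simp only [Function.uncurry]
      rw [norm_mul, norm_mul, norm_exp_neg_I_mul_ofReal, one_mul, norm_mul]
  simp only [inverseFourierST]
  simp_rw [mul_left_comm (invF σ _)]
  rw [integral_const_mul]
  congr 1
  simp_rw [← integral_const_mul (invF σ _)]
  rw [integral_integral_swap hint]
  congr 1; funext q
  rw [← integral_exp_smul_invF hσ.smooth hσ.compact (-q.2), ← integral_mul_const,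
    ← integral_const_mul]
  congr 1; funext r
  rw [e, smul_eq_mul]; ring

/-- The symbol of the product of two inverse Fourier transforms, in the form needed to shift the
spectral support: `ȟ(b) ǧ(c - b)` has, as a function of `b`, the symbol `twist h g c`. -/
def twist (h g : Spacetime d → ℂ) (c p : Spacetime d) : ℂ :=
  ∫ q, (Complex.exp (-(Complex.I * (minkPairing c q : ℂ))) * g q) * h (p + q)

theorem isCc_convolution {V : Type*} [NormedAddCommGroup V] [NormedSpace ℝ V]
    [FiniteDimensional ℝ V] [MeasurableSpace V] [BorelSpace V] (μ : Measure V)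
    [IsFiniteMeasureOnCompacts μ] {k h : V → ℂ} (hk : Continuous k) (hks : HasCompactSupport k)
    (hh : IsCc h) : IsCc fun p => ∫ q, k q * h (p - q) ∂μ := by
  have e : (fun p => ∫ q, k q * h (p - q) ∂μ)
      = convolution k h (ContinuousLinearMap.mul ℝ ℂ) μ := by
    funext p
    rw [convolution_def]
    simp only [ContinuousLinearMap.mul_apply']
  rw [e]
  have h2 : LocallyIntegrable k μ := (hk.integrable_of_hasCompactSupport hks).locallyIntegrable
  exact ⟨HasCompactSupport.contDiff_convolution_right _ hh.compact h2 hh.smooth,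
    HasCompactSupport.convolution _ hks hh.compact⟩

theorem isCc_twist {h g : Spacetime d → ℂ} (hh : IsCc h) (hg : IsCc g) (c : Spacetime d) :
    IsCc (twist h g c) := by
  have hk : Continuous fun q : Spacetime d =>
      Complex.exp (-(Complex.I * (minkPairing c (-q) : ℂ))) * g (-q) := by
    have := hg.smooth.continuous
    have := continuous_minkPairing (d := d)
    fun_prop
  have h0 : HasCompactSupport fun q => g (-q) :=
    hg.compact.comp_homeomorph (Homeomorph.neg (Spacetime d))
  have h1 := isCc_convolution volume hk h0.mul_left hh
  have e : twist h g c = fun p => ∫ q : Spacetime d,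
      Complex.exp (-(Complex.I * (minkPairing c (-q) : ℂ))) * g (-q) * h (p - q) := by
    funext p
    rw [twist, ← integral_neg_eq_self]
    simp only [sub_eq_add_neg]
  rw [e]
  exact h1

theorem tsupport_twist_subset {h g : Spacetime d → ℂ} (hh : IsCc h) (hg : IsCc g)
    (c : Spacetime d) :
    tsupport (twist h g c) ⊆ {p | ∃ q ∈ tsupport g, p + q ∈ tsupport h} := by
  have hcl : IsClosed {p : Spacetime d | ∃ q ∈ tsupport g, p + q ∈ tsupport h} := by
    have : {p : Spacetime d | ∃ q ∈ tsupport g, p + q ∈ tsupport h}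
        = (fun z : Spacetime d × Spacetime d => z.1 - z.2) '' (tsupport h ×ˢ tsupport g) := by
      ext p
      constructor
      · rintro ⟨q, hq, hp⟩
        exact ⟨(p + q, q), ⟨hp, hq⟩, add_sub_cancel_right p q⟩
      · rintro ⟨⟨a, q⟩, ⟨ha, hq⟩, rfl⟩
        exact ⟨q, hq, by simpa using ha⟩
    rw [this]
    exact ((hh.compact.isCompact.prod hg.compact.isCompact).image (by fun_prop)).isClosed
  refine closure_minimal (fun p hp => ?_) hcl
  by_contra hno
  refine hp ?_
  rw [twist]
  refine integral_eq_zero_of_ae (Eventually.of_forall fun q => ?_)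
  by_cases hq : q ∈ tsupport g
  · have : p + q ∉ tsupport h := fun h' => hno ⟨q, hq, h'⟩
    simp [image_eq_zero_of_notMem_tsupport this]
  · simp [image_eq_zero_of_notMem_tsupport hq]

theorem exists_inverseFourierST_twist (d : ℕ) : ∃ c₀ : ℂ, ∀ {h g : Spacetime d → ℂ}, IsCc h →
    IsCc g → ∀ c b, inverseFourierST h b * inverseFourierST g (c - b)
      = c₀ * inverseFourierST (twist h g c) b := by
  refine ⟨(((2 * Real.pi) ^ (-(1 + (d : ℝ)) / 2) : ℝ) : ℂ), fun {h g} hh hg c b => ?_⟩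
  have hgi := integrable_exp_minkPairing_mul (hg.integrable (μ := volume)) c
  have e : ∀ p q : Spacetime d, Complex.exp (-(Complex.I * (minkPairing b p : ℂ)))
      * ((Complex.exp (-(Complex.I * (minkPairing c q : ℂ))) * g q) * h (p + q))
      = (Complex.exp (-(Complex.I * (minkPairing (c - b) q : ℂ))) * g q)
        * (Complex.exp (-(Complex.I * (minkPairing b (p + q) : ℂ))) * h (p + q)) := fun p q => by
    have : Complex.exp (-(Complex.I * (minkPairing b p : ℂ)))
        * Complex.exp (-(Complex.I * (minkPairing c q : ℂ)))
        = Complex.exp (-(Complex.I * (minkPairing (c - b) q : ℂ)))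
          * Complex.exp (-(Complex.I * (minkPairing b (p + q) : ℂ))) := by
      rw [← Complex.exp_add, ← Complex.exp_add, minkPairing_sub_left, minkPairing_add_right]
      congr 1; push_cast; ring
    linear_combination (g q * h (p + q)) * this
  obtain ⟨M, hM⟩ := hh.compact.exists_bound_of_continuous hh.smooth.continuous
  have hint : Integrable (Function.uncurry fun (p q : Spacetime d) =>
      Complex.exp (-(Complex.I * (minkPairing b p : ℂ)))
      * ((Complex.exp (-(Complex.I * (minkPairing c q : ℂ))) * g q) * h (p + q))) := by
    have hcont : Continuous (Function.uncurry fun (p q : Spacetime d) =>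
      Complex.exp (-(Complex.I * (minkPairing b p : ℂ)))
      * ((Complex.exp (-(Complex.I * (minkPairing c q : ℂ))) * g q) * h (p + q))) := by
      have := hg.smooth.continuous
      have := hh.smooth.continuous
      have := continuous_minkPairing (d := d)
      rw [Function.uncurry_def]
      fun_prop
    refine hcont.integrable_of_hasCompactSupport (HasCompactSupport.intro
      (K := (fun z : Spacetime d × Spacetime d => (z.1 - z.2, z.2)) '' (tsupport h ×ˢ tsupport g))
      ((hh.compact.isCompact.prod hg.compact.isCompact).image (by fun_prop)) fun z hz => ?_)
    obtain ⟨p, q⟩ := z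
    simp only [Function.uncurry]
    by_cases hq : q ∈ tsupport g
    · have : p + q ∉ tsupport h := fun h' => hz ⟨(p + q, q), ⟨h', hq⟩, by simp⟩
      simp [image_eq_zero_of_notMem_tsupport this]
    · simp [image_eq_zero_of_notMem_tsupport hq]
  simp only [inverseFourierST, twist]
  simp_rw [← integral_const_mul (Complex.exp (-(Complex.I * (minkPairing b _ : ℂ))))]
  rw [integral_integral_swap hint]
  have h2 : ∀ q : Spacetime d, ∫ p, Complex.exp (-(Complex.I * (minkPairing b p : ℂ)))
      * ((Complex.exp (-(Complex.I * (minkPairing c q : ℂ))) * g q) * h (p + q))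
      = (Complex.exp (-(Complex.I * (minkPairing (c - b) q : ℂ))) * g q)
        * ∫ p, Complex.exp (-(Complex.I * (minkPairing b p : ℂ))) * h p := fun q => by
    simp_rw [e]
    rw [integral_const_mul, integral_add_right_eq_self (fun p : Spacetime d =>
      Complex.exp (-(Complex.I * (minkPairing b p : ℂ))) * h p)]
  simp_rw [h2]
  rw [integral_mul_const]
  ring

/-- A smooth function with compact support is a finite sum of such functions with support in the
members of a given open cover. -/
theorem IsCc.exists_finite_decomposition {V : Type*} [NormedAddCommGroup V] [NormedSpace ℝ V]
    [FiniteDimensional ℝ V] {f : V → ℂ} (hf : IsCc f) {W : V → Set V}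
    (hW : ∀ x ∈ tsupport f, IsOpen (W x) ∧ x ∈ W x) :
    ∃ (t : Finset V) (g : V → V → ℂ), (∀ x ∈ t, x ∈ tsupport f) ∧
      (∀ x ∈ t, IsCc (g x) ∧ tsupport (g x) ⊆ W x ∧ tsupport (g x) ⊆ tsupport f) ∧
      ∀ y, f y = ∑ x ∈ t, g x y := by
  obtain ⟨t, htf, hcov⟩ := hf.compact.isCompact.elim_nhds_subcover W
    fun x hx => (hW x hx).1.mem_nhds (hW x hx).2
  obtain ⟨ρ, hρ⟩ := SmoothPartitionOfUnity.exists_isSubordinate (modelWithCornersSelf ℝ V)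
    (isClosed_tsupport f) (fun x : t => W x) (fun x => (hW x (htf x x.2)).1)
    (fun y hy => by
      obtain ⟨x, hx, hyx⟩ := mem_iUnion₂.1 (hcov hy)
      exact mem_iUnion.2 ⟨⟨x, hx⟩, hyx⟩)
  classical
  refine ⟨t, fun x y => if hx : x ∈ t then ((ρ ⟨x, hx⟩ y : ℝ) : ℂ) * f y else 0, htf,
    fun x hx => ?_, fun y => ?_⟩
  · have e : (fun y => if hx : x ∈ t then ((ρ ⟨x, hx⟩ y : ℝ) : ℂ) * f y else 0)
        = fun y => ((ρ ⟨x, hx⟩ y : ℝ) : ℂ) * f y := by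
      funext y; rw [dif_pos hx]
    beta_reduce
    rw [e]
    refine ⟨hf.mul_left (Complex.ofRealCLM.contDiff.comp ((ρ ⟨x, hx⟩).contMDiff.contDiff)),
      ?_, closure_mono (Function.support_mul_subset_right _ _)⟩
    refine Subset.trans ?_ (hρ ⟨x, hx⟩)
    refine closure_mono fun y hy => ?_
    intro h0
    exact hy (by simp [h0])
  · by_cases hy : y ∈ tsupport f
    · have h1 := ρ.sum_eq_one hy
      rw [finsum_eq_sum_of_fintype] at h1
      rw [← Finset.sum_attach]
      have : ∀ x : {x // x ∈ t}, (if hx : (x : V) ∈ t then ((ρ ⟨x, hx⟩ y : ℝ) : ℂ) * f y else 0)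
          = ((ρ x y : ℝ) : ℂ) * f y := fun x => by rw [dif_pos x.2]
      simp_rw [this]
      rw [← Finset.sum_mul, ← Complex.ofReal_sum]
      have h2 : ∑ x ∈ t.attach, ρ x y = 1 := h1
      rw [h2, Complex.ofReal_one, one_mul]
    · have h0 := image_eq_zero_of_notMem_tsupport hy
      simp [h0]

end Spacetime

/-! ### Smearing of orbits -/

section Smear

variable {d : ℕ} {X : Type*} [NormedAddCommGroup X] [NormedSpace ℂ X]

/-- Bounded continuous functions on spacetime. -/
structure BddCont (Φ : Spacetime d → X) : Prop where
  cont : Continuous Φ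
  bdd : ∃ M, ∀ a, ‖Φ a‖ ≤ M

/-- The function `Φ` smeared with the inverse Fourier transform of `g`, translated to `b`. For
`Φ(a) = B(a)` this is the translate to `b` of the part of `B` with energy-momentum transfer cut off
by `g`, and for `Φ(a) = U(a)ψ` and `b = 0` it is `g(H, P)ψ`, both up to a constant. -/
def smear (g : Spacetime d → ℂ) (Φ : Spacetime d → X) (b : Spacetime d) : X :=
  ∫ a, inverseFourierST g (a - b) • Φ a

theorem smear_eq (g : Spacetime d → ℂ) (Φ : Spacetime d → X) (b : Spacetime d) :
    smear g Φ b = ∫ a, inverseFourierST g a • Φ (a + b) := by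
  rw [smear, ← integral_add_right_eq_self (fun a => inverseFourierST g (a - b) • Φ a) b]
  simp only [add_sub_cancel_right]

theorem integrable_smear {g : Spacetime d → ℂ} (hg : IsCc g) {Φ : Spacetime d → X} (hΦ : BddCont Φ)
    (b : Spacetime d) : Integrable fun a => inverseFourierST g (a - b) • Φ a := by
  obtain ⟨M, hM⟩ := hΦ.bdd
  exact ((integrable_inverseFourierST hg).comp_sub_right b).smul_bdd M
    hΦ.cont.aestronglyMeasurable (Eventually.of_forall hM)

theorem integrable_smear' {g : Spacetime d → ℂ} (hg : IsCc g) {Φ : Spacetime d → X}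
    (hΦ : BddCont Φ) (b : Spacetime d) :
    Integrable fun a => inverseFourierST g a • Φ (a + b) := by
  obtain ⟨M, hM⟩ := hΦ.bdd
  exact (integrable_inverseFourierST hg).smul_bdd M
    (hΦ.cont.comp (continuous_add_const b)).aestronglyMeasurable
    (Eventually.of_forall fun a => hM _)

theorem norm_smear_le {g : Spacetime d → ℂ} (hg : IsCc g) {Φ : Spacetime d → X} {M : ℝ}
    (hM : ∀ a, ‖Φ a‖ ≤ M) (b : Spacetime d) :
    ‖smear g Φ b‖ ≤ (∫ a, ‖inverseFourierST g a‖) * M := by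
  rw [smear_eq, ← integral_mul_const]
  refine norm_integral_le_of_norm_le ((integrable_inverseFourierST hg).norm.mul_const M)
    (Eventually.of_forall fun a => ?_)
  rw [norm_smul]
  exact mul_le_mul_of_nonneg_left (hM _) (norm_nonneg _)

theorem BddCont.smear {g : Spacetime d → ℂ} (hg : IsCc g) {Φ : Spacetime d → X} (hΦ : BddCont Φ) :
    BddCont (smear g Φ) := by
  obtain ⟨M, hM⟩ := hΦ.bdd
  refine ⟨?_, _, norm_smear_le hg hM⟩
  rw [show PropEst.smear g Φ = _ from funext (smear_eq g Φ)]
  refine continuous_of_dominated (bound := fun a => ‖inverseFourierST g a‖ * M)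
    (fun b => (integrable_smear' hg hΦ b).1) (fun b => Eventually.of_forall fun a => ?_)
    ((integrable_inverseFourierST hg).norm.mul_const M) (Eventually.of_forall fun a => ?_)
  · rw [norm_smul]
    exact mul_le_mul_of_nonneg_left (hM _) (norm_nonneg _)
  · have := hΦ.cont
    fun_prop

theorem smear_sum {α : Type*} (s : Finset α) {g : α → Spacetime d → ℂ} (hg : ∀ i ∈ s, IsCc (g i))
    {Φ : Spacetime d → X} (hΦ : BddCont Φ) (b : Spacetime d) :
    smear (fun q => ∑ i ∈ s, g i q) Φ b = ∑ i ∈ s, smear (g i) Φ b := by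
  simp only [smear]
  simp_rw [inverseFourierST_sum s hg, Finset.sum_smul]
  rw [integral_finsetSum _ fun i hi => integrable_smear (hg i hi) hΦ b]

theorem smear_sub {f g : Spacetime d → ℂ} (hf : IsCc f) (hg : IsCc g)
    {Φ : Spacetime d → X} (hΦ : BddCont Φ) (b : Spacetime d) :
    smear (fun q => f q - g q) Φ b = smear f Φ b - smear g Φ b := by
  simp only [smear]
  simp_rw [inverseFourierST_sub hf hg, sub_smul]
  rw [integral_sub (integrable_smear hf hΦ b) (integrable_smear hg hΦ b)]

theorem smear_const_mul (c : ℂ) (g : Spacetime d → ℂ) (Φ : Spacetime d → X) (b : Spacetime d) :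
    smear (fun q => c * g q) Φ b = c • smear g Φ b := by
  simp only [smear]
  simp_rw [inverseFourierST_const_mul, mul_smul]
  rw [integral_smul]

theorem map_smear [CompleteSpace X] {Y : Type*} [NormedAddCommGroup Y] [NormedSpace ℂ Y]
    [CompleteSpace Y] (T : X →L[ℂ] Y) {g : Spacetime d → ℂ} (hg : IsCc g) {Φ : Spacetime d → X}
    (hΦ : BddCont Φ) (b : Spacetime d) : T (smear g Φ b) = smear g (fun a => T (Φ a)) b := by
  simp only [smear]
  rw [← T.integral_comp_comm (integrable_smear hg hΦ b)]
  simp only [map_smul]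

theorem wt_sub_time_le (N : ℕ) (a : Spacetime d) {s t : ℝ} (hs : |s - t| ≤ 1)
    (x : EuclideanSpace ℝ (Fin d)) : wt N (a - (s, x)) ≤ 2 ^ N * wt N (a - (t, x)) := by
  have h1 := wt_mul_wt_sub_le N a ((s, x) : Spacetime d) (t, x)
  have h2 : ‖((s, x) : Spacetime d) - (t, x)‖ ≤ 1 := by
    rw [Prod.mk_sub_mk, sub_self, Prod.norm_mk, norm_zero]
    simpa using hs
  have h3 : (2 ^ N)⁻¹ ≤ wt N (((s, x) : Spacetime d) - (t, x)) := by
    unfold wt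
    refine inv_anti₀ (by positivity) (pow_le_pow_left₀ (by positivity) (by linarith) N)
  have h4 := mul_le_mul_of_nonneg_left h3 (wt_nonneg N (a - (s, x)))
  have h5 := h4.trans h1
  rwa [← div_eq_mul_inv, div_le_iff₀ (by positivity), mul_comm] at h5

/-- The time derivative of a smeared function. -/
theorem hasDerivAt_smear {g : Spacetime d → ℂ} (hg : IsCc g) {Φ : Spacetime d → X}
    (hΦ : BddCont Φ) (t : ℝ) (x : EuclideanSpace ℝ (Fin d)) :
    HasDerivAt (fun t => smear g Φ (t, x))
      (smear (fun q => Complex.I * (q.1 : ℂ) * g q) Φ (t, x)) t := by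
  have hg' : IsCc fun q : Spacetime d => Complex.I * (q.1 : ℂ) * g q :=
    hg.mul_left (contDiff_const.mul (Complex.ofRealCLM.contDiff.comp contDiff_fst))
  obtain ⟨M, hM⟩ := hΦ.bdd
  obtain ⟨C, hC0, hC⟩ := exists_norm_inverseFourierST_le_wt hg' (dimST d)
  have hd : ∀ (a : Spacetime d) (s : ℝ), HasDerivAt (fun s => inverseFourierST g (a - (s, x)))
      (inverseFourierST (fun q => Complex.I * (q.1 : ℂ) * g q) (a - (s, x))) s := fun a s => by
    have h1 := (hasDerivAt_inverseFourierST hg (a.1 - s) (a.2 - x)).comp_const_sub a.1 s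
    refine h1.congr_deriv ?_
    have h2 := inverseFourierST_const_mul (-1) (fun q => -(Complex.I * (q.1 : ℂ)) * g q)
      (a - (s, x))
    rw [neg_one_mul] at h2
    refine h2.symm.trans ?_
    congr 1; funext q; ring
  unfold smear
  refine (hasDerivAt_integral_of_dominated_loc_of_deriv_le (x₀ := t) (s := Metric.ball t 1)
    (bound := fun a => C * (2 ^ dimST d * wt (dimST d) (a - (t, x))) * M)
    (F' := fun s a => inverseFourierST (fun q => Complex.I * (q.1 : ℂ) * g q) (a - (s, x)) • Φ a)
    (Metric.ball_mem_nhds t one_pos)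
    (Eventually.of_forall fun s => (integrable_smear hg hΦ _).1)
    (integrable_smear hg hΦ _) (integrable_smear hg' hΦ _).1
    (Eventually.of_forall fun a s hs => ?_)
    (((integrable_wt_dimST.comp_sub_right _).const_mul _).const_mul _ |>.mul_const M)
    (Eventually.of_forall fun a s _ => (hd a s).smul_const (Φ a))).2
  rw [norm_smul]
  have h1 : |s - t| ≤ 1 := by
    rw [Metric.mem_ball, Real.dist_eq] at hs
    exact hs.le
  have h2 := (hC (a - (s, x))).trans (mul_le_mul_of_nonneg_left (wt_sub_time_le (dimST d) a h1 x) hC0)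
  have h3 := wt_nonneg (dimST d) (a - (t, x))
  exact mul_le_mul h2 (hM a) (norm_nonneg _) (by positivity)

/-- Convolution of a smeared function in the space variables. -/
theorem integral_invF_smul_smear [CompleteSpace X] {σ : EuclideanSpace ℝ (Fin d) → ℂ}
    (hσ : IsCc σ) {g : Spacetime d → ℂ} (hg : IsCc g) {Φ : Spacetime d → X} (hΦ : BddCont Φ)
    (t : ℝ) (x : EuclideanSpace ℝ (Fin d)) :
    ∫ r, invF σ r • smear g Φ (t, x - r) = smear (fun q => σ (-q.2) * g q) Φ (t, x) := by
  obtain ⟨M, hM⟩ := hΦ.bdd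
  obtain ⟨C, hC0, hC⟩ := exists_norm_inverseFourierST_le_wt hg (dimST d)
  obtain ⟨C', hC'0, hC'⟩ := exists_norm_invF_le_wt hσ.smooth hσ.compact (dimST d + (d + 1))
  have hσc := continuous_invF (hσ.integrable (μ := volume))
  have hgc := continuous_inverseFourierST hg
  have hint : Integrable (Function.uncurry fun (r : EuclideanSpace ℝ (Fin d)) (a : Spacetime d) =>
      invF σ r • inverseFourierST g (a - (t, x - r)) • Φ a) := by
    refine (((integrable_wt (V := EuclideanSpace ℝ (Fin d)) (N := d + 1) (by simp)).mul_prod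
      ((integrable_wt_dimST (d := d)).comp_sub_right (t, x))).const_mul (C' * C * M)).mono'
      (Continuous.aestronglyMeasurable ?_) (Eventually.of_forall fun z => ?_)
    · have := hΦ.cont
      rw [Function.uncurry_def]
      fun_prop
    · obtain ⟨r, a⟩ := z
      simp only [Function.uncurry, norm_smul]
      have h1 : wt (dimST d) r * wt (dimST d) (a - (t, x - r)) ≤ wt (dimST d) (a - (t, x)) := by
        have h := wt_mul_wt_le (dimST d) ((0, -r) : Spacetime d) (a - (t, x - r))
        have e1 : ((0, -r) : Spacetime d) + (a - (t, x - r)) = a - (t, x) := by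
          refine Prod.ext ?_ ?_
          · simp
          · simp only [Prod.snd_add, Prod.snd_sub]; abel
        have e2 : wt (dimST d) ((0, -r) : Spacetime d) = wt (dimST d) r := by
          simp [wt, Prod.norm_mk]
        rwa [e1, e2] at h
      have h2 := wt_nonneg (dimST d) r
      have h3 := wt_nonneg (d + 1) r
      have h4 := wt_nonneg (dimST d) (a - (t, x - r))
      have hM0 : 0 ≤ M := (norm_nonneg _).trans (hM a)
      have h5 := hC' r
      rw [wt_add] at h5
      calc ‖invF σ r‖ * (‖inverseFourierST g (a - (t, x - r))‖ * ‖Φ a‖)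
          ≤ (C' * (wt (dimST d) r * wt (d + 1) r)) * (C * wt (dimST d) (a - (t, x - r)) * M) := by
            gcongr
            · exact hC _
            · exact hM a
        _ = C' * C * M * (wt (d + 1) r * (wt (dimST d) r * wt (dimST d) (a - (t, x - r)))) := by ring
        _ ≤ _ := by gcongr
  simp only [smear]
  simp_rw [← integral_smul (invF σ _)]
  rw [integral_integral_swap hint]
  congr 1; funext a
  simp_rw [smul_smul]
  rw [integral_smul_const, show a - (t, x) = (a.1 - t, a.2 - x) from rfl,
    ← integral_invF_mul_inverseFourierST hσ hg]
  congr 2; funext r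
  congr 2
  refine Prod.ext ?_ ?_
  · simp
  · simp only [Prod.snd_sub]; abel

theorem inverseFourierST_comp_smul (f : Spacetime d → ℂ) {ε : ℝ} (hε : 0 < ε) (a : Spacetime d) :
    inverseFourierST (fun q => f (ε • q)) (ε • a)
      = ((ε ^ Module.finrank ℝ (Spacetime d) : ℝ) : ℂ)⁻¹ * inverseFourierST f a := by
  simp only [inverseFourierST]
  have h := Measure.integral_comp_smul_of_nonneg (volume : Measure (Spacetime d))
    (fun q => Complex.exp (-(Complex.I * (minkPairing a q : ℂ))) * f q) ε (hR := hε.le)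
  rw [Complex.real_smul, Complex.ofReal_inv] at h
  rw [mul_left_comm, ← h]
  congr 2; funext q
  have : minkPairing (ε • a) q = minkPairing a (ε • q) := by
    simp [minkPairing, inner_smul_left, inner_smul_right, mul_left_comm, mul_assoc]
  rw [this]

/-- A smooth cutoff which equals one near the bounded set that carries the Fourier transform of `Φ`
acts as the identity. -/
theorem smear_eq_of_eventually_eq_one [CompleteSpace X] {Φ : Spacetime d → X} (hΦ : BddCont Φ)
    {S : Set (Spacetime d)} (hS : Bornology.IsBounded S)
    (h0 : ∀ h, IsCc h → Disjoint (tsupport h) S → smear h Φ 0 = 0)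
    {f : Spacetime d → ℂ} (hf : IsCc f) (hf1 : ∀ q ∈ S, ∀ᶠ p in nhds q, f p = 1) :
    smear f Φ 0 = kap d • Φ 0 := by
  obtain ⟨χ₀, hχs, hχc, hχ1, -, -⟩ := exists_smooth_cutoff
    (isCompact_closedBall (0 : Spacetime d) 1) isOpen_univ (subset_univ _)
  set χ : Spacetime d → ℂ := fun q => ((χ₀ q : ℝ) : ℂ)
  have hχ : IsCc χ := isCc_ofReal hχs hχc
  have hχ1' : ∀ q ∈ Metric.closedBall (0 : Spacetime d) 1, χ q = 1 := fun q hq => by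
    simp only [χ]
    rw [hχ1.self_of_nhdsSet q hq, Complex.ofReal_one]
  set G : ℝ → X := fun ε => ∫ a, inverseFourierST χ a • Φ (ε • a)
  obtain ⟨M, hM⟩ := hΦ.bdd
  have hχi := integrable_inverseFourierST hχ
  have hχcont := continuous_inverseFourierST hχ
  have hΦc := hΦ.cont
  have hG : Continuous G := by
    refine continuous_of_dominated (bound := fun a => ‖inverseFourierST χ a‖ * M)
      (fun ε => Continuous.aestronglyMeasurable (by fun_prop))
      (fun ε => Eventually.of_forall fun a => ?_) (hχi.norm.mul_const M)
      (Eventually.of_forall fun a => by fun_prop)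
    rw [norm_smul]
    exact mul_le_mul_of_nonneg_left (hM _) (norm_nonneg _)
  have hG0 : G 0 = kap d • Φ 0 := by
    simp only [G, zero_smul]
    rw [integral_smul_const]
    have h1 := integral_exp_mul_inverseFourierST hχ 0
    have h2 : ∀ a : Spacetime d, minkPairing a 0 = 0 := fun a => by simp [minkPairing]
    simp only [h2, Complex.ofReal_zero, mul_zero, Complex.exp_zero, one_mul] at h1
    rw [h1, hχ1' 0 (by simp), mul_one]
  obtain ⟨R, hR0, hR⟩ := hS.subset_ball_lt 0 0
  have hGε : ∀ ε, 0 < ε → ε < R⁻¹ → G ε = smear f Φ 0 := fun ε hε hεR => by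
    have hχε : IsCc fun q => χ (ε • q) :=
      hχ.comp_equiv (ContinuousLinearEquiv.smulLeft (Units.mk0 ε hε.ne'))
    have h1 : smear (fun q => χ (ε • q)) Φ 0 = G ε := by
      rw [smear_eq]
      simp only [add_zero, G]
      have h := Measure.integral_comp_smul_of_nonneg (volume : Measure (Spacetime d))
        (fun a => inverseFourierST (fun q => χ (ε • q)) a • Φ a) ε (hR := hε.le)
      simp_rw [inverseFourierST_comp_smul χ hε, mul_smul] at h
      rw [integral_smul, ← Complex.ofReal_inv, Complex.coe_smul] at h
      exact (smul_right_injective X (inv_ne_zero (pow_ne_zero _ hε.ne')) h).symm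
    rw [← h1, ← sub_eq_zero, ← smear_sub hχε hf hΦ]
    refine h0 _ (hχε.sub hf) ?_
    rw [Set.disjoint_right]
    intro q hq
    rw [notMem_tsupport_iff_eventuallyEq]
    filter_upwards [hf1 q hq, Metric.isOpen_ball.mem_nhds (hR hq)] with p hp hpR
    rw [hp, hχ1' _ ?_, sub_self]
    · rfl
    · rw [mem_closedBall_zero_iff, norm_smul, Real.norm_of_nonneg hε.le]
      rw [mem_ball_zero_iff] at hpR
      calc ε * ‖p‖ ≤ R⁻¹ * R := by gcongr
        _ = 1 := inv_mul_cancel₀ hR0.ne'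
  have hlim : Tendsto G (nhdsWithin 0 (Ioi 0)) (nhds (G 0)) :=
    (hG.tendsto 0).mono_left nhdsWithin_le_nhds
  rw [← hG0]
  refine tendsto_nhds_unique (tendsto_const_nhds.congr' ?_) hlim
  filter_upwards [Ioo_mem_nhdsGT (inv_pos.2 hR0)] with ε hε
  exact (hGε ε hε.1 hε.2).symm

end Smear

/-! ### Translations and spectral subspaces -/

section Translations

variable {d : ℕ} {𝓗 : Type*} [NormedAddCommGroup 𝓗] [InnerProductSpace ℂ 𝓗] [CompleteSpace 𝓗]
  (U : Multiplicative (Spacetime d) →* unitary (𝓗 →L[ℂ] 𝓗))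

theorem transl_add (a b : Spacetime d) : transl U (a + b) = transl U a * transl U b := by
  simp [transl, ofAdd_add]

theorem transl_zero : transl U 0 = 1 := by simp [transl]

theorem star_transl (a : Spacetime d) : star (transl U a) = transl U (-a) := by
  rw [transl, transl, ofAdd_neg, map_inv]
  rfl

theorem transl_zero_apply (ψ : 𝓗) : transl U 0 ψ = ψ := by rw [transl_zero]; rfl

theorem transl_apply_transl (a b : Spacetime d) (ψ : 𝓗) :
    transl U a (transl U b ψ) = transl U (a + b) ψ := by
  rw [transl_add]; rfl

theorem inner_transl_left (a : Spacetime d) (φ ψ : 𝓗) :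
    inner ℂ (transl U a φ) ψ = inner ℂ φ (transl U (-a) ψ) := by
  rw [← star_transl, ContinuousLinearMap.star_eq_adjoint, ContinuousLinearMap.adjoint_inner_right]

theorem norm_transl_apply (a : Spacetime d) (ψ : 𝓗) : ‖transl U a ψ‖ = ‖ψ‖ := by
  rw [norm_eq_sqrt_re_inner (𝕜 := ℂ), norm_eq_sqrt_re_inner (𝕜 := ℂ) ψ, inner_transl_left,
    transl_apply_transl, neg_add_cancel, transl_zero]
  rfl

theorem inner_transl_transl (a b : Spacetime d) (φ ψ : 𝓗) :
    inner ℂ (transl U a φ) (transl U b ψ) = inner ℂ φ (transl U (b - a) ψ) := by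
  rw [inner_transl_left, transl_apply_transl, neg_add_eq_sub]

theorem translOp_apply (a : Spacetime d) (B : 𝓗 →L[ℂ] 𝓗) (ψ : 𝓗) :
    translOp U a B ψ = transl U a (B (transl U (-a) ψ)) := by
  rw [translOp, star_transl]; rfl

theorem translOp_zero (B : 𝓗 →L[ℂ] 𝓗) : translOp U 0 B = B := by
  ext ψ; rw [translOp_apply, neg_zero, transl_zero]; rfl

theorem translOp_translOp (a b : Spacetime d) (B : 𝓗 →L[ℂ] 𝓗) :
    translOp U a (translOp U b B) = translOp U (a + b) B := by
  ext ψ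
  simp only [translOp_apply, transl_apply_transl]
  rw [neg_add_rev]

theorem translOp_mul (a : Spacetime d) (A B : 𝓗 →L[ℂ] 𝓗) :
    translOp U a (A * B) = translOp U a A * translOp U a B := by
  ext ψ
  change _ = translOp U a A (translOp U a B ψ)
  simp only [translOp_apply, transl_apply_transl, neg_add_cancel, transl_zero_apply]
  rfl

theorem translOp_star (a : Spacetime d) (B : 𝓗 →L[ℂ] 𝓗) :
    translOp U a (star B) = star (translOp U a B) := by
  simp [translOp, mul_assoc]

theorem norm_translOp_le (a : Spacetime d) (B : 𝓗 →L[ℂ] 𝓗) : ‖translOp U a B‖ ≤ ‖B‖ :=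
  ContinuousLinearMap.opNorm_le_bound _ (norm_nonneg _) fun ψ => by
    rw [translOp_apply, norm_transl_apply]
    refine (B.le_opNorm _).trans (le_of_eq ?_)
    rw [norm_transl_apply]

theorem transl_translOp (a : Spacetime d) (B : 𝓗 →L[ℂ] 𝓗) (ψ : 𝓗) :
    transl U a (B ψ) = translOp U a B (transl U a ψ) := by
  rw [translOp_apply, transl_apply_transl, neg_add_cancel, transl_zero]; rfl

/-- `B ↦ U(a) B U(a)*` as a linear map. -/
def translL (a : Spacetime d) : (𝓗 →L[ℂ] 𝓗) →L[ℂ] (𝓗 →L[ℂ] 𝓗) :=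
  LinearMap.mkContinuous
    { toFun := translOp U a
      map_add' := fun A B => by simp [translOp, mul_add, add_mul]
      map_smul' := fun c A => by simp [translOp] } 1 fun B => by
    rw [one_mul]; exact norm_translOp_le U a B

theorem translL_apply (a : Spacetime d) (B : 𝓗 →L[ℂ] 𝓗) : translL U a B = translOp U a B := rfl

theorem smear_translOp (a b : Spacetime d) {g : Spacetime d → ℂ} (hg : IsCc g) {B : 𝓗 →L[ℂ] 𝓗}
    (hB : BddCont fun a => translOp U a B) :
    translOp U a (smear g (fun a => translOp U a B) b) = smear g (fun a => translOp U a B) (a + b) := by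
  rw [smear_eq, smear_eq, ← translL_apply, ← ContinuousLinearMap.integral_comp_comm _
    (integrable_smear' hg hB b)]
  congr 1; funext c
  rw [map_smul, translL_apply, translOp_translOp]
  congr 2; abel

variable {U} (hU : ∀ ψ : 𝓗, Continuous fun a : Spacetime d => transl U a ψ)

include hU

theorem bddCont_transl (ψ : 𝓗) : BddCont fun a => transl U a ψ :=
  ⟨hU ψ, ‖ψ‖, fun a => (norm_transl_apply U a ψ).le⟩

omit hU

variable (U) in
/-- The vectors with energy-momentum in the closure of `S`: they are annihilated by `h(H, P)` for
all test functions `h` with support disjoint from `S`. -/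
def specSub (S : Set (Spacetime d)) : Set 𝓗 :=
  {ψ | ∀ h, IsCc h → Disjoint (tsupport h) S → smear h (fun a => transl U a ψ) 0 = 0}

theorem specSub_mono {S S' : Set (Spacetime d)} (h : S ⊆ S') : specSub U S ⊆ specSub U S' :=
  fun _ hψ k hk hd => hψ k hk (hd.mono_right h)

include hU

theorem specSub_add {S : Set (Spacetime d)} {φ ψ : 𝓗} (hφ : φ ∈ specSub U S)
    (hψ : ψ ∈ specSub U S) : φ + ψ ∈ specSub U S := fun h hh hd => by
  simp only [smear, map_add, smul_add]
  rw [integral_add (integrable_smear hh (bddCont_transl hU φ) 0)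
    (integrable_smear hh (bddCont_transl hU ψ) 0)]
  have h1 := hφ h hh hd
  have h2 := hψ h hh hd
  simp only [smear] at h1 h2
  rw [h1, h2, add_zero]

theorem smear_transl_map (T : 𝓗 →L[ℂ] 𝓗) (hT : ∀ a φ, transl U a (T φ) = T (transl U a φ))
    {h : Spacetime d → ℂ} (hh : IsCc h) (ψ : 𝓗) :
    smear h (fun a => transl U a (T ψ)) 0 = T (smear h (fun a => transl U a ψ) 0) := by
  rw [map_smear T hh (bddCont_transl hU ψ)]
  simp_rw [hT]

theorem specSub_map (T : 𝓗 →L[ℂ] 𝓗) (hT : ∀ a φ, transl U a (T φ) = T (transl U a φ))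
    {S : Set (Spacetime d)} {ψ : 𝓗} (hψ : ψ ∈ specSub U S) : T ψ ∈ specSub U S := fun h hh hd => by
  rw [smear_transl_map hU T hT hh, hψ h hh hd, map_zero]

theorem specSub_smul {S : Set (Spacetime d)} (c : ℂ) {ψ : 𝓗} (hψ : ψ ∈ specSub U S) :
    c • ψ ∈ specSub U S :=
  specSub_map hU (c • ContinuousLinearMap.id ℂ 𝓗) (fun a φ => by simp) hψ

theorem specSub_transl {S : Set (Spacetime d)} (b : Spacetime d) {ψ : 𝓗} (hψ : ψ ∈ specSub U S) :
    transl U b ψ ∈ specSub U S :=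
  specSub_map hU (transl U b) (fun a φ => by
    rw [transl_apply_transl, transl_apply_transl, add_comm]) hψ

/-- Existence of the spectral measure of a vector. -/
theorem exists_spectralMeasure (ψ : 𝓗) : ∃ μ : Measure (Spacetime d), IsFiniteMeasure μ ∧
    ∀ a, inner ℂ ψ (transl U a ψ) = ∫ q, Complex.exp (Complex.I * (minkPairing a q : ℂ)) ∂μ := by
  obtain ⟨μ, hμ, hc⟩ := exists_measure_of_orbit (V := EST d)
    (T := fun v => transl U ((posE d).symm v) ψ) ((hU ψ).comp (posE d).symm.continuous)
    (g := fun v => inner ℂ ψ (transl U ((posE d).symm v) ψ)) (fun a b => by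
      rw [inner_transl_transl, map_sub])
  refine ⟨μ.map fun z => -(toE d).symm z, inferInstance, fun a => ?_⟩
  have hm : Continuous fun z => -(toE d).symm z := (toE d).symm.continuous.neg
  have hcont : Continuous fun q : Spacetime d => Complex.exp (Complex.I * (minkPairing a q : ℂ)) := by
    have := continuous_minkPairing (d := d)
    fun_prop
  rw [integral_map hm.aemeasurable hcont.aestronglyMeasurable]
  have h1 := hc (posE d a)
  rw [ContinuousLinearEquiv.symm_apply_apply] at h1
  rw [← h1, charFun_apply]
  congr 1; funext z
  have h2 := inner_posE_toE a ((toE d).symm z)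
  rw [ContinuousLinearEquiv.apply_symm_apply] at h2
  rw [minkPairing_neg_right, ← h2, real_inner_comm, mul_comm]

/-- Matrix elements of `h(H, P)ψ` in terms of the spectral measure of `ψ`. -/
theorem inner_transl_smear {ψ : 𝓗} {μ : Measure (Spacetime d)} [IsFiniteMeasure μ]
    (hμ : ∀ a, inner ℂ ψ (transl U a ψ) = ∫ q, Complex.exp (Complex.I * (minkPairing a q : ℂ)) ∂μ)
    {h : Spacetime d → ℂ} (hh : IsCc h) (b : Spacetime d) :
    inner ℂ (transl U b ψ) (smear h (fun a => transl U a ψ) 0)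
      = ∫ q, Complex.exp (-(Complex.I * (minkPairing b q : ℂ))) * (kap d * h q) ∂μ := by
  have h1 : inner ℂ (transl U b ψ) (smear h (fun a => transl U a ψ) 0)
      = ∫ a, inverseFourierST h a * inner ℂ ψ (transl U (a - b) ψ) := by
    rw [smear, ← integral_inner (integrable_smear hh (bddCont_transl hU ψ) 0)]
    congr 1; funext a
    rw [inner_smul_right, inner_transl_transl, sub_zero]
  have hint : Integrable (Function.uncurry fun (a q : Spacetime d) => inverseFourierST h a
      * Complex.exp (Complex.I * (minkPairing (a - b) q : ℂ))) (volume.prod μ) := by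
    refine ((integrable_inverseFourierST hh).mul_prod (integrable_const (μ := μ) (1 : ℂ))).norm.mono'
      (Continuous.aestronglyMeasurable ?_) (Eventually.of_forall fun z => ?_)
    · have := continuous_minkPairing (d := d)
      have := continuous_inverseFourierST hh
      rw [Function.uncurry_def]
      fun_prop
    · simp only [Function.uncurry]
      rw [norm_mul, norm_exp_I_mul_ofReal, mul_one, mul_one]
  rw [h1]
  simp_rw [hμ, ← integral_const_mul (inverseFourierST h _)]
  rw [integral_integral_swap hint]
  congr 1; funext q
  rw [← integral_exp_mul_inverseFourierST hh, ← integral_const_mul]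
  congr 1; funext a
  have : Complex.exp (Complex.I * (minkPairing (a - b) q : ℂ))
      = Complex.exp (-(Complex.I * (minkPairing b q : ℂ)))
        * Complex.exp (Complex.I * (minkPairing a q : ℂ)) := by
    rw [← Complex.exp_add, minkPairing_sub_left]
    congr 1; push_cast; ring
  rw [this]; ring

/-- The spectral measure of `h(H, P)ψ` is `|h|²` times that of `ψ`. -/
theorem inner_smear_transl_smear {ψ : 𝓗} {μ : Measure (Spacetime d)} [IsFiniteMeasure μ]
    (hμ : ∀ a, inner ℂ ψ (transl U a ψ) = ∫ q, Complex.exp (Complex.I * (minkPairing a q : ℂ)) ∂μ)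
    {h : Spacetime d → ℂ} (hh : IsCc h) (b : Spacetime d) :
    inner ℂ (smear h (fun a => transl U a ψ) 0) (transl U b (smear h (fun a => transl U a ψ) 0))
      = ∫ q, Complex.exp (Complex.I * (minkPairing b q : ℂ)) * ((‖kap d * h q‖ ^ 2 : ℝ) : ℂ) ∂μ := by
  set Φ := smear h (fun a => transl U a ψ) 0 with hΦ
  have hhi : Integrable (fun q => kap d * h q) μ := hh.integrable.const_mul _
  have h1 : inner ℂ Φ (transl U b Φ) = ∫ a, (starRingEnd ℂ) (inverseFourierST h a)
      * inner ℂ (transl U (a - b) ψ) Φ := by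
    have e : inner ℂ (transl U b Φ) Φ = ∫ a, inverseFourierST h a * inner ℂ (transl U b Φ) (transl U a ψ) := by
      have e0 : Φ = ∫ a, inverseFourierST h (a - 0) • transl U a ψ := rfl
      generalize transl U b Φ = χ
      rw [e0, ← integral_inner (integrable_smear hh (bddCont_transl hU ψ) 0)]
      congr 1; funext a
      rw [inner_smul_right, sub_zero]
    rw [← inner_conj_symm, e, ← integral_conj]
    congr 1; funext a
    rw [map_mul, inner_conj_symm, inner_transl_transl, ← neg_sub, ← inner_transl_left]
  have hint : Integrable (Function.uncurry fun (a q : Spacetime d) =>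
      (starRingEnd ℂ) (inverseFourierST h a)
      * (Complex.exp (-(Complex.I * (minkPairing (a - b) q : ℂ))) * (kap d * h q)))
      (volume.prod μ) := by
    refine ((integrable_inverseFourierST hh).mul_prod hhi).norm.mono'
      (Continuous.aestronglyMeasurable ?_) (Eventually.of_forall fun z => ?_)
    · have := continuous_minkPairing (d := d)
      have := continuous_inverseFourierST hh
      have := hh.smooth.continuous
      rw [Function.uncurry_def]
      fun_prop
    · simp only [Function.uncurry]
      rw [norm_mul, norm_mul, norm_mul, norm_exp_neg_I_mul_ofReal, one_mul, RCLike.norm_conj,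
        norm_mul (inverseFourierST h z.1), norm_mul]
  rw [h1]
  simp_rw [hΦ, inner_transl_smear hU hμ hh, ← integral_const_mul ((starRingEnd ℂ) _)]
  rw [integral_integral_swap hint]
  congr 1; funext q
  have h2 : ((‖kap d * h q‖ ^ 2 : ℝ) : ℂ)
      = (starRingEnd ℂ) (kap d * h q) * (kap d * h q) := by
    rw [Complex.conj_mul']; norm_cast
  rw [h2, ← integral_exp_mul_inverseFourierST hh, ← integral_conj, ← integral_mul_const,
    ← integral_const_mul]
  congr 1; funext a
  have : Complex.exp (-(Complex.I * (minkPairing (a - b) q : ℂ)))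
      = Complex.exp (Complex.I * (minkPairing b q : ℂ))
        * (starRingEnd ℂ) (Complex.exp (Complex.I * (minkPairing a q : ℂ))) := by
    rw [← Complex.exp_conj, ← Complex.exp_add, minkPairing_sub_left, map_mul, Complex.conj_I,
      Complex.conj_ofReal]
    congr 1; push_cast; ring
  rw [this, map_mul]; ring

theorem norm_smear_transl_sq {ψ : 𝓗} {μ : Measure (Spacetime d)} [IsFiniteMeasure μ]
    (hμ : ∀ a, inner ℂ ψ (transl U a ψ) = ∫ q, Complex.exp (Complex.I * (minkPairing a q : ℂ)) ∂μ)
    {h : Spacetime d → ℂ} (hh : IsCc h) :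
    ‖smear h (fun a => transl U a ψ) 0‖ ^ 2 = ∫ q, ‖kap d * h q‖ ^ 2 ∂μ := by
  have h1 := inner_smear_transl_smear hU hμ hh 0
  rw [transl_zero_apply, inner_self_eq_norm_sq_to_K] at h1
  have h2 : ∀ q : Spacetime d, minkPairing 0 q = 0 := fun q => by simp [minkPairing]
  simp only [h2, Complex.ofReal_zero, mul_zero, Complex.exp_zero, one_mul] at h1
  rw [integral_complex_ofReal] at h1
  exact Complex.ofReal_injective (by rw [← h1]; norm_cast)

theorem smear_transl_eq_zero {ψ : 𝓗} {μ : Measure (Spacetime d)} [IsFiniteMeasure μ]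
    (hμ : ∀ a, inner ℂ ψ (transl U a ψ) = ∫ q, Complex.exp (Complex.I * (minkPairing a q : ℂ)) ∂μ)
    {h : Spacetime d → ℂ} (hh : IsCc h) (h0 : ∀ᵐ q ∂μ, h q = 0) :
    smear h (fun a => transl U a ψ) 0 = 0 := by
  have h1 := norm_smear_transl_sq hU hμ hh
  rw [integral_eq_zero_of_ae] at h1
  · simpa using h1
  · filter_upwards [h0] with q hq
    simp [hq]

theorem mem_specSub_of_inSpectralSubspace {Δ : Set (Spacetime d)} {ψ : 𝓗}
    (hψ : InSpectralSubspace U Δ ψ) : ψ ∈ specSub U Δ := fun h hh hd => by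
  obtain ⟨μ, hμf, hμ, h0⟩ := hψ
  refine smear_transl_eq_zero hU hμ hh ?_
  have h1 : ∀ᵐ q ∂μ, q ∈ Δ := h0
  filter_upwards [h1] with q hq
  exact image_eq_zero_of_notMem_tsupport fun h' => Set.disjoint_left.1 hd h' hq

theorem inSpectralSubspace_smear (ψ : 𝓗) {V : Set (Spacetime d)} {h : Spacetime d → ℂ}
    (hh : IsCc h) (hV : tsupport h ⊆ V) :
    InSpectralSubspace U V (smear h (fun a => transl U a ψ) 0) := by
  obtain ⟨μ, hμf, hμ⟩ := exists_spectralMeasure hU ψ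
  have hhc := hh.smooth.continuous
  have hm : Measurable fun q => ENNReal.ofReal (‖kap d * h q‖ ^ 2) :=
    (ENNReal.continuous_ofReal.comp (by fun_prop)).measurable
  have hi : Integrable (fun q => ‖kap d * h q‖ ^ 2) μ := by
    refine Continuous.integrable_of_hasCompactSupport (by fun_prop) ?_
    exact hh.compact.comp_left (g := fun z => ‖kap d * z‖ ^ 2) (by simp)
  refine ⟨μ.withDensity fun q => ENNReal.ofReal (‖kap d * h q‖ ^ 2),
    isFiniteMeasure_withDensity_ofReal hi.2, fun a => ?_, ?_⟩
  · rw [inner_smear_transl_smear hU hμ hh, integral_withDensity_eq_integral_toReal_smul hm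
      (Eventually.of_forall fun q => ENNReal.ofReal_lt_top)]
    congr 1; funext q
    rw [ENNReal.toReal_ofReal (by positivity), Complex.real_smul, mul_comm]
  · refine withDensity_apply_eq_zero' hm.aemeasurable |>.2 ?_
    have : {q | ENNReal.ofReal (‖kap d * h q‖ ^ 2) ≠ 0} ∩ Vᶜ = ∅ := by
      ext q
      simp only [mem_inter_iff, mem_compl_iff, mem_empty_iff_false, iff_false, not_and, not_not]
      intro hq
      refine hV (subset_tsupport _ fun h0 => hq ?_)
      simp [h0]
    rw [this, measure_empty]

/-- A set is null for the spectral measure of `ψ` if `h(H, P)ψ = 0` for all `h` supported there. -/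
theorem spectralMeasure_eq_zero {ψ : 𝓗} {μ : Measure (Spacetime d)} [IsFiniteMeasure μ]
    (hμ : ∀ a, inner ℂ ψ (transl U a ψ) = ∫ q, Complex.exp (Complex.I * (minkPairing a q : ℂ)) ∂μ)
    {S : Set (Spacetime d)} (hS : ∀ q ∉ S, ∃ V, IsOpen V ∧ q ∈ V ∧ ∀ h, IsCc h → tsupport h ⊆ V →
      smear h (fun a => transl U a ψ) 0 = 0) : μ Sᶜ = 0 := by
  refine measure_null_of_locally_null _ fun q hq => ?_
  obtain ⟨V, hVo, hqV, hV⟩ := hS q hq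
  obtain ⟨χ, hχs, hχc, hχ1, hχV, -⟩ := exists_smooth_cutoff (isCompact_singleton (x := q)) hVo
    (singleton_subset_iff.2 hqV)
  have hχ : IsCc fun q => ((χ q : ℝ) : ℂ) := isCc_ofReal hχs hχc
  have hsub : tsupport (fun q => ((χ q : ℝ) : ℂ)) ⊆ V := by
    refine Subset.trans (closure_mono fun y hy => ?_) hχV
    intro h0
    exact hy (by simp [h0])
  have h1 := norm_smear_transl_sq hU hμ hχ
  rw [hV _ hχ hsub, norm_zero, zero_pow two_ne_zero, eq_comm] at h1
  have hcont : Continuous fun q => ‖kap d * ((χ q : ℝ) : ℂ)‖ ^ 2 := by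
    have := hχs.continuous
    fun_prop
  have hi : Integrable (fun q => ‖kap d * ((χ q : ℝ) : ℂ)‖ ^ 2) μ := by
    refine Continuous.integrable_of_hasCompactSupport hcont ?_
    exact hχc.comp_left (g := fun z : ℝ => ‖kap d * (z : ℂ)‖ ^ 2) (by simp)
  rw [integral_eq_zero_iff_of_nonneg (fun q => by positivity) hi] at h1
  rw [nhdsSet_singleton] at hχ1
  refine ⟨{p | χ p = 1}, mem_nhdsWithin_of_mem_nhds hχ1, ?_⟩
  refine measure_mono_null (fun p hp => ?_) h1
  intro h2
  have hp' : χ p = 1 := hp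
  simp [hp', kap_ne_zero] at h2

omit hU in
theorem eq_zero_of_spectralMeasure {ψ : 𝓗} {μ : Measure (Spacetime d)}
    (hμ : ∀ a, inner ℂ ψ (transl U a ψ) = ∫ q, Complex.exp (Complex.I * (minkPairing a q : ℂ)) ∂μ)
    (h0 : μ univ = 0) : ψ = 0 := by
  have h1 := hμ 0
  rw [Measure.measure_univ_eq_zero.1 h0, integral_zero_measure, transl_zero_apply,
    inner_self_eq_zero] at h1
  exact h1

theorem exists_nhds_smear_eq_zero (ψ : 𝓗) {q : Spacetime d} (hq : q ∉ jointSpectrum U) :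
    ∃ V, IsOpen V ∧ q ∈ V ∧ ∀ h, IsCc h → tsupport h ⊆ V →
      smear h (fun a => transl U a ψ) 0 = 0 := by
  simp only [jointSpectrum, Set.mem_ofPred_eq, not_forall, not_exists, not_and] at hq
  obtain ⟨V, hVo, hqV, hV⟩ := hq
  refine ⟨V, hVo, hqV, fun h hh hs => ?_⟩
  by_contra hne
  exact hV _ hne (inSpectralSubspace_smear hU ψ hh hs)

/-- There are no vectors with energy-momentum in a closed set disjoint from the spectrum. -/
theorem eq_zero_of_mem_specSub {S : Set (Spacetime d)} (hS : IsClosed S)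
    (hd : Disjoint S (jointSpectrum U)) {ψ : 𝓗} (hψ : ψ ∈ specSub U S) : ψ = 0 := by
  obtain ⟨μ, hμf, hμ⟩ := exists_spectralMeasure hU ψ
  refine eq_zero_of_spectralMeasure hμ ?_
  have h := spectralMeasure_eq_zero hU hμ (S := ∅) fun q _ => ?_
  · simpa using h
  by_cases hq : q ∈ S
  · exact exists_nhds_smear_eq_zero hU ψ (Set.disjoint_left.1 hd hq)
  · exact ⟨Sᶜ, hS.isOpen_compl, hq, fun h hh hs =>
      hψ h hh (Set.disjoint_left.2 fun x hx hxS => hs hx hxS)⟩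

/-- An operator with energy-momentum transfer in the support of `g` shifts the spectral subspaces
accordingly. -/
theorem smear_translOp_mem_specSub {B : 𝓗 →L[ℂ] 𝓗} (hB : BddCont fun a => translOp U a B)
    {g : Spacetime d → ℂ} (hg : IsCc g) {S : Set (Spacetime d)} {ψ : 𝓗} (hψ : ψ ∈ specSub U S) :
    smear g (fun a => translOp U a B) 0 ψ ∈ specSub U {p | ∃ s ∈ S, ∃ q ∈ tsupport g, p = s + q} := by
  intro h hh hd
  obtain ⟨c₀, hc₀⟩ := exists_inverseFourierST_twist d
  obtain ⟨M, hM⟩ := hB.bdd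
  have h1 : ∀ b, transl U b (smear g (fun a => translOp U a B) 0 ψ)
      = ∫ c, inverseFourierST g (c - b) • translOp U c B (transl U b ψ) := fun b => by
    rw [transl_translOp, smear_translOp U b 0 hg hB, add_zero, smear,
      ContinuousLinearMap.integral_apply (integrable_smear hg hB b)]
    rfl
  have hgc := continuous_inverseFourierST hg
  have hhc := continuous_inverseFourierST hh
  have hcont : Continuous fun z : Spacetime d × Spacetime d =>
      translOp U z.2 B (transl U z.1 ψ) :=
    (hB.cont.comp continuous_snd).clm_apply ((hU ψ).comp continuous_fst)
  have hint : Integrable (Function.uncurry fun (b c : Spacetime d) =>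
      inverseFourierST h b • inverseFourierST g (c - b) • translOp U c B (transl U b ψ)) := by
    have hkey : Integrable fun z : Spacetime d × Spacetime d =>
        ‖inverseFourierST h z.1‖ * ‖inverseFourierST g (z.2 - z.1)‖ := by
      refine (integrable_prod_iff (Continuous.aestronglyMeasurable (by fun_prop))).2
        ⟨Eventually.of_forall fun b => ?_, ?_⟩
      · exact ((integrable_inverseFourierST hg).comp_sub_right b).norm.const_mul
          ‖inverseFourierST h b‖
      · simp_rw [norm_mul, norm_norm, integral_const_mul]
        have : ∀ b : Spacetime d, ∫ c, ‖inverseFourierST g (c - b)‖ = ∫ c, ‖inverseFourierST g c‖ :=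
          fun b => integral_sub_right_eq_self (fun c => ‖inverseFourierST g c‖) b
        simp_rw [this]
        exact (integrable_inverseFourierST hh).norm.mul_const _
    refine (hkey.mul_const (M * ‖ψ‖)).mono' (Continuous.aestronglyMeasurable (by
      rw [Function.uncurry_def]; fun_prop)) (Eventually.of_forall fun z => ?_)
    obtain ⟨b, c⟩ := z
    simp only [Function.uncurry, norm_smul]
    rw [mul_assoc]
    gcongr
    refine ((translOp U c B).le_opNorm _).trans ?_
    rw [norm_transl_apply]
    exact mul_le_mul_of_nonneg_right (hM c) (norm_nonneg _)
  rw [smear]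
  simp_rw [sub_zero, h1, ← integral_smul (inverseFourierST h _)]
  rw [integral_integral_swap hint]
  refine integral_eq_zero_of_ae (Eventually.of_forall fun c => ?_)
  have h2 := hψ (twist h g c) (isCc_twist hh hg c) (by
    rw [Set.disjoint_left]
    intro p hp hpS
    obtain ⟨q, hq, hpq⟩ := tsupport_twist_subset hh hg c hp
    exact Set.disjoint_left.1 hd hpq ⟨p, hpS, q, hq, rfl⟩)
  have h3 : ∀ b, inverseFourierST h b • inverseFourierST g (c - b) • translOp U c B (transl U b ψ)
      = (c₀ • translOp U c B) (inverseFourierST (twist h g c) b • transl U b ψ) := fun b => by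
    rw [smul_smul, hc₀ hh hg, mul_smul, smul_apply, map_smul]
  simp_rw [h3]
  have h4 := integrable_smear (isCc_twist hh hg c) (bddCont_transl hU ψ) 0
  simp only [smear, sub_zero] at h2 h4
  rw [ContinuousLinearMap.integral_comp_comm _ h4, h2, map_zero]
  rfl

theorem translOp_mem_specSub {B : 𝓗 →L[ℂ] 𝓗} {S S' : Set (Spacetime d)}
    (hB : ∀ ψ ∈ specSub U S, B ψ ∈ specSub U S') (a : Spacetime d) {ψ : 𝓗}
    (hψ : ψ ∈ specSub U S) : translOp U a B ψ ∈ specSub U S' := by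
  rw [translOp_apply]
  exact specSub_transl hU a (hB _ (specSub_transl hU _ hψ))

end Translations

/-! ### Energy-momentum transfer -/

section Net

variable {d : ℕ} {m : ℝ} {𝓗 : Type*} [NormedAddCommGroup 𝓗] [InnerProductSpace ℂ 𝓗]
  [CompleteSpace 𝓗] (N : HaagKastlerNet d m 𝓗)

/-- The orbit `a ↦ B(a)` of an operator under translations. -/
def orb (B : 𝓗 →L[ℂ] 𝓗) (a : Spacetime d) : 𝓗 →L[ℂ] 𝓗 := translOp N.U a B

theorem orb_zero (B : 𝓗 →L[ℂ] 𝓗) : orb N B 0 = B := translOp_zero _ _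

theorem norm_orb_le (B : 𝓗 →L[ℂ] 𝓗) (a : Spacetime d) : ‖orb N B a‖ ≤ ‖B‖ := norm_translOp_le _ _ _

theorem orb_add (A B : 𝓗 →L[ℂ] 𝓗) (a : Spacetime d) : orb N (A + B) a = orb N A a + orb N B a :=
  map_add (translL N.U a) A B

theorem orb_smul (c : ℂ) (B : 𝓗 →L[ℂ] 𝓗) (a : Spacetime d) : orb N (c • B) a = c • orb N B a :=
  map_smul (translL N.U a) c B

/-- The part of almost locality which concerns the approximation by local operators. -/
def HasLocalApprox (B : 𝓗 →L[ℂ] 𝓗) : Prop :=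
  ∃ A : ℝ → (𝓗 →L[ℂ] 𝓗), (∀ r > 0, A r ∈ N.alg (doubleCone d r)) ∧
    ∀ k : ℕ, ∃ C : ℝ, ∀ r > 0, (1 + r ^ 2) ^ k * ‖B - A r‖ ≤ C

theorem HasLocalApprox.add {B B' : 𝓗 →L[ℂ] 𝓗} (h : HasLocalApprox N B) (h' : HasLocalApprox N B') :
    HasLocalApprox N (B + B') := by
  obtain ⟨A, hA, hC⟩ := h
  obtain ⟨A', hA', hC'⟩ := h'
  refine ⟨fun r => A r + A' r, fun r hr => add_mem (hA r hr) (hA' r hr), fun k => ?_⟩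
  obtain ⟨C, hC⟩ := hC k
  obtain ⟨C', hC'⟩ := hC' k
  refine ⟨C + C', fun r hr => ?_⟩
  calc (1 + r ^ 2) ^ k * ‖B + B' - (A r + A' r)‖
      ≤ (1 + r ^ 2) ^ k * (‖B - A r‖ + ‖B' - A' r‖) := by
        gcongr
        rw [add_sub_add_comm]
        exact norm_add_le _ _
    _ ≤ C + C' := by rw [mul_add]; exact add_le_add (hC r hr) (hC' r hr)

theorem HasLocalApprox.smul (c : ℂ) {B : 𝓗 →L[ℂ] 𝓗} (h : HasLocalApprox N B) :
    HasLocalApprox N (c • B) := by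
  obtain ⟨A, hA, hC⟩ := h
  refine ⟨fun r => c • A r, fun r hr => (N.alg (doubleCone d r)).toStarSubalgebra.smul_mem (hA r hr) c,
    fun k => ?_⟩
  obtain ⟨C, hC⟩ := hC k
  refine ⟨‖c‖ * C, fun r hr => ?_⟩
  rw [← smul_sub, norm_smul, mul_left_comm]
  exact mul_le_mul_of_nonneg_left (hC r hr) (norm_nonneg _)

theorem HasLocalApprox.star {B : 𝓗 →L[ℂ] 𝓗} (h : HasLocalApprox N B) :
    HasLocalApprox N (star B) := by
  obtain ⟨A, hA, hC⟩ := h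
  refine ⟨fun r => Star.star (A r), fun r hr => star_mem (hA r hr), fun k => ?_⟩
  obtain ⟨C, hC⟩ := hC k
  refine ⟨C, fun r hr => ?_⟩
  rw [← star_sub, norm_star]
  exact hC r hr

theorem HasLocalApprox.zero : HasLocalApprox N (0 : 𝓗 →L[ℂ] 𝓗) :=
  ⟨fun _ => 0, fun _ _ => zero_mem _, fun k => ⟨0, fun r _ => by simp⟩⟩

/-- The properties of the elements of `𝓛₀` used below. -/
structure Good (B : 𝓗 →L[ℂ] 𝓗) : Prop where
  bddCont : BddCont (orb N B)
  bounded : Bornology.IsBounded (N.transferSupport B)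
  decreasing : Disjoint (N.transferSupport B) (forwardCone d)
  local_approx : HasLocalApprox N B

theorem smear_orb_apply {B : 𝓗 →L[ℂ] 𝓗} (hB : BddCont (orb N B)) {g : Spacetime d → ℂ}
    (hg : IsCc g) (ψ : 𝓗) : smear g (orb N B) 0 ψ = N.energyMomentumDistribution B g ψ := by
  rw [smear, ContinuousLinearMap.integral_apply (integrable_smear hg hB 0)]
  simp only [sub_zero]
  rfl

theorem notMem_transferSupport_iff {B : 𝓗 →L[ℂ] 𝓗} (hB : BddCont (orb N B)) {q : Spacetime d} :
    q ∉ N.transferSupport B ↔ ∃ V, IsOpen V ∧ q ∈ V ∧ ∀ g, IsCc g → tsupport g ⊆ V →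
      smear g (orb N B) 0 = 0 := by
  constructor
  · intro h
    simp only [HaagKastlerNet.transferSupport, Set.mem_ofPred_eq, not_forall] at h
    obtain ⟨V, hV, hq, h⟩ := h
    refine ⟨V, hV, hq, fun g hg hgV => ?_⟩
    ext ψ
    by_contra hne
    rw [smear_orb_apply N hB hg] at hne
    exact h ⟨g, hg.smooth, hg.compact, hgV, ψ, hne⟩
  · rintro ⟨V, hV, hq, h⟩ hmem
    obtain ⟨g, hgs, hgc, hgV, ψ, hne⟩ := hmem V hV hq
    rw [← smear_orb_apply N hB ⟨hgs, hgc⟩, h g ⟨hgs, hgc⟩ hgV] at hne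
    exact hne rfl

theorem isClosed_transferSupport (B : 𝓗 →L[ℂ] 𝓗) : IsClosed (N.transferSupport B) := by
  rw [← isOpen_compl_iff, isOpen_iff_forall_mem_open]
  intro q hq
  have h : ∃ V, IsOpen V ∧ q ∈ V ∧ ¬ ∃ f : Spacetime d → ℂ, ContDiff ℝ ∞ f ∧ HasCompactSupport f ∧
      tsupport f ⊆ V ∧ ∃ ψ : 𝓗, N.energyMomentumDistribution B f ψ ≠ 0 := by
    by_contra hno
    push Not at hno
    exact hq fun V hV hqV => by
      obtain ⟨f, h1, h2, h3, h4⟩ := hno V hV hqV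
      exact ⟨f, h1, h2, h3, h4⟩
  obtain ⟨V, hV, hqV, hno⟩ := h
  exact ⟨V, fun p hp hmem => hno (hmem V hV hp), hV, hqV⟩

theorem transferSupport_add_subset {A B : 𝓗 →L[ℂ] 𝓗} (hA : BddCont (orb N A))
    (hB : BddCont (orb N B)) (hAB : BddCont (orb N (A + B))) :
    N.transferSupport (A + B) ⊆ N.transferSupport A ∪ N.transferSupport B := by
  intro q hq
  by_contra hno
  rw [mem_union, not_or, notMem_transferSupport_iff N hA, notMem_transferSupport_iff N hB] at hno
  obtain ⟨⟨V, hV, hqV, h⟩, V', hV', hqV', h'⟩ := hno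
  refine (notMem_transferSupport_iff N hAB).2 ⟨V ∩ V', hV.inter hV', ⟨hqV, hqV'⟩,
    fun g hg hgV => ?_⟩ hq
  have h1 := h g hg (hgV.trans inter_subset_left)
  have h2 := h' g hg (hgV.trans inter_subset_right)
  have h3 := integral_add (integrable_smear hg hA 0) (integrable_smear hg hB 0)
  simp only [smear] at h1 h2 ⊢
  simp_rw [orb_add, smul_add]
  rw [h3, h1, h2, add_zero]

theorem transferSupport_smul_subset (c : ℂ) {B : 𝓗 →L[ℂ] 𝓗} (hB : BddCont (orb N B))
    (hcB : BddCont (orb N (c • B))) : N.transferSupport (c • B) ⊆ N.transferSupport B := by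
  intro q hq
  by_contra hno
  obtain ⟨V, hV, hqV, h⟩ := (notMem_transferSupport_iff N hB).1 hno
  refine (notMem_transferSupport_iff N hcB).2 ⟨V, hV, hqV, fun g hg hgV => ?_⟩ hq
  have h1 := h g hg hgV
  simp only [smear] at h1 ⊢
  simp_rw [orb_smul, smul_comm _ c]
  rw [integral_smul, h1, smul_zero]

theorem good_of_mem_L0 {B : 𝓗 →L[ℂ] 𝓗} (hB : B ∈ N.L0) : Good N B := by
  induction hB using Submodule.span_induction with
  | mem B hB =>
    obtain ⟨-, hdec, hcomp, hsm, hal⟩ := hB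
    refine ⟨⟨hsm.continuous, ‖B‖, norm_orb_le N B⟩, hcomp.isBounded,
      disjoint_iff_inter_eq_empty.2 hdec, ?_⟩
    have h := (hal 0 0 0).2
    rw [iteratedFDeriv_zero_apply, translOp_zero] at h
    exact h
  | zero =>
    have h0 : orb N (0 : 𝓗 →L[ℂ] 𝓗) = fun _ => 0 := by
      funext a; exact map_zero (translL N.U a)
    have h1 : N.transferSupport (0 : 𝓗 →L[ℂ] 𝓗) = ∅ := by
      refine eq_empty_of_forall_notMem fun q => ?_
      refine (notMem_transferSupport_iff N ?_).2 ⟨univ, isOpen_univ, mem_univ _, fun g _ _ => ?_⟩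
      · rw [h0]; exact ⟨continuous_const, 0, fun _ => by simp⟩
      · rw [h0]; simp [smear]
    refine ⟨?_, by rw [h1]; exact Bornology.isBounded_empty, by rw [h1]; exact empty_disjoint _,
      HasLocalApprox.zero N⟩
    rw [h0]; exact ⟨continuous_const, 0, fun _ => by simp⟩
  | add A B _ _ hA hB =>
    have h : BddCont (orb N (A + B)) := by
      refine ⟨?_, ‖A + B‖, norm_orb_le N _⟩
      rw [show orb N (A + B) = fun a => orb N A a + orb N B a from funext (orb_add N A B)]
      exact hA.bddCont.cont.add hB.bddCont.cont
    have hs := transferSupport_add_subset N hA.bddCont hB.bddCont h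
    exact ⟨h, (hA.bounded.union hB.bounded).subset hs,
      (hA.decreasing.union_left hB.decreasing).mono_left hs, hA.local_approx.add N hB.local_approx⟩
  | smul c B _ hB =>
    have h : BddCont (orb N (c • B)) := by
      refine ⟨?_, ‖c • B‖, norm_orb_le N _⟩
      rw [show orb N (c • B) = fun a => c • orb N B a from funext (orb_smul N c B)]
      exact hB.bddCont.cont.const_smul c
    have hs := transferSupport_smul_subset N c hB.bddCont h
    exact ⟨h, hB.bounded.subset hs, hB.decreasing.mono_left hs, hB.local_approx.smul N c⟩

/-- `B̂(h) = 0` if the support of `h` does not meet the energy-momentum transfer of `B`. -/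
theorem smear_orb_eq_zero {B : 𝓗 →L[ℂ] 𝓗} (hB : BddCont (orb N B)) {h : Spacetime d → ℂ}
    (hh : IsCc h) (hd : Disjoint (tsupport h) (N.transferSupport B)) : smear h (orb N B) 0 = 0 := by
  have hV := fun q : Spacetime d => fun hq : q ∉ N.transferSupport B =>
    (notMem_transferSupport_iff N hB).1 hq
  choose! V hVo hqV hV0 using hV
  obtain ⟨t, g, ht, hg, hsum⟩ := hh.exists_finite_decomposition (W := V) fun q hq =>
    ⟨hVo q (Set.disjoint_left.1 hd hq), hqV q (Set.disjoint_left.1 hd hq)⟩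
  rw [show h = _ from funext hsum, smear_sum t (fun x hx => (hg x hx).1) hB]
  exact Finset.sum_eq_zero fun x hx =>
    hV0 x (Set.disjoint_left.1 hd (ht x hx)) (g x) (hg x hx).1 (hg x hx).2.1

/-- An operator with bounded energy-momentum transfer is reproduced by smearing with a smooth
cutoff. -/
theorem smear_orb_eq_smul {B : 𝓗 →L[ℂ] 𝓗} (hB : Good N B) {f : Spacetime d → ℂ} (hf : IsCc f)
    (hf1 : ∀ q ∈ N.transferSupport B, ∀ᶠ p in nhds q, f p = 1) (a : Spacetime d) :
    smear f (orb N B) a = kap d • orb N B a := by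
  have h := smear_eq_of_eventually_eq_one hB.bddCont hB.bounded
    (fun h hh hd => smear_orb_eq_zero N hB.bddCont hh hd) hf hf1
  rw [orb_zero] at h
  have h1 := smear_translOp N.U a 0 hf hB.bddCont
  rw [add_zero] at h1
  have h2 : smear f (fun a => translOp N.U a B) a = smear f (orb N B) a := rfl
  rw [← h2, ← h1]
  have h3 : smear f (fun a => translOp N.U a B) 0 = smear f (orb N B) 0 := rfl
  rw [h3, h]
  exact orb_smul N _ _ _

/-! ### The vacuum -/

theorem transl_vacuum (a : Spacetime d) : transl N.U a N.Ω = N.Ω := by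
  obtain ⟨μ, hμf, hμ, h0⟩ := (N.vacuum_unique N.Ω).2 (Submodule.mem_span_singleton_self _)
  have h1 : ∀ b : Spacetime d, inner ℂ N.Ω (transl N.U b N.Ω) = ((μ.real univ : ℝ) : ℂ) := fun b => by
    rw [hμ]
    have h2 : ∀ᵐ q ∂μ, q = 0 := h0
    have h3 : ∫ q, Complex.exp (Complex.I * (minkPairing b q : ℂ)) ∂μ = ∫ _, (1 : ℂ) ∂μ := by
      refine integral_congr_ae ?_
      filter_upwards [h2] with q hq
      simp [hq, minkPairing]
    rw [h3, integral_const, Complex.real_smul, mul_one]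
  have h2 : inner ℂ N.Ω (transl N.U a N.Ω) = (1 : ℂ) := by
    have h3 := h1 0
    rw [transl_zero_apply, inner_self_eq_norm_sq_to_K, N.vacuum_norm] at h3
    rw [h1, ← h3]; norm_num
  rw [← sub_eq_zero, ← norm_eq_zero, ← sq_eq_zero_iff, @norm_sub_sq ℂ, norm_transl_apply,
    N.vacuum_norm, ← inner_conj_symm, h2]
  norm_num

/-- The reflected conjugate `q ↦ conj (h(-q))`. -/
def conjRefl (h : Spacetime d → ℂ) (q : Spacetime d) : ℂ := (starRingEnd ℂ) (h (-q))

theorem conjRefl_conjRefl (h : Spacetime d → ℂ) : conjRefl (conjRefl h) = h := by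
  funext q; simp [conjRefl]

theorem IsCc.conjRefl {h : Spacetime d → ℂ} (hh : IsCc h) : IsCc (conjRefl h) := by
  have h1 := hh.comp_equiv (ContinuousLinearEquiv.neg ℝ)
  exact ⟨Complex.conjCLE.contDiff.comp h1.smooth,
    h1.compact.comp_left (g := starRingEnd ℂ) (map_zero _)⟩

/-- The adjoint of a smeared operator creates from the vacuum the vector `B*Ω` with its
energy-momentum cut off. -/
theorem star_smear_orb_vacuum {B : 𝓗 →L[ℂ] 𝓗} (hB : BddCont (orb N B)) {h : Spacetime d → ℂ}
    (hh : IsCc h) : star (smear h (orb N B) 0) N.Ω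
      = smear (conjRefl h) (fun a => transl N.U a (star B N.Ω)) 0 := by
  have h1 : star (smear h (orb N B) 0)
      = ∫ a, inverseFourierST (conjRefl h) a • star (orb N B a) := by
    rw [smear]
    have h2 := (starL' ℝ : (𝓗 →L[ℂ] 𝓗) ≃L[ℝ] (𝓗 →L[ℂ] 𝓗)).integral_comp_comm (μ := volume)
      fun a => inverseFourierST h (a - 0) • orb N B a
    refine h2.symm.trans ?_
    congr 1; funext a
    have e := conj_inverseFourierST h a
    simp only [sub_zero]
    change star (inverseFourierST h a • orb N B a) = _
    rw [star_smul]
    congr 1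
  have h3 : Integrable fun a => inverseFourierST (conjRefl h) a • star (orb N B a) := by
    have : BddCont fun a => star (orb N B a) := by
      refine ⟨hB.cont.star, ‖B‖, fun a => ?_⟩
      rw [norm_star]; exact norm_orb_le N B a
    simpa using integrable_smear hh.conjRefl this 0
  rw [h1, ContinuousLinearMap.integral_apply h3, smear]
  congr 1; funext a
  rw [sub_zero, orb, ← translOp_star]
  change inverseFourierST (conjRefl h) a • translOp N.U a (star B) N.Ω = _
  rw [translOp_apply, transl_vacuum]

/-- The adjoint of `B̂(h)` annihilates the vacuum if `h` vanishes on the part of the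
energy-momentum transfer which leads from the vacuum to one-particle vectors. -/
theorem star_smear_orb_vacuum_eq_zero {B : 𝓗 →L[ℂ] 𝓗} (hB : BddCont (orb N B))
    (hH : ∀ q ∈ N.transferSupport B, -q ∈ jointSpectrum N.U → -q ∈ massHyperboloid d m)
    {h : Spacetime d → ℂ} (hh : IsCc h)
    (h0 : ∀ q ∈ N.transferSupport B, -q ∈ massHyperboloid d m → h q = 0) (b : Spacetime d) :
    star (smear h (orb N B) b) N.Ω = 0 := by
  have key : star (smear h (orb N B) 0) N.Ω = 0 := by
    rw [star_smear_orb_vacuum N hB hh]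
    obtain ⟨μ, hμf, hμ⟩ := exists_spectralMeasure N.strongly_continuous (star B N.Ω)
    have h1 := spectralMeasure_eq_zero N.strongly_continuous hμ
      (S := jointSpectrum N.U ∩ {q | -q ∈ N.transferSupport B}) fun q hq => by
        by_cases hqs : q ∈ jointSpectrum N.U
        · have hq' : -q ∉ N.transferSupport B := fun h' => hq ⟨hqs, h'⟩
          refine ⟨{q | -q ∈ (N.transferSupport B)ᶜ},
            (isClosed_transferSupport N B).isOpen_compl.preimage continuous_neg, hq',
            fun k hk hkV => ?_⟩
          have h2 := star_smear_orb_vacuum N hB hk.conjRefl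
          rw [conjRefl_conjRefl] at h2
          rw [← h2, smear_orb_eq_zero N hB hk.conjRefl, star_zero]
          · rfl
          rw [Set.disjoint_left]
          intro p hp hpB
          have h3 : -p ∈ tsupport k := by
            have hcl : IsClosed {p : Spacetime d | -p ∈ tsupport k} :=
              (isClosed_tsupport k).preimage continuous_neg
            refine closure_minimal (fun y hy => ?_) hcl hp
            refine subset_tsupport _ fun h0 => hy ?_
            simp [conjRefl, h0]
          have h4 := hkV h3
          exact h4 (by rwa [neg_neg])
        · exact exists_nhds_smear_eq_zero N.strongly_continuous _ hqs
    have h2 : ∀ᵐ q ∂μ, q ∈ jointSpectrum N.U ∩ {q | -q ∈ N.transferSupport B} := h1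
    refine smear_transl_eq_zero N.strongly_continuous hμ hh.conjRefl ?_
    filter_upwards [h2] with q hq
    have h3 := h0 (-q) hq.2 (hH (-q) hq.2 (by rw [neg_neg]; exact hq.1))
    simp [conjRefl, h3]
  have h1 := smear_translOp N.U b 0 hh hB
  rw [add_zero] at h1
  have h2 : smear h (orb N B) b = translOp N.U b (smear h (orb N B) 0) := h1.symm
  rw [h2, ← translOp_star, translOp_apply, transl_vacuum, key, map_zero]

end Net

/-! ### Decay of commutators -/

section Commutators

variable {d : ℕ} {m : ℝ} {𝓗 : Type*} [NormedAddCommGroup 𝓗] [InnerProductSpace ℂ 𝓗]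
  [CompleteSpace 𝓗]

/-- A weight which decays rapidly in the spatial distance. -/
def cwt (N : ℕ) (a : Spacetime d) : ℝ := (1 + |a.1|) ^ N * wt N a.2

theorem cwt_nonneg (N : ℕ) (a : Spacetime d) : 0 ≤ cwt N a := by
  unfold cwt; have := wt_nonneg N a.2; positivity

theorem cwt_neg (N : ℕ) (a : Spacetime d) : cwt N (-a) = cwt N a := by
  simp [cwt, wt_neg]

/-- Translations change the weight at most by a polynomial factor. -/
theorem cwt_add_mul_wt_le (N : ℕ) (a b : Spacetime d) : cwt N (a + b) * wt (2 * N) b ≤ cwt N a := by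
  have h1 : (1 + |a.1 + b.1|) ≤ (1 + |a.1|) * (1 + ‖b‖) := by
    have h2 : |b.1| ≤ ‖b‖ := norm_fst_le b
    nlinarith [abs_add_le a.1 b.1, abs_nonneg a.1, norm_nonneg b]
  have h3 : wt N (a.2 + b.2) * wt N b ≤ wt N a.2 := by
    have h4 := wt_mul_wt_le N (a.2 + b.2) (-b.2)
    rw [add_neg_cancel_right, wt_neg] at h4
    refine le_trans (mul_le_mul_of_nonneg_left ?_ (wt_nonneg _ _)) h4
    unfold wt
    have : ‖b.2‖ ≤ ‖b‖ := norm_snd_le b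
    exact inv_anti₀ (by positivity) (pow_le_pow_left₀ (by positivity) (by linarith) N)
  have h5 := wt_nonneg N (a.2 + b.2)
  have h6 := wt_nonneg N b
  calc cwt N (a + b) * wt (2 * N) b
      ≤ ((1 + |a.1|) * (1 + ‖b‖)) ^ N * wt N (a.2 + b.2) * (wt N b * wt N b) := by
        rw [two_mul, wt_add]
        unfold cwt
        gcongr
        · exact h1
        · exact le_rfl
    _ = (1 + |a.1|) ^ N * ((1 + ‖b‖) ^ N * wt N b) * (wt N (a.2 + b.2) * wt N b) := by
        rw [mul_pow]; ring
    _ = (1 + |a.1|) ^ N * (wt N (a.2 + b.2) * wt N b) := by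
        rw [show (1 + ‖b‖) ^ N * wt N b = 1 from mul_inv_cancel₀ (by positivity), mul_one]
    _ ≤ (1 + |a.1|) ^ N * wt N a.2 := by gcongr

/-- The commutators of two families of operators decay rapidly in the spatial distance. -/
def CommDecay (Φ Ψ : Spacetime d → 𝓗 →L[ℂ] 𝓗) : Prop :=
  ∀ N : ℕ, ∃ C, 0 ≤ C ∧ ∀ a b, ‖Φ a * Ψ b - Ψ b * Φ a‖ ≤ C * cwt N (a - b)

theorem CommDecay.symm {Φ Ψ : Spacetime d → 𝓗 →L[ℂ] 𝓗} (h : CommDecay Φ Ψ) : CommDecay Ψ Φ := by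
  intro N
  obtain ⟨C, hC0, hC⟩ := h N
  refine ⟨C, hC0, fun a b => ?_⟩
  rw [norm_sub_rev, ← cwt_neg, neg_sub]
  exact hC b a

theorem CommDecay.star {Φ Ψ : Spacetime d → 𝓗 →L[ℂ] 𝓗} (h : CommDecay (fun a => star (Φ a)) Ψ) :
    CommDecay Φ fun a => star (Ψ a) := by
  intro N
  obtain ⟨C, hC0, hC⟩ := h N
  refine ⟨C, hC0, fun a b => ?_⟩
  rw [← norm_star, star_sub, star_mul, star_mul, star_star, norm_sub_rev]
  exact hC a b

theorem CommDecay.smear {g : Spacetime d → ℂ} (hg : IsCc g) {Φ Ψ : Spacetime d → 𝓗 →L[ℂ] 𝓗}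
    (hΦ : BddCont Φ) (h : CommDecay Φ Ψ) : CommDecay (smear g Φ) Ψ := by
  intro N
  obtain ⟨C, hC0, hC⟩ := h N
  obtain ⟨C', hC'0, hC'⟩ := exists_norm_inverseFourierST_le_wt hg (2 * N + dimST d)
  refine ⟨C' * C * ∫ c : Spacetime d, wt (dimST d) c, ?_, fun a b => ?_⟩
  · have := integral_wt_nonneg (μ := (volume : Measure (Spacetime d))) (dimST d)
    positivity
  set T : (𝓗 →L[ℂ] 𝓗) →L[ℂ] (𝓗 →L[ℂ] 𝓗) :=
    (ContinuousLinearMap.mul ℂ (𝓗 →L[ℂ] 𝓗)).flip (Ψ b) - ContinuousLinearMap.mul ℂ (𝓗 →L[ℂ] 𝓗) (Ψ b)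
  have hT : ∀ A, T A = A * Ψ b - Ψ b * A := fun A => rfl
  rw [← hT, map_smear T hg hΦ, smear_eq, mul_assoc, mul_comm (∫ _, _), ← mul_assoc,
    ← integral_const_mul]
  refine norm_integral_le_of_norm_le (integrable_wt_dimST.const_mul _) (Eventually.of_forall fun c => ?_)
  rw [norm_smul, hT]
  have h1 := hC' c
  rw [wt_add] at h1
  have h2 := hC (c + a) b
  have h3 := cwt_add_mul_wt_le N (a - b) c
  rw [show a - b + c = c + a - b by abel] at h3
  have h4 := wt_nonneg (2 * N) c
  have h5 := wt_nonneg (dimST d) c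
  have h6 := cwt_nonneg N (c + a - b)
  calc ‖inverseFourierST g c‖ * ‖Φ (c + a) * Ψ b - Ψ b * Φ (c + a)‖
      ≤ (C' * (wt (2 * N) c * wt (dimST d) c)) * (C * cwt N (c + a - b)) := by gcongr
    _ = C' * C * (cwt N (c + a - b) * wt (2 * N) c) * wt (dimST d) c := by ring
    _ ≤ C' * C * cwt N (a - b) * wt (dimST d) c := by gcongr

variable (N : HaagKastlerNet d m 𝓗)

theorem isOpen_doubleCone (r : ℝ) : IsOpen (doubleCone d r) :=
  isOpen_lt (by fun_prop) continuous_const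

theorem isBounded_doubleCone (r : ℝ) : Bornology.IsBounded (doubleCone d r) := by
  refine (Metric.isBounded_ball (x := (0 : Spacetime d)) (r := r)).subset fun a ha => ?_
  have h : |a.1| + ‖a.2‖ < r := ha
  rw [mem_ball_zero_iff, Prod.norm_def, Real.norm_eq_abs]
  exact max_lt (by linarith [norm_nonneg a.2]) (by linarith [abs_nonneg a.1])

theorem translOp_mem_alg {O : Set (Spacetime d)} (hO : IsOpen O) (hb : Bornology.IsBounded O)
    (a : Spacetime d) {A : 𝓗 →L[ℂ] 𝓗} (hA : A ∈ N.alg O) :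
    translOp N.U a A ∈ N.alg ((fun b => b + a) '' O) := by
  have h := N.covariance O hO hb a
  have h1 : translOp N.U a A ∈ translOp N.U a '' {A | A ∈ N.alg O} := mem_image_of_mem _ hA
  rw [h] at h1
  exact h1

/-- Operators localized in translates of double cones commute at large spatial distance. -/
theorem translOp_comm {r : ℝ} {A B : 𝓗 →L[ℂ] 𝓗} (hA : A ∈ N.alg (doubleCone d r))
    (hB : B ∈ N.alg (doubleCone d r)) {a b : Spacetime d}
    (hab : 2 * r ≤ ‖a.2 - b.2‖ - |a.1 - b.1|) :
    orb N A a * orb N B b = orb N B b * orb N A a := by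
  have ho := isOpen_doubleCone (d := d) r
  have hb := isBounded_doubleCone (d := d) r
  have himg : ∀ c : Spacetime d, IsOpen ((fun b => b + c) '' doubleCone d r) ∧
      Bornology.IsBounded ((fun b => b + c) '' doubleCone d r) := fun c =>
    ⟨(Homeomorph.addRight c).isOpenMap _ ho, by
      obtain ⟨R, hR⟩ := hb.subset_closedBall 0
      refine (Metric.isBounded_closedBall (x := c) (r := R)).subset ?_
      rintro _ ⟨x, hx, rfl⟩
      have := hR hx
      rw [mem_closedBall_zero_iff] at this
      simpa [dist_eq_norm] using this⟩
  refine N.locality _ _ (himg a).1 (himg a).2 (himg b).1 (himg b).2 ?_ _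
    (translOp_mem_alg N ho hb a hA) _ (translOp_mem_alg N ho hb b hB)
  rintro _ ⟨u, hu, rfl⟩ _ ⟨v, hv, rfl⟩
  have hu' : |u.1| + ‖u.2‖ < r := hu
  have hv' : |v.1| + ‖v.2‖ < r := hv
  simp only [Prod.fst_add, Prod.snd_add]
  have h1 : |u.1 + a.1 - (v.1 + b.1)| ≤ |a.1 - b.1| + |u.1| + |v.1| := by
    rw [show u.1 + a.1 - (v.1 + b.1) = (a.1 - b.1) + u.1 + -v.1 by ring]
    refine (abs_add_le _ _).trans ?_
    rw [abs_neg]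
    linarith [abs_add_le (a.1 - b.1) u.1]
  have h2 : ‖a.2 - b.2‖ ≤ ‖u.2 + a.2 - (v.2 + b.2)‖ + ‖u.2‖ + ‖v.2‖ := by
    rw [show a.2 - b.2 = (u.2 + a.2 - (v.2 + b.2)) + -u.2 + v.2 by abel]
    refine (norm_add_le _ _).trans ?_
    have := norm_add_le (u.2 + a.2 - (v.2 + b.2)) (-u.2)
    rw [norm_neg] at this
    linarith
  linarith

/-- Commutators of almost local operators decay rapidly at spacelike distances. -/
theorem commDecay_orb {A B : 𝓗 →L[ℂ] 𝓗} (hA : HasLocalApprox N A) (hB : HasLocalApprox N B) :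
    CommDecay (orb N A) (orb N B) := by
  intro k
  obtain ⟨A', hA', hAC⟩ := hA
  obtain ⟨B', hB', hBC⟩ := hB
  obtain ⟨C, hC⟩ := hAC k
  obtain ⟨C', hC'⟩ := hBC k
  obtain ⟨C₀, hC₀⟩ := hAC 0
  have hCn : 0 ≤ C := le_trans (by positivity) (hC 1 one_pos)
  have hCn' : 0 ≤ C' := le_trans (by positivity) (hC' 1 one_pos)
  have hC₀n : 0 ≤ C₀ := le_trans (by positivity) (hC₀ 1 one_pos)
  have hnA : ∀ r > 0, ‖A' r‖ ≤ ‖A‖ + C₀ := fun r hr => by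
    have h1 := hC₀ r hr
    rw [pow_zero, one_mul] at h1
    have h2 := norm_sub_le A (A - A' r)
    rw [sub_sub_cancel] at h2
    linarith
  set M : ℝ := 2 * (C * ‖B‖ + (‖A‖ + C₀) * C') + 2 * ‖A‖ * ‖B‖
  have hM : 0 ≤ M := by positivity
  refine ⟨4 ^ k * M, by positivity, fun a b => ?_⟩
  set δ : ℝ := ‖a.2 - b.2‖ - |a.1 - b.1|
  have hcwt : ∀ y : ℝ, 0 ≤ y → ‖a.2 - b.2‖ ≤ y + |a.1 - b.1| → 1 ≤ (1 + y) ^ k * cwt k (a - b) := by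
    intro y hy hle
    unfold cwt wt
    simp only [Prod.fst_sub, Prod.snd_sub]
    rw [← mul_assoc, ← mul_pow, ← div_eq_mul_inv, one_le_div (by positivity)]
    refine pow_le_pow_left₀ (by positivity) ?_ k
    nlinarith [abs_nonneg (a.1 - b.1)]
  by_cases hδ : 0 < δ
  · have hr : 0 < δ / 2 := by positivity
    have hcomm := translOp_comm N (hA' _ hr) (hB' _ hr) (a := a) (b := b)
      (by change 2 * (δ / 2) ≤ δ; linarith)
    have e : orb N A a * orb N B b - orb N B b * orb N A a
        = (orb N (A - A' (δ / 2)) a * orb N B b - orb N B b * orb N (A - A' (δ / 2)) a)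
          + (orb N (A' (δ / 2)) a * orb N (B - B' (δ / 2)) b
            - orb N (B - B' (δ / 2)) b * orb N (A' (δ / 2)) a) := by
      have h1 : orb N (A - A' (δ / 2)) a = orb N A a - orb N (A' (δ / 2)) a :=
        map_sub (translL N.U a) _ _
      have h2 : orb N (B - B' (δ / 2)) b = orb N B b - orb N (B' (δ / 2)) b :=
        map_sub (translL N.U b) _ _
      rw [h1, h2, sub_mul, mul_sub, mul_sub, sub_mul, hcomm]
      abel
    have hcn : ∀ (S T : 𝓗 →L[ℂ] 𝓗), ‖orb N S a * orb N T b - orb N T b * orb N S a‖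
        ≤ 2 * (‖S‖ * ‖T‖) := fun S T => by
      have h1 := norm_orb_le N S a
      have h2 := norm_orb_le N T b
      calc _ ≤ ‖orb N S a * orb N T b‖ + ‖orb N T b * orb N S a‖ := norm_sub_le _ _
        _ ≤ ‖orb N S a‖ * ‖orb N T b‖ + ‖orb N T b‖ * ‖orb N S a‖ :=
          add_le_add (norm_mul_le _ _) (norm_mul_le _ _)
        _ ≤ ‖S‖ * ‖T‖ + ‖T‖ * ‖S‖ := by gcongr
        _ = _ := by ring
    set w : ℝ := (1 + (δ / 2) ^ 2) ^ k
    have hw : 0 < w := by positivity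
    have h1 : w * ‖orb N A a * orb N B b - orb N B b * orb N A a‖ ≤ M := by
      rw [e]
      have h2 := hcn (A - A' (δ / 2)) B
      have h3 := hcn (A' (δ / 2)) (B - B' (δ / 2))
      have h4 := hC (δ / 2) hr
      have h5 := hC' (δ / 2) hr
      have h6 := hnA (δ / 2) hr
      calc _ ≤ w * (2 * (‖A - A' (δ / 2)‖ * ‖B‖) + 2 * (‖A' (δ / 2)‖ * ‖B - B' (δ / 2)‖)) := by
            gcongr
            exact (norm_add_le _ _).trans (add_le_add h2 h3)
        _ = 2 * ((w * ‖A - A' (δ / 2)‖) * ‖B‖ + ‖A' (δ / 2)‖ * (w * ‖B - B' (δ / 2)‖)) := by ring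
        _ ≤ 2 * (C * ‖B‖ + (‖A‖ + C₀) * C') := by gcongr
        _ ≤ M := by
            have : 0 ≤ 2 * ‖A‖ * ‖B‖ := by positivity
            simp only [M]; linarith
    have h2 : (1 + δ) ^ k ≤ 4 ^ k * w := by
      rw [← mul_pow]
      refine pow_le_pow_left₀ (by positivity) ?_ k
      nlinarith [sq_nonneg (δ - 1)]
    have h3 := hcwt δ hδ.le (by simp only [δ]; linarith)
    have h4 := cwt_nonneg k (a - b)
    have h5 := norm_nonneg (orb N A a * orb N B b - orb N B b * orb N A a)
    calc ‖orb N A a * orb N B b - orb N B b * orb N A a‖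
        ≤ ((1 + δ) ^ k * cwt k (a - b)) * ‖orb N A a * orb N B b - orb N B b * orb N A a‖ :=
          le_mul_of_one_le_left h5 h3
      _ ≤ ((4 ^ k * w) * cwt k (a - b)) * ‖orb N A a * orb N B b - orb N B b * orb N A a‖ := by gcongr
      _ = 4 ^ k * (w * ‖orb N A a * orb N B b - orb N B b * orb N A a‖) * cwt k (a - b) := by ring
      _ ≤ 4 ^ k * M * cwt k (a - b) := by gcongr
  · have h3 := hcwt 0 le_rfl (by simp only [δ] at hδ; linarith)
    rw [add_zero, one_pow, one_mul] at h3
    have h1 := norm_orb_le N A a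
    have h2 := norm_orb_le N B b
    have h4 : (1 : ℝ) ≤ 4 ^ k := one_le_pow₀ (by norm_num)
    calc _ ≤ ‖orb N A a * orb N B b‖ + ‖orb N B b * orb N A a‖ := norm_sub_le _ _
      _ ≤ ‖orb N A a‖ * ‖orb N B b‖ + ‖orb N B b‖ * ‖orb N A a‖ :=
          add_le_add (norm_mul_le _ _) (norm_mul_le _ _)
      _ ≤ ‖A‖ * ‖B‖ + ‖B‖ * ‖A‖ := by gcongr
      _ ≤ M := by
          have : 0 ≤ 2 * (C * ‖B‖ + (‖A‖ + C₀) * C') := by positivity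
          simp only [M]; linarith
      _ ≤ 4 ^ k * M := le_mul_of_one_le_left hM h4
      _ ≤ 4 ^ k * M * cwt k (a - b) := le_mul_of_one_le_right (by positivity) h3

end Commutators

/-! ### Square-integrability of energy decreasing operators -/

section Buchholz

variable {𝓗 : Type*} [NormedAddCommGroup 𝓗] [InnerProductSpace ℂ 𝓗] [CompleteSpace 𝓗]

/-- The vectors annihilated by all products of `N` operators of a family. -/
def Annih {Y : Type*} (A : Y → 𝓗 →L[ℂ] 𝓗) : ℕ → 𝓗 → Prop
  | 0, ψ => ψ = 0
  | N + 1, ψ => ∀ x, Annih A N (A x ψ)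

theorem inner_star_left (A : 𝓗 →L[ℂ] 𝓗) (φ ψ : 𝓗) : inner ℂ (star A φ) ψ = inner ℂ φ (A ψ) := by
  rw [ContinuousLinearMap.star_eq_adjoint, ContinuousLinearMap.adjoint_inner_left]

/-- Buchholz' estimate over a region of finite measure: the bound depends only on the number of
operators needed to annihilate the vector and on the integral of the commutators. -/
theorem integral_norm_sq_le_of_annih {Y : Type*} [TopologicalSpace Y] [SecondCountableTopology Y]
    [MeasurableSpace Y] [OpensMeasurableSpace Y] (ν : Measure Y) [IsFiniteMeasure ν]
    {A : Y → 𝓗 →L[ℂ] 𝓗} (hA : Continuous A) {M : ℝ} (hM : ∀ x, ‖A x‖ ≤ M) {c : ℝ} (hc0 : 0 ≤ c)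
    (hc : ∀ x, ∫ y, ‖A x * star (A y) - star (A y) * A x‖ ∂ν ≤ c) (n : ℕ) :
    ∀ ψ, Annih A n ψ → ∫ x, ‖A x ψ‖ ^ 2 ∂ν ≤ n * c * ‖ψ‖ ^ 2 := by
  have hbd1 : ∀ {f : Y → ℝ} {K : ℝ}, Continuous f → (∀ y, ‖f y‖ ≤ K) → Integrable f ν := fun hf hK =>
    (integrable_const _).mono' hf.aestronglyMeasurable (Eventually.of_forall hK)
  have hbd2 : ∀ {f : Y × Y → ℝ} {K : ℝ}, Continuous f → (∀ y, ‖f y‖ ≤ K) →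
      Integrable f (ν.prod ν) := fun hf hK =>
    (integrable_const _).mono' hf.aestronglyMeasurable (Eventually.of_forall hK)
  induction n with
  | zero =>
    intro ψ hψ
    have : ψ = 0 := hψ
    simp [this]
  | succ n ih =>
    intro ψ hψ
    by_cases hY : Nonempty Y
    swap
    · have : IsEmpty Y := not_nonempty_iff.1 hY
      rw [integral_of_isEmpty]
      positivity
    have hM0 : 0 ≤ M := (norm_nonneg _).trans (hM hY.some)
    have hAφ : ∀ x φ, ‖A x φ‖ ≤ M * ‖φ‖ := fun x φ =>
      ((A x).le_opNorm φ).trans (mul_le_mul_of_nonneg_right (hM x) (norm_nonneg _))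
    have hAsφ : ∀ x φ, ‖star (A x) φ‖ ≤ M * ‖φ‖ := fun x φ =>
      ((star (A x)).le_opNorm φ).trans (mul_le_mul_of_nonneg_right
        (by rw [norm_star]; exact hM x) (norm_nonneg _))
    obtain ⟨k, hk⟩ : ∃ k : Y → Y → ℝ, ∀ x y, k x y = ‖A x * star (A y) - star (A y) * A x‖ :=
      ⟨_, fun _ _ => rfl⟩
    have hkn : ∀ x y, 0 ≤ k x y := fun x y => by rw [hk]; exact norm_nonneg _
    have hck : ∀ x, ∫ y, k x y ∂ν ≤ c := fun x => by simpa only [hk] using hc x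
    have hksymm : ∀ x y, k x y = k y x := fun x y => by
      simp only [hk]
      rw [← norm_star, star_sub, star_mul, star_mul, star_star]
    have hkc : Continuous fun z : Y × Y => k z.1 z.2 := by simp only [hk]; fun_prop
    have hkb : ∀ x y, k x y ≤ 2 * M * M := fun x y => by
      rw [hk]
      calc _ ≤ ‖A x * star (A y)‖ + ‖star (A y) * A x‖ := norm_sub_le _ _
        _ ≤ ‖A x‖ * ‖A y‖ + ‖A y‖ * ‖A x‖ := by
          have h1 := norm_mul_le (A x) (star (A y))
          have h2 := norm_mul_le (star (A y)) (A x)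
          rw [norm_star] at h1 h2
          linarith
        _ ≤ M * M + M * M := by gcongr <;> exact hM _
        _ = _ := by ring
    set I : 𝓗 → ℝ := fun φ => ∫ x, ‖A x φ‖ ^ 2 ∂ν
    have hI0 : ∀ φ, 0 ≤ I φ := fun φ => integral_nonneg fun x => by positivity
    have hAi : ∀ φ, Integrable (fun x => ‖A x φ‖ ^ 2) ν := fun φ => by
      refine hbd1 (K := (M * ‖φ‖) ^ 2) (by fun_prop) fun x => ?_
      rw [Real.norm_of_nonneg (by positivity)]
      exact pow_le_pow_left₀ (norm_nonneg _) (hAφ x φ) 2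
    have hwi : Integrable (fun x => star (A x) (A x ψ)) ν := by
      refine (integrable_const (M * (M * ‖ψ‖))).mono' (Continuous.aestronglyMeasurable (by fun_prop))
        (Eventually.of_forall fun x => (hAsφ x _).trans ?_)
      exact mul_le_mul_of_nonneg_left (hAφ x ψ) hM0
    -- `∫ ‖A x ψ‖² = ⟨ψ, Q⟩` is estimated through the norm of `Q`
    set Q : 𝓗 := ∫ x, star (A x) (A x ψ) ∂ν with hQ
    have hIQ : I ψ ≤ ‖ψ‖ * ‖Q‖ := by
      have h1 : inner ℂ ψ Q = ((I ψ : ℝ) : ℂ) := by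
        rw [hQ, ← integral_inner hwi, ← integral_complex_ofReal]
        congr 1; funext x
        rw [← inner_conj_symm, inner_star_left, inner_self_eq_norm_sq_to_K]
        simp
      have h2 := norm_inner_le_norm (𝕜 := ℂ) ψ Q
      rwa [h1, Complex.norm_real, Real.norm_of_nonneg (hI0 ψ)] at h2
    -- the integrand of `‖Qψ‖²`, after exchanging `A x` and `(A y)*`
    have hpt : ∀ x y, ‖inner ℂ (A x ψ) (A x (star (A y) (A y ψ)))‖
        ≤ (‖A y (A x ψ)‖ ^ 2 + ‖A x (A y ψ)‖ ^ 2) / 2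
          + (k x y * ‖A x ψ‖ ^ 2 + k x y * ‖A y ψ‖ ^ 2) / 2 := fun x y => by
      have e : A x (star (A y) (A y ψ)) = star (A y) (A x (A y ψ))
          + (A x * star (A y) - star (A y) * A x) (A y ψ) := by
        rw [sub_apply]
        change _ = _ + (A x (star (A y) (A y ψ)) - star (A y) (A x (A y ψ)))
        abel
      rw [e, inner_add_right]
      have h1 : ‖inner ℂ (A x ψ) (star (A y) (A x (A y ψ)))‖ ≤ ‖A y (A x ψ)‖ * ‖A x (A y ψ)‖ := by
        have := inner_star_left (star (A y)) (A x ψ) (A x (A y ψ))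
        rw [star_star] at this
        rw [← this]
        exact norm_inner_le_norm _ _
      have h2 : ‖inner ℂ (A x ψ) ((A x * star (A y) - star (A y) * A x) (A y ψ))‖
          ≤ ‖A x ψ‖ * (k x y * ‖A y ψ‖) :=
        (norm_inner_le_norm _ _).trans
          (mul_le_mul_of_nonneg_left (by rw [hk]; exact ContinuousLinearMap.le_opNorm _ _)
            (norm_nonneg _))
      refine (norm_add_le _ _).trans (add_le_add (h1.trans ?_) (h2.trans ?_))
      · nlinarith [sq_nonneg (‖A y (A x ψ)‖ - ‖A x (A y ψ)‖)]
      · have hk0 := hkn x y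
        nlinarith [mul_nonneg hk0 (sq_nonneg (‖A x ψ‖ - ‖A y ψ‖))]
    have hi1 : Integrable (fun z : Y × Y => ‖A z.2 (A z.1 ψ)‖ ^ 2) (ν.prod ν) := by
      refine hbd2 (K := (M * (M * ‖ψ‖)) ^ 2) (by fun_prop) fun z => ?_
      rw [Real.norm_of_nonneg (by positivity)]
      exact pow_le_pow_left₀ (norm_nonneg _)
        ((hAφ _ _).trans (mul_le_mul_of_nonneg_left (hAφ _ _) hM0)) 2
    have hi2 : Integrable (fun z : Y × Y => k z.1 z.2 * ‖A z.1 ψ‖ ^ 2) (ν.prod ν) := by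
      refine hbd2 (K := 2 * M * M * (M * ‖ψ‖) ^ 2) (by fun_prop) fun z => ?_
      have hk0 := hkn z.1 z.2
      rw [Real.norm_of_nonneg (by positivity)]
      have := hkb z.1 z.2
      have := hAφ z.1 ψ
      gcongr
    have hi1' : Integrable (fun z : Y × Y => ‖A z.1 (A z.2 ψ)‖ ^ 2) (ν.prod ν) := hi1.swap
    have hi2' : Integrable (fun z : Y × Y => k z.1 z.2 * ‖A z.2 ψ‖ ^ 2) (ν.prod ν) := by
      refine hi2.swap.congr (Eventually.of_forall fun z => ?_)
      simp only [Function.comp_apply, Prod.fst_swap, Prod.snd_swap]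
      rw [hksymm]
    have hJ1 : ∫ z : Y × Y, ‖A z.2 (A z.1 ψ)‖ ^ 2 ∂ν.prod ν ≤ n * c * I ψ := by
      rw [integral_prod _ hi1, ← integral_const_mul]
      exact integral_mono hi1.integral_prod_left ((hAi ψ).const_mul _) fun x => ih _ (hψ x)
    have hJ2 : ∫ z : Y × Y, k z.1 z.2 * ‖A z.1 ψ‖ ^ 2 ∂ν.prod ν ≤ c * I ψ := by
      rw [integral_prod _ hi2, ← integral_const_mul]
      refine integral_mono hi2.integral_prod_left ((hAi ψ).const_mul _) fun x => ?_
      simp only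
      rw [integral_mul_const]
      exact mul_le_mul_of_nonneg_right (hck x) (by positivity)
    have hJ1' : ∫ z : Y × Y, ‖A z.1 (A z.2 ψ)‖ ^ 2 ∂ν.prod ν ≤ n * c * I ψ := by
      rw [← integral_prod_swap]
      exact hJ1
    have hJ2' : ∫ z : Y × Y, k z.1 z.2 * ‖A z.2 ψ‖ ^ 2 ∂ν.prod ν ≤ c * I ψ := by
      rw [← integral_prod_swap]
      refine le_trans (le_of_eq ?_) hJ2
      congr 1; funext z
      simp only [Prod.fst_swap, Prod.snd_swap]
      rw [hksymm]
    have hQQ : ‖Q‖ ^ 2 ≤ (n + 1) * c * I ψ := by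
      have h1 : inner ℂ Q Q = ∫ x, ∫ y, inner ℂ (A x ψ) (A x (star (A y) (A y ψ))) ∂ν ∂ν := by
        have h2 : ∀ φ : 𝓗, inner ℂ φ Q = ∫ y, inner ℂ φ (star (A y) (A y ψ)) ∂ν := fun φ => by
          rw [hQ, ← integral_inner hwi]
        have h3 : inner ℂ Q Q = ∫ x, inner ℂ (star (A x) (A x ψ)) Q ∂ν := by
          rw [← inner_conj_symm, h2, ← integral_conj]
          congr 1; funext x
          rw [inner_conj_symm]
        rw [h3]
        congr 1; funext x
        rw [h2]
        congr 1; funext y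
        rw [inner_star_left]
      have h2 : ‖Q‖ ^ 2 = ‖(inner ℂ Q Q : ℂ)‖ := by
        rw [inner_self_eq_norm_sq_to_K]; simp
      have hsum : Integrable (fun z : Y × Y => (‖A z.2 (A z.1 ψ)‖ ^ 2 + ‖A z.1 (A z.2 ψ)‖ ^ 2) / 2
          + (k z.1 z.2 * ‖A z.1 ψ‖ ^ 2 + k z.1 z.2 * ‖A z.2 ψ‖ ^ 2) / 2) (ν.prod ν) :=
        ((hi1.add hi1').div_const 2).add ((hi2.add hi2').div_const 2)
      rw [h2, h1]
      calc _ ≤ ∫ x, ∫ y, ((‖A y (A x ψ)‖ ^ 2 + ‖A x (A y ψ)‖ ^ 2) / 2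
          + (k x y * ‖A x ψ‖ ^ 2 + k x y * ‖A y ψ‖ ^ 2) / 2) ∂ν ∂ν := by
            refine norm_integral_le_of_norm_le hsum.integral_prod_left (Eventually.of_forall fun x => ?_)
            refine norm_integral_le_of_norm_le ?_ (Eventually.of_forall fun y => hpt x y)
            refine hbd1 (K := (M * (M * ‖ψ‖)) ^ 2 + 2 * M * M * (M * ‖ψ‖) ^ 2) ?_ fun y => ?_
            · have : Continuous fun y => k x y := hkc.comp (by fun_prop : Continuous fun y => (x, y))
              fun_prop
            · have hk0 := hkn x y
              rw [Real.norm_of_nonneg (by positivity)]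
              have e1 : ‖A y (A x ψ)‖ ^ 2 ≤ (M * (M * ‖ψ‖)) ^ 2 := pow_le_pow_left₀ (norm_nonneg _)
                ((hAφ _ _).trans (mul_le_mul_of_nonneg_left (hAφ _ _) hM0)) 2
              have e2 : ‖A x (A y ψ)‖ ^ 2 ≤ (M * (M * ‖ψ‖)) ^ 2 := pow_le_pow_left₀ (norm_nonneg _)
                ((hAφ _ _).trans (mul_le_mul_of_nonneg_left (hAφ _ _) hM0)) 2
              have e3 : k x y * ‖A x ψ‖ ^ 2 ≤ 2 * M * M * (M * ‖ψ‖) ^ 2 := by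
                have := hkb x y
                have := hAφ x ψ
                gcongr
              have e4 : k x y * ‖A y ψ‖ ^ 2 ≤ 2 * M * M * (M * ‖ψ‖) ^ 2 := by
                have := hkb x y
                have := hAφ y ψ
                gcongr
              linarith
        _ = ∫ z : Y × Y, ((‖A z.2 (A z.1 ψ)‖ ^ 2 + ‖A z.1 (A z.2 ψ)‖ ^ 2) / 2
          + (k z.1 z.2 * ‖A z.1 ψ‖ ^ 2 + k z.1 z.2 * ‖A z.2 ψ‖ ^ 2) / 2) ∂ν.prod ν :=
            (integral_prod _ hsum).symm
        _ = ((∫ z : Y × Y, ‖A z.2 (A z.1 ψ)‖ ^ 2 ∂ν.prod ν)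
            + ∫ z : Y × Y, ‖A z.1 (A z.2 ψ)‖ ^ 2 ∂ν.prod ν) / 2
            + ((∫ z : Y × Y, k z.1 z.2 * ‖A z.1 ψ‖ ^ 2 ∂ν.prod ν)
              + ∫ z : Y × Y, k z.1 z.2 * ‖A z.2 ψ‖ ^ 2 ∂ν.prod ν) / 2 := by
            rw [← integral_add hi1 hi1', ← integral_add hi2 hi2', ← integral_div, ← integral_div]
            exact integral_add ((hi1.add hi1').div_const 2) ((hi2.add hi2').div_const 2)
        _ ≤ _ := by linarith
    -- `‖Q‖² ≤ (n + 1) c ‖ψ‖ ‖Q‖`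
    have hQ1 : ‖Q‖ ≤ (n + 1) * c * ‖ψ‖ := by
      by_cases hQ0 : ‖Q‖ = 0
      · rw [hQ0]; positivity
      have hQp : 0 < ‖Q‖ := lt_of_le_of_ne (norm_nonneg _) (Ne.symm hQ0)
      have h1 : ‖Q‖ * ‖Q‖ ≤ ((n + 1) * c * ‖ψ‖) * ‖Q‖ := by
        calc ‖Q‖ * ‖Q‖ = ‖Q‖ ^ 2 := by ring
          _ ≤ (n + 1) * c * I ψ := hQQ
          _ ≤ (n + 1) * c * (‖ψ‖ * ‖Q‖) := by gcongr
          _ = _ := by ring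
      exact le_of_mul_le_mul_right h1 hQp
    calc I ψ ≤ ‖ψ‖ * ‖Q‖ := hIQ
      _ ≤ ‖ψ‖ * ((n + 1) * c * ‖ψ‖) := by gcongr
      _ = _ := by push_cast; ring

/-- Buchholz' estimate for families indexed by `ℝ^d`. -/
theorem lintegral_enorm_sq_le_of_annih {d : ℕ} {A : EuclideanSpace ℝ (Fin d) → 𝓗 →L[ℂ] 𝓗}
    (hA : Continuous A) {M : ℝ} (hM : ∀ x, ‖A x‖ ≤ M) {C : ℝ} (hC0 : 0 ≤ C)
    (hC : ∀ x y, ‖A x * star (A y) - star (A y) * A x‖ ≤ C * wt (d + 1) (x - y)) (n : ℕ) :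
    ∃ c : ℝ, 0 ≤ c ∧ ∀ ψ, Annih A n ψ → ∫⁻ x, ‖A x ψ‖ₑ ^ 2 ≤ ENNReal.ofReal (c * ‖ψ‖ ^ 2) := by
  have hwi : Integrable (wt (d + 1) : EuclideanSpace ℝ (Fin d) → ℝ) := integrable_wt (by simp)
  have hw0 := integral_wt_nonneg (μ := (volume : Measure (EuclideanSpace ℝ (Fin d)))) (d + 1)
  refine ⟨n * (C * ∫ y : EuclideanSpace ℝ (Fin d), wt (d + 1) y), by positivity, fun ψ hψ => ?_⟩
  have hm : Measurable fun x => ‖A x ψ‖ₑ ^ 2 := by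
    have : Continuous fun x => A x ψ := by fun_prop
    exact (this.enorm.measurable).pow_const 2
  have huniv : (⋃ k : ℕ, Metric.closedBall (0 : EuclideanSpace ℝ (Fin d)) k) = univ :=
    Metric.iUnion_closedBall_nat 0
  rw [← setLIntegral_univ, ← huniv, setLIntegral_iUnion_of_directed _
    (Monotone.directed_le fun i j hij => Metric.closedBall_subset_closedBall (by exact_mod_cast hij))]
  refine iSup_le fun k => ?_
  set K := Metric.closedBall (0 : EuclideanSpace ℝ (Fin d)) k
  have hfin : IsFiniteMeasure (volume.restrict K) :=
    ⟨by rw [Measure.restrict_apply_univ]; exact measure_closedBall_lt_top⟩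
  have h1 := integral_norm_sq_le_of_annih (volume.restrict K) hA hM
    (c := C * ∫ y : EuclideanSpace ℝ (Fin d), wt (d + 1) y) (by positivity) (fun x => ?_) n ψ hψ
  · have h2 : ∀ x, ‖A x ψ‖ₑ ^ 2 = ENNReal.ofReal (‖A x ψ‖ ^ 2) := fun x => by
      rw [ENNReal.ofReal_pow (norm_nonneg _), ofReal_norm]
    simp_rw [h2]
    rw [← ofReal_integral_eq_lintegral_ofReal]
    · exact ENNReal.ofReal_le_ofReal h1
    · have hc : Continuous fun x => ‖A x ψ‖ ^ 2 := by fun_prop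
      exact hc.continuousOn.integrableOn_compact (isCompact_closedBall _ _)
    · exact Eventually.of_forall fun x => by positivity
  · have h3 : ∫ y : EuclideanSpace ℝ (Fin d), wt (d + 1) (x - y) = ∫ y, wt (d + 1) y :=
      integral_sub_left_eq_self (fun y : EuclideanSpace ℝ (Fin d) => wt (d + 1) y) volume x
    rw [← h3, ← integral_const_mul]
    have hi : Integrable fun y => C * wt (d + 1) (x - y) := (hwi.comp_sub_left x).const_mul C
    refine (integral_mono_of_nonneg (Eventually.of_forall fun y => norm_nonneg _) hi.restrict
      (Eventually.of_forall fun y => hC x y)).trans ?_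
    exact setIntegral_le_integral hi (Eventually.of_forall fun y =>
      mul_nonneg hC0 (wt_nonneg _ _))

end Buchholz

section Decreasing

variable {d : ℕ} {m : ℝ} {𝓗 : Type*} [NormedAddCommGroup 𝓗] [InnerProductSpace ℂ 𝓗]
  [CompleteSpace 𝓗] (N : HaagKastlerNet d m 𝓗)

theorem norm_le_of_mem_jointSpectrum {q : Spacetime d} (hq : q ∈ jointSpectrum N.U) :
    ‖q.2‖ ≤ q.1 := by
  rw [N.spectrum_condition] at hq
  have h : ∀ μ : ℝ, ‖q.2‖ ≤ √(‖q.2‖ ^ 2 + μ ^ 2) := fun μ =>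
    Real.le_sqrt_of_sq_le (by nlinarith [sq_nonneg μ])
  rcases hq with (hq | hq) | hq
  · rw [mem_singleton_iff] at hq; simp [hq]
  · have hq' : q.1 = _ := hq
    rw [hq']; exact h m
  · exact (h _).trans hq

theorem bddCont_smear_orb_slice {B : 𝓗 →L[ℂ] 𝓗} (hB : BddCont (orb N B)) {g : Spacetime d → ℂ}
    (hg : IsCc g) : Continuous (fun x : EuclideanSpace ℝ (Fin d) => smear g (orb N B) (0, x)) :=
  (hB.smear hg).cont.comp (by fun_prop)

theorem smear_orb_mem_specSub {B : 𝓗 →L[ℂ] 𝓗} (hB : BddCont (orb N B)) {g : Spacetime d → ℂ}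
    (hg : IsCc g) {S : Set (Spacetime d)} {ψ : 𝓗} (hψ : ψ ∈ specSub N.U S) (a : Spacetime d) :
    smear g (orb N B) a ψ ∈ specSub N.U {p | ∃ s ∈ S, ∃ q ∈ tsupport g, p = s + q} := by
  have h1 := smear_translOp N.U a 0 hg hB
  rw [add_zero] at h1
  have h2 : smear g (orb N B) a = translOp N.U a (smear g (orb N B) 0) := h1.symm
  rw [h2]
  exact translOp_mem_specSub N.strongly_continuous
    (fun φ hφ => smear_translOp_mem_specSub N.strongly_continuous hB hg hφ) a hψ

/-- Operators which lower the quantity `E - v · p` annihilate, in sufficiently large number, all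
vectors on which this quantity is bounded. -/
theorem annih_smear_orb {B : 𝓗 →L[ℂ] 𝓗} (hB : BddCont (orb N B)) {g : Spacetime d → ℂ}
    (hg : IsCc g) {v : EuclideanSpace ℝ (Fin d)} (hv : ‖v‖ ≤ 1) {δ : ℝ}
    (hgs : ∀ q ∈ tsupport g, q.1 - inner ℝ v q.2 ≤ -δ) (n : ℕ) :
    ∀ r : ℝ, r - n * δ < 0 → ∀ ψ ∈ specSub N.U {q | q.1 - inner ℝ v q.2 ≤ r},
      Annih (fun x : EuclideanSpace ℝ (Fin d) => smear g (orb N B) (0, x)) n ψ := by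
  induction n with
  | zero =>
    intro r hr ψ hψ
    refine eq_zero_of_mem_specSub N.strongly_continuous
      (isClosed_le (by fun_prop) continuous_const) ?_ hψ
    rw [Set.disjoint_left]
    intro q hq hqs
    have h1 := norm_le_of_mem_jointSpectrum N hqs
    have h2 := real_inner_le_norm v q.2
    have h3 : ‖v‖ * ‖q.2‖ ≤ ‖q.2‖ := mul_le_of_le_one_left (norm_nonneg _) hv
    have h4 : q.1 - inner ℝ v q.2 ≤ r := hq
    simp only [Nat.cast_zero, zero_mul, sub_zero] at hr
    linarith
  | succ n ih =>
    intro r hr ψ hψ x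
    refine ih (r - δ) (by push_cast at hr; linarith) _
      (specSub_mono ?_ (smear_orb_mem_specSub N hB hg hψ (0, x)))
    rintro _ ⟨s, hs, q, hq, rfl⟩
    have h1 : s.1 - inner ℝ v s.2 ≤ r := hs
    have h2 := hgs q hq
    change (s + q).1 - inner ℝ v (s + q).2 ≤ r - δ
    rw [Prod.fst_add, Prod.snd_add, inner_add_right]
    linarith

theorem enorm_sum_sq_le {α : Type*} (t : Finset α) (v : α → 𝓗) :
    ‖∑ i ∈ t, v i‖ₑ ^ 2 ≤ (t.card : ℝ≥0∞) * ∑ i ∈ t, ‖v i‖ₑ ^ 2 := by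
  have h1 : ∀ w : 𝓗, ‖w‖ₑ ^ 2 = ENNReal.ofReal (‖w‖ ^ 2) := fun w => by
    rw [ENNReal.ofReal_pow (norm_nonneg _), ofReal_norm]
  simp_rw [h1]
  rw [← ENNReal.ofReal_sum_of_nonneg fun i _ => by positivity, ← ENNReal.ofReal_natCast,
    ← ENNReal.ofReal_mul (Nat.cast_nonneg _)]
  refine ENNReal.ofReal_le_ofReal ?_
  exact (pow_le_pow_left₀ (norm_nonneg _) (norm_sum_le _ _) 2).trans sq_sum_le_card_mul_sum_sq

/-- Smeared energy decreasing operators are square-integrable on vectors of bounded energy. -/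
theorem exists_lintegral_smear_orb_le {B : 𝓗 →L[ℂ] 𝓗} (hB : Good N B) {g : Spacetime d → ℂ}
    (hg : IsCc g) (hgd : Disjoint (tsupport g) (forwardCone d)) {S : Set (Spacetime d)}
    (hS : Bornology.IsBounded S) :
    ∃ C : ℝ≥0∞, C ≠ ⊤ ∧ ∀ ψ ∈ specSub N.U S,
      ∫⁻ x : EuclideanSpace ℝ (Fin d), ‖smear g (orb N B) (0, x) ψ‖ₑ ^ 2 ≤ C * ‖ψ‖ₑ ^ 2 := by
  -- the direction and the amount of decrease at a point of the support
  set v : Spacetime d → EuclideanSpace ℝ (Fin d) := fun q => ‖q.2‖⁻¹ • q.2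
  have hv1 : ∀ q, ‖v q‖ ≤ 1 := fun q => by
    simp only [v]
    rw [norm_smul, norm_inv, norm_norm]
    exact inv_mul_le_one
  have hvq : ∀ q, inner ℝ (v q) q.2 = ‖q.2‖ := fun q => by
    simp only [v]
    rw [inner_smul_left, real_inner_self_eq_norm_sq]
    by_cases h : ‖q.2‖ = 0
    · simp [h]
    · simp only [conj_trivial]; field_simp
  set δ : Spacetime d → ℝ := fun q => (‖q.2‖ - q.1) / 2
  have hδ : ∀ q ∈ tsupport g, 0 < δ q := fun q hq => by
    have h1 : q ∉ forwardCone d := Set.disjoint_left.1 hgd hq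
    have h2 : ¬ ‖q.2‖ ≤ q.1 := h1
    simp only [δ]; linarith [not_le.1 h2]
  obtain ⟨t, f, ht, hf, hsum⟩ := hg.exists_finite_decomposition
    (W := fun q => {p | p.1 - inner ℝ (v q) p.2 < -δ q}) fun q hq =>
      ⟨isOpen_lt (by fun_prop) continuous_const, by
        change q.1 - inner ℝ (v q) q.2 < -δ q
        have := hδ q hq
        rw [hvq]; simp only [δ] at this ⊢; linarith⟩
  obtain ⟨R, hR⟩ := hS.subset_closedBall 0
  have hone : ∀ q ∈ t, ∃ c : ℝ, 0 ≤ c ∧ ∀ ψ ∈ specSub N.U S,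
      ∫⁻ x : EuclideanSpace ℝ (Fin d), ‖smear (f q) (orb N B) (0, x) ψ‖ₑ ^ 2
        ≤ ENNReal.ofReal (c * ‖ψ‖ ^ 2) := fun q hq => by
    obtain ⟨hfq, hfs, -⟩ := hf q hq
    have hδq := hδ q (ht q hq)
    obtain ⟨n, hn⟩ := exists_nat_gt (2 * R / δ q)
    have hn' : 2 * R - n * δ q < 0 := by
      rw [div_lt_iff₀ hδq] at hn; linarith
    obtain ⟨M, hM⟩ := (hB.bddCont.smear hfq).bdd
    have hcd : CommDecay (smear (f q) (orb N B)) fun a => star (smear (f q) (orb N B) a) := by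
      have h0 : CommDecay (orb N B) (orb N (star B)) :=
        commDecay_orb N hB.local_approx (hB.local_approx.star N)
      have h1 : orb N (star B) = fun a => star (orb N B a) := funext fun a => translOp_star _ _ _
      rw [h1] at h0
      exact (((h0.smear hfq hB.bddCont).symm).star).smear hfq hB.bddCont
    obtain ⟨C, hC0, hC⟩ := hcd (d + 1)
    obtain ⟨c, hc0, hc⟩ := lintegral_enorm_sq_le_of_annih
      (bddCont_smear_orb_slice N hB.bddCont hfq) (fun x => hM (0, x)) hC0 (fun x y => by
        have := hC (0, x) (0, y)
        simpa [cwt] using this) n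
    refine ⟨c, hc0, fun ψ hψ => hc ψ ?_⟩
    refine annih_smear_orb N hB.bddCont hfq (hv1 q) (fun p hp => (hfs hp).le) n (2 * R) hn' ψ
      (specSub_mono (fun p hp => ?_) hψ)
    have h1 : ‖p‖ ≤ R := by simpa using hR hp
    have h2 := (abs_le.1 ((Real.norm_eq_abs p.1) ▸ (norm_fst_le p).trans h1)).2
    have h3 := abs_real_inner_le_norm (v q) p.2
    have h4 : ‖v q‖ * ‖p.2‖ ≤ R := (mul_le_of_le_one_left (norm_nonneg _) (hv1 q)).trans
      ((norm_snd_le p).trans h1)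
    have h5 := neg_abs_le (inner ℝ (v q) p.2)
    change p.1 - inner ℝ (v q) p.2 ≤ 2 * R
    linarith
  choose! c hc0 hc using hone
  refine ⟨(t.card : ℝ≥0∞) * ∑ q ∈ t, ENNReal.ofReal (c q),
    ENNReal.mul_ne_top (ENNReal.natCast_ne_top _) (ENNReal.sum_ne_top.2 fun q _ => ENNReal.ofReal_ne_top),
    fun ψ hψ => ?_⟩
  have e : ∀ x : EuclideanSpace ℝ (Fin d), smear g (orb N B) (0, x) ψ
      = ∑ q ∈ t, smear (f q) (orb N B) (0, x) ψ := fun x => by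
    rw [show g = _ from funext hsum, smear_sum t (fun q hq => (hf q hq).1) hB.bddCont,
      sum_apply]
  have hmeas : ∀ q ∈ t, Measurable fun x : EuclideanSpace ℝ (Fin d) =>
      ‖smear (f q) (orb N B) (0, x) ψ‖ₑ ^ 2 := fun q hq => by
    have := bddCont_smear_orb_slice N hB.bddCont (hf q hq).1
    have h2 : Continuous fun x : EuclideanSpace ℝ (Fin d) => smear (f q) (orb N B) (0, x) ψ := by
      fun_prop
    exact (h2.enorm.measurable).pow_const 2
  calc ∫⁻ x, ‖smear g (orb N B) (0, x) ψ‖ₑ ^ 2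
      ≤ ∫⁻ x, (t.card : ℝ≥0∞) * ∑ q ∈ t, ‖smear (f q) (orb N B) (0, x) ψ‖ₑ ^ 2 :=
        lintegral_mono fun x => by rw [e]; exact enorm_sum_sq_le _ _
    _ = (t.card : ℝ≥0∞) * ∑ q ∈ t, ∫⁻ x, ‖smear (f q) (orb N B) (0, x) ψ‖ₑ ^ 2 := by
        rw [lintegral_const_mul' _ _ (ENNReal.natCast_ne_top _), lintegral_finsetSum' _ fun q hq =>
          (hmeas q hq).aemeasurable]
    _ ≤ (t.card : ℝ≥0∞) * ∑ q ∈ t, ENNReal.ofReal (c q * ‖ψ‖ ^ 2) := by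
        gcongr with q hq
        exact hc q hq ψ hψ
    _ = _ := by
        rw [mul_assoc, Finset.sum_mul]
        congr 1
        refine Finset.sum_congr rfl fun q hq => ?_
        rw [ENNReal.ofReal_mul (hc0 q hq), ENNReal.ofReal_pow (norm_nonneg _), ofReal_norm]

end Decreasing

/-! ### Products of energy decreasing operators -/

section Products

variable {d : ℕ} {𝓗 : Type*} [NormedAddCommGroup 𝓗] [InnerProductSpace ℂ 𝓗] [CompleteSpace 𝓗]
  {U : Multiplicative (Spacetime d) →* unitary (𝓗 →L[ℂ] 𝓗)}

/-- If each factor is square-integrable on vectors of bounded energy-momentum, and changes the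
energy-momentum by a bounded amount, then so is the product as a function of all positions. -/
theorem exists_lintegral_prod_le (n : ℕ) : ∀ (A : Fin n → EuclideanSpace ℝ (Fin d) → 𝓗 →L[ℂ] 𝓗),
    (∀ i, Continuous (A i)) →
    (∀ i (S : Set (Spacetime d)), Bornology.IsBounded S → ∃ C : ℝ≥0∞, C ≠ ⊤ ∧ ∀ ψ ∈ specSub U S,
      ∫⁻ x, ‖A i x ψ‖ₑ ^ 2 ≤ C * ‖ψ‖ₑ ^ 2) →
    (∀ i (S : Set (Spacetime d)), Bornology.IsBounded S → ∃ S', Bornology.IsBounded S' ∧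
      ∀ x, ∀ ψ ∈ specSub U S, A i x ψ ∈ specSub U S') →
    ∀ S : Set (Spacetime d), Bornology.IsBounded S →
      (∃ C : ℝ≥0∞, C ≠ ⊤ ∧ ∀ ψ ∈ specSub U S, ∫⁻ x : Fin n → EuclideanSpace ℝ (Fin d),
        ‖(List.ofFn fun i => A i (x i)).prod ψ‖ₑ ^ 2 ≤ C * ‖ψ‖ₑ ^ 2) ∧
      ∃ S', Bornology.IsBounded S' ∧ ∀ x : Fin n → EuclideanSpace ℝ (Fin d), ∀ ψ ∈ specSub U S,
        (List.ofFn fun i => A i (x i)).prod ψ ∈ specSub U S' := by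
  induction n with
  | zero =>
    intro A _ _ _ S hS
    refine ⟨⟨1, ENNReal.one_ne_top, fun ψ _ => ?_⟩, S, hS, fun x ψ hψ => ?_⟩
    · simp only [List.ofFn_zero, List.prod_nil, lintegral_const]
      change ‖ψ‖ₑ ^ 2 * _ ≤ _
      rw [volume_pi, Measure.pi_empty_univ, mul_one, one_mul]
    · rw [List.ofFn_zero, List.prod_nil]; exact hψ
  | succ n ih =>
    intro A hA h1 h2 S hS
    obtain ⟨⟨C, hCt, hC⟩, S', hS', hSS'⟩ := ih (fun i => A i.succ) (fun i => hA i.succ)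
      (fun i => h1 i.succ) (fun i => h2 i.succ) S hS
    obtain ⟨C₀, hC₀t, hC₀⟩ := h1 0 S' hS'
    obtain ⟨S'', hS'', hSS''⟩ := h2 0 S' hS'
    refine ⟨⟨C₀ * C, ENNReal.mul_ne_top hC₀t hCt, fun ψ hψ => ?_⟩, S'', hS'', fun x ψ hψ => ?_⟩
    · have hmp := (volume_preserving_piFinSuccAbove
        (fun _ : Fin (n + 1) => EuclideanSpace ℝ (Fin d)) 0).symm
      rw [← hmp.lintegral_comp_emb (MeasurableEquiv.measurableEmbedding _)]
      have e : ∀ z : EuclideanSpace ℝ (Fin d) × (Fin n → EuclideanSpace ℝ (Fin d)),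
          (List.ofFn fun i => A i ((MeasurableEquiv.piFinSuccAbove
            (fun _ : Fin (n + 1) => EuclideanSpace ℝ (Fin d)) 0).symm z i)).prod ψ
          = A 0 z.1 ((List.ofFn fun i => A i.succ (z.2 i)).prod ψ) := fun z => by
        rw [List.ofFn_succ, List.prod_cons]
        rfl
      simp_rw [e]
      have hc2 : Continuous fun z : EuclideanSpace ℝ (Fin d) × (Fin n → EuclideanSpace ℝ (Fin d)) =>
          (List.ofFn fun i => A i.succ (z.2 i)).prod := by
        have h3 : Continuous fun z : EuclideanSpace ℝ (Fin d) × (Fin n → EuclideanSpace ℝ (Fin d)) =>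
          ContinuousMultilinearMap.mkPiAlgebraFin ℂ n (𝓗 →L[ℂ] 𝓗) fun i => A i.succ (z.2 i) := by
          refine (ContinuousMultilinearMap.mkPiAlgebraFin ℂ n (𝓗 →L[ℂ] 𝓗)).cont.comp ?_
          exact continuous_pi fun i => (hA i.succ).comp (by fun_prop)
        simpa only [ContinuousMultilinearMap.mkPiAlgebraFin_apply] using h3
      have hc1 := hA 0
      have hcont : Continuous fun z : EuclideanSpace ℝ (Fin d) × (Fin n → EuclideanSpace ℝ (Fin d)) =>
          A 0 z.1 ((List.ofFn fun i => A i.succ (z.2 i)).prod ψ) := by fun_prop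
      have hmeas : Measurable fun z : EuclideanSpace ℝ (Fin d) × (Fin n → EuclideanSpace ℝ (Fin d)) =>
          ‖A 0 z.1 ((List.ofFn fun i => A i.succ (z.2 i)).prod ψ)‖ₑ ^ 2 :=
        hcont.enorm.measurable.pow_const 2
      rw [Measure.volume_eq_prod, lintegral_prod_symm' _ hmeas]
      calc _ ≤ ∫⁻ y : Fin n → EuclideanSpace ℝ (Fin d),
            C₀ * ‖(List.ofFn fun i => A i.succ (y i)).prod ψ‖ₑ ^ 2 :=
            lintegral_mono fun y => hC₀ _ (hSS' y ψ hψ)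
        _ ≤ C₀ * (C * ‖ψ‖ₑ ^ 2) := by
            rw [lintegral_const_mul' _ _ hC₀t]
            gcongr
            exact hC ψ hψ
        _ = _ := by rw [mul_assoc]
    · rw [List.ofFn_succ, List.prod_cons]
      exact hSS'' _ _ (hSS' (fun i => x i.succ) ψ hψ)

/-- The particle positions as a linear isomorphism. -/
def particleEquiv (n d : ℕ) : Config n d ≃L[ℝ] (Fin n → EuclideanSpace ℝ (Fin d)) :=
  LinearEquiv.toContinuousLinearEquiv
    { toFun := fun x i => particle x i
      invFun := fun y => WithLp.toLp 2 fun k => y k.1 k.2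
      map_add' := fun a b => by funext i; exact particle_add a b i
      map_smul' := fun c a => by funext i; exact particle_smul c a i
      left_inv := fun a => by ext k; rfl
      right_inv := fun z => by funext i; ext j; rfl }

theorem exists_lintegral_config_eq (n d : ℕ) : ∃ c : ℝ≥0∞, c ≠ ⊤ ∧
    ∀ f : (Fin n → EuclideanSpace ℝ (Fin d)) → ℝ≥0∞,
      ∫⁻ x : Config n d, f (fun i => particle x i) = c * ∫⁻ y, f y := by
  have : (volume : Measure (Fin n → EuclideanSpace ℝ (Fin d))).IsAddHaarMeasure :=
    inferInstanceAs (Measure.pi fun _ => volume).IsAddHaarMeasure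
  obtain ⟨c, -, hct, hc⟩ := exists_map_volume_eq_smul (particleEquiv n d)
  refine ⟨c, hct, fun f => ?_⟩
  rw [← smul_eq_mul, ← lintegral_smul_measure, ← hc]
  exact ((particleEquiv n d).toHomeomorph.measurableEmbedding.lintegral_map _).symm

theorem norm_prod_ofFn_le (n : ℕ) : ∀ (A : Fin n → 𝓗 →L[ℂ] 𝓗) {M : ℝ}, 1 ≤ M →
    (∀ j, ‖A j‖ ≤ M) → ‖(List.ofFn A).prod‖ ≤ M ^ n := by
  induction n with
  | zero =>
    intro A M _ _
    rw [List.ofFn_zero, List.prod_nil, pow_zero]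
    exact ContinuousLinearMap.norm_id_le
  | succ n ih =>
    intro A M hM hA
    rw [List.ofFn_succ, List.prod_cons, pow_succ']
    have h1 := ih (fun i => A i.succ) hM fun j => hA j.succ
    exact (norm_mul_le _ _).trans (mul_le_mul (hA 0) h1 (norm_nonneg _) (by linarith))

/-- Moving one factor of a product to the left, up to commutators. -/
theorem exists_prod_eq_mul_add (n : ℕ) : ∀ (A : Fin n → 𝓗 →L[ℂ] 𝓗) (i : Fin n) {M : ℝ}, 1 ≤ M →
    (∀ j, ‖A j‖ ≤ M) → ∃ Y Z : 𝓗 →L[ℂ] 𝓗, (List.ofFn A).prod = A i * Y + Z ∧ ‖Y‖ ≤ M ^ n ∧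
      ‖Z‖ ≤ M ^ n * ∑ j ∈ Finset.univ.filter (fun j => j ≠ i), ‖A j * A i - A i * A j‖ := by
  induction n with
  | zero => intro A i; exact i.elim0
  | succ n ih =>
    intro A i M hM hA
    have hM0 : 0 ≤ M := by linarith
    rw [List.ofFn_succ, List.prod_cons]
    refine Fin.cases ?_ (fun i => ?_) i
    · refine ⟨(List.ofFn fun i => A i.succ).prod, 0, by rw [add_zero], ?_, ?_⟩
      · exact (norm_prod_ofFn_le n (fun i => A i.succ) hM fun j => hA j.succ).trans
          (pow_le_pow_right₀ hM (Nat.le_succ n))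
      · rw [norm_zero]; positivity
    · obtain ⟨Y, Z, h, hY, hZ⟩ := ih (fun i => A i.succ) i hM fun j => hA j.succ
      refine ⟨A 0 * Y, (A 0 * A i.succ - A i.succ * A 0) * Y + A 0 * Z, ?_, ?_, ?_⟩
      · rw [h]; noncomm_ring
      · rw [pow_succ']
        exact (norm_mul_le _ _).trans (mul_le_mul (hA 0) hY (norm_nonneg _) hM0)
      · have hfil : ∑ j ∈ Finset.univ.filter (fun j : Fin (n + 1) => j ≠ i.succ),
            ‖A j * A i.succ - A i.succ * A j‖
            = ‖A 0 * A i.succ - A i.succ * A 0‖ + ∑ j ∈ Finset.univ.filter (fun j : Fin n => j ≠ i),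
              ‖A j.succ * A i.succ - A i.succ * A j.succ‖ := by
          rw [Finset.sum_filter, Fin.sum_univ_succ, Finset.sum_filter, if_pos (Fin.succ_ne_zero i).symm]
          simp only [ne_eq, Fin.succ_inj]
        have h1 := norm_nonneg (A 0 * A i.succ - A i.succ * A 0)
        have h2 : M ^ n ≤ M ^ (n + 1) := pow_le_pow_right₀ hM (Nat.le_succ n)
        rw [hfil, mul_add]
        refine (norm_add_le _ _).trans (add_le_add ?_ ?_)
        · refine (norm_mul_le _ _).trans ?_
          rw [mul_comm]
          exact mul_le_mul_of_nonneg_right (hY.trans h2) h1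
        · refine (norm_mul_le _ _).trans ?_
          rw [pow_succ', mul_assoc]
          exact mul_le_mul (hA 0) hZ (norm_nonneg _) hM0

end Products

/-! ### The amplitudes `(Ω | B₁(t, x₁) ⋯ Bₙ(t, xₙ) Ψ)` -/

section SpecDeriv

variable {d : ℕ} {𝓗 : Type*} [NormedAddCommGroup 𝓗] [InnerProductSpace ℂ 𝓗] [CompleteSpace 𝓗]
  {U : Multiplicative (Spacetime d) →* unitary (𝓗 →L[ℂ] 𝓗)}

/-- The operator `h(H, P)`, up to a constant. -/
def smearL (hU : ∀ ψ : 𝓗, Continuous fun a : Spacetime d => transl U a ψ) {h : Spacetime d → ℂ}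
    (hh : IsCc h) : 𝓗 →L[ℂ] 𝓗 :=
  LinearMap.mkContinuous
    { toFun := fun ψ => smear h (fun a => transl U a ψ) 0
      map_add' := fun φ ψ => by
        simp only [smear, map_add, smul_add]
        exact integral_add (integrable_smear hh (bddCont_transl hU φ) 0)
          (integrable_smear hh (bddCont_transl hU ψ) 0)
      map_smul' := fun c ψ => by
        simp only [smear, map_smul, smul_comm _ c, RingHom.id_apply]
        exact integral_smul _ _ } (∫ a, ‖inverseFourierST h a‖) fun ψ =>
    norm_smear_le hh (fun a => (norm_transl_apply U a ψ).le) 0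

theorem smearL_apply (hU : ∀ ψ : 𝓗, Continuous fun a : Spacetime d => transl U a ψ)
    {h : Spacetime d → ℂ} (hh : IsCc h) (ψ : 𝓗) :
    smearL hU hh ψ = smear h (fun a => transl U a ψ) 0 := rfl

theorem transl_smear (hU : ∀ ψ : 𝓗, Continuous fun a : Spacetime d => transl U a ψ)
    {h : Spacetime d → ℂ} (hh : IsCc h) (b : Spacetime d) (ψ : 𝓗) :
    transl U b (smear h (fun a => transl U a ψ) 0) = smear h (fun a => transl U a ψ) b := by
  rw [smear_eq, smear_eq, ← ContinuousLinearMap.integral_comp_comm _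
    (integrable_smear' hh (bddCont_transl hU ψ) 0)]
  congr 1; funext a
  rw [map_smul, transl_apply_transl, add_zero, add_comm]

/-- On vectors with bounded energy-momentum the time evolution is differentiable in norm, and the
generator preserves the energy-momentum support. -/
theorem exists_hasDerivAt_transl (hU : ∀ ψ : 𝓗, Continuous fun a : Spacetime d => transl U a ψ)
    {S : Set (Spacetime d)} (hS : Bornology.IsBounded S) {Ψ : 𝓗} (hΨ : Ψ ∈ specSub U S) :
    ∃ Ψ' ∈ specSub U S, ∀ t : ℝ, HasDerivAt
      (fun t : ℝ => transl U (-t, (0 : EuclideanSpace ℝ (Fin d))) Ψ) (transl U (-t, 0) Ψ') t := by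
  obtain ⟨χ, hχs, hχc, hχ1, -, -⟩ := exists_smooth_cutoff hS.isCompact_closure isOpen_univ
    (subset_univ _)
  have hf : IsCc fun q => ((χ q : ℝ) : ℂ) := isCc_ofReal hχs hχc
  have hf' : IsCc fun q : Spacetime d => Complex.I * (q.1 : ℂ) * ((χ q : ℝ) : ℂ) :=
    hf.mul_left (contDiff_const.mul (Complex.ofRealCLM.contDiff.comp contDiff_fst))
  have h1 := smear_eq_of_eventually_eq_one (bddCont_transl hU Ψ) hS hΨ hf fun q hq => by
    filter_upwards [(eventually_nhdsSet_iff_forall.1 hχ1) q (subset_closure hq)] with p hp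
    rw [hp, Complex.ofReal_one]
  rw [transl_zero_apply] at h1
  have hk := kap_ne_zero d
  have h2 : ∀ b, transl U b Ψ = (kap d)⁻¹ • smear (fun q => ((χ q : ℝ) : ℂ)) (fun a => transl U a Ψ) b :=
    fun b => by
      rw [← transl_smear hU hf, h1, map_smul, smul_smul, inv_mul_cancel₀ hk, one_smul]
  refine ⟨-((kap d)⁻¹ • smearL hU hf' Ψ), ?_, fun t => ?_⟩
  · rw [← neg_smul]
    exact specSub_smul hU _ (specSub_map hU (smearL hU hf') (fun a φ => by
      rw [smearL_apply, smearL_apply, smear_transl_map hU (transl U a) (fun b φ => by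
        rw [transl_apply_transl, transl_apply_transl, add_comm]) hf']) hΨ)
  · have h3 := (hasDerivAt_smear hf (bddCont_transl hU Ψ) (-t) 0)
    have h4 := (h3.scomp t (hasDerivAt_neg t)).const_smul (kap d)⁻¹
    have e : (fun t : ℝ => transl U (-t, (0 : EuclideanSpace ℝ (Fin d))) Ψ)
        = fun t : ℝ => (kap d)⁻¹ • smear (fun q => ((χ q : ℝ) : ℂ)) (fun a => transl U a Ψ) (-t, 0) :=
      funext fun t => h2 _
    rw [e]
    refine h4.congr_deriv ?_
    rw [map_neg, map_smul, smearL_apply, transl_smear hU hf', neg_one_smul, smul_neg]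

end SpecDeriv

section Amplitude

variable {n d : ℕ} {m : ℝ} {𝓗 : Type*} [NormedAddCommGroup 𝓗] [InnerProductSpace ℂ 𝓗]
  [CompleteSpace 𝓗] (N : HaagKastlerNet d m 𝓗) (B : Fin n → (𝓗 →L[ℂ] 𝓗))

/-- The factors of the product `B₁(t, x₁) ⋯ Bₙ(t, xₙ)`, with energy-momentum transfers cut off by
`g`. -/
def fac (g : Fin n → Spacetime d → ℂ) (t : ℝ) (x : Config n d) (i : Fin n) : 𝓗 →L[ℂ] 𝓗 :=
  smear (g i) (orb N (B i)) (t, particle x i)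

/-- The amplitude `(Ω | B₁(t, x₁) ⋯ Bₙ(t, xₙ) ψ)`, with energy-momentum transfers cut off by `g`. -/
def amp (g : Fin n → Spacetime d → ℂ) (ψ : 𝓗) (t : ℝ) (x : Config n d) : ℂ :=
  inner ℂ N.Ω ((List.ofFn (fac N B g t x)).prod ψ)

theorem fac_update (g : Fin n → Spacetime d → ℂ) (t : ℝ) (x : Config n d) (i : Fin n)
    (k : Spacetime d → ℂ) : fac N B (Function.update g i k) t x
      = Function.update (fac N B g t x) i (smear k (orb N (B i)) (t, particle x i)) := by
  funext j
  by_cases h : j = i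
  · subst h; simp [fac]
  · simp [fac, h]

/-- The amplitude as a function of its `i`-th factor. -/
def slot (A : Fin n → (𝓗 →L[ℂ] 𝓗)) (ψ : 𝓗) (i : Fin n) : (𝓗 →L[ℂ] 𝓗) →L[ℂ] ℂ :=
  (innerSL ℂ N.Ω).comp ((ContinuousLinearMap.apply ℂ 𝓗 ψ).comp
    ((ContinuousMultilinearMap.mkPiAlgebraFin ℂ n (𝓗 →L[ℂ] 𝓗)).toContinuousLinearMap A i))

theorem slot_apply (A : Fin n → (𝓗 →L[ℂ] 𝓗)) (ψ : 𝓗) (i : Fin n) (T : 𝓗 →L[ℂ] 𝓗) :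
    slot N A ψ i T = inner ℂ N.Ω ((List.ofFn (Function.update A i T)).prod ψ) := by
  simp only [slot, ContinuousLinearMap.comp_apply, innerSL_apply_apply, ContinuousLinearMap.apply_apply]
  congr 2

theorem amp_update (g : Fin n → Spacetime d → ℂ) (ψ : 𝓗) (t : ℝ) (x : Config n d) (i : Fin n)
    (k : Spacetime d → ℂ) : amp N B (Function.update g i k) ψ t x
      = slot N (fac N B g t x) ψ i (smear k (orb N (B i)) (t, particle x i)) := by
  rw [slot_apply, amp, fac_update]

theorem translOp_list_prod (a : Spacetime d) (l : List (𝓗 →L[ℂ] 𝓗)) :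
    translOp N.U a l.prod = (l.map (translOp N.U a)).prod := by
  induction l with
  | nil =>
    rw [List.prod_nil, List.map_nil, List.prod_nil]
    ext ψ
    rw [translOp_apply]
    change transl N.U a (transl N.U (-a) ψ) = ψ
    rw [transl_apply_transl, add_neg_cancel, transl_zero_apply]
  | cons A l ih => rw [List.prod_cons, List.map_cons, List.prod_cons, translOp_mul, ih]

variable {B} (hB : ∀ i, Good N (B i))

include hB

/-- The time dependence of the amplitudes can be shifted to the vector. -/
theorem amp_transl {g : Fin n → Spacetime d → ℂ} (hg : ∀ i, IsCc (g i)) (ψ : 𝓗) (t : ℝ)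
    (x : Config n d) : amp N B g (transl N.U (-t, 0) ψ) 0 x = amp N B g ψ t x := by
  have h1 : translOp N.U (t, 0) (List.ofFn (fac N B g 0 x)).prod = (List.ofFn (fac N B g t x)).prod := by
    rw [translOp_list_prod, List.map_ofFn]
    congr 2; funext i
    simp only [Function.comp_apply, fac]
    have h2 := smear_translOp N.U (t, 0) (0, particle x i) (hg i) (hB i).bddCont
    rw [Prod.mk_add_mk, add_zero, zero_add] at h2
    exact h2
  rw [amp, amp, ← h1, translOp_apply, ← neg_neg ((t, 0) : Spacetime d), ← inner_transl_left,
    neg_neg, transl_vacuum, Prod.neg_mk, neg_zero]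

theorem continuous_fac {g : Fin n → Spacetime d → ℂ} (hg : ∀ i, IsCc (g i)) (t : ℝ) (i : Fin n) :
    Continuous fun x => fac N B g t x i := by
  have h1 := ((hB i).bddCont.smear (hg i)).cont
  have h2 := continuous_particle (d := d) i
  simp only [fac]
  fun_prop

theorem continuous_amp {g : Fin n → Spacetime d → ℂ} (hg : ∀ i, IsCc (g i)) (ψ : 𝓗) (t : ℝ) :
    Continuous (amp N B g ψ t) := by
  have h1 : Continuous fun x => (List.ofFn (fac N B g t x)).prod := by
    have h2 : Continuous fun x =>
        ContinuousMultilinearMap.mkPiAlgebraFin ℂ n (𝓗 →L[ℂ] 𝓗) (fac N B g t x) :=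
      (ContinuousMultilinearMap.mkPiAlgebraFin ℂ n (𝓗 →L[ℂ] 𝓗)).cont.comp
        (continuous_pi fun i => continuous_fac N hB hg t i)
    simpa only [ContinuousMultilinearMap.mkPiAlgebraFin_apply] using h2
  unfold amp
  fun_prop

theorem exists_norm_fac_le {g : Fin n → Spacetime d → ℂ} (hg : ∀ i, IsCc (g i)) :
    ∃ M, 1 ≤ M ∧ ∀ t x i, ‖fac N B g t x i‖ ≤ M := by
  have h1 : ∀ i, ∃ M, ∀ a, ‖smear (g i) (orb N (B i)) a‖ ≤ M := fun i =>
    ((hB i).bddCont.smear (hg i)).bdd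
  choose M hM using h1
  have hM0 : ∀ i, 0 ≤ M i := fun i => (norm_nonneg _).trans (hM i 0)
  refine ⟨1 + ∑ i, M i, by linarith [Finset.sum_nonneg fun i (_ : i ∈ Finset.univ) => hM0 i],
    fun t x i => (hM i _).trans ?_⟩
  have := Finset.single_le_sum (fun i _ => hM0 i) (Finset.mem_univ i)
  linarith

theorem exists_norm_amp_le {g : Fin n → Spacetime d → ℂ} (hg : ∀ i, IsCc (g i)) :
    ∃ C, 0 ≤ C ∧ ∀ ψ t x, ‖amp N B g ψ t x‖ ≤ C * ‖ψ‖ := by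
  obtain ⟨M, hM1, hM⟩ := exists_norm_fac_le N hB hg
  refine ⟨M ^ n, by positivity, fun ψ t x => ?_⟩
  refine (norm_inner_le_norm _ _).trans ?_
  rw [N.vacuum_norm, one_mul]
  exact (ContinuousLinearMap.le_opNorm _ _).trans
    (mul_le_mul_of_nonneg_right (norm_prod_ofFn_le n _ hM1 (hM t x)) (norm_nonneg _))

omit hB in
theorem memLp_of_lintegral_le {f : Config n d → ℂ} (hf : Continuous f) {K : ℝ} (hK : 0 ≤ K)
    (h : ∫⁻ x, ‖f x‖ₑ ^ 2 ≤ ENNReal.ofReal (K ^ 2)) :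
    ∃ hf : MemLp f 2 volume, ‖hf.toLp f‖ ≤ K := by
  have h1 : eLpNorm f 2 volume ≤ ENNReal.ofReal K := by
    rw [eLpNorm_eq_lintegral_rpow_enorm_toReal two_ne_zero ENNReal.ofNat_ne_top]
    have h2 : (2 : ℝ≥0∞).toReal = ((2 : ℕ) : ℝ) := by norm_num
    rw [h2]
    simp_rw [ENNReal.rpow_natCast]
    rw [ENNReal.ofReal_pow hK] at h
    calc _ ≤ (ENNReal.ofReal K ^ 2) ^ (1 / ((2 : ℕ) : ℝ)) := by gcongr
      _ = _ := by
        rw [← ENNReal.rpow_natCast, ← ENNReal.rpow_mul]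
        norm_num
  have h2 : MemLp f 2 volume := ⟨hf.aestronglyMeasurable, h1.trans_lt ENNReal.ofReal_lt_top⟩
  refine ⟨h2, ?_⟩
  rw [Lp.norm_toLp]
  exact ENNReal.toReal_le_of_le_ofReal hK h1

/-- The amplitudes are square-integrable, with a bound depending on the vector only through its
norm. -/
theorem exists_memLp_amp {g : Fin n → Spacetime d → ℂ} (hg : ∀ i, IsCc (g i))
    (hgd : ∀ i, Disjoint (tsupport (g i)) (forwardCone d)) {S : Set (Spacetime d)}
    (hS : Bornology.IsBounded S) : ∃ K : ℝ, 0 ≤ K ∧ ∀ ψ ∈ specSub N.U S,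
      ∃ h : MemLp (amp N B g ψ 0) 2 volume, ‖h.toLp (amp N B g ψ 0)‖ ≤ K * ‖ψ‖ := by
  obtain ⟨⟨C, hCt, hC⟩, -⟩ := exists_lintegral_prod_le (U := N.U) n
    (fun i y => smear (g i) (orb N (B i)) (0, y))
    (fun i => bddCont_smear_orb_slice N (hB i).bddCont (hg i))
    (fun i S hS => exists_lintegral_smear_orb_le N (hB i) (hg i) (hgd i) hS)
    (fun i S hS => by
      refine ⟨_, ?_, fun x ψ hψ => smear_orb_mem_specSub N (hB i).bddCont (hg i) hψ (0, x)⟩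
      obtain ⟨R, hR⟩ := hS.exists_norm_le
      obtain ⟨R', hR'⟩ := (hg i).compact.isCompact.isBounded.exists_norm_le
      refine (isBounded_iff_forall_norm_le).2 ⟨R + R', ?_⟩
      rintro _ ⟨s, hs, q, hq, rfl⟩
      exact (norm_add_le _ _).trans (add_le_add (hR s hs) (hR' q hq))) S hS
  obtain ⟨c, hct, hc⟩ := exists_lintegral_config_eq n d
  refine ⟨√((c * C).toReal), Real.sqrt_nonneg _, fun ψ hψ => ?_⟩
  refine memLp_of_lintegral_le (continuous_amp N hB hg ψ 0) (by positivity) ?_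
  have h1 : ∀ x, ‖amp N B g ψ 0 x‖ₑ ^ 2 ≤ ‖(List.ofFn (fac N B g 0 x)).prod ψ‖ₑ ^ 2 := fun x => by
    gcongr
    rw [enorm_le_iff_norm_le]
    refine (norm_inner_le_norm _ _).trans ?_
    rw [N.vacuum_norm, one_mul]
  calc ∫⁻ x, ‖amp N B g ψ 0 x‖ₑ ^ 2 ≤ ∫⁻ x, ‖(List.ofFn (fac N B g 0 x)).prod ψ‖ₑ ^ 2 :=
        lintegral_mono h1
    _ = c * ∫⁻ y : Fin n → EuclideanSpace ℝ (Fin d),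
        ‖(List.ofFn fun i => smear (g i) (orb N (B i)) (0, y i)).prod ψ‖ₑ ^ 2 :=
        hc fun y => ‖(List.ofFn fun i => smear (g i) (orb N (B i)) (0, y i)).prod ψ‖ₑ ^ 2
    _ ≤ c * (C * ‖ψ‖ₑ ^ 2) := by gcongr; exact hC ψ hψ
    _ = ENNReal.ofReal ((√((c * C).toReal) * ‖ψ‖) ^ 2) := by
        rw [mul_pow, Real.sq_sqrt ENNReal.toReal_nonneg, ENNReal.ofReal_mul ENNReal.toReal_nonneg,
          ENNReal.ofReal_toReal (ENNReal.mul_ne_top hct hCt), ENNReal.ofReal_pow (norm_nonneg _),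
          ofReal_norm, mul_assoc]

theorem hasDerivAt_amp {g : Fin n → Spacetime d → ℂ} (hg : ∀ i, IsCc (g i)) (ψ : 𝓗) (t : ℝ)
    (x : Config n d) : HasDerivAt (fun t => amp N B g ψ t x)
      (∑ i, amp N B (Function.update g i fun q => Complex.I * (q.1 : ℂ) * g i q) ψ t x) t := by
  have h1 : HasDerivAt (fun t => fac N B g t x) (fun i =>
      smear (fun q => Complex.I * (q.1 : ℂ) * g i q) (orb N (B i)) (t, particle x i)) t :=
    hasDerivAt_pi.2 fun i => hasDerivAt_smear (hg i) (hB i).bddCont t (particle x i)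
  have h2 := (((ContinuousMultilinearMap.mkPiAlgebraFin ℂ n (𝓗 →L[ℂ] 𝓗)).hasFDerivAt
    (fac N B g t x)).restrictScalars ℝ).comp_hasDerivAt t h1
  have h3 := ((((innerSL ℂ N.Ω).comp (ContinuousLinearMap.apply ℂ 𝓗 ψ)).restrictScalars ℝ).hasFDerivAt
    ).comp_hasDerivAt t h2
  refine h3.congr_deriv ?_
  simp only [ContinuousLinearMap.coe_restrictScalars', ContinuousLinearMap.comp_apply,
    ContinuousMultilinearMap.linearDeriv_apply, map_sum]
  refine Finset.sum_congr rfl fun i _ => ?_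
  rw [amp_update, slot_apply]
  rfl

/-- The operator `σ(Dᵢ)` on the amplitudes: it sees the negative of the momentum transfer of `Bᵢ`,
because `Bᵢ(0, x)` transfers the momentum `p` with the phase `exp(-i p · x)`. -/
theorem pconv_amp {g : Fin n → Spacetime d → ℂ} (hg : ∀ i, IsCc (g i)) (ψ : 𝓗) (t : ℝ)
    {σ : EuclideanSpace ℝ (Fin d) → ℂ} (hσ : IsCc σ) (i : Fin n) (x : Config n d) :
    pconv σ i (amp N B g ψ t) x
      = amp N B (Function.update g i fun q => σ (-q.2) * g i q) ψ t x := by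
  have h1 : ∀ r, amp N B g ψ t (x - single i r)
      = slot N (fac N B g t x) ψ i (smear (g i) (orb N (B i)) (t, particle x i - r)) := fun r => by
    rw [slot_apply, amp]
    congr 3
    congr 1
    funext j
    simp only [fac, particle_sub, particle_single]
    by_cases h : j = i
    · subst h; simp
    · simp [h, fac]
  rw [amp_update, ← integral_invF_smul_smear hσ (hg i) (hB i).bddCont,
    ← ContinuousLinearMap.integral_comp_comm]
  · simp only [pconv, h1, map_smul, smul_eq_mul]
  · obtain ⟨M, hM⟩ := ((hB i).bddCont.smear (hg i)).bdd
    have hc := ((hB i).bddCont.smear (hg i)).cont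
    exact (integrable_invF hσ.smooth hσ.compact).smul_bdd M
      (Continuous.aestronglyMeasurable (by fun_prop)) (Eventually.of_forall fun r => hM _)

theorem exists_norm_commutator_fac_le {g : Fin n → Spacetime d → ℂ} (hg : ∀ i, IsCc (g i))
    (i j : Fin n) (k : ℕ) : ∃ C, 0 ≤ C ∧ ∀ x, ‖fac N B g 0 x j * fac N B g 0 x i
      - fac N B g 0 x i * fac N B g 0 x j‖ ≤ C * wt k (particle x j - particle x i) := by
  have h1 : CommDecay (orb N (B j)) (orb N (B i)) :=
    commDecay_orb N (hB j).local_approx (hB i).local_approx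
  have h2 := ((h1.smear (hg j) (hB j).bddCont).symm.smear (hg i) (hB i).bddCont).symm
  obtain ⟨C, hC0, hC⟩ := h2 k
  refine ⟨C, hC0, fun x => ?_⟩
  have h3 := hC (0, particle x j) (0, particle x i)
  rw [Prod.mk_sub_mk, sub_zero] at h3
  simpa only [cwt, fac, abs_zero, add_zero, one_pow, one_mul] using h3

omit hB in
theorem wt_le_collWt (k : ℕ) (x : Config n d) {i j : Fin n} (hj : j ≠ i) :
    wt k (particle x j - particle x i) ≤ collWt k x := by
  have h1 : (j, i) ∈ Finset.univ.filter (fun p : Fin n × Fin n => p.1 ≠ p.2) :=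
    Finset.mem_filter.2 ⟨Finset.mem_univ _, hj⟩
  have h2 := Finset.single_le_sum
    (f := fun p : Fin n × Fin n => wt k (particle x p.1 - particle x p.2))
    (fun p _ => wt_nonneg _ _) h1
  rw [collWt]
  exact h2

/-- The amplitude is small away from the collision planes if the adjoint of one of its factors
annihilates the vacuum. -/
theorem exists_norm_amp_le_collWt {g : Fin n → Spacetime d → ℂ} (hg : ∀ i, IsCc (g i)) (i : Fin n)
    (h0 : ∀ b, star (smear (g i) (orb N (B i)) b) N.Ω = 0) (k : ℕ) :
    ∃ C, 0 ≤ C ∧ ∀ ψ x, ‖amp N B g ψ 0 x‖ ≤ C * ‖ψ‖ * collWt k x := by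
  obtain ⟨M, hM1, hM⟩ := exists_norm_fac_le N hB hg
  choose C hC0 hC using fun j => exists_norm_commutator_fac_le N hB hg i j k
  have hS0 : 0 ≤ ∑ j, C j := Finset.sum_nonneg fun j _ => hC0 j
  refine ⟨M ^ n * ∑ j, C j, by positivity, fun ψ x => ?_⟩
  obtain ⟨Y, Z, h, -, hZ⟩ := exists_prod_eq_mul_add n (fac N B g 0 x) i hM1 (hM 0 x)
  have hi : star (fac N B g 0 x i) N.Ω = 0 := h0 _
  have e : amp N B g ψ 0 x = inner ℂ N.Ω (Z ψ) := by
    rw [amp, h, add_apply, mul_apply_eq_comp, inner_add_right,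
      ← ContinuousLinearMap.adjoint_inner_left, ← ContinuousLinearMap.star_eq_adjoint, hi,
      inner_zero_left, zero_add]
  have h1 : ∑ j ∈ Finset.univ.filter (fun j => j ≠ i), ‖fac N B g 0 x j * fac N B g 0 x i
      - fac N B g 0 x i * fac N B g 0 x j‖ ≤ (∑ j, C j) * collWt k x := by
    rw [Finset.sum_mul]
    refine (Finset.sum_le_sum fun j hj => ?_).trans (Finset.sum_le_sum_of_subset_of_nonneg
      (Finset.filter_subset _ _) fun j _ _ => mul_nonneg (hC0 j) (collWt_nonneg k x))
    exact (hC j x).trans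
      (mul_le_mul_of_nonneg_left (wt_le_collWt k x (Finset.mem_filter.1 hj).2) (hC0 j))
  have h2 : ‖Z‖ ≤ M ^ n * ((∑ j, C j) * collWt k x) :=
    hZ.trans (mul_le_mul_of_nonneg_left h1 (by positivity))
  rw [e]
  refine (norm_inner_le_norm _ _).trans ?_
  rw [N.vacuum_norm, one_mul]
  calc ‖Z ψ‖ ≤ ‖Z‖ * ‖ψ‖ := Z.le_opNorm ψ
    _ ≤ (M ^ n * ((∑ j, C j) * collWt k x)) * ‖ψ‖ :=
        mul_le_mul_of_nonneg_right h2 (norm_nonneg _)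
    _ = _ := by ring

end Amplitude

/-! ### The evolution equation of the amplitudes -/

section Equation

variable {n d : ℕ} {m : ℝ} {𝓗 : Type*} [NormedAddCommGroup 𝓗] [InnerProductSpace ℂ 𝓗]
  [CompleteSpace 𝓗] (N : HaagKastlerNet d m 𝓗) {B : Fin n → (𝓗 →L[ℂ] 𝓗)}

theorem amp_sub (g : Fin n → Spacetime d → ℂ) (φ ψ : 𝓗) (t : ℝ) (x : Config n d) :
    amp N B g (φ - ψ) t x = amp N B g φ t x - amp N B g ψ t x := by
  rw [amp, map_sub, inner_sub_right]; rfl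

theorem amp_real_smul (g : Fin n → Spacetime d → ℂ) (r : ℝ) (ψ : 𝓗) (t : ℝ) (x : Config n d) :
    amp N B g ((r : ℂ) • ψ) t x = (r : ℂ) * amp N B g ψ t x := by
  rw [amp, map_smul, inner_smul_right]; rfl

/-- Differentiability of the amplitudes in `L²`, inherited from that of the vector. -/
theorem hasDerivAt_toLp_amp (hU : ∀ ψ : 𝓗, Continuous fun a : Spacetime d => transl N.U a ψ)
    {g : Fin n → Spacetime d → ℂ} {S : Set (Spacetime d)} {K : ℝ}
    (hK : ∀ ψ ∈ specSub N.U S,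
      ∃ h : MemLp (amp N B g ψ 0) 2 volume, ‖h.toLp (amp N B g ψ 0)‖ ≤ K * ‖ψ‖)
    {ψ : ℝ → 𝓗} {ψ' : 𝓗} {t : ℝ} (hψ : ∀ t, ψ t ∈ specSub N.U S) (hψ' : ψ' ∈ specSub N.U S)
    (hd : HasDerivAt ψ ψ' t) (h : ∀ t, MemLp (amp N B g (ψ t) 0) 2 volume)
    (h' : MemLp (amp N B g ψ' 0) 2 volume) :
    HasDerivAt (fun t => (h t).toLp (amp N B g (ψ t) 0)) (h'.toLp (amp N B g ψ' 0)) t := by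
  rw [hasDerivAt_iff_isLittleO] at hd ⊢
  refine Asymptotics.IsBigO.trans_isLittleO (Asymptotics.IsBigO.of_bound K
    (Eventually.of_forall fun s => ?_)) hd
  have h1 : ψ s - ψ t - (s - t) • ψ' ∈ specSub N.U S := by
    have e : ψ s - ψ t - (s - t) • ψ' = (ψ s + (-1 : ℂ) • ψ t) + ((t - s : ℝ) : ℂ) • ψ' := by
      rw [Complex.coe_smul]; module
    rw [e]
    exact specSub_add hU (specSub_add hU (hψ s) (specSub_smul hU _ (hψ t)))
      (specSub_smul hU _ hψ')
  obtain ⟨h2, h3⟩ := hK _ h1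
  have e : (h s).toLp (amp N B g (ψ s) 0) - (h t).toLp (amp N B g (ψ t) 0)
      - (s - t) • h'.toLp (amp N B g ψ' 0) = h2.toLp _ := by
    rw [← MemLp.toLp_sub, ← MemLp.toLp_const_smul, ← MemLp.toLp_sub]
    refine MemLp.toLp_congr _ _ (Eventually.of_forall fun x => ?_)
    rw [amp_sub, amp_sub, ← Complex.coe_smul (s - t) ψ', amp_real_smul, Pi.sub_apply,
      Pi.sub_apply, Pi.smul_apply, Complex.real_smul]
  rw [e]
  exact h3

theorem F_eq_amp (hB : ∀ i, Good N (B i)) {f : Fin n → Spacetime d → ℂ}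
    (hf : ∀ i b, smear (f i) (orb N (B i)) b = orb N (B i) b) (hfc : ∀ i, IsCc (f i)) (Ψ : 𝓗)
    (t : ℝ) : N.F B Ψ t = amp N B f (transl N.U (-t, 0) Ψ) 0 := by
  funext x
  rw [amp_transl N hB hfc, HaagKastlerNet.F, amp]
  congr 3
  congr 1
  funext i
  exact (hf i _).symm

/-- The time derivative of the amplitudes is given by the symbol `∑ᵢ σ(ξᵢ)`, up to the amplitudes
in which one of the energy-momentum cutoffs carries the factor `-(E + σ(-p))`. -/
theorem equation_amp (hB : ∀ i, Good N (B i)) {g : Fin n → Spacetime d → ℂ} (hg : ∀ i, IsCc (g i))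
    {Ψ Ψ' : 𝓗} (hΨ : ∀ t : ℝ, HasDerivAt (fun t : ℝ => transl N.U (-t, (0 : EuclideanSpace ℝ (Fin d))) Ψ)
      (transl N.U (-t, 0) Ψ') t)
    {σ : EuclideanSpace ℝ (Fin d) → ℂ} (hσ : IsCc σ) (t : ℝ) (x : Config n d) :
    Complex.I * amp N B g (transl N.U (-t, 0) Ψ') 0 x
      = (∑ i, pconv σ i (amp N B g (transl N.U (-t, 0) Ψ) 0) x)
        + ∑ i, amp N B (Function.update g i fun q =>
          Complex.I * (Complex.I * (q.1 : ℂ) * g i q) - σ (-q.2) * g i q)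
            (transl N.U (-t, 0) Ψ) 0 x := by
  have h1 : HasDerivAt (fun t => amp N B g Ψ t x) (amp N B g (transl N.U (-t, 0) Ψ') 0 x) t := by
    have h2 := ((((innerSL ℂ N.Ω).comp (List.ofFn (fac N B g 0 x)).prod).restrictScalars
      ℝ).hasFDerivAt).comp_hasDerivAt t (hΨ t)
    refine h2.congr_of_eventuallyEq (Eventually.of_forall fun s => ?_)
    exact (amp_transl N hB hg Ψ s x).symm
  have hE : ∀ i, IsCc fun q : Spacetime d => Complex.I * (q.1 : ℂ) * g i q := fun i =>
    (hg i).mul_left (contDiff_const.mul (Complex.ofRealCLM.contDiff.comp contDiff_fst))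
  have hP : ∀ i, IsCc fun q : Spacetime d => σ (-q.2) * g i q := fun i =>
    (hg i).mul_left (hσ.smooth.comp contDiff_snd.neg)
  rw [h1.unique (hasDerivAt_amp N hB hg Ψ t x), Finset.mul_sum, ← Finset.sum_add_distrib]
  refine Finset.sum_congr rfl fun i _ => ?_
  have hup : ∀ k : Spacetime d → ℂ, IsCc k → ∀ j, IsCc (Function.update g i k j) := fun k hk j => by
    by_cases hj : j = i
    · subst hj; rwa [Function.update_self]
    · rw [Function.update_of_ne hj]; exact hg j
  have e : amp N B g (transl N.U (-t, 0) Ψ) 0 = amp N B g Ψ t :=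
    funext fun y => amp_transl N hB hg Ψ t y
  rw [e, pconv_amp N hB hg Ψ t hσ i x, amp_transl N hB (hup _ (((hE i).mul_left contDiff_const).sub
    (hP i))), amp_update, amp_update, amp_update, smear_sub ((hE i).mul_left contDiff_const) (hP i)
    (hB i).bddCont, smear_const_mul, map_sub, map_smul, smul_eq_mul, add_sub_cancel]

/-- The propagation estimate for the amplitudes of a Haag-Kastler net. -/
theorem propagation_of_net (hm : 0 < m) {H : Config n d × Config n d → Config n d}
    (hH : AdmissibleSymbol m H) {Δ : Set (Spacetime d)} {Ψ : 𝓗} (hb : Bornology.IsBounded Δ)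
    (hd : N.DeltaAdmissible Δ B) (hΨ : InSpectralSubspace N.U Δ Ψ) :
    (∀ t : ℝ, MemLp (N.F B Ψ t) 2 volume) ∧
      IntegrableOn (fun t : ℝ => ‖propagationVector m H t (N.F B Ψ t)‖ ^ 2 / t) (Ioi 1) := by
  have hU := N.strongly_continuous
  have hB : ∀ i, Good N (B i) := fun i => good_of_mem_L0 N (hd.mem_L0 i)
  have hS := mem_specSub_of_inSpectralSubspace hU hΨ
  obtain ⟨ρ, hρ⟩ := propagation_of_equation hm hH
  -- a symbol which agrees with the dispersion relation on all relevant momenta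
  obtain ⟨R, hρR, hR⟩ : ∃ R, ρ ≤ R ∧ ∀ i, ∀ q ∈ N.transferSupport (B i), ‖q‖ ≤ R := by
    choose r hr using fun i => (hB i).bounded.exists_norm_le
    refine ⟨|ρ| + ∑ i, |r i|, (le_abs_self ρ).trans (le_add_of_nonneg_right
      (Finset.sum_nonneg fun i _ => abs_nonneg _)), fun i q hq => ?_⟩
    have h1 := Finset.single_le_sum (fun j _ => abs_nonneg (r j)) (Finset.mem_univ i)
    have h2 := hr i q hq
    linarith [le_abs_self (r i), abs_nonneg ρ]
  obtain ⟨χ, hχs, hχc, hχ1, -, -⟩ := exists_smooth_cutoff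
    (isCompact_closedBall (0 : EuclideanSpace ℝ (Fin d)) R) isOpen_univ (subset_univ _)
  obtain ⟨σ, hσ, hσR⟩ : ∃ σ : EuclideanSpace ℝ (Fin d) → ℂ, IsCc σ ∧
      ∀ p, ‖p‖ ≤ R → σ p = ((√(‖p‖ ^ 2 + m ^ 2) : ℝ) : ℂ) := by
    refine ⟨fun p => ((√(‖p‖ ^ 2 + m ^ 2) * χ p : ℝ) : ℂ),
      isCc_ofReal ((contDiff_omega hm).mul hχs) hχc.mul_left, fun p hp => ?_⟩
    have h1 := hχ1.self_of_nhdsSet p (mem_closedBall_zero_iff.2 hp)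
    simp only [h1, mul_one]
  -- cutoffs in the energy-momentum transfer which do not change the operators
  have hf : ∀ i, ∃ f : Spacetime d → ℂ, IsCc f ∧ Disjoint (tsupport f) (forwardCone d) ∧
      ∀ b, smear f (orb N (B i)) b = orb N (B i) b := fun i => by
    have hcone : IsClosed (forwardCone d) := isClosed_le (by fun_prop) (by fun_prop)
    obtain ⟨η, hηs, hηc, hη1, hηU, -⟩ := exists_smooth_cutoff
      (Metric.isCompact_of_isClosed_isBounded (isClosed_transferSupport N (B i)) (hB i).bounded)
      hcone.isOpen_compl (disjoint_left.1 (hB i).decreasing)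
    have hη : IsCc fun q => ((η q : ℝ) : ℂ) := isCc_ofReal hηs hηc
    refine ⟨fun q => (kap d)⁻¹ * ((η q : ℝ) : ℂ), hη.mul_left contDiff_const, ?_, fun b => ?_⟩
    · refine disjoint_left.2 fun q hq => hηU (closure_mono (fun p hp => ?_) hq)
      intro h0
      exact hp (by simp only [h0, Complex.ofReal_zero, mul_zero])
    · rw [smear_const_mul, smear_orb_eq_smul N (hB i) hη, smul_smul,
        inv_mul_cancel₀ (kap_ne_zero d), one_smul]
      intro q hq
      filter_upwards [(eventually_nhdsSet_iff_forall.1 hη1) q hq] with p hp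
      rw [hp, Complex.ofReal_one]
  choose f hfc hfd hf1 using hf
  have hF : ∀ t, N.F B Ψ t = amp N B f (transl N.U (-t, 0) Ψ) 0 := F_eq_amp N hB hf1 hfc Ψ
  obtain ⟨Ψ', hS', hder⟩ := exists_hasDerivAt_transl hU hb hS
  obtain ⟨K, hK0, hK⟩ := exists_memLp_amp N hB hfc hfd hb
  obtain ⟨A₁, hA₁0, hA₁⟩ := exists_norm_amp_le N hB hfc
  obtain ⟨r, hr⟩ : ∃ r : Fin n → Spacetime d → ℂ, ∀ i, r i = fun q =>
      Complex.I * (Complex.I * (q.1 : ℂ) * f i q) - σ (-q.2) * f i q := ⟨_, fun _ => rfl⟩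
  have hrc : ∀ i, IsCc (r i) := fun i => by
    rw [hr]
    exact (((hfc i).mul_left (contDiff_const.mul (Complex.ofRealCLM.contDiff.comp
      contDiff_fst))).mul_left contDiff_const).sub ((hfc i).mul_left
        (hσ.smooth.comp contDiff_snd.neg))
  have hrd : ∀ i, Disjoint (tsupport (r i)) (forwardCone d) := fun i => by
    have h1 : Function.support (r i) ⊆ Function.support (f i) := fun q hq h0 => hq (by
      rw [hr]
      simp only [h0, mul_zero, sub_zero])
    exact (hfd i).mono_left (closure_mono h1)
  have hcc : ∀ i j, IsCc (Function.update f i (r i) j) := fun i j => by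
    by_cases hj : j = i
    · subst hj; rw [Function.update_self]; exact hrc j
    · rw [Function.update_of_ne hj]; exact hfc j
  have hcd : ∀ i j, Disjoint (tsupport (Function.update f i (r i) j)) (forwardCone d) :=
    fun i j => by
    by_cases hj : j = i
    · subst hj; rw [Function.update_self]; exact hrd j
    · rw [Function.update_of_ne hj]; exact hfd j
  -- the remainder is concentrated near the collision planes: on the mass shell `E = -σ(-p)`
  have hr0 : ∀ i b, star (smear (Function.update f i (r i) i) (orb N (B i)) b) N.Ω = 0 :=
    fun i b => by
    rw [Function.update_self]
    refine star_smear_orb_vacuum_eq_zero N (hB i).bddCont (hd.to_hyperboloid i) (hrc i)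
      (fun q hq hqm => ?_) b
    have h1 : -q.1 = √(‖-q.2‖ ^ 2 + m ^ 2) := hqm
    have h2 : σ (-q.2) = ((√(‖-q.2‖ ^ 2 + m ^ 2) : ℝ) : ℂ) :=
      hσR _ (by rw [norm_neg]; exact (norm_snd_le q).trans (hR i q hq))
    rw [hr]
    simp only [h2, ← h1, Complex.ofReal_neg]
    linear_combination (q.1 : ℂ) * f i q * Complex.I_mul_I
  choose K' _ hK' using fun i => exists_memLp_amp N hB (hcc i) (hcd i) hb
  choose C hC0 hC using fun i => exists_norm_amp_le_collWt N hB (hcc i) i (hr0 i) (collN n d)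
  have hψ : ∀ t : ℝ, transl N.U (-t, 0) Ψ ∈ specSub N.U Δ := fun t => specSub_transl hU _ hS
  have hψ' : ∀ t : ℝ, transl N.U (-t, 0) Ψ' ∈ specSub N.U Δ := fun t => specSub_transl hU _ hS'
  have hFm : ∀ t : ℝ, MemLp (amp N B f (transl N.U (-t, 0) Ψ) 0) 2 volume :=
    fun t => (hK _ (hψ t)).1
  have hFm' : ∀ t : ℝ, MemLp (amp N B f (transl N.U (-t, 0) Ψ') 0) 2 volume :=
    fun t => (hK _ (hψ' t)).1
  have key := hρ σ hσ (fun p hp => hσR p (hp.trans hρR))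
    (fun t => amp N B f (transl N.U (-t, 0) Ψ) 0) (fun t => amp N B f (transl N.U (-t, 0) Ψ') 0)
    (fun t x => ∑ i, amp N B (Function.update f i (r i)) (transl N.U (-t, 0) Ψ) 0 x) hFm hFm'
    (K * ‖Ψ‖) (A₁ * ‖Ψ‖) ((∑ i, C i) * ‖Ψ‖)
    (fun t => memLp_finsetSum _ fun i _ => (hK' i _ (hψ t)).1)
    (fun t => hasDerivAt_toLp_amp N hU hK hψ (hψ' t) (hder t) hFm (hFm' t))
    (fun t => ((hK _ (hψ t)).2).trans_eq (by rw [norm_transl_apply]))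
    (fun t => continuous_amp N hB hfc _ 0)
    (fun t x => (hA₁ _ _ x).trans_eq (by rw [norm_transl_apply]))
    (fun t => continuous_finsetSum _ fun i _ => continuous_amp N hB (hcc i) _ 0)
    (fun t x => by
      rw [Finset.sum_mul, Finset.sum_mul]
      refine (norm_sum_le _ _).trans (Finset.sum_le_sum fun i _ => (hC i _ x).trans_eq ?_)
      rw [norm_transl_apply])
    (fun t x => by
      have h := equation_amp N hB hfc hder hσ t x
      simp only [← hr] at h
      exact h)
  refine ⟨fun t => by rw [hF]; exact hFm t, ?_⟩
  simp only [hF]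
  exact key

end Equation

end PropEst

end

theorem proposition5p2 (n d : ℕ) (m : ℝ) (hm : 0 < m)
    (H : PropEst.Config n d × PropEst.Config n d → PropEst.Config n d)
    (hH : PropEst.AdmissibleSymbol m H) :
    -- the operators `H_{k,t}^w` and `x_k H_{k,t}^w` map `L²` to `L²`
    (∀ t : ℝ, 0 < t → ∀ k : Fin n × Fin d, ∀ u : PropEst.Config n d → ℂ, MemLp u 2 volume →
      MemLp (PropEst.weyl (PropEst.scaledComponent H k t) u) 2 volume ∧
      MemLp (fun x => ((x k / t : ℝ) : ℂ) * PropEst.weyl (PropEst.scaledComponent H k t) u x)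
        2 volume) ∧
    -- the estimate for `F_t`
    (∀ (𝓗 : Type*) [NormedAddCommGroup 𝓗] [InnerProductSpace ℂ 𝓗] [CompleteSpace 𝓗]
      (N : PropEst.HaagKastlerNet d m 𝓗) (Δ : Set (PropEst.Spacetime d))
      (B : Fin n → (𝓗 →L[ℂ] 𝓗)) (Ψ : 𝓗),
      IsOpen Δ → Bornology.IsBounded Δ → N.DeltaAdmissible Δ B →
      PropEst.InSpectralSubspace N.U Δ Ψ →
      (∀ t : ℝ, MemLp (N.F B Ψ t) 2 volume) ∧
      IntegrableOn (fun t : ℝ => ‖PropEst.propagationVector m H t (N.F B Ψ t)‖ ^ 2 / t)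
        (Ioi 1)) ∧
    -- the estimate for the free evolution
    (∃ c : ℝ, ∀ u : PropEst.L2 (Fin n × Fin d),
      IntegrableOn (fun t : ℝ =>
        ‖PropEst.propagationVector m H t (PropEst.freeEvolution m t u)‖ ^ 2 / t) (Ioi 1) ∧
      ∫ t in Ioi (1 : ℝ),
        ‖PropEst.propagationVector m H t (PropEst.freeEvolution m t u)‖ ^ 2 / t
          ≤ c * ‖u‖ ^ 2) := by
  refine ⟨fun t ht k u hu => ⟨PropEst.memLp_weyl hH k t hu, PropEst.memLp_coord_mul_weyl hH k ht hu⟩,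
    ?_, PropEst.propagation_freeEvolution hm hH⟩
  intro 𝓗 _ _ _ N Δ B Ψ _ hb hd hΨ
  exact PropEst.propagation_of_net N hm hH hb hd hΨ
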